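/- **Setting.** Let $\alpha,\beta,\gamma\ge 0$, $\sigma>0$ with $\alpha\sigma\ge\gamma^2+\beta^2/16$ and $\alpha\sigma>\gamma^2$. Let $X=L^2(\mathbb R^6;(1+|v|^2)^2\,dx\,dv)$ (real-valued functions of $(x,v)\in\mathbb R^3\times\mathbb R^3$), and for $u\in X$ let $n[u](x)=\int u(x,v)\,dv$, $V[u]=-\frac1{4\pi|x|}*n[u]$, so that $\nabla V[u]=\frac{1}{4\pi}\frac{x}{|x|^3}*n[u]$; $\delta V(x,\eta)=V(x+\frac\eta2)-V(x-\frac\eta2)$ is understood through the absolutely convergent integral $\frac1{4\pi}\int\big(|y-\frac\eta2|^{-1}-|y+\frac\eta2|^{-1}\big)n(x-y)\,dy$, and $\Theta[V]u=\mathcal F^{-1}_{\eta\to v}\big(i\,\delta V(x,\eta)\,\mathcal F_{v\to\eta}u\big)$. Let $\overline A$ be the closure in $X$ of $$Au=-v\cdot\nabla_xu+\beta\,\mathrm{div}_v(vu)+\sigma\Delta_vu+2\gamma\,\mathrm{div}_v\nabla_xu+\alpha\Delta_xu,$$ $$D(A)=\{u\in X: v\cdot\nabla_xu,\ v\cdot\nabla_vu,\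 \Delta_vu,\ \mathrm{div}_v\nabla_xu,\ \Delta_xu\in X\},$$ and $e^{t\overline A}$ the $C_0$ semigroup it generates. For $T>0$, $Y_T$ is the set of $w\in C([0,T];X)$ with $\nabla_vw\in C((0,T];X)$ and $\|\nabla_vw(t)\|_X\le Ct^{-1/2}$ for $0<t<T$. A mild solution on $[0,T]$ of the Wigner–Poisson–Fokker–Planck (WPFP) equation with initial value $w_0\in X$ is a $w\in Y_T$ with $$w(t)=e^{t\overline A}w_0+\int_0^te^{(t-s)\overline A}\,\Theta[V[w(s)]]w(s)\,ds,\qquad 0\le t\le T,$$ where $\Theta[V[w(s)]]w(s)$ is defined in $X$ for $0<s\le T$ and is integrable in $s$. Let $\vartheta(t)=\frac{1-e^{-\beta t}}\beta$ and $$R(t)=2\alpha t+\sigma\,\frac{4e^{-\beta t}-e^{-2\beta t}+2\beta t-3}{\beta^3}+4\gamma\,\frac{e^{-\beta t}+\beta t-1}{\beta^2}$$ (for $\beta=0$: the limits $\vartheta(t)=t$, $R(t)=2\alpha t+2\gamma t^2+\frac23\sigma t^3$), $\mathcal N(x)=(2\pi)^{-3/2}e^{-|x|^2/2}$, $\mathcal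 N_r(x)=r^{-3/2}\mathcal N(x/\sqrt r)$, and $$n_0^\vartheta(x,t)=\int w_0(x-\vartheta(t)v,v)\,dv,\qquad n_0(\cdot,t)=\mathcal N_{R(t)}*n_0^\vartheta(\cdot,t),$$ $$n_1(x,t)=\int_0^t\!\iint\mathcal N_{R(s)}(x-x_0-\vartheta(s)v_0)\,\big(\Theta[V[w(t-s)]]w(t-s)\big)(x_0,v_0)\,dx_0\,dv_0\,ds,$$ $$E_i=\frac1{4\pi}\frac{x}{|x|^3}*n_i\quad(i=0,1).$$ Condition (A) for $\omega\in[0,1)$: for every $T>0$ there is $C_T$ with $\|n_0^\vartheta(t)\|_{L^{6/5}}\le C_T\,\vartheta(t)^{-\omega}$ for all $t\in(0,T]$. Put $M_T=\sup_{0<s\le T}\vartheta(s)^\omega\|n_0^\vartheta(s)\|_{L^{6/5}}$. For real $\mu$ let $V_{T,\mu}$ be the space of $E\in C((0,T];L^2(\mathbb R^3))$ with $\sup_{0<t\le T}t^\mu\|E(t)\|_2<\infty$. **Statement.** Let $w_0\in X$ satisfy (A) for some $\omega\in[0,1)$, let $T>0$, and let $w$ be a mild solution of the WPFP equation on $[0,T]$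 with initial value $w_0$. Then, for every $t\in(0,T]$, the integrals defining $\nabla V[w(t)]$, $E_0(t)$ and $E_1(t)$ converge absolutely for almost every $x$, and $n[w(t)]=n_0(t)+n_1(t)$, $\nabla V[w(t)]=E_0(t)+E_1(t)$ almost everywhere. Moreover: 0. $E_1\in V_{T,\omega-1/2}$; and the field $\nabla V[w(t)]$ lies in $L^2$, is weakly continuous from $(0,T]$ into $L^2(\mathbb R^3)$, and satisfies $\sup_{0<t\le T}t^{\omega}\|\nabla V[w(t)]\|_2<\infty$. 1. For $2\le p\le6$ and $\theta=\frac{3(p-2)}{2p}$: $\ \|E_0(t)\|_p\le C_0(T)\,\|w_0\|_X^\theta\,\|n_0^\vartheta(t)\|_{L^{6/5}}^{1-\theta}$ for all $t\in(0,T]$, and the right-hand side yields $\|E_0(t)\|_p\le K\,t^{-\omega(1-\theta)}$ on $(0,T]$ with some constant $K$. 2. $\|E_1(t)\|_2\le C_1(T,\|w_0\|_2,M_T)\,t^{1/2-\omega}$ for all $t\in(0,T]$. 3. For every $p\in[2,6)$: $\ \|E_1(t)\|_p\le C_2(p,T,\|w_0\|_2,M_T)\,t^{\frac3{2p}-\frac14-\omega}$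 for all $t\in(0,T]$. Here $C_0,C_1,C_2$ are functions of the displayed arguments and of $\alpha,\beta,\gamma,\sigma$ only ($C_1,C_2$ also of $\omega$), continuous in $T\in(0,\infty)$. -/

import Mathlib

open MeasureTheory Set Filter Topology
open scoped ENNReal

noncomputable section

namespace WPFP

/-! ### Phase space and state space -/

/-- Physical space `ℝ³` with the Euclidean norm. -/
abbrev E3 : Type := EuclideanSpace ℝ (Fin 3)

/-- Phase space `ℝ³ₓ × ℝ³ᵥ`. A point is `z = (z.1, z.2) = (x, v)`. -/
abbrev Phase : Type := E3 × E3

/-- The measure `(1 + |v|²)² dx dv` on phase space. -/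
def weightMeasure : Measure Phase :=
  (volume : Measure Phase).withDensity fun z => ENNReal.ofReal ((1 + ‖z.2‖ ^ 2) ^ 2)

/-- The real state space `X = L²(ℝ⁶; (1 + |v|²)² dx dv)`. -/
abbrev X : Type := Lp ℝ 2 weightMeasure

/-- The unweighted norm `‖u‖₂` of an element of `X` (finite because the weight is `≥ 1`). -/
def norm2 (u : X) : ℝ := (eLpNorm (fun z => u z) 2 (volume : Measure Phase)).toReal

/-! ### Derivatives of test functions and weak identities -/

/-- A test function: smooth with compact support in phase space. -/
def IsTest (φ : Phase → ℝ) : Prop := ContDiff ℝ (⊤ : ℕ∞) φ ∧ HasCompactSupport φ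

/-- `∂φ/∂xᵢ`. -/
def dX (i : Fin 3) (φ : Phase → ℝ) : Phase → ℝ :=
  fun z => fderiv ℝ φ z (EuclideanSpace.single i 1, 0)

/-- `∂φ/∂vᵢ`. -/
def dV (i : Fin 3) (φ : Phase → ℝ) : Phase → ℝ :=
  fun z => fderiv ℝ φ z (0, EuclideanSpace.single i 1)

/-- The distribution `P u` is (represented by) `g ∈ X`, where the differential operator `P` is
given through its formal adjoint `P'`: `∫ g φ = ∫ u P'φ` for every test function `φ`. -/
def WeakEq (P' : (Phase → ℝ) → Phase → ℝ) (u g : X) : Prop :=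
  ∀ φ : Phase → ℝ, IsTest φ → ∫ z, g z * φ z = ∫ z, u z * P' φ z

/-- `g = ∂u/∂vᵢ` in the weak sense. -/
def IsWeakDV (i : Fin 3) (u g : X) : Prop := WeakEq (fun φ z => - dV i φ z) u g

/-! ### The linear Wigner–Fokker–Planck operator and its semigroup -/

/-- The graph of
`A u = - v·∇ₓu + β divᵥ(v u) + σ Δᵥu + 2γ divᵥ∇ₓu + α Δₓu`
on `D(A) = {u ∈ X | v·∇ₓu, v·∇ᵥu, Δᵥu, divᵥ∇ₓu, Δₓu ∈ X}` (distributional derivatives); note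
`divᵥ(v u) = 3u + v·∇ᵥu`. -/
def graphA (α β γ σ : ℝ) : Set (X × X) :=
  {p | ∃ g₁ g₂ g₃ g₄ g₅ : X,
    -- `g₁ = v·∇ₓu`, `g₂ = v·∇ᵥu`, `g₃ = Δᵥu`, `g₄ = divᵥ∇ₓu`, `g₅ = Δₓu`
    WeakEq (fun φ z => - ∑ i, z.2 i * dX i φ z) p.1 g₁ ∧
    WeakEq (fun φ z => - ∑ i, dV i (fun y => y.2 i * φ y) z) p.1 g₂ ∧
    WeakEq (fun φ z => ∑ i, dV i (dV i φ) z) p.1 g₃ ∧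
    WeakEq (fun φ z => ∑ i, dV i (dX i φ) z) p.1 g₄ ∧
    WeakEq (fun φ z => ∑ i, dX i (dX i φ) z) p.1 g₅ ∧
    p.2 = - g₁ + β • ((3 : ℝ) • p.1 + g₂) + σ • g₃ + (2 * γ) • g₄ + α • g₅}

/-- `S` is a `C₀` semigroup of bounded operators on `X` (only times `t ≥ 0` matter). -/
structure IsC0Semigroup (S : ℝ → X →L[ℝ] X) : Prop where
  zero : S 0 = ContinuousLinearMap.id ℝ X
  add : ∀ s t : ℝ, 0 ≤ s → 0 ≤ t → S (s + t) = (S s).comp (S t)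
  continuous : ∀ u : X, Tendsto (fun t => S t u) (𝓝[>] 0) (𝓝 u)

/-- The graph of the infinitesimal generator of `S`. -/
def generatorGraph (S : ℝ → X →L[ℝ] X) : Set (X × X) :=
  {p | Tendsto (fun h : ℝ => h⁻¹ • (S h p.1 - p.1)) (𝓝[>] 0) (𝓝 p.2)}

/-- `S t = e^{tĀ}`: the `C₀` semigroup whose generator is the closure `Ā` of `A`. (A `C₀` semigroup
is determined on `t ≥ 0` by its generator.) -/
def IsWFPSemigroup (α β γ σ : ℝ) (S : ℝ → X →L[ℝ] X) : Prop :=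
  IsC0Semigroup S ∧ generatorGraph S = closure (graphA α β γ σ)

/-! ### Density, Newtonian field and the operator `Θ` -/

/-- The particle density `n[u](x) = ∫ u(x,v) dv`. -/
def density (u : Phase → ℝ) (x : E3) : ℝ := ∫ v : E3, u (x, v)

/-- The field `(1/4π) x/|x|³ * n`, i.e. `∇V` for the potential `V = -(1/(4π|x|)) * n`. -/
def field (n : E3 → ℝ) (x : E3) : E3 :=
  (4 * Real.pi)⁻¹ • ∫ y : E3, (n (x - y) * (‖y‖ ^ 3)⁻¹) • y

/-- The integral defining `field n` converges absolutely almost everywhere. -/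
def FieldConverges (n : E3 → ℝ) : Prop :=
  ∀ᵐ x : E3, Integrable fun y : E3 => (n (x - y) * (‖y‖ ^ 3)⁻¹) • y

/-- `δV(x,η) = V(x + η/2) - V(x - η/2)` for `V = -(1/(4π|x|)) * n`, written with the dipole kernel
`1/|y - η/2| - 1/|y + η/2|` (square integrable in `y`, so the integral converges absolutely for
`n ∈ L²`, whereas the integral for `V` itself need not converge). -/
def deltaV (n : E3 → ℝ) (x η : E3) : ℝ :=
  (4 * Real.pi)⁻¹ *
    ∫ y : E3, (‖y - (1 / 2 : ℝ) • η‖⁻¹ - ‖y + (1 / 2 : ℝ) • η‖⁻¹) * n (x - y)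

/-- The partial Fourier transform
`(F_{v→η} u)(x,η) = (2π)^{-3/2} ∫ u(x,v) e^{-i v·η} dv`; for `u ∈ X` the integral converges absolutely
for almost every `x`. -/
def fourierV (u : Phase → ℝ) (x η : E3) : ℂ :=
  (((2 * Real.pi) ^ (-(3 / 2 : ℝ)) : ℝ) : ℂ) *
    ∫ v : E3, (u (x, v) : ℂ) * Complex.exp (-Complex.I * ((inner ℝ v η : ℝ) : ℂ))

/-- `f = Θ[V[z]] u`, i.e. `F_{v→η} f = i δV[z] F_{v→η} u` almost everywhere. This determines `f ∈ X`. -/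
def IsTheta (z u f : X) : Prop :=
  ∀ᵐ p : Phase, fourierV (fun q => f q) p.1 p.2 =
    Complex.I * (deltaV (density fun q => z q) p.1 p.2 : ℂ) * fourierV (fun q => u q) p.1 p.2

open Classical in
/-- The element `Θ[V[z]] u` of `X` (with value `0` if it does not exist in `X`). -/
def Theta (z u : X) : X := if h : ∃ f : X, IsTheta z u f then h.choose else 0

/-! ### Mild solutions -/

/-- `w ∈ Y_T`: `w ∈ C([0,T]; X)`, `∇ᵥw ∈ C((0,T]; X)` and `‖∇ᵥw(t)‖ ≤ C t^{-1/2}`. -/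
def MemY (T : ℝ) (w : ℝ → X) : Prop :=
  ContinuousOn w (Icc 0 T) ∧
  ∃ g : Fin 3 → ℝ → X,
    (∀ i, ∀ t ∈ Ioc 0 T, IsWeakDV i (w t) (g i t)) ∧
    (∀ i, ContinuousOn (g i) (Ioc 0 T)) ∧
    ∃ C : ℝ, ∀ i, ∀ t ∈ Ioo 0 T, ‖g i t‖ ≤ C * t ^ (-(1 / 2 : ℝ))

/-- `w` is the mild solution on `[0,T]`, in the class `Y_T`, of
`w_t = Ā w + Θ[V[w]] w`, `w(0) = w₀`:
`w(t) = e^{tĀ} w₀ + ∫₀ᵗ e^{(t-s)Ā} Θ[V[w(s)]] w(s) ds` in `X`, where the nonlinear term is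
defined in `X` for `s ∈ (0,T]` and Bochner integrable in time. -/
def IsMildSolution (α β γ σ T : ℝ) (w₀ : X) (w : ℝ → X) : Prop :=
  MemY T w ∧
  (∀ s ∈ Ioc 0 T, IsTheta (w s) (w s) (Theta (w s) (w s))) ∧
  IntervalIntegrable (fun s => Theta (w s) (w s)) volume 0 T ∧
  ∃ S : ℝ → X →L[ℝ] X, IsWFPSemigroup α β γ σ S ∧
    ∀ t ∈ Icc 0 T, w t = S t w₀ + ∫ s in (0 : ℝ)..t, S (t - s) (Theta (w s) (w s))

/-! ### The splitting of density and field -/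

/-- `ϑ(t) = (1 - e^{-βt})/β` for `β > 0` and `ϑ(t) = t` for `β = 0`. -/
def vth (β t : ℝ) : ℝ := if β = 0 then t else (1 - Real.exp (-(β * t))) / β

/-- The variance `R(t)`; for `β = 0` this is the limit `β → 0` of the general formula. -/
def R (α β γ σ t : ℝ) : ℝ :=
  if β = 0 then 2 * α * t + 2 * γ * t ^ 2 + (2 / 3) * σ * t ^ 3
  else 2 * α * t +
    σ * ((4 * Real.exp (-(β * t)) - Real.exp (-(2 * β * t)) + 2 * β * t - 3) / β ^ 3) +
    4 * γ * ((Real.exp (-(β * t)) + β * t - 1) / β ^ 2)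

/-- The Gaussian `r^{-3/2} 𝒩(x/√r)`, `𝒩(x) = (2π)^{-3/2} exp(-|x|²/2)`. -/
def gauss (r : ℝ) (x : E3) : ℝ :=
  r ^ (-(3 / 2 : ℝ)) * ((2 * Real.pi) ^ (-(3 / 2 : ℝ)) * Real.exp (-(‖x‖ ^ 2 / (2 * r))))

/-- `n₀^ϑ(x,t) = ∫ w₀(x - ϑ(t)v, v) dv`. -/
def n0th (β : ℝ) (w₀ : X) (t : ℝ) (x : E3) : ℝ := ∫ v : E3, w₀ (x - vth β t • v, v)

/-- `‖n₀^ϑ(t)‖_{L^{6/5}}` as an extended real. -/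
def n0thNorm (β : ℝ) (w₀ : X) (t : ℝ) : ℝ≥0∞ :=
  eLpNorm (n0th β w₀ t) (ENNReal.ofReal (6 / 5)) volume

/-- `n₀(·,t) = R(t)^{-3/2} 𝒩(·/√R(t)) * n₀^ϑ(·,t)`. -/
def n0 (α β γ σ : ℝ) (w₀ : X) (t : ℝ) (x : E3) : ℝ :=
  ∫ y : E3, gauss (R α β γ σ t) (x - y) * n0th β w₀ t y

/-- `n₁(x,t) = ∫₀ᵗ R(s)^{-3/2} ∬ 𝒩((x - x₀ - ϑ(s)v₀)/√R(s)) (Θ[V]w)(x₀,v₀,t-s) dx₀ dv₀ ds`, the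
part of the density produced by the nonlinear term. -/
def n1 (α β γ σ : ℝ) (w : ℝ → X) (t : ℝ) (x : E3) : ℝ :=
  ∫ s in (0 : ℝ)..t, ∫ z : Phase,
    gauss (R α β γ σ s) (x - z.1 - vth β s • z.2) * Theta (w (t - s)) (w (t - s)) z

/-- `E₀ = (1/4π) x/|x|³ * n₀`. -/
def E0 (α β γ σ : ℝ) (w₀ : X) (t : ℝ) : E3 → E3 := field (n0 α β γ σ w₀ t)

/-- `E₁ = (1/4π) x/|x|³ * n₁`. -/
def E1 (α β γ σ : ℝ) (w : ℝ → X) (t : ℝ) : E3 → E3 := field (n1 α β γ σ w t)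

/-- The self-consistent field `∇V[w(t)]`. -/
def gradV (w : ℝ → X) (t : ℝ) : E3 → E3 := field (density fun z => w t z)

/-- Condition (A): for every `T > 0` there is `C_T` with
`‖n₀^ϑ(t)‖_{L^{6/5}} ≤ C_T ϑ(t)^{-ω}` for `t ∈ (0,T]`. -/
def ConditionA (β ω : ℝ) (w₀ : X) : Prop :=
  ∀ T : ℝ, 0 < T → ∃ C : ℝ, ∀ t ∈ Ioc 0 T,
    n0thNorm β w₀ t ≤ ENNReal.ofReal (C * vth β t ^ (-ω))

/-- `sup_{s ∈ (0,T]} ϑ(s)^ω ‖n₀^ϑ(s)‖_{L^{6/5}}` (finite under condition (A)). -/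
def supA (β ω T : ℝ) (w₀ : X) : ℝ :=
  (⨆ s ∈ Ioc (0 : ℝ) T, ENNReal.ofReal (vth β s ^ ω) * n0thNorm β w₀ s).toReal

/-- `E ∈ V_{T,ω}`: `E ∈ C((0,T]; L²(ℝ³))` with `sup_{0<t≤T} t^ω ‖E(t)‖₂ < ∞`. -/
def MemV (T ω : ℝ) (E : ℝ → E3 → E3) : Prop :=
  ∃ e : ℝ → Lp E3 2 (volume : Measure E3),
    (∀ t ∈ Ioc 0 T, (fun x => e t x) =ᵐ[volume] E t) ∧
    ContinuousOn e (Ioc 0 T) ∧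
    ∃ C : ℝ, ∀ t ∈ Ioc 0 T, t ^ ω * ‖e t‖ ≤ C

/-- As `MemV`, but with `E` weakly continuous from `(0,T]` to `L²(ℝ³)`. -/
def MemVWeak (T ω : ℝ) (E : ℝ → E3 → E3) : Prop :=
  ∃ e : ℝ → Lp E3 2 (volume : Measure E3),
    (∀ t ∈ Ioc 0 T, (fun x => e t x) =ᵐ[volume] E t) ∧
    (∀ g : Lp E3 2 (volume : Measure E3),
      ContinuousOn (fun t => (inner ℝ g (e t) : ℝ)) (Ioc 0 T)) ∧
    ∃ C : ℝ, ∀ t ∈ Ioc 0 T, t ^ ω * ‖e t‖ ≤ C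

end WPFP

end

open ENNReal (ofReal ofReal_mul rpow_mul ofReal_le_ofReal ofReal_ne_top rpow_le_rpow mul_lt_top)
open ENNReal (rpow_natCast mul_rpow_of_nonneg rpow_one rpow_lt_top_of_nonneg ofReal_ofNat)
open ENNReal (toReal_nonneg ofReal_toReal ofReal_lt_top toReal_mono ofReal_one)
open ENNReal (ofReal_rpow_of_nonneg rpow_two tendsto_nhds_zero rpow_add_of_nonneg ofReal_add)
open scoped Real
open Real (exp norm_of_nonneg rpow_add sqrt exp_pos enorm_of_nonneg log rpow_neg mul_rpow)
open Real (exp_add rpow_nonneg fourierInv_eq' rpow_pos_of_pos)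
open Filter.Eventually (of_forall)
open Function (uncurry)
open MeasureTheory.Measure (volume_eq_prod)
open MeasureTheory.StronglyMeasurable (integral_prod_right')
open Metric (ball isOpen_ball closedBall)
open EuclideanSpace (proj)
open Measurable (lintegral_prod_right')
open ContinuousLinearMap (le_opNorm integral_comp_comm)
open Finset (sum_le_sum sum_congr mul_sum abs_sum_le_sum_abs)
open Complex (norm_real norm_exp_ofReal_mul_I ofRealCLM I)

namespace WPFP

/-! ### Radial integrals on `ℝ³` -/

lemma lintegral_swap {α β : Type*} [MeasurableSpace α] [MeasurableSpace β] {μ : Measure α} {ν : Measure β} [SFinite μ]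
    [SFinite ν] {f : α → β → ℝ≥0∞} (h : AEMeasurable (fun p : α × β => f p.1 p.2) (μ.prod ν)) :
    ∫⁻ x, ∫⁻ y, f x y ∂ν ∂μ = ∫⁻ y, ∫⁻ x, f x y ∂μ ∂ν :=
  lintegral_lintegral_swap h

lemma integral_congr {α E : Type*} [MeasurableSpace α] [NormedAddCommGroup E] [NormedSpace ℝ E] {μ : Measure α}
    {f g : α → E} (h : ∀ x, f x = g x) :
    ∫ x, f x ∂μ = ∫ x, g x ∂μ :=
  congrArg _ (funext h)

lemma finrank_E3 : Module.finrank ℝ E3 = 3 := by simp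

lemma lintegral_comp_smul (f : E3 → ℝ≥0∞) {r : ℝ} (hr : 0 < r) :
    ∫⁻ y : E3, f y = ofReal (r ^ 3) * ∫⁻ y : E3, f (r • y) := by
  have h := Measure.map_addHaar_smul (volume : Measure E3) hr.ne'
  have he : MeasurableEmbedding (fun x : E3 => r • x) := (Homeomorph.smulOfNeZero r hr.ne').measurableEmbedding
  have h2 := he.lintegral_map (μ := volume) f; rw [h, finrank_E3, lintegral_smul_measure] at h2
  rw [← h2, smul_eq_mul, ← mul_assoc, ← ofReal_mul (by positivity), abs_of_pos (by positivity),
    mul_inv_cancel₀ (by positivity), ofReal_one, one_mul]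

lemma lintegral_ball_rpow_lt_top {s : ℝ} (hs : s < 3) : ∫⁻ y in ball (0 : E3) 1, ofReal (‖y‖ ^ (-s)) < ∞ := by
  have h : IntegrableOn (fun x : E3 => ‖x‖ ^ (-s)) (ball 0 1) volume := by
    rw [integrableOn_fun_norm_addHaar (volume : Measure E3) (f := fun t => t ^ (-s))]
    have : IntegrableOn (fun t : ℝ => t ^ (2 - s)) (Ioo 0 1) := by
      have := intervalIntegral.intervalIntegrable_rpow' (a := 0) (b := 1) (r := 2 - s) (by linarith)
      rw [intervalIntegrable_iff_integrableOn_Ioo_of_le zero_le_one] at this; exact this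
    refine this.congr_fun (fun t ht => ?_) measurableSet_Ioo; simp only [finrank_E3, smul_eq_mul]
    rw [← Real.rpow_natCast, ← rpow_add ht.1]; norm_num; ring_nf
  have := h.2; rw [hasFiniteIntegral_iff_norm] at this
  refine lt_of_le_of_lt (lintegral_mono fun y => ?_) this; rw [norm_of_nonneg (by positivity)]

lemma lintegral_ball_compl_rpow_lt_top {s : ℝ} (hs : 3 < s) :
    ∫⁻ y in (ball (0 : E3) 1)ᶜ, ofReal (‖y‖ ^ (-s)) < ∞ := by
  have h := finite_integral_one_add_norm (μ := (volume : Measure E3)) (r := s) (by rw [finrank_E3]; exact_mod_cast hs)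
  calc _ ≤ ∫⁻ y in (ball (0 : E3) 1)ᶜ, ofReal (2 ^ s) *
        ofReal ((1 + ‖y‖) ^ (-s)) := by
        refine setLIntegral_mono (by fun_prop) fun y hy => ?_
        have hy1 : 1 ≤ ‖y‖ := by simpa using hy
        rw [← ofReal_mul (by positivity)]; refine ofReal_le_ofReal ?_
        rw [rpow_neg (by positivity), rpow_neg (by positivity),
          inv_eq_one_div, inv_eq_one_div, mul_one_div, div_le_div_iff₀ (by positivity) (by positivity),
          one_mul, ← mul_rpow (by norm_num) (by positivity)]
        exact Real.rpow_le_rpow (by positivity) (by linarith) (by linarith)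
    _ ≤ ∫⁻ y : E3, ofReal (2 ^ s) * ofReal ((1 + ‖y‖) ^ (-s)) :=
        setLIntegral_le_lintegral _ _
    _ = ofReal (2 ^ s) * ∫⁻ y : E3, ofReal ((1 + ‖y‖) ^ (-s)) :=
        lintegral_const_mul _ (by fun_prop)
    _ < ∞ := mul_lt_top ofReal_lt_top h

lemma lintegral_ball_rpow (s : ℝ) {r : ℝ} (hr : 0 < r) : ∫⁻ y in ball (0 : E3) r, ofReal (‖y‖ ^ (-s)) =
      ofReal (r ^ (3 - s)) * ∫⁻ y in ball (0 : E3) 1, ofReal (‖y‖ ^ (-s)) := by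
  rw [← lintegral_indicator isOpen_ball.measurableSet, lintegral_comp_smul _ hr,
    ← lintegral_indicator isOpen_ball.measurableSet, ← lintegral_const_mul' _ _ ofReal_ne_top,
    ← lintegral_const_mul' _ _ ofReal_ne_top]
  congr 1; ext y; simp only [indicator, Metric.mem_ball, dist_zero_right, norm_smul, norm_of_nonneg hr.le]
  have : r * ‖y‖ < r ↔ ‖y‖ < 1 := by constructor <;> intro h <;> nlinarith
  simp only [this]
  split_ifs
  · rw [← ofReal_mul (by positivity), ← ofReal_mul (by positivity),
      mul_rpow hr.le (norm_nonneg _), ← mul_assoc, ← Real.rpow_natCast, ← rpow_add hr]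
    norm_num [sub_eq_add_neg]
  · simp

/-! ### The Riesz potential of order one and the Hardy–Littlewood–Sobolev inequality -/

/-- The kernel `|y|⁻²`. -/
noncomputable def kern (y : E3) : ℝ≥0∞ := ofReal (‖y‖ ^ (-2 : ℝ))

/-- The Riesz potential `∫ |x - y|⁻² f(y) dy`. -/
noncomputable def riesz (f : E3 → ℝ≥0∞) (x : E3) : ℝ≥0∞ := ∫⁻ y : E3, kern (x - y) * f y

@[fun_prop] lemma measurable_kern : Measurable kern := by unfold kern; fun_prop

lemma measurable_riesz {f : E3 → ℝ≥0∞} (hf : Measurable f) : Measurable (riesz f) := by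
  unfold riesz; exact lintegral_prod_right' (f := fun p : E3 × E3 => kern (p.1 - p.2) * f p.2) (by fun_prop)

lemma kern_neg (y : E3) : kern (-y) = kern y := by simp [kern]

lemma setLIntegral_sub (f : E3 → ℝ≥0∞) (S : Set E3) (hS : MeasurableSet S) (x : E3) :
    ∫⁻ z, S.indicator f (x - z) = ∫⁻ z in S, f z := by
  rw [lintegral_sub_left_eq_self, lintegral_indicator hS]

lemma exists_kern_mul_kern : ∃ C : ℝ≥0∞, C ≠ ∞ ∧ ∀ x y : E3, x ≠ y →
      ∫⁻ z, kern (x - z) * kern (z - y) ≤ C * ofReal (‖x - y‖ ^ (-1 : ℝ)) := by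
  set G : ℝ → E3 → ℝ≥0∞ := fun d u => kern u * min (kern u) (ofReal (d ^ (-2 : ℝ)))
  have hGm : ∀ d, Measurable (G d) := fun d => by fun_prop
  have hG1 : ∫⁻ u, G 1 u < ∞ := by
    rw [← lintegral_add_compl _ (isOpen_ball.measurableSet : MeasurableSet (ball (0 : E3) 1))]
    refine ENNReal.add_lt_top.2 ⟨lt_of_le_of_lt (lintegral_mono fun u => ?_) (lintegral_ball_rpow_lt_top (s := 2) (by norm_num)),
      lt_of_le_of_lt (lintegral_mono fun u => ?_) (lintegral_ball_compl_rpow_lt_top (s := 4) (by norm_num))⟩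
    · exact (mul_le_mul_right (min_le_right _ _) _).trans (by simp [kern])
    · refine (mul_le_mul_right (min_le_left _ _) _).trans (le_of_eq ?_)
      rw [kern, ← ofReal_mul (by positivity), ← sq, ← Real.rpow_natCast, ← Real.rpow_mul (norm_nonneg _)]; norm_num
  refine ⟨4 * ∫⁻ u, G 1 u, by finiteness, fun x y hxy => ?_⟩
  have hxy' : 0 < ‖x - y‖ := norm_pos_iff.2 (sub_ne_zero.2 hxy); set d : ℝ := ‖x - y‖ / 2 with hd
  have hd0 : 0 < d := by positivity
  have hmax : ∀ a b : E3, ‖a‖ ≤ ‖b‖ → d ≤ ‖b‖ → kern a * kern b ≤ G d a := fun a b hab hb => by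
    rcases eq_or_ne a 0 with rfl | ha
    · simp [kern]
    · exact mul_le_mul_right (le_min (ofReal_le_ofReal (Real.rpow_le_rpow_of_nonpos (norm_pos_iff.2 ha) hab (by norm_num)))
        (ofReal_le_ofReal (Real.rpow_le_rpow_of_nonpos hd0 hb (by norm_num)))) _
  have hsc : ∫⁻ u, G d u = ofReal (d ^ (-1 : ℝ)) * ∫⁻ u, G 1 u := by
    rw [lintegral_comp_smul _ hd0, ← lintegral_const_mul' _ _ ofReal_ne_top, ← lintegral_const_mul' _ _ ofReal_ne_top]
    refine lintegral_congr fun u => ?_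
    have h1 : kern (d • u) = ofReal (d ^ (-2 : ℝ)) * kern u := by
      rw [kern, kern, norm_smul, norm_of_nonneg hd0.le, mul_rpow hd0.le (norm_nonneg _), ofReal_mul (by positivity)]
    simp only [G]
    have h2 : min (ofReal (d ^ (-2 : ℝ)) * kern u) (ofReal (d ^ (-2 : ℝ))) =
        ofReal (d ^ (-2 : ℝ)) * min (kern u) (ofReal (1 ^ (-2 : ℝ))) := by rw [mul_min]; simp
    have h3 : ofReal (d ^ (-1 : ℝ)) = ofReal (d ^ 3) * (ofReal (d ^ (-2 : ℝ)) * ofReal (d ^ (-2 : ℝ))) := by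
      rw [← ofReal_mul (by positivity), ← ofReal_mul (by positivity), ← Real.rpow_natCast, ← rpow_add hd0, ← rpow_add hd0]
      norm_num
    rw [h1, h2, h3]; ring
  calc _ ≤ ∫⁻ z, (G d (x - z) + G d (y - z)) := lintegral_mono fun z => by
        rw [← kern_neg (z - y), neg_sub]; have htri := norm_sub_le (x - z) (y - z)
        rw [sub_sub_sub_cancel_right] at htri
        rcases le_total ‖x - z‖ ‖y - z‖ with h | h
        · exact le_add_right (hmax _ _ h (by linarith))
        · rw [mul_comm]; exact le_add_left (hmax _ _ h (by linarith))
    _ = 2 * (ofReal (d ^ (-1 : ℝ)) * ∫⁻ u, G 1 u) := by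
      rw [lintegral_add_left (by fun_prop), lintegral_sub_left_eq_self, lintegral_sub_left_eq_self, hsc, two_mul]
    _ = _ := by
      have : d ^ (-1 : ℝ) = 2 * ‖x - y‖ ^ (-1 : ℝ) := by rw [Real.rpow_neg_one, Real.rpow_neg_one, hd]; field_simp
      rw [this, ofReal_mul (by norm_num), ofReal_ofNat]; ring

lemma exists_lintegral_inv_norm_le : ∃ C : ℝ≥0∞, C ≠ ∞ ∧ ∀ (A : Set E3), MeasurableSet A → ∀ y : E3,
      ∫⁻ z in A, ofReal (‖y - z‖ ^ (-1 : ℝ)) ≤ C * volume A ^ (2 / 3 : ℝ) := by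
  set c1 := ∫⁻ y in ball (0 : E3) 1, ofReal (‖y‖ ^ (-1 : ℝ))
  have h1 : c1 ≠ ∞ := (lintegral_ball_rpow_lt_top (by norm_num)).ne; refine ⟨c1 + 1, by finiteness, fun A hA y => ?_⟩
  rcases eq_or_ne (volume A) 0 with h0 | h0
  · rw [Measure.restrict_eq_zero.2 h0]; simp
  rcases eq_or_ne (volume A) ∞ with ht | ht
  · rw [ht, ENNReal.top_rpow_of_pos (by norm_num), ENNReal.mul_top (by simp)]; exact le_top
  set a : ℝ := (volume A).toReal with ha; have ha0 : 0 < a := ENNReal.toReal_pos h0 ht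
  set r : ℝ := a ^ (1 / 3 : ℝ) with hr
  have hr0 : 0 < r := by positivity
  set g : E3 → ℝ≥0∞ := fun y => ofReal (‖y‖ ^ (-1 : ℝ)) with hg
  have hBm : MeasurableSet (ball (0 : E3) r) := isOpen_ball.measurableSet
  have hgm : Measurable ((ball (0 : E3) r).indicator g) := (by fun_prop : Measurable g).indicator hBm
  calc _ ≤ ∫⁻ z in A, ((ball (0 : E3) r).indicator g (y - z) + ofReal (r ^ (-1 : ℝ))) := by
        refine lintegral_mono fun z => ?_
        by_cases h : y - z ∈ ball (0 : E3) r
        · rw [indicator_of_mem h]; exact le_self_add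
        · refine le_add_left (ofReal_le_ofReal ?_)
          exact Real.rpow_le_rpow_of_nonpos hr0 (by simpa using h) (by norm_num)
    _ = (∫⁻ z in A, (ball (0 : E3) r).indicator g (y - z)) +
        ofReal (r ^ (-1 : ℝ)) * volume A := by
        rw [lintegral_add_left (by fun_prop), setLIntegral_const]
    _ ≤ ofReal (r ^ (3 - 1 : ℝ)) * c1 + ofReal (r ^ (-1 : ℝ)) * volume A := by
      refine add_le_add ((setLIntegral_le_lintegral _ _).trans ?_) le_rfl
      rw [setLIntegral_sub _ _ hBm, lintegral_ball_rpow 1 hr0]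
    _ = (c1 + 1) * ofReal (a ^ (2 / 3 : ℝ)) := by
      have e1 : r ^ (3 - 1 : ℝ) = a ^ (2 / 3 : ℝ) := by rw [hr, ← Real.rpow_mul ha0.le]; norm_num
      have e2 : r ^ (-1 : ℝ) * a = a ^ (2 / 3 : ℝ) := by
        rw [hr, ← Real.rpow_mul ha0.le]; nth_rewrite 2 [← Real.rpow_one a]; rw [← rpow_add ha0]; norm_num
      have e3 : volume A = ofReal a := (ofReal_toReal ht).symm; rw [e3, ← ofReal_mul (by positivity), e1, e2]; ring
    _ = _ := by rw [← ENNReal.ofReal_rpow_of_pos ha0, ha, ofReal_toReal ht]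

lemma mul_le_lintegral_min {s t : ℝ} (hs : 0 ≤ s) (hst : s ≤ t) : ofReal s * ofReal t ≤
      4 * ∫⁻ b in Ioi 0, (Iio t).indicator (fun b => ofReal (min s b)) b := by
  have h : ofReal (s / 2) * ofReal (t / 2) ≤ ∫⁻ b in Ioi 0, (Iio t).indicator (fun b => ofReal (min s b)) b := by
    calc _ = ∫⁻ b in Ioo (t / 2) t, ofReal (s / 2) := by rw [setLIntegral_const, Real.volume_Ioo]; congr 2; ring
      _ ≤ ∫⁻ b in Ioo (t / 2) t, (Iio t).indicator (fun b => ofReal (min s b)) b := by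
        refine setLIntegral_mono' measurableSet_Ioo fun b hb => ?_; rw [indicator_of_mem (show b ∈ Iio t from hb.2)]
        exact ofReal_le_ofReal (le_min (by linarith) (by linarith [hb.1]))
      _ ≤ _ := lintegral_mono_set fun b hb => lt_of_le_of_lt (by linarith) hb.1
  calc _ = 4 * (ofReal (s / 2) * ofReal (t / 2)) := by
        rw [← ofReal_ofNat 4, ← ofReal_mul (by linarith), ← ofReal_mul (by linarith), ← ofReal_mul (by norm_num)]
        congr 1; ring
    _ ≤ _ := by gcongr

lemma exists_lintegral_kern_min_le : ∃ C : ℝ≥0∞, C ≠ ∞ ∧ ∀ (f : E3 → ℝ), Measurable f → ∀ (z : E3) (b : ℝ),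
      ∫⁻ y, ofReal (‖z - y‖ ^ (-1 : ℝ)) * ofReal (min (f y) b) ≤
        C * ∫⁻ a in Ioo 0 b, volume {y | a < f y} ^ (2 / 3 : ℝ) := by
  obtain ⟨C, hC, h⟩ := exists_lintegral_inv_norm_le; refine ⟨C, hC, fun f hf z b => ?_⟩
  have hm : MeasurableSet {p : E3 × ℝ | p.2 < f p.1} := measurableSet_lt measurable_snd (by fun_prop)
  have e : ∀ y, ofReal (min (f y) b) = ∫⁻ a in Ioo 0 b, {p : E3 × ℝ | p.2 < f p.1}.indicator 1 (y, a) := by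
    intro y
    have : (fun a => {p : E3 × ℝ | p.2 < f p.1}.indicator (1 : E3 × ℝ → ℝ≥0∞) (y, a)) =
        (Iio (f y)).indicator 1 := by ext a; simp [indicator]
    rw [this, lintegral_indicator_one measurableSet_Iio, Measure.restrict_apply measurableSet_Iio,
      ← Ioi_inter_Iio, inter_comm, inter_assoc, Iio_inter_Iio, Ioi_inter_Iio, Real.volume_Ioo,
      sub_zero, inf_comm]
  have hmi : Measurable ({p : E3 × ℝ | p.2 < f p.1}.indicator (1 : E3 × ℝ → ℝ≥0∞)) := measurable_one.indicator hm
  calc _ = ∫⁻ y, ∫⁻ a in Ioo 0 b, ofReal (‖z - y‖ ^ (-1 : ℝ)) *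
        {p : E3 × ℝ | p.2 < f p.1}.indicator 1 (y, a) := by
        congr 1; ext y; rw [e, lintegral_const_mul' _ _ ofReal_ne_top]
    _ = ∫⁻ a in Ioo 0 b, ∫⁻ y, ofReal (‖z - y‖ ^ (-1 : ℝ)) *
        {p : E3 × ℝ | p.2 < f p.1}.indicator 1 (y, a) :=
        lintegral_swap (by fun_prop)
    _ ≤ ∫⁻ a in Ioo 0 b, C * volume {y | a < f y} ^ (2 / 3 : ℝ) := by
      refine lintegral_mono fun a => ?_; have hA : MeasurableSet {y | a < f y} := measurableSet_lt measurable_const hf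
      refine le_trans (le_of_eq ?_) (h _ hA z); rw [← lintegral_indicator hA]
      congr 1; ext y; by_cases hy : a < f y <;> simp [indicator, hy]
    _ = _ := lintegral_const_mul' _ _ hC

lemma lintegral_rpow_two_thirds_le {F : ℝ → ℝ≥0∞} (hFm : Measurable F) {b : ℝ} (hb : 0 < b) :
    ∫⁻ a in Ioo 0 b, F a ^ (2 / 3 : ℝ) ≤ (∫⁻ a in Ioi 0, F a * ofReal (a ^ (1 / 5 : ℝ))) ^ (2 / 3 : ℝ) *
        (2 * ofReal (b ^ (1 / 5 : ℝ))) := by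
  have hc : (3 / 2 : ℝ).HolderConjugate 3 := by rw [Real.holderConjugate_iff]; norm_num
  have h1 := ENNReal.lintegral_mul_le_Lp_mul_Lq (volume.restrict (Ioo 0 b)) hc
    (f := fun a => (F a * ofReal (a ^ (1 / 5 : ℝ))) ^ (2 / 3 : ℝ))
    (g := fun a => ofReal (a ^ (-(2 / 15) : ℝ))) (by fun_prop) (by fun_prop)
  calc _ = ∫⁻ a in Ioo 0 b, ((fun a => (F a * ofReal (a ^ (1 / 5 : ℝ))) ^ (2 / 3 : ℝ)) *
        (fun a => ofReal (a ^ (-(2 / 15) : ℝ)))) a := by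
        refine setLIntegral_congr_fun measurableSet_Ioo fun a ha => ?_; simp only [Pi.mul_apply]
        rw [mul_rpow_of_nonneg _ _ (by norm_num), ENNReal.ofReal_rpow_of_pos (rpow_pos_of_pos ha.1 _),
          ← Real.rpow_mul ha.1.le, mul_assoc, ← ofReal_mul (rpow_nonneg ha.1.le _),
          ← rpow_add ha.1]
        norm_num
    _ ≤ _ := h1
    _ ≤ _ := by
      refine mul_le_mul' ?_ ?_
      · have : ∀ a, ((F a * ofReal (a ^ (1 / 5 : ℝ))) ^ (2 / 3 : ℝ)) ^ (3 / 2 : ℝ) =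
            F a * ofReal (a ^ (1 / 5 : ℝ)) := fun a => by
          rw [← rpow_mul]; norm_num
        simp only [this]; norm_num; exact rpow_le_rpow (lintegral_mono_set fun a ha => ha.1) (by norm_num)
      · have : ∫⁻ a in Ioo 0 b, ofReal (a ^ (-(2 / 15) : ℝ)) ^ (3 : ℝ) = ofReal (b ^ (3 / 5 : ℝ) / (3 / 5)) := by
          have hi := intervalIntegral.intervalIntegrable_rpow' (a := 0) (b := b) (r := -(2 / 5)) (by norm_num)
          rw [intervalIntegrable_iff_integrableOn_Ioo_of_le hb.le] at hi
          have e2 : ∫⁻ a in Ioo 0 b, ofReal (a ^ (-(2 / 15) : ℝ)) ^ (3 : ℝ) =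
              ∫⁻ a in Ioo 0 b, ofReal (a ^ (-(2 / 5) : ℝ)) := by
            refine setLIntegral_congr_fun measurableSet_Ioo fun a ha => ?_
            rw [ENNReal.ofReal_rpow_of_pos (rpow_pos_of_pos ha.1 _), ← Real.rpow_mul ha.1.le]; norm_num
          rw [e2, ← ofReal_integral_eq_lintegral_ofReal hi
            ((ae_restrict_iff' measurableSet_Ioo).2 (of_forall fun a ha =>
              rpow_nonneg ha.1.le _)), ← integral_Ioc_eq_integral_Ioo,
            ← intervalIntegral.integral_of_le hb.le, integral_rpow (Or.inl (by norm_num))]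
          congr 1; rw [Real.zero_rpow (by norm_num)]; norm_num
        rw [this, ofReal_rpow_of_nonneg (by positivity) (by norm_num),
          Real.div_rpow (by positivity) (by norm_num), ← Real.rpow_mul hb.le,
          ← ofReal_ofNat 2, ← ofReal_mul (by norm_num)]
        refine ofReal_le_ofReal ?_
        have e3 : (2 : ℝ)⁻¹ ≤ (3 / 5 : ℝ) ^ (1 / 3 : ℝ) := by
          calc (2 : ℝ)⁻¹ ≤ (3 / 5 : ℝ) := by norm_num
            _ = (3 / 5 : ℝ) ^ (1 : ℝ) := by simp
            _ ≤ _ := Real.rpow_le_rpow_of_exponent_ge (by norm_num) (by norm_num) (by norm_num)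
        rw [div_eq_mul_inv, mul_comm 2]
        have : (3 / 5 * (1 / 3) : ℝ) = 1 / 5 := by norm_num
        rw [this]; refine mul_le_mul_of_nonneg_left ?_ (by positivity); exact inv_le_of_inv_le₀ (by positivity) e3

set_option maxHeartbeats 800000 in
lemma exists_lintegral_inv_norm_mul_mul_le : ∃ C : ℝ≥0∞, C ≠ ∞ ∧ ∀ f : E3 → ℝ, Measurable f → (∀ x, 0 ≤ f x) →
      ∫⁻ y, ∫⁻ z, ofReal (‖y - z‖ ^ (-1 : ℝ)) * (ofReal (f y) * ofReal (f z)) ≤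
        C * (∫⁻ x, ofReal (f x ^ (6 / 5 : ℝ))) ^ (5 / 3 : ℝ) := by
  obtain ⟨C, hC, h⟩ := exists_lintegral_kern_min_le; refine ⟨16 * C, by finiteness, fun f hf hf0 => ?_⟩
  set κ : E3 → E3 → ℝ≥0∞ := fun y z => ofReal (‖y - z‖ ^ (-1 : ℝ)) with hκ
  have hκs : ∀ y z, κ y z = κ z y := fun y z => by simp only [hκ]; rw [norm_sub_rev]
  have hκm : Measurable (fun p : E3 × E3 => κ p.1 p.2) := by simp only [hκ]; fun_prop
  set H : ℝ → ℝ → ℝ≥0∞ := fun s t => ∫⁻ b in Ioi 0, (Iio t).indicator (fun b => ofReal (min s b)) b with hH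
  set G : E3 → E3 → ℝ → ℝ≥0∞ := fun y z b =>
    {q : E3 × ℝ | q.2 < f q.1}.indicator (1 : E3 × ℝ → ℝ≥0∞) (z, b) * (κ z y * ofReal (min (f y) b)) with hG
  have hset : MeasurableSet {p : E3 × ℝ | p.2 < f p.1} := measurableSet_lt measurable_snd (by fun_prop)
  have hmi : Measurable ({p : E3 × ℝ | p.2 < f p.1}.indicator (1 : E3 × ℝ → ℝ≥0∞)) := measurable_one.indicator hset
  have hGm : Measurable (fun p : (E3 × E3) × ℝ => G p.1.1 p.1.2 p.2) := by
    simp only [hG]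
    have h3 : Measurable (fun p : (E3 × E3) × ℝ => κ p.1.2 p.1.1) :=
      hκm.comp (f := fun p : (E3 × E3) × ℝ => (p.1.2, p.1.1)) (by fun_prop)
    fun_prop
  have hHG : ∀ y z, κ y z * H (f y) (f z) = ∫⁻ b in Ioi 0, G y z b := by
    intro y z; simp only [hH, hG]; rw [← lintegral_const_mul' _ _ ofReal_ne_top]; congr 1; ext b
    by_cases hb : b < f z
    · rw [← hκs y z]; simp [hκ, indicator, hb]
    · simp [indicator, hb]
  have hHm : Measurable (fun p : E3 × E3 => κ p.1 p.2 * H (f p.1) (f p.2)) := by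
    simp only [hHG]; exact hGm.lintegral_prod_right'
  set F : ℝ → ℝ≥0∞ := fun a => volume {y | a < f y} with hF
  have hFm : Measurable F := by
    have : Antitone F := fun a b hab => measure_mono fun y hy => lt_of_le_of_lt hab hy; exact this.measurable
  set W : ℝ≥0∞ := ∫⁻ a in Ioi 0, F a * ofReal (a ^ (1 / 5 : ℝ)) with hW
  have hN : ∫⁻ x, ofReal (f x ^ (6 / 5 : ℝ)) = ofReal (6 / 5) * W := by
    rw [lintegral_rpow_eq_lintegral_meas_lt_mul volume (of_forall hf0) hf.aemeasurable (by norm_num)]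
    norm_num [hW, hF]
  have hhold := fun b hb => lintegral_rpow_two_thirds_le hFm (b := b) hb
  have hmain : ∫⁻ y, ∫⁻ z, κ y z * H (f y) (f z) ≤ 2 * C * W ^ (5 / 3 : ℝ) := by
    calc _ = ∫⁻ p : E3 × E3, ∫⁻ b in Ioi 0, G p.1 p.2 b := by
          rw [volume_eq_prod, lintegral_prod]
          · simp only [hHG]
          · exact hGm.lintegral_prod_right'.aemeasurable
      _ = ∫⁻ b in Ioi 0, ∫⁻ p : E3 × E3, G p.1 p.2 b := lintegral_lintegral_swap hGm.aemeasurable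
      _ = ∫⁻ b in Ioi 0, ∫⁻ z, ∫⁻ y, G y z b := by
        congr 1; ext b
        have : Measurable (fun p : E3 × E3 => G p.1 p.2 b) := hGm.comp (f := fun p : E3 × E3 => (p, b)) (by fun_prop)
        exact lintegral_prod_symm _ this.aemeasurable
      _ ≤ ∫⁻ b in Ioi 0, ∫⁻ z, {q : E3 × ℝ | q.2 < f q.1}.indicator (1 : E3 × ℝ → ℝ≥0∞) (z, b) *
            (C * ∫⁻ a in Ioo 0 b, F a ^ (2 / 3 : ℝ)) := by
          refine lintegral_mono fun b => lintegral_mono fun z => ?_; simp only [hG]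
          rw [lintegral_const_mul' _ _ (by by_cases h : b < f z <;> simp [indicator, h])]
          exact mul_le_mul_right (h f hf z b) _
      _ = ∫⁻ b in Ioi 0, F b * (C * ∫⁻ a in Ioo 0 b, F a ^ (2 / 3 : ℝ)) := by
        congr 1; ext b; rw [lintegral_mul_const _ (by fun_prop)]
        congr 1; have : MeasurableSet {y | b < f y} := measurableSet_lt measurable_const hf
        simp only [hF]; rw [← lintegral_indicator_one this]; rfl
      _ ≤ ∫⁻ b in Ioi 0, (2 * C * W ^ (2 / 3 : ℝ)) * (F b * ofReal (b ^ (1 / 5 : ℝ))) := by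
        refine setLIntegral_mono (by fun_prop) fun b hb => ?_
        calc _ ≤ F b * (C * (W ^ (2 / 3 : ℝ) * (2 * ofReal (b ^ (1 / 5 : ℝ))))) := by gcongr; exact hhold b hb
          _ = _ := by ring
      _ = 2 * C * W ^ (2 / 3 : ℝ) * W := lintegral_const_mul _ (by fun_prop)
      _ = _ := by
        have : W ^ (5 / 3 : ℝ) = W ^ (2 / 3 : ℝ) * W := by
          rw [show (5 / 3 : ℝ) = 2 / 3 + 1 by norm_num, rpow_add_of_nonneg _ _ (by norm_num) (by norm_num),
            rpow_one]
        rw [this]; ring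
  have hpt : ∀ y z, κ y z * (ofReal (f y) * ofReal (f z)) ≤ 4 * (κ y z * H (f y) (f z) + κ z y * H (f z) (f y)) := by
    intro y z
    rcases le_total (f y) (f z) with hyz | hyz
    · calc _ ≤ κ y z * (4 * H (f y) (f z)) := by exact mul_le_mul_right (mul_le_lintegral_min (hf0 y) hyz) _
        _ = 4 * (κ y z * H (f y) (f z)) := by ring
        _ ≤ _ := by gcongr; exact le_self_add
    · calc _ ≤ κ y z * (4 * H (f z) (f y)) := by
            rw [mul_comm (ofReal (f y))]; exact mul_le_mul_right (mul_le_lintegral_min (hf0 z) hyz) _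
        _ = 4 * (κ z y * H (f z) (f y)) := by rw [hκs y z]; ring
        _ ≤ _ := by gcongr; exact le_add_self
  change ∫⁻ y, ∫⁻ z, κ y z * (ofReal (f y) * ofReal (f z)) ≤ _
  clear_value G H κ F W
  have hHm' : Measurable (fun p : E3 × E3 => κ p.2 p.1 * H (f p.2) (f p.1)) := hHm.comp measurable_swap
  calc _ ≤ ∫⁻ y, ∫⁻ z, 4 * (κ y z * H (f y) (f z) + κ z y * H (f z) (f y)) :=
        lintegral_mono fun y => lintegral_mono fun z => hpt y z
    _ = 4 * ((∫⁻ y, ∫⁻ z, κ y z * H (f y) (f z)) + ∫⁻ y, ∫⁻ z, κ z y * H (f z) (f y)) := by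
      have h1 : ∀ y, ∫⁻ z, 4 * (κ y z * H (f y) (f z) + κ z y * H (f z) (f y)) =
          4 * ((∫⁻ z, κ y z * H (f y) (f z)) + ∫⁻ z, κ z y * H (f z) (f y)) := fun y => by
        have hs : Measurable (fun z => κ y z * H (f y) (f z)) := hHm.comp (f := fun z => (y, z)) (by fun_prop)
        rw [lintegral_const_mul' _ _ (by norm_num), lintegral_add_left hs]
      simp only [h1]; rw [lintegral_const_mul' _ _ (by norm_num), lintegral_add_left hHm.lintegral_prod_right']
    _ = 4 * (2 * ∫⁻ y, ∫⁻ z, κ y z * H (f y) (f z)) := by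
      have hsw : ∫⁻ y, ∫⁻ z, κ z y * H (f z) (f y) = ∫⁻ y, ∫⁻ z, κ y z * H (f y) (f z) :=
        lintegral_lintegral_swap hHm'.aemeasurable
      rw [hsw, two_mul]
    _ ≤ 4 * (2 * (2 * C * W ^ (5 / 3 : ℝ))) := by gcongr
    _ = 16 * C * W ^ (5 / 3 : ℝ) := by ring
    _ ≤ _ := by
      rw [hN]; gcongr
      calc W = 1 * W := (one_mul W).symm
        _ ≤ _ := by gcongr; rw [ENNReal.one_le_ofReal]; norm_num

lemma exists_lintegral_riesz_sq_le : ∃ C : ℝ≥0∞, C ≠ ∞ ∧ ∀ f : E3 → ℝ, Measurable f → (∀ x, 0 ≤ f x) →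
      ∫⁻ x, riesz (fun y => ofReal (f y)) x ^ 2 ≤ C * (∫⁻ x, ofReal (f x ^ (6 / 5 : ℝ))) ^ (5 / 3 : ℝ) := by
  obtain ⟨C, hC, h⟩ := exists_lintegral_inv_norm_mul_mul_le; obtain ⟨D, hD, hk⟩ := exists_kern_mul_kern
  refine ⟨D * C, by finiteness, fun f hf hf0 => ?_⟩; set g : E3 → ℝ≥0∞ := fun y => ofReal (f y)
  have hgm : Measurable g := by fun_prop
  have e1 : ∀ x, riesz g x ^ 2 = ∫⁻ p : E3 × E3, (kern (x - p.1) * g p.1) * (kern (x - p.2) * g p.2) := by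
    intro x
    rw [volume_eq_prod, lintegral_prod_mul (f := fun y => kern (x - y) * g y)
      (g := fun y => kern (x - y) * g y) (by fun_prop) (by fun_prop), sq]; rfl
  have hm : Measurable (fun q : E3 × (E3 × E3) =>
      (kern (q.1 - q.2.1) * g q.2.1) * (kern (q.1 - q.2.2) * g q.2.2)) := by fun_prop
  calc _ = ∫⁻ p : E3 × E3, ∫⁻ x, (kern (x - p.1) * g p.1) * (kern (x - p.2) * g p.2) := by
        simp only [e1]; exact lintegral_lintegral_swap hm.aemeasurable
    _ = ∫⁻ y, ∫⁻ z, ∫⁻ x, (kern (x - y) * g y) * (kern (x - z) * g z) := by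
      rw [volume_eq_prod, lintegral_prod]; exact (hm.comp measurable_swap).lintegral_prod_right'.aemeasurable
    _ ≤ ∫⁻ y, ∫⁻ z, D * (ofReal (‖y - z‖ ^ (-1 : ℝ)) * (g y * g z)) := by
      refine lintegral_mono fun y => lintegral_mono_ae ?_
      have : ∀ᵐ z : E3, z ≠ y := by simp [ae_iff]
      filter_upwards [this] with z hz
      calc _ = ∫⁻ x, (g y * g z) * (kern (y - x) * kern (x - z)) := by
            congr 1; ext x; rw [← kern_neg (x - y), neg_sub]; ring
        _ = (g y * g z) * ∫⁻ x, kern (y - x) * kern (x - z) :=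
            lintegral_const_mul _ (by fun_prop)
        _ ≤ (g y * g z) * (D * ofReal (‖y - z‖ ^ (-1 : ℝ))) := by gcongr; exact hk y z hz.symm
        _ = _ := by ring
    _ = D * ∫⁻ y, ∫⁻ z, ofReal (‖y - z‖ ^ (-1 : ℝ)) * (g y * g z) := by simp only [lintegral_const_mul' _ _ hD]
    _ ≤ D * (C * (∫⁻ x, ofReal (f x ^ (6 / 5 : ℝ))) ^ (5 / 3 : ℝ)) := by gcongr; exact h f hf hf0
    _ = _ := by ring

/-- Converse of Hölder's inequality, tested against bounded functions of bounded support. -/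
lemma lintegral_rpow_le_of_forall_mul_le {h : E3 → ℝ≥0∞} (hh : Measurable h) {p q : ℝ}
    (hpq : p.HolderConjugate q) {B : ℝ≥0∞}
    (H : ∀ g : E3 → ℝ, Measurable g → (∀ x, 0 ≤ g x) → (∃ N : ℝ, ∀ x, g x ≤ N) → (∃ N : ℝ, ∀ x, N < ‖x‖ → g x = 0) →
      ∫⁻ x, h x * ofReal (g x) ≤ B * (∫⁻ x, ofReal (g x ^ q)) ^ (1 / q)) :
    ∫⁻ x, h x ^ p ≤ B ^ p := by
  have hp0 : 0 < p := hpq.pos; have hp1 : 1 < p := hpq.lt; have hq0 : 0 < q := hpq.symm.pos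
  have hS : ∀ N : ℕ, MeasurableSet {x : E3 | ‖x‖ ≤ N} := fun N => measurableSet_le measurable_norm measurable_const
  set I : ℕ → E3 → ℝ≥0∞ := fun N => {x : E3 | ‖x‖ ≤ N}.indicator (fun x => min (h x) N ^ p) with hI
  have hIm : ∀ N, Measurable (I N) := fun N => Measurable.indicator (by fun_prop) (hS N)
  have hbound : ∀ N, ∫⁻ x, I N x ≤ B ^ p := by
    intro N; set g : E3 → ℝ := {x : E3 | ‖x‖ ≤ N}.indicator (fun x => (min (h x) N).toReal ^ (p - 1)) with hg
    have hmin : ∀ x, min (h x) N ≠ ∞ := fun x => ne_top_of_le_ne_top (by simp) (min_le_right _ _)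
    have hgm : Measurable g := Measurable.indicator (by fun_prop) (hS N)
    have key := H g hgm (fun x => indicator_nonneg (fun x _ => by positivity) x)
      ⟨(N : ℝ) ^ (p - 1), fun x => indicator_le' (f := fun x => (min (h x) N).toReal ^ (p - 1))
        (g := fun _ => (N : ℝ) ^ (p - 1)) (fun x _ => Real.rpow_le_rpow (by positivity)
          (by simpa using toReal_mono (by simp) (min_le_right (h x) N)) (by linarith))
        (fun x _ => by positivity) x⟩
      ⟨N, fun x hx => indicator_of_notMem (by simpa using hx) _⟩
    have e1 : ∀ x, ofReal (g x ^ q) = I N x := by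
      intro x
      by_cases hx : ‖x‖ ≤ N
      · simp only [hg, hI, indicator, mem_ofPred_eq, hx, if_true]
        rw [← Real.rpow_mul (by positivity), hpq.sub_one_mul_conj, ← ofReal_rpow_of_nonneg (by positivity) hp0.le,
          ofReal_toReal (hmin x)]
      · simp [hg, hI, indicator, hx, Real.zero_rpow hq0.ne', ENNReal.zero_rpow_of_pos hq0]
    have e2 : ∀ x, I N x ≤ h x * ofReal (g x) := by
      intro x
      by_cases hx : ‖x‖ ≤ N
      · simp only [hg, hI, indicator, mem_ofPred_eq, hx, if_true]
        rw [← ofReal_rpow_of_nonneg (by positivity) (by linarith), ofReal_toReal (hmin x)]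
        calc _ = min (h x) N ^ (1 + (p - 1)) := by ring_nf
          _ = min (h x) N * min (h x) N ^ (p - 1) := by
            rw [rpow_add_of_nonneg _ _ zero_le_one (by linarith), rpow_one]
          _ ≤ _ := by gcongr; exact min_le_left _ _
      · simp [hI, indicator, hx]
    simp only [e1] at key; have hle := (lintegral_mono e2).trans key
    have hfin : ∫⁻ x, I N x ≠ ∞ := by
      have : ∫⁻ x, I N x ≤ (N : ℝ≥0∞) ^ p * volume (closedBall (0 : E3) N) := by
        rw [← setLIntegral_const, ← lintegral_indicator Metric.isClosed_closedBall.measurableSet]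
        refine lintegral_mono fun x => ?_
        by_cases hx : ‖x‖ ≤ N
        · simp only [hI, indicator, mem_ofPred_eq, hx, if_true, Metric.mem_closedBall, dist_zero_right]
          exact rpow_le_rpow (min_le_right _ _) hp0.le
        · simp [hI, indicator, hx]
      refine ne_top_of_le_ne_top (ENNReal.mul_ne_top (ENNReal.rpow_ne_top_of_nonneg hp0.le (by simp)) ?_) this
      exact measure_closedBall_lt_top.ne
    rcases eq_or_ne (∫⁻ x, I N x) 0 with h0 | h0
    · rw [h0]; exact zero_le
    set J := ∫⁻ x, I N x; have hJq0 : J ^ (1 / q) ≠ 0 := (ENNReal.rpow_pos (pos_iff_ne_zero.2 h0) hfin).ne'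
    have hJqt : J ^ (1 / q) ≠ ∞ := ENNReal.rpow_ne_top_of_nonneg (by positivity) hfin
    have hJ : J ^ (1 / p) ≤ B := by
      have e3 : J = J ^ (1 / p) * J ^ (1 / q) := by
        rw [← ENNReal.rpow_add _ _ h0 hfin, one_div, one_div, hpq.inv_add_inv_eq_one, rpow_one]
      have : J ^ (1 / p) * J ^ (1 / q) ≤ B * J ^ (1 / q) := by rw [← e3]; exact hle
      exact (ENNReal.mul_le_mul_iff_left hJq0 hJqt).1 this
    calc J = (J ^ (1 / p)) ^ p := by rw [← rpow_mul, one_div_mul_cancel hp0.ne', rpow_one]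
      _ ≤ B ^ p := rpow_le_rpow hJ hp0.le
  have hlim : ∀ x, Tendsto (fun N => I N x) atTop (𝓝 (h x ^ p)) := by
    intro x
    have h1 : Tendsto (fun N : ℕ => min (h x) (N : ℝ≥0∞) ^ p) atTop (𝓝 (h x ^ p)) := by
      have h2 : Tendsto (fun N : ℕ => min (h x) (N : ℝ≥0∞)) atTop (𝓝 (min (h x) ∞)) :=
        tendsto_const_nhds.min ENNReal.tendsto_nat_nhds_top
      rw [min_eq_left le_top] at h2; exact h2.ennrpow_const p
    refine h1.congr' ?_; obtain ⟨M, hM⟩ := exists_nat_ge ‖x‖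
    filter_upwards [eventually_ge_atTop M] with N hN
    have : ‖x‖ ≤ N := hM.trans (by exact_mod_cast hN); simp [hI, indicator, this]
  calc ∫⁻ x, h x ^ p = ∫⁻ x, liminf (fun N => I N x) atTop := by congr 1; ext x; exact (hlim x).liminf_eq.symm
    _ ≤ liminf (fun N => ∫⁻ x, I N x) atTop := lintegral_liminf_le hIm
    _ ≤ liminf (fun _ : ℕ => B ^ p) atTop := liminf_le_liminf (of_forall hbound)
    _ = B ^ p := by simp

lemma lintegral_riesz_mul (f g : E3 → ℝ≥0∞) (hf : Measurable f) (hg : Measurable g) :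
    ∫⁻ x, riesz f x * g x = ∫⁻ x, f x * riesz g x := by
  unfold riesz
  calc _ = ∫⁻ x, ∫⁻ y, kern (x - y) * f y * g x := by congr 1; ext x; rw [lintegral_mul_const _ (by fun_prop)]
    _ = ∫⁻ y, ∫⁻ x, kern (x - y) * f y * g x :=
        lintegral_swap (by fun_prop)
    _ = _ := by
      congr 1; ext y; rw [← lintegral_const_mul _ (by fun_prop)]; congr 1; ext x; rw [← kern_neg, neg_sub]; ring

lemma exists_lintegral_riesz_pow_six_le : ∃ C : ℝ≥0∞, C ≠ ∞ ∧ ∀ f : E3 → ℝ≥0∞, Measurable f →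
      (∫⁻ x, riesz f x ^ (6 : ℝ)) ^ (1 / 6 : ℝ) ≤ C * (∫⁻ x, f x ^ (2 : ℝ)) ^ (1 / 2 : ℝ) := by
  obtain ⟨C, hC, h⟩ := exists_lintegral_riesz_sq_le; refine ⟨C ^ (1 / 2 : ℝ), by finiteness, fun f hf => ?_⟩
  have hpq : (6 : ℝ).HolderConjugate (6 / 5) := by rw [Real.holderConjugate_iff]; norm_num
  have := lintegral_rpow_le_of_forall_mul_le (measurable_riesz hf) hpq
    (B := C ^ (1 / 2 : ℝ) * (∫⁻ x, f x ^ (2 : ℝ)) ^ (1 / 2 : ℝ)) (fun g hg hg0 _ _ => by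
      rw [lintegral_riesz_mul _ _ hf (by fun_prop)]
      have hgm : Measurable (riesz fun y => ofReal (g y)) := measurable_riesz (by fun_prop)
      refine (ENNReal.lintegral_mul_le_Lp_mul_Lq volume Real.HolderConjugate.two_two hf.aemeasurable
        hgm.aemeasurable).trans ?_
      rw [mul_comm (C ^ (1 / 2 : ℝ)), mul_assoc]; gcongr; have h1 := h g hg hg0; simp only [ENNReal.rpow_ofNat]
      calc _ ≤ (C * (∫⁻ x, ofReal (g x ^ (6 / 5 : ℝ))) ^ (5 / 3 : ℝ)) ^ (1 / 2 : ℝ) :=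
            rpow_le_rpow h1 (by norm_num)
        _ = _ := by rw [mul_rpow_of_nonneg _ _ (by norm_num), ← rpow_mul]; norm_num)
  calc _ ≤ ((C ^ (1 / 2 : ℝ) * (∫⁻ x, f x ^ (2 : ℝ)) ^ (1 / 2 : ℝ)) ^ (6 : ℝ)) ^ (1 / 6 : ℝ) :=
        rpow_le_rpow this (by norm_num)
    _ = _ := by rw [← rpow_mul]; norm_num

/-- Complex-valued square-integrable functions on `ℝ³`. -/
local notation "L2C" => Lp ℂ 2 (volume : Measure E3)

open scoped FourierTransform SchwartzMap

/-! ### Plancherel for integrable square-integrable functions on `ℝ³` -/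

lemma coeFn_fourier_toLp {f : E3 → ℂ} (h1 : Integrable f) (h2 : MemLp f 2) :
    (𝓕 (h2.toLp f) : L2C) =ᵐ[volume] 𝓕 f := by
  have hcont : Continuous (𝓕 f) :=
    VectorFourier.fourierIntegral_continuous Real.continuous_fourierChar continuous_inner h1
  refine ae_eq_of_integral_contDiff_smul_eq
    ((Lp.memLp _).locallyIntegrable (by norm_num)) hcont.locallyIntegrable fun g hg hgc => ?_
  have hgC : ContDiff ℝ ((⊤ : ℕ∞) : WithTop ℕ∞) (fun x => (g x : ℂ)) := ofRealCLM.contDiff.comp hg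
  have hgCc : HasCompactSupport (fun x => (g x : ℂ)) := hgc.comp_left (g := fun r : ℝ => (r : ℂ)) rfl
  set G : 𝓢(E3, ℂ) := hgCc.toSchwartzMap hgC; have hGg : ∀ x, G x = (g x : ℂ) := fun x => rfl
  have key := congrArg (fun T => T G) (Lp.fourier_toTemperedDistribution_eq (h2.toLp f))
  simp only [TemperedDistribution.fourier_apply, Lp.toTemperedDistribution_apply] at key
  have e1 : ∫ x, g x • (𝓕 (h2.toLp f) : L2C) x = ∫ x, G x • (𝓕 (h2.toLp f) : L2C) x := by congr 1
  rw [e1, ← key]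
  have e2 : ∫ x, (𝓕 G) x • (h2.toLp f) x = ∫ x, (𝓕 G) x • f x := by
    refine integral_congr_ae ?_
    filter_upwards [h2.coeFn_toLp] with x hx
    rw [hx]
  rw [e2]
  have e3 := VectorFourier.integral_fourierIntegral_smul_eq_flip (L := innerₗ E3) (μ := volume)
    (ν := volume) Real.continuous_fourierChar continuous_inner G.integrable h1
  have e4 : ((innerₗ E3) : E3 →ₗ[ℝ] E3 →ₗ[ℝ] ℝ).flip = innerₗ E3 := by ext x y; simp [real_inner_comm]
  rw [e4] at e3; exact e3

lemma memLp_fourier {f : E3 → ℂ} (h1 : Integrable f) (h2 : MemLp f 2) : MemLp (𝓕 f) 2 :=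
  (memLp_congr_ae (coeFn_fourier_toLp h1 h2)).1 (Lp.memLp _)

lemma eLpNorm_fourier {f : E3 → ℂ} (h1 : Integrable f) (h2 : MemLp f 2) :
    eLpNorm (𝓕 f) 2 volume = eLpNorm f 2 volume := by
  rw [← eLpNorm_congr_ae (coeFn_fourier_toLp h1 h2), ← eLpNorm_congr_ae h2.coeFn_toLp,
    ← Lp.enorm_def, ← Lp.enorm_def, ← ofReal_norm, ← ofReal_norm, Lp.norm_fourier_eq]

lemma integral_conj_fourier_mul {f g : E3 → ℂ} (h1 : Integrable f) (h2 : MemLp f 2)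
    (g1 : Integrable g) (g2 : MemLp g 2) :
    ∫ x, (starRingEnd ℂ) (𝓕 f x) * 𝓕 g x = ∫ x, (starRingEnd ℂ) (f x) * g x := by
  have h := Lp.inner_fourier_eq (h2.toLp f) (g2.toLp g); rw [L2.inner_def, L2.inner_def] at h
  calc _ = ∫ x, inner ℂ ((𝓕 (h2.toLp f) : L2C) x)
        ((𝓕 (g2.toLp g) : L2C) x) := by
        refine integral_congr_ae ?_
        filter_upwards [coeFn_fourier_toLp h1 h2, coeFn_fourier_toLp g1 g2] with x hx hy
        rw [hx, hy, RCLike.inner_apply, mul_comm]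
    _ = _ := by
      rw [h]; refine integral_congr_ae ?_
      filter_upwards [h2.coeFn_toLp, g2.coeFn_toLp] with x hx hy
      rw [hx, hy, RCLike.inner_apply, mul_comm]

lemma eLpNorm_fourierInv {f : E3 → ℂ} (h1 : Integrable f) (h2 : MemLp f 2) :
    eLpNorm (𝓕⁻ f) 2 volume = eLpNorm f 2 volume := by
  rw [← eLpNorm_fourier h1 h2]
  have : 𝓕⁻ f = (𝓕 f) ∘ (fun x => -x) := by ext x; rw [Real.fourierInv_eq_fourier_neg]; rfl
  rw [this]; exact eLpNorm_comp_measurePreserving (memLp_fourier h1 h2).1 (Measure.measurePreserving_neg volume)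

lemma continuous_fourierInv {f : E3 → ℂ} (h1 : Integrable f) : Continuous (𝓕⁻ f) := by
  have : 𝓕⁻ f = (𝓕 f) ∘ (fun x => -x) := by ext x; rw [Real.fourierInv_eq_fourier_neg]; rfl
  rw [this]
  exact (VectorFourier.fourierIntegral_continuous Real.continuous_fourierChar continuous_inner h1).comp continuous_neg

lemma continuous_fourier {f : E3 → ℂ} (h1 : Integrable f) : Continuous (𝓕 f) :=
  VectorFourier.fourierIntegral_continuous Real.continuous_fourierChar continuous_inner h1

/-! ### The correlation of two `L²` functions is the Fourier transform of an `L¹` function -/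

lemma integral_mul_sub_schwartz (f g : 𝓢(E3, ℂ)) (x : E3) :
    ∫ y, f y * g (x - y) = ∫ k, 𝓕 f k * (Complex.exp (↑(2 * π * inner ℝ k x) * I) * 𝓕 g k) := by
  have h := SchwartzMap.convolution_apply (ContinuousLinearMap.mul ℂ ℂ) f g x
  have h2 := SchwartzMap.fourier_convolution (ContinuousLinearMap.mul ℂ ℂ) f g
  have h3 : SchwartzMap.convolution (ContinuousLinearMap.mul ℂ ℂ) f g =
      𝓕⁻ (SchwartzMap.pairing (ContinuousLinearMap.mul ℂ ℂ) (𝓕 f) (𝓕 g)) := by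
    rw [← h2, FourierTransform.fourierInv_fourier_eq]
  rw [h3] at h; simp only [MeasureTheory.convolution, ContinuousLinearMap.mul_apply'] at h
  rw [← h, SchwartzMap.fourierInv_coe, fourierInv_eq']; congr 1; ext k; simp [smul_eq_mul]; ring

lemma measurePreserving_sub_left (x : E3) : MeasurePreserving (fun y => x - y) (volume : Measure E3) volume := by
  have : (fun y : E3 => x - y) = (fun y => x + y) ∘ (fun y => -y) := by ext y; simp [sub_eq_add_neg]
  rw [this]; exact (measurePreserving_add_left volume x).comp (Measure.measurePreserving_neg volume)

lemma memLp_exp_mul {f : E3 → ℂ} (hf : MemLp f 2) (x : E3) :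
    MemLp (fun k => Complex.exp (↑(2 * π * inner ℝ k x) * I) * f k) 2 := by
  refine hf.congr_norm (AEStronglyMeasurable.mul (by fun_prop) hf.1) (of_forall fun k => ?_)
  rw [norm_mul, norm_exp_ofReal_mul_I, one_mul]

lemma integral_mul_sub_eq (f g : L2C) (x : E3) : ∫ y, f y * g (x - y) =
      ∫ k, (𝓕 f : L2C) k * (Complex.exp (↑(2 * π * inner ℝ k x) * I) * (𝓕 g : L2C) k) := by
  set M := (ContinuousLinearMap.mul ℂ ℂ).lpPairing (volume : Measure E3) 2 2 with hM
  have hMe : ∀ (u v : L2C), M u v = ∫ y, u y * v y := fun u v => by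
    rw [hM, ContinuousLinearMap.lpPairing_eq_integral]; rfl
  have hsub : ∀ {h : E3 → ℂ}, MemLp h 2 → MemLp (fun y => h (x - y)) 2 := fun hh =>
    hh.comp_measurePreserving (measurePreserving_sub_left x)
  -- reduce to Schwartz functions in the first argument, the second one being arbitrary
  have hL : ∀ (u v : L2C), ∫ y, u y * v (x - y) = M u ((hsub (Lp.memLp v)).toLp _) := fun u v => by
    rw [hMe]; refine integral_congr_ae ?_
    filter_upwards [(hsub (Lp.memLp v)).coeFn_toLp] with y hy; rw [hy]
  have hL' : ∀ (u v : L2C), ∫ y, u y * v (x - y) = M ((hsub (Lp.memLp u)).toLp _) v := fun u v => by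
    rw [hMe, ← integral_sub_left_eq_self _ volume x]; refine integral_congr_ae ?_
    filter_upwards [(hsub (Lp.memLp u)).coeFn_toLp] with y hy; rw [hy, sub_sub_cancel]
  have hR : ∀ (u v : L2C), ∫ k, u k * (Complex.exp (↑(2 * π * inner ℝ k x) * I) * v k) =
      M u ((memLp_exp_mul (Lp.memLp v) x).toLp _) := fun u v => by
    rw [hMe]; refine integral_congr_ae ?_
    filter_upwards [(memLp_exp_mul (Lp.memLp v) x).coeFn_toLp] with y hy; rw [hy]
  have hR' : ∀ (u v : L2C), ∫ k, u k * (Complex.exp (↑(2 * π * inner ℝ k x) * I) * v k) =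
      M ((memLp_exp_mul (Lp.memLp u) x).toLp _) v := fun u v => by
    rw [hMe]; refine integral_congr_ae ?_
    filter_upwards [(memLp_exp_mul (Lp.memLp u) x).coeFn_toLp] with y hy; rw [hy]; ring
  refine DenseRange.induction_on (p := fun f : L2C => ∫ y, f y * g (x - y) = ∫ k, (𝓕 f : L2C) k *
        (Complex.exp (↑(2 * π * inner ℝ k x) * I) * (𝓕 g : L2C) k))
    (SchwartzMap.denseRange_toLpCLM (p := 2) ENNReal.ofNat_ne_top) f ?_ fun f => ?_
  · simp only [hL, hR]
    exact isClosed_eq ((M.flip _).continuous) (((M.flip _).continuous).comp (Lp.fourierTransformₗᵢ E3 ℂ).continuous)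
  refine DenseRange.induction_on (p := fun g : L2C =>
      ∫ y, (SchwartzMap.toLpCLM ℂ (E := E3) ℂ 2 volume f) y * g (x - y) =
      ∫ k, (𝓕 (SchwartzMap.toLpCLM ℂ (E := E3) ℂ 2 volume f) : L2C) k * (Complex.exp (↑(2 * π * inner ℝ k x) * I) *
          (𝓕 g : L2C) k))
    (SchwartzMap.denseRange_toLpCLM (p := 2) ENNReal.ofNat_ne_top) g ?_ fun g => ?_
  · simp only [hL', hR']
    exact isClosed_eq (M _).continuous ((M _).continuous.comp (Lp.fourierTransformₗᵢ E3 ℂ).continuous)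
  have h := integral_mul_sub_schwartz f g x; have hf := f.coeFn_toLp 2 (volume : Measure E3)
  have hg := g.coeFn_toLp 2 (volume : Measure E3); have hf' := (𝓕 f).coeFn_toLp 2 (volume : Measure E3)
  have hg' := (𝓕 g).coeFn_toLp 2 (volume : Measure E3)
  simp only [SchwartzMap.toLpCLM_apply, SchwartzMap.toLp_fourier_eq]
  calc _ = ∫ y, f y * g (x - y) := by
        refine integral_congr_ae ?_
        filter_upwards [hf, (measurePreserving_sub_left x).quasiMeasurePreserving.ae hg] with y h1 h2
        rw [h1, h2]
    _ = _ := by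
      rw [h]; refine integral_congr_ae ?_
      filter_upwards [hf', hg'] with y h1 h2
      rw [h1, h2]

/-- The convolution of two square integrable functions has an integrable Fourier transform. -/
lemma exists_integrable_fourierInv_eq {K n : E3 → ℂ} (hK : MemLp K 2) (hn : MemLp n 2) : ∃ a : E3 → ℂ, Integrable a ∧
      ∫⁻ k, ‖a k‖ₑ ≤ eLpNorm K 2 volume * eLpNorm n 2 volume ∧
      ∀ x, ∫ y, K y * n (x - y) = 𝓕⁻ a x := by
  set κ : L2C := 𝓕 (hK.toLp K) with hκ; set ν : L2C := 𝓕 (hn.toLp n) with hν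
  have hbd : ∫⁻ k, ‖κ k * ν k‖ₑ ≤ eLpNorm K 2 volume * eLpNorm n 2 volume := by
    have h1 := ENNReal.lintegral_mul_le_Lp_mul_Lq (volume : Measure E3) Real.HolderConjugate.two_two
      (f := fun k => ‖κ k‖ₑ) (g := fun k => ‖ν k‖ₑ) (Lp.aestronglyMeasurable κ).enorm
      (Lp.aestronglyMeasurable ν).enorm
    have e : ∀ u : L2C, (∫⁻ k, ‖u k‖ₑ ^ (2 : ℝ)) ^ (1 / 2 : ℝ) = ‖u‖ₑ := fun u => by
      rw [Lp.enorm_def, eLpNorm_eq_lintegral_rpow_enorm_toReal (by norm_num) (by norm_num)]; simp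
    rw [e, e] at h1
    have e2 : ∀ {f : E3 → ℂ} (hf : MemLp f 2), ‖(𝓕 (hf.toLp f) : L2C)‖ₑ = eLpNorm f 2 volume := fun hf => by
      rw [← ofReal_norm, Lp.norm_fourier_eq, ofReal_norm, Lp.enorm_def, eLpNorm_congr_ae hf.coeFn_toLp]
    rw [hκ, hν, e2, e2] at h1; simpa [enorm_mul] using h1
  have hm : AEStronglyMeasurable (fun k => κ k * ν k) volume :=
    (Lp.aestronglyMeasurable κ).mul (Lp.aestronglyMeasurable ν)
  refine ⟨fun k => κ k * ν k, ⟨hm, lt_of_le_of_lt hbd (mul_lt_top hK.2 hn.2)⟩, hbd, fun x => ?_⟩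
  have h := integral_mul_sub_eq (hK.toLp K) (hn.toLp n) x; rw [fourierInv_eq']
  calc _ = ∫ y, (hK.toLp K) y * (hn.toLp n) (x - y) := by
        refine integral_congr_ae ?_
        filter_upwards [hK.coeFn_toLp,
          (measurePreserving_sub_left x).quasiMeasurePreserving.ae hn.coeFn_toLp] with y h1 h2
        rw [h1, h2]
    _ = _ := by rw [h]; congr 1; ext k; simp only [smul_eq_mul]; ring

open scoped FourierTransform

/-! ### Averages against probability densities -/

section Average

variable {V : Type*} [NormedAddCommGroup V] [NormedSpace ℝ V] [FiniteDimensional ℝ V]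
  [MeasureSpace V] [BorelSpace V] [(volume : Measure V).IsAddHaarMeasure]

/-- Jensen's inequality for `t ↦ t ^ p` and a probability density. -/
lemma lintegral_mul_rpow_le {α : Type*} [MeasurableSpace α] {μ : Measure α} {ρ f : α → ℝ≥0∞}
    (hρ : Measurable ρ) (hf : Measurable f) (h1 : ∫⁻ y, ρ y ∂μ = 1) {p : ℝ} (hp : 1 < p) :
    (∫⁻ y, ρ y * f y ∂μ) ^ p ≤ ∫⁻ y, ρ y * f y ^ p ∂μ := by
  have hpq : p.HolderConjugate (p / (p - 1)) := Real.HolderConjugate.conjExponent hp; set q := p / (p - 1)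
  have hp0 : 0 < p := by linarith
  have hq0 : 0 < q := hpq.symm.pos
  have h := ENNReal.lintegral_mul_le_Lp_mul_Lq μ hpq.symm (f := fun y => ρ y ^ (1 / q))
    (g := fun y => ρ y ^ (1 / p) * f y) (by fun_prop) (by fun_prop)
  have e1 : ∀ y, (ρ y ^ (1 / q)) ^ q = ρ y := fun y => by rw [← rpow_mul, one_div_mul_cancel hq0.ne', rpow_one]
  have e2 : ∀ y, (ρ y ^ (1 / p) * f y) ^ p = ρ y * f y ^ p := fun y => by
    rw [mul_rpow_of_nonneg _ _ hp0.le, ← rpow_mul, one_div_mul_cancel hp0.ne', rpow_one]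
  have e3 : ∀ y, ((fun y => ρ y ^ (1 / q)) * (fun y => ρ y ^ (1 / p) * f y)) y = ρ y * f y := fun y => by
    simp only [Pi.mul_apply]
    rw [← mul_assoc, ← rpow_add_of_nonneg _ _ (by positivity) (by positivity), one_div, one_div,
      hpq.symm.inv_add_inv_eq_one, rpow_one]
  simp only [e1, e2, e3, h1, ENNReal.one_rpow, one_mul] at h
  calc _ ≤ ((∫⁻ y, ρ y * f y ^ p ∂μ) ^ (1 / p)) ^ p := rpow_le_rpow h hp0.le
    _ = _ := by rw [← rpow_mul, one_div_mul_cancel hp0.ne', rpow_one]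

lemma sq_rpow_half (a : ℝ≥0∞) : (a ^ 2) ^ (1 / 2 : ℝ) = a := by rw [← rpow_natCast, ← rpow_mul]; norm_num

lemma rpow_half_sq (a : ℝ≥0∞) : (a ^ (1 / 2 : ℝ)) ^ 2 = a := by rw [← rpow_natCast, ← rpow_mul]; norm_num

/-- The Cauchy–Schwarz inequality in the form used throughout. -/
lemma lintegral_mul_le_sqrt {α : Type*} [MeasurableSpace α] {μ : Measure α} {f g : α → ℝ≥0∞}
    (hf : AEMeasurable f μ) (hg : AEMeasurable g μ) :
    ∫⁻ a, f a * g a ∂μ ≤ (∫⁻ a, f a ^ 2 ∂μ) ^ (1 / 2 : ℝ) * (∫⁻ a, g a ^ 2 ∂μ) ^ (1 / 2 : ℝ) := by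
  simpa using ENNReal.lintegral_mul_le_Lp_mul_Lq μ Real.HolderConjugate.two_two hf hg

lemma lintegral_mul_sq_le {α : Type*} [MeasurableSpace α] {μ : Measure α} {k f : α → ℝ≥0∞}
    (hk : Measurable k) (hf : Measurable f) :
    (∫⁻ y, k y * f y ∂μ) ^ 2 ≤ (∫⁻ y, k y ∂μ) * ∫⁻ y, k y * f y ^ 2 ∂μ := by
  have h := lintegral_mul_le_sqrt (μ := μ) (f := fun y => k y ^ (1 / 2 : ℝ)) (g := fun y => k y ^ (1 / 2 : ℝ) * f y)
    (by fun_prop) (by fun_prop)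
  have e2 : ∀ y, k y ^ (1 / 2 : ℝ) * (k y ^ (1 / 2 : ℝ) * f y) = k y * f y := fun y => by
    rw [← mul_assoc, ← sq, rpow_half_sq]
  simp_rw [e2, mul_pow, rpow_half_sq] at h; rw [← mul_rpow_of_nonneg _ _ (by norm_num)] at h
  exact (pow_le_pow_left' h 2).trans_eq (rpow_half_sq _)

lemma add_sq_le_two (a b : ℝ≥0∞) : (a + b) ^ 2 ≤ 2 * a ^ 2 + 2 * b ^ 2 := by
  rcases eq_or_ne a ∞ with rfl | ha
  · simp
  rcases eq_or_ne b ∞ with rfl | hb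
  · simp
  lift a to NNReal using ha; lift b to NNReal using hb
  norm_cast; rw [← NNReal.coe_le_coe]; push_cast
  nlinarith [sq_nonneg ((a : ℝ) - b)]

lemma lintegral_average_sq_le {ρ : V → ℝ≥0∞} (hρ : Measurable ρ) (h1 : ∫⁻ y, ρ y = 1) {g : V → ℝ}
    (hg : Measurable g) :
    ∫⁻ x, (∫⁻ y, ρ y * ‖g (x - y) - g x‖ₑ) ^ 2 ≤ 4 * ∫⁻ x, ‖g x‖ₑ ^ 2 := by
  calc _ ≤ ∫⁻ x, ∫⁻ y, ρ y * (2 * ‖g (x - y)‖ₑ ^ 2 + 2 * ‖g x‖ₑ ^ 2) := by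
        refine lintegral_mono fun x => (lintegral_mul_sq_le hρ (by fun_prop)).trans ?_; rw [h1, one_mul]
        refine lintegral_mono fun y => mul_le_mul_right ((pow_le_pow_left' (enorm_sub_le (E := ℝ)) 2).trans
          (add_sq_le_two _ _)) _
    _ = ∫⁻ y, ∫⁻ x, ρ y * (2 * ‖g (x - y)‖ₑ ^ 2 + 2 * ‖g x‖ₑ ^ 2) :=
        lintegral_swap (by fun_prop)
    _ = ∫⁻ y, ρ y * (4 * ∫⁻ x, ‖g x‖ₑ ^ 2) := by
      congr 1; ext y
      rw [lintegral_const_mul _ (by fun_prop), lintegral_add_left (by fun_prop),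
        lintegral_const_mul _ (by fun_prop), lintegral_const_mul _ (by fun_prop),
        lintegral_sub_right_eq_self (fun x => ‖g x‖ₑ ^ 2) y, ← add_mul]
      norm_num
    _ = _ := by rw [lintegral_mul_const _ hρ, h1, one_mul]

lemma tendsto_lintegral_average_sq {ρ : ℕ → V → ℝ≥0∞} (hρ : ∀ i, Measurable (ρ i))
    (h1 : ∀ i, ∫⁻ y, ρ i y = 1) (h2 : Tendsto (fun i => ∫⁻ y, ρ i y * ‖y‖ₑ) atTop (𝓝 0))
    {h : V → ℝ} (hm : Measurable h) (hh : MemLp h 2) :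
    Tendsto (fun i => ∫⁻ x, (∫⁻ y, ρ i y * ‖h (x - y) - h x‖ₑ) ^ 2) atTop (𝓝 0) := by
  rw [tendsto_nhds_zero]; intro ε hε
  obtain ⟨δ, hδ0, hδ⟩ : ∃ δ : ℝ, 0 < δ ∧ 8 * ofReal δ ^ 2 ≤ ε / 2 := by
    have hc : Tendsto (fun δ : ℝ => 8 * ofReal δ ^ 2) (𝓝[>] 0) (𝓝 0) := by
      have : Tendsto (fun δ : ℝ => 8 * ofReal δ ^ 2) (𝓝 0) (𝓝 (8 * ofReal 0 ^ 2)) :=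
        ENNReal.Tendsto.const_mul ((ENNReal.continuous_pow 2).comp ENNReal.continuous_ofReal).continuousAt
          (Or.inr (by norm_num))
      simpa using this.mono_left nhdsWithin_le_nhds
    have := (tendsto_nhds_zero.1 hc (ε / 2) (ENNReal.half_pos hε.ne')).and self_mem_nhdsWithin
    obtain ⟨δ, h⟩ := this.exists; exact ⟨δ, h.2, h.1⟩
  obtain ⟨ψ, hψc, hψs, hψ⟩ := hh.exist_eLpNorm_sub_le (by norm_num) (by norm_num) hδ0
  have hψm : Measurable ψ := hψs.continuous.measurable
  obtain ⟨L, hL⟩ := hψs.lipschitzWith_of_hasCompactSupport hψc (by norm_num)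
  have hψ1 : ∫⁻ x, ‖ψ x‖ₑ ≠ ∞ := (hψs.continuous.integrable_of_hasCompactSupport hψc).2.ne
  have hsm : ∀ i, ∫⁻ x, (∫⁻ y, ρ i y * ‖ψ (x - y) - ψ x‖ₑ) ^ 2 ≤ (L * ∫⁻ y, ρ i y * ‖y‖ₑ) * (2 * ∫⁻ x, ‖ψ x‖ₑ) := by
    intro i
    have hJ : Measurable (fun x => ∫⁻ y, ρ i y * ‖ψ (x - y) - ψ x‖ₑ) := by
      have := hρ i
      exact lintegral_prod_right' (f := fun p : V × V => ρ i p.2 * ‖ψ (p.1 - p.2) - ψ p.1‖ₑ) (by fun_prop)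
    have hJ1 : ∀ x, ∫⁻ y, ρ i y * ‖ψ (x - y) - ψ x‖ₑ ≤ L * ∫⁻ y, ρ i y * ‖y‖ₑ := by
      intro x; rw [← lintegral_const_mul _ (by have := hρ i; fun_prop : Measurable fun y => ρ i y * ‖y‖ₑ)]
      refine lintegral_mono fun y => ?_; have := hL.edist_le_mul (x - y) x
      rw [edist_eq_enorm_sub, edist_eq_enorm_sub, sub_sub_cancel_left, enorm_neg] at this
      calc _ ≤ ρ i y * (L * ‖y‖ₑ) := by gcongr
        _ = _ := by ring
    have hJ2 : ∫⁻ x, ∫⁻ y, ρ i y * ‖ψ (x - y) - ψ x‖ₑ ≤ 2 * ∫⁻ x, ‖ψ x‖ₑ := by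
      have := hρ i
      calc _ ≤ ∫⁻ x, ∫⁻ y, ρ i y * (‖ψ (x - y)‖ₑ + ‖ψ x‖ₑ) := by gcongr; exact enorm_sub_le
        _ = ∫⁻ y, ∫⁻ x, ρ i y * (‖ψ (x - y)‖ₑ + ‖ψ x‖ₑ) :=
            lintegral_swap (by fun_prop)
        _ = ∫⁻ y, ρ i y * (2 * ∫⁻ x, ‖ψ x‖ₑ) := by
          congr 1; ext y
          rw [lintegral_const_mul _ (by fun_prop), lintegral_add_left (by fun_prop),
            lintegral_sub_right_eq_self (fun x => ‖ψ x‖ₑ) y, two_mul]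
        _ = _ := by rw [lintegral_mul_const _ (hρ i), h1, one_mul]
    calc _ ≤ ∫⁻ x, (L * ∫⁻ y, ρ i y * ‖y‖ₑ) * ∫⁻ y, ρ i y * ‖ψ (x - y) - ψ x‖ₑ := by
          refine lintegral_mono fun x => ?_; rw [sq]; gcongr; exact hJ1 x
      _ = (L * ∫⁻ y, ρ i y * ‖y‖ₑ) * ∫⁻ x, ∫⁻ y, ρ i y * ‖ψ (x - y) - ψ x‖ₑ :=
          lintegral_const_mul _ hJ
      _ ≤ _ := by gcongr
  have hlim : Tendsto (fun i => 2 * ((L * ∫⁻ y, ρ i y * ‖y‖ₑ) * (2 * ∫⁻ x, ‖ψ x‖ₑ))) atTop (𝓝 0) := by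
    have h3 : Tendsto (fun i => (2 * (2 * ∫⁻ x, ‖ψ x‖ₑ) * L) * ∫⁻ y, ρ i y * ‖y‖ₑ) atTop (𝓝 ((2 * (2 * ∫⁻ x, ‖ψ x‖ₑ) * L) * 0)) :=
      ENNReal.Tendsto.const_mul h2 (Or.inr (by finiteness))
    rw [mul_zero] at h3
    refine h3.congr fun i => by ring
  have hev := tendsto_nhds_zero.1 hlim (ε / 2) (ENNReal.half_pos hε.ne')
  filter_upwards [hev] with i hi
  have hρi := hρ i
  have hdiff : ∫⁻ x, ‖(h - ψ) x‖ₑ ^ 2 ≤ ofReal δ ^ 2 := by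
    rw [eLpNorm_eq_lintegral_rpow_enorm_toReal (by norm_num) (by norm_num)] at hψ
    have := rpow_le_rpow hψ (z := 2) (by norm_num); rw [← rpow_mul] at this; simpa using this
  have hm2 : Measurable (h - ψ) := hm.sub hψm
  calc _ ≤ ∫⁻ x, (2 * (∫⁻ y, ρ i y * ‖ψ (x - y) - ψ x‖ₑ) ^ 2 +
        2 * (∫⁻ y, ρ i y * ‖(h - ψ) (x - y) - (h - ψ) x‖ₑ) ^ 2) := by
        refine lintegral_mono fun x => le_trans (pow_le_pow_left' ?_ 2) (add_sq_le_two _ _)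
        rw [← lintegral_add_left (by fun_prop)]; refine lintegral_mono fun y => ?_; rw [← mul_add]; gcongr
        calc ‖h (x - y) - h x‖ₑ = ‖(ψ (x - y) - ψ x) + ((h - ψ) (x - y) - (h - ψ) x)‖ₑ := by
              congr 1; simp only [Pi.sub_apply]; ring
          _ ≤ _ := enorm_add_le _ _
    _ = 2 * (∫⁻ x, (∫⁻ y, ρ i y * ‖ψ (x - y) - ψ x‖ₑ) ^ 2) +
        2 * ∫⁻ x, (∫⁻ y, ρ i y * ‖(h - ψ) (x - y) - (h - ψ) x‖ₑ) ^ 2 := by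
        have hJ : Measurable (fun x => ∫⁻ y, ρ i y * ‖ψ (x - y) - ψ x‖ₑ) :=
          lintegral_prod_right' (f := fun p : V × V => ρ i p.2 * ‖ψ (p.1 - p.2) - ψ p.1‖ₑ) (by fun_prop)
        have hJ' : Measurable (fun x => ∫⁻ y, ρ i y * ‖(h - ψ) (x - y) - (h - ψ) x‖ₑ) := lintegral_prod_right'
            (f := fun p : V × V => ρ i p.2 * ‖(h - ψ) (p.1 - p.2) - (h - ψ) p.1‖ₑ) (by fun_prop)
        rw [lintegral_add_left (by fun_prop), lintegral_const_mul _ (by fun_prop),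
          lintegral_const_mul _ (by fun_prop)]
    _ ≤ 2 * ((L * ∫⁻ y, ρ i y * ‖y‖ₑ) * (2 * ∫⁻ x, ‖ψ x‖ₑ)) + 2 * (4 * ofReal δ ^ 2) := by
      gcongr
      · exact hsm i
      · exact (lintegral_average_sq_le hρi (h1 i) hm2).trans (by gcongr)
    _ ≤ ε / 2 + ε / 2 := by gcongr; rw [← mul_assoc]; norm_num; exact hδ
    _ = ε := ENNReal.add_halves ε

end Average

open scoped FourierTransform

/-! ### Gaussians and the Coulomb kernel -/

section Gaussian

lemma gauss_eq (r : ℝ) (x : E3) :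
    gauss r x = r ^ (-(3 / 2 : ℝ)) * (2 * π) ^ (-(3 / 2 : ℝ)) * exp (-(1 / (2 * r)) * ‖x‖ ^ 2) := by
  rw [gauss, mul_assoc]; congr 3; ring

lemma gauss_pos {r : ℝ} (hr : 0 < r) (x : E3) : 0 < gauss r x := by unfold gauss; positivity

lemma gauss_neg (r : ℝ) (x : E3) : gauss r (-x) = gauss r x := by simp [gauss]

@[fun_prop]
lemma continuous_gauss (r : ℝ) : Continuous (gauss r) := by unfold gauss; fun_prop

@[fun_prop]
lemma measurable_gauss_uncurry : Measurable fun p : ℝ × E3 => gauss p.1 p.2 := by unfold gauss; fun_prop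

lemma integrable_exp_neg_mul_norm_sq {b : ℝ} (hb : 0 < b) : Integrable fun x : E3 => exp (-b * ‖x‖ ^ 2) := by
  have h := (GaussianFourier.integrable_cexp_neg_mul_sq_norm_add (V := E3) (b := b) (by simpa using hb) 0 0).norm
  refine h.congr (ae_of_all _ fun x => ?_); simp only [Complex.norm_exp]; congr 1; simp [← Complex.ofReal_pow]

lemma norm_mul_exp_le {b t : ℝ} (hb : 0 < b) : t * exp (-b * t ^ 2) ≤ (1 + 1 / (2 * b)) * exp (-(b / 2) * t ^ 2) := by
  have h1 : t ≤ b / 2 * t ^ 2 + 1 / (2 * b) := by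
    have : b / 2 * t ^ 2 + 1 / (2 * b) - t = (b * t - 1) ^ 2 / (2 * b) := by field_simp; ring
    have : 0 ≤ (b * t - 1) ^ 2 / (2 * b) := by positivity
    linarith
  have h2 : t ≤ (1 + 1 / (2 * b)) * exp (b / 2 * t ^ 2) := by
    have h3 := Real.add_one_le_exp (b / 2 * t ^ 2)
    have h4 : 0 ≤ b / 2 * t ^ 2 := by positivity
    have h5 : 0 ≤ 1 / (2 * b) := by positivity
    nlinarith
  have h6 : exp (-(b / 2) * t ^ 2) = exp (b / 2 * t ^ 2) * exp (-b * t ^ 2) := by rw [← exp_add]; ring_nf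
  rw [h6, ← mul_assoc]; gcongr

lemma integrable_norm_mul_exp {b : ℝ} (hb : 0 < b) : Integrable fun x : E3 => ‖x‖ * exp (-b * ‖x‖ ^ 2) := by
  refine ((integrable_exp_neg_mul_norm_sq (half_pos hb)).const_mul (1 + 1 / (2 * b))).mono'
    (by fun_prop) (ae_of_all _ fun x => ?_)
  rw [norm_of_nonneg (by positivity)]; exact norm_mul_exp_le hb

lemma integrable_gauss {r : ℝ} (hr : 0 < r) : Integrable (gauss r) := by
  simp only [funext (gauss_eq r)]; exact (integrable_exp_neg_mul_norm_sq (by positivity)).const_mul _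

lemma gauss_const {r : ℝ} (hr : 0 < r) :
    (π / (1 / (2 * r))) ^ (3 / 2 : ℝ) * (r ^ (-(3 / 2 : ℝ)) * (2 * π) ^ (-(3 / 2 : ℝ))) = 1 := by
  have e : π / (1 / (2 * r)) = r * (2 * π) := by field_simp
  rw [e, ← mul_rpow (by positivity) (by positivity), ← rpow_add (by positivity)]; norm_num

lemma integral_gauss {r : ℝ} (hr : 0 < r) : ∫ x, gauss r x = 1 := by
  simp only [gauss_eq r]
  rw [integral_const_mul, GaussianFourier.integral_rexp_neg_mul_sq_norm (by positivity), finrank_E3, mul_comm]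
  exact_mod_cast gauss_const hr

lemma lintegral_gauss {r : ℝ} (hr : 0 < r) : ∫⁻ x, ofReal (gauss r x) = 1 := by
  rw [← ofReal_integral_eq_lintegral_ofReal (integrable_gauss hr) (ae_of_all _ fun x => (gauss_pos hr x).le),
    integral_gauss hr, ofReal_one]

lemma gauss_le {r : ℝ} (hr : 0 < r) (x : E3) : gauss r x ≤ r ^ (-(3 / 2 : ℝ)) := by
  unfold gauss
  have h1 : (2 * π) ^ (-(3 / 2 : ℝ)) ≤ 1 :=
    Real.rpow_le_one_of_one_le_of_nonpos (by nlinarith [Real.pi_gt_three]) (by norm_num)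
  have h2 : exp (-(‖x‖ ^ 2 / (2 * r))) ≤ 1 := Real.exp_le_one_iff.2 (by simp; positivity)
  have h3 : (2 * π) ^ (-(3 / 2 : ℝ)) * exp (-(‖x‖ ^ 2 / (2 * r))) ≤ 1 := mul_le_one₀ h1 (by positivity) h2
  calc _ ≤ r ^ (-(3 / 2 : ℝ)) * 1 := by gcongr
    _ = _ := mul_one _

/-- The Fourier transform `e^{-2π²r|ξ|²}` of `gauss r`. -/
noncomputable def gexp (r : ℝ) (ξ : E3) : ℝ := exp (-(2 * π ^ 2 * r) * ‖ξ‖ ^ 2)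

@[fun_prop]
lemma continuous_gexp (r : ℝ) : Continuous (gexp r) := by unfold gexp; fun_prop

@[fun_prop]
lemma measurable_gexp_uncurry : Measurable fun p : ℝ × E3 => gexp p.1 p.2 := by unfold gexp; fun_prop

lemma gexp_pos (r : ℝ) (ξ : E3) : 0 < gexp r ξ := exp_pos _

lemma gexp_le_one {r : ℝ} (hr : 0 ≤ r) (ξ : E3) : gexp r ξ ≤ 1 := Real.exp_le_one_iff.2 (by
    have : 0 ≤ 2 * π ^ 2 * r * ‖ξ‖ ^ 2 := by positivity
    linarith)

lemma gexp_add (r s : ℝ) (ξ : E3) : gexp (r + s) ξ = gexp r ξ * gexp s ξ := by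
  rw [gexp, gexp, gexp, ← exp_add]; congr 1; ring

lemma integrable_gexp {r : ℝ} (hr : 0 < r) : Integrable (gexp r) := integrable_exp_neg_mul_norm_sq (by positivity)

lemma fourier_gauss {r : ℝ} (hr : 0 < r) (ξ : E3) : 𝓕 (fun x => (gauss r x : ℂ)) ξ = gexp r ξ := by
  have h := fourier_gaussian_innerProductSpace (V := E3) (b := ((1 / (2 * r) : ℝ) : ℂ))
    (by rw [Complex.ofReal_re]; positivity) ξ
  have e : (fun x => (gauss r x : ℂ)) = ((r ^ (-(3 / 2 : ℝ)) * (2 * π) ^ (-(3 / 2 : ℝ)) : ℝ) : ℂ) •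
      (fun v : E3 => Complex.exp (-((1 / (2 * r) : ℝ) : ℂ) * (‖v‖ : ℂ) ^ 2)) := by
    funext x
    rw [gauss_eq, Pi.smul_apply, smul_eq_mul, Complex.ofReal_mul, Complex.ofReal_exp]
    push_cast; rfl
  have e2 : 𝓕 (((r ^ (-(3 / 2 : ℝ)) * (2 * π) ^ (-(3 / 2 : ℝ)) : ℝ) : ℂ) •
      (fun v : E3 => Complex.exp (-((1 / (2 * r) : ℝ) : ℂ) * (‖v‖ : ℂ) ^ 2))) ξ =
      ((r ^ (-(3 / 2 : ℝ)) * (2 * π) ^ (-(3 / 2 : ℝ)) : ℝ) : ℂ) •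
        𝓕 (fun v : E3 => Complex.exp (-((1 / (2 * r) : ℝ) : ℂ) * (‖v‖ : ℂ) ^ 2)) ξ := by
    simp only [Real.fourier_eq, Pi.smul_apply]; rw [← integral_smul]; congr 1; ext v; rw [smul_comm]
  rw [e, e2, h, finrank_E3, smul_eq_mul, ← mul_assoc]
  have e3 : ((π : ℂ) / ((1 / (2 * r) : ℝ) : ℂ)) ^ (((3 : ℕ) : ℂ) / 2) =
      (((π / (1 / (2 * r))) ^ (3 / 2 : ℝ) : ℝ) : ℂ) := by
    rw [Complex.ofReal_cpow (by positivity)]; push_cast; rfl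
  rw [e3, ← Complex.ofReal_mul, mul_comm _ ((π / (1 / (2 * r))) ^ (3 / 2 : ℝ)), gauss_const hr,
    gexp, Complex.ofReal_exp, Complex.ofReal_one, one_mul]
  congr 1
  push_cast; field_simp

lemma fourierInv_gexp {r : ℝ} (hr : 0 < r) (x : E3) : 𝓕⁻ (fun ξ => (gexp r ξ : ℂ)) x = gauss r x := by
  have h := fourier_gaussian_innerProductSpace (V := E3) (b := ((2 * π ^ 2 * r : ℝ) : ℂ))
    (by rw [Complex.ofReal_re]; positivity) (-x)
  have e : (fun ξ => (gexp r ξ : ℂ)) = (fun v : E3 => Complex.exp (-((2 * π ^ 2 * r : ℝ) : ℂ) * (‖v‖ : ℂ) ^ 2)) := by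
    funext x
    rw [gexp, Complex.ofReal_exp]
    push_cast; rfl
  rw [Real.fourierInv_eq_fourier_neg, e, h, finrank_E3]
  have e3 : ((π : ℂ) / ((2 * π ^ 2 * r : ℝ) : ℂ)) ^ (((3 : ℕ) : ℂ) / 2) =
      (((π / (2 * π ^ 2 * r)) ^ (3 / 2 : ℝ) : ℝ) : ℂ) := by
    rw [Complex.ofReal_cpow (by positivity)]; push_cast; rfl
  have e4 : (π / (2 * π ^ 2 * r)) ^ (3 / 2 : ℝ) = r ^ (-(3 / 2 : ℝ)) * (2 * π) ^ (-(3 / 2 : ℝ)) := by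
    rw [← mul_rpow (by positivity) (by positivity), rpow_neg (by positivity), ← Real.inv_rpow (by positivity)]
    congr 1; field_simp
  rw [e3, e4, gauss_eq, norm_neg, Complex.ofReal_mul (_ * _) (exp _), Complex.ofReal_exp]; congr 2
  push_cast; field_simp

/-- Convolution with an inverse Fourier transform. -/
lemma integral_fourierInv_mul {m g : E3 → ℂ} (hm : Integrable m) (hg : Integrable g) (x : E3) :
    ∫ y, 𝓕⁻ m (x - y) * g y = 𝓕⁻ (fun ξ => m ξ * 𝓕 g ξ) x := by
  simp only [fourierInv_eq', Real.fourier_eq', smul_eq_mul]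
  have hint : Integrable (fun p : E3 × E3 =>
      Complex.exp (((2 * π * inner ℝ p.2 (x - p.1) : ℝ) : ℂ) * I) * (g p.1 * m p.2))
      (volume.prod volume) := by
    refine (hg.mul_prod hm).bdd_mul (c := 1) (Continuous.aestronglyMeasurable (by fun_prop)) (ae_of_all _ fun p => ?_)
    rw [norm_exp_ofReal_mul_I]
  calc _ = ∫ y, ∫ ξ, Complex.exp (((2 * π * inner ℝ ξ (x - y) : ℝ) : ℂ) * I) * (g y * m ξ) := by
        congr 1; ext y; rw [← integral_mul_const]; congr 1; ext ξ; ring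
    _ = ∫ ξ, ∫ y, Complex.exp (((2 * π * inner ℝ ξ (x - y) : ℝ) : ℂ) * I) * (g y * m ξ) :=
        integral_integral_swap hint
    _ = _ := by
      congr 1; ext ξ; rw [mul_comm (m ξ), ← mul_assoc, mul_comm _ (m ξ), ← integral_const_mul, ← integral_const_mul]
      congr 1; ext y
      rw [inner_sub_right, mul_sub, Complex.ofReal_sub, sub_mul, sub_eq_add_neg, Complex.exp_add, real_inner_comm ξ y]
      have : (-(((2 * π * inner ℝ ξ y : ℝ) : ℂ) * I)) = ((-2 * π * inner ℝ ξ y : ℝ) : ℂ) * I := by push_cast; ring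
      rw [this, real_inner_comm]; ring

lemma gauss_add {r s : ℝ} (hr : 0 < r) (hs : 0 < s) (x : E3) :
    ∫ y, gauss r (x - y) * gauss s y = gauss (r + s) x := by
  have h := integral_fourierInv_mul (integrable_gexp hr).ofReal (integrable_gauss hs).ofReal x (m := fun ξ => (gexp r ξ : ℂ))
    (g := fun ξ => (gauss s ξ : ℂ))
  simp only [fourierInv_gexp hr, fourier_gauss hs, ← Complex.ofReal_mul, ← gexp_add] at h
  rw [fourierInv_gexp (by positivity), integral_complex_ofReal] at h; exact_mod_cast h

/-- The Fourier representation of the gradient of a Gaussian. -/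
lemma fourierInv_coord_mul_gexp {r : ℝ} (hr : 0 < r) (j : Fin 3) (x : E3) :
    𝓕⁻ (fun ξ : E3 => -2 * π * I * ξ j * gexp r ξ) x = (x j / r * gauss r x : ℝ) := by
  set b : ℝ := 2 * π ^ 2 * r with hb
  have hb0 : 0 < b := by positivity
  set g : E3 → ℂ := fun ξ => Complex.exp (((2 * π * inner ℝ ξ x : ℝ) : ℂ) * I) * (gexp r ξ : ℂ) with hg
  set v : E3 := EuclideanSpace.single j 1
  have hvi : ∀ ξ : E3, inner ℝ v ξ = ξ j := fun ξ => by simp [v, EuclideanSpace.inner_single_left]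
  have hder : ∀ ξ, HasFDerivAt g ((Complex.exp (((2 * π * inner ℝ ξ x : ℝ) : ℂ) * I)) •
        (ofRealCLM.comp ((exp (-b * ‖ξ‖ ^ 2)) • (-b • (2 • innerSL ℝ ξ)))) +
        (gexp r ξ : ℂ) • ((Complex.exp (((2 * π * inner ℝ ξ x : ℝ) : ℂ) * I)) •
          ((ContinuousLinearMap.smulRight (ofRealCLM.comp ((2 * π) • (innerSL ℝ x))) I)))) ξ := by
    intro ξ
    have h1 : HasFDerivAt (fun ξ : E3 => gexp r ξ) ((exp (-b * ‖ξ‖ ^ 2)) • (-b • (2 • innerSL ℝ ξ))) ξ :=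
      (((hasStrictFDerivAt_norm_sq ξ).hasFDerivAt.const_mul (-b))).exp
    have h2 : HasFDerivAt (fun ξ : E3 => (2 * π * inner ℝ ξ x : ℝ)) ((2 * π) • (innerSL ℝ x)) ξ := by
      have := ((innerSL ℝ x).hasFDerivAt (x := ξ)).const_mul (2 * π)
      refine this.congr_of_eventuallyEq (of_forall fun y => ?_); simp [real_inner_comm]
    have h3 := ((ofRealCLM.hasFDerivAt.comp ξ h2).mul_const' I).cexp; exact h3.mul (ofRealCLM.hasFDerivAt.comp ξ h1)
  have hgi : Integrable g := by
    refine (integrable_gexp hr).ofReal.bdd_mul (c := 1) (Continuous.aestronglyMeasurable (by fun_prop)) (ae_of_all _ fun p => ?_)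
    rw [norm_exp_ofReal_mul_I]
  have hgj : Integrable (fun ξ : E3 => (ξ j : ℂ) * g ξ) := by
    refine (integrable_norm_mul_exp hb0).mono' (by fun_prop) (ae_of_all _ fun ξ => ?_); simp only [hg]
    rw [norm_mul, norm_mul, norm_exp_ofReal_mul_I, one_mul, norm_real, norm_real, norm_of_nonneg (gexp_pos r ξ).le]
    exact mul_le_mul_of_nonneg_right (PiLp.norm_apply_le ξ j) (exp_pos _).le
  have hfd : ∀ ξ, fderiv ℝ g ξ v = (-2 * b : ℂ) * ((ξ j : ℂ) * g ξ) + (2 * π * x j * I) * g ξ := by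
    intro ξ; rw [(hder ξ).fderiv]
    simp only [ContinuousLinearMap.add_apply, ContinuousLinearMap.smul_apply, ContinuousLinearMap.comp_apply,
      ContinuousLinearMap.smulRight_apply, innerSL_apply_apply, real_inner_comm v, hvi, Complex.ofRealCLM_apply, hg, gexp, hb,
      smul_eq_mul, nsmul_eq_mul, Complex.real_smul]
    push_cast; ring
  have hzero := integral_mul_fderiv_eq_neg_fderiv_mul_of_integrable (μ := (volume : Measure E3)) (𝕜 := ℂ) (f := fun _ => (1 : ℂ)) (g := g) (v := v)
    (by simp) (by simp only [one_mul, hfd]; exact (hgj.const_mul _).add (hgi.const_mul _)) (by simpa using hgi)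
    (by fun_prop) (fun ξ _ => (hder ξ).differentiableAt)
  simp only [one_mul, hfd] at hzero
  rw [integral_add (hgj.const_mul _) (hgi.const_mul _), integral_const_mul, integral_const_mul] at hzero
  have hgg : ∫ ξ, g ξ = gauss r x := by rw [← fourierInv_gexp hr, fourierInv_eq']; rfl
  rw [hgg] at hzero
  have hl : 𝓕⁻ (fun ξ : E3 => -2 * π * I * ξ j * gexp r ξ) x = (-2 * π * I) * ∫ ξ, (ξ j : ℂ) * g ξ := by
    rw [fourierInv_eq', ← integral_const_mul]; congr 1; ext ξ; simp only [hg, smul_eq_mul]; ring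
  rw [hl]
  have hz2 : (2 * b : ℂ) * ∫ ξ, (ξ j : ℂ) * g ξ = (2 * π * x j * I) * gauss r x := by
    simp at hzero
    linear_combination (-1 : ℂ) * hzero
  have hbC : (b : ℂ) = 2 * π ^ 2 * r := by rw [hb]; push_cast; ring
  rw [hbC] at hz2
  have hr' : (r : ℂ) ≠ 0 := by exact_mod_cast hr.ne'
  have hpi : (π : ℂ) ≠ 0 := by exact_mod_cast Real.pi_ne_zero
  push_cast; field_simp
  have h4 : (π : ℂ) * (4 * π * r * (∫ ξ, (ξ j : ℂ) * g ξ) - 2 * (x j * I * gauss r x)) = 0 := by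
    linear_combination hz2
  have h5 := (mul_eq_zero.1 h4).resolve_left hpi
  linear_combination (-I / 2) * h5 + (-(x j : ℂ) * gauss r x) * Complex.I_sq

end Gaussian

open scoped FourierTransform

section Coulomb

/-- The `j`-th component of the kernel `x / (4π|x|³)`. -/
noncomputable def coul (j : Fin 3) (y : E3) : ℝ := (4 * π)⁻¹ * ((‖y‖ ^ 3)⁻¹ * y j)

@[fun_prop] lemma measurable_coul (j : Fin 3) : Measurable (coul j) := by unfold coul; fun_prop

lemma coul_neg (j : Fin 3) (y : E3) : coul j (-y) = -coul j y := by simp [coul]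

lemma enorm_coul_le (j : Fin 3) (y : E3) : ‖coul j y‖ₑ ≤ kern y := by
  rw [kern, ← ofReal_norm]; apply ofReal_le_ofReal
  rcases eq_or_ne y 0 with rfl | hy
  · simp [coul]
  have hy' : 0 < ‖y‖ := norm_pos_iff.2 hy
  rw [coul, norm_mul, norm_mul, norm_of_nonneg (by positivity), norm_of_nonneg (by positivity)]
  have h1 : (4 * π)⁻¹ ≤ 1 := inv_le_one_of_one_le₀ (by nlinarith [Real.pi_gt_three])
  calc _ ≤ 1 * ((‖y‖ ^ 3)⁻¹ * ‖y‖) := by gcongr; exact PiLp.norm_apply_le y j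
    _ = _ := by rw [rpow_neg hy'.le, one_mul]; norm_cast; field_simp

/-- `|y|^{-s}`, `0 ≤ s < 3`, is integrable against a bounded integrable function. -/
lemma lintegral_rpow_mul_le {s : ℝ} (hs0 : 0 ≤ s) (f : E3 → ℝ≥0∞) {B : ℝ≥0∞} (hB : ∀ y, f y ≤ B) (x : E3) :
    ∫⁻ y, ofReal (‖x - y‖ ^ (-s)) * f y ≤ B * (∫⁻ y in ball (0 : E3) 1, ofReal (‖y‖ ^ (-s))) + ∫⁻ y, f y := by
  have hm : Measurable fun y : E3 => (ball (0 : E3) 1).indicator (fun y => ofReal (‖y‖ ^ (-s))) (x - y) :=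
    Measurable.comp (g := (ball (0 : E3) 1).indicator (fun y => ofReal (‖y‖ ^ (-s))))
      (Measurable.indicator (by fun_prop) isOpen_ball.measurableSet) (by fun_prop)
  calc _ ≤ ∫⁻ y, (B * (ball (0 : E3) 1).indicator (fun y => ofReal (‖y‖ ^ (-s))) (x - y) + f y) := by
        refine lintegral_mono fun y => ?_
        by_cases h : x - y ∈ ball (0 : E3) 1
        · rw [indicator_of_mem h, mul_comm]; exact le_add_right (mul_le_mul_left (hB y) _)
        · rw [indicator_of_notMem h, mul_zero, zero_add]
          have h1 : ‖x - y‖ ^ (-s) ≤ 1 := Real.rpow_le_one_of_one_le_of_nonpos (by simpa using h) (by linarith)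
          calc _ ≤ 1 * f y := mul_le_mul_left (by simpa using h1) _
            _ = _ := one_mul _
    _ = _ := by
      rw [lintegral_add_left (by fun_prop), lintegral_const_mul _ hm, setLIntegral_sub _ _ isOpen_ball.measurableSet]

lemma riesz_lt_top {f : E3 → ℝ≥0∞} {B : ℝ≥0∞} (hB : ∀ y, f y ≤ B) (hBt : B ≠ ∞) (hf : ∫⁻ y, f y ≠ ∞)
    (x : E3) : riesz f x < ∞ := by
  refine lt_of_le_of_lt (lintegral_rpow_mul_le (s := 2) (by norm_num) f hB x) ?_
  have := lintegral_ball_rpow_lt_top (s := 2) (by norm_num)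
  finiteness

lemma integral_inv_mul_gauss {y : E3} (hy : y ≠ 0) : IntegrableOn (fun r => r⁻¹ * gauss r y) (Ioi 0) ∧
    ∫ r in Ioi 0, r⁻¹ * gauss r y = (2 * π)⁻¹ * (‖y‖ ^ 3)⁻¹ := by
  have hy' : 0 < ‖y‖ := norm_pos_iff.2 hy; set c := ‖y‖ ^ 2 / 2 with hc
  have hc0 : 0 < c := by positivity
  have hG := Real.integral_rpow_mul_exp_neg_mul_Ioi (a := 3 / 2) (r := c) (by norm_num) hc0
  have hS := integral_comp_rpow_Ioi (fun l : ℝ => l ^ ((3 / 2 : ℝ) - 1) * exp (-(c * l))) (p := -1) (by norm_num)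
  have he : ∀ r ∈ Ioi (0 : ℝ), r⁻¹ * gauss r y = (2 * π) ^ (-(3 / 2 : ℝ)) *
      ((|(-1 : ℝ)| * r ^ ((-1 : ℝ) - 1)) • ((fun l : ℝ => l ^ ((3 / 2 : ℝ) - 1) * exp (-(c * l))) (r ^ (-1 : ℝ)))) := by
    intro r hr; have hr : 0 < r := hr; simp only [smul_eq_mul]
    rw [gauss, ← Real.rpow_mul hr.le, abs_neg, abs_one, one_mul, ← mul_assoc (r ^ ((-1 : ℝ) - 1)), ← rpow_add hr,
      Real.rpow_neg_one]
    have e1 : c * r⁻¹ = ‖y‖ ^ 2 / (2 * r) := by rw [hc]; field_simp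
    have e2 : r ^ ((-1 : ℝ) - 1 + -1 * (3 / 2 - 1)) = r⁻¹ * r ^ (-(3 / 2 : ℝ)) := by
      rw [← Real.rpow_neg_one, ← rpow_add hr]; norm_num
    rw [e1, e2]; ring
  have hval : ∫ r in Ioi 0, r⁻¹ * gauss r y = (2 * π)⁻¹ * (‖y‖ ^ 3)⁻¹ := by
    rw [setIntegral_congr_fun measurableSet_Ioi he, integral_const_mul, hS, hG]
    have e3 : Real.Gamma (3 / 2) = sqrt π / 2 := by
      have := Real.Gamma_add_one (s := 1 / 2) (by norm_num); rw [Real.Gamma_one_half_eq] at this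
      norm_num at this ⊢; rw [this]; ring
    have e4 : (1 / c) ^ (3 / 2 : ℝ) = 2 ^ (3 / 2 : ℝ) * (‖y‖ ^ 3)⁻¹ := by
      rw [hc, one_div_div, Real.div_rpow (by norm_num) (by positivity), div_eq_mul_inv]; congr 2
      rw [← Real.rpow_natCast, ← Real.rpow_natCast, ← Real.rpow_mul hy'.le]; norm_num
    have e5 : (2 * π) ^ (-(3 / 2 : ℝ)) * 2 ^ (3 / 2 : ℝ) * sqrt π = π⁻¹ := by
      rw [mul_rpow (by norm_num) Real.pi_pos.le, Real.sqrt_eq_rpow]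
      calc _ = ((2 : ℝ) ^ (-(3 / 2 : ℝ)) * 2 ^ (3 / 2 : ℝ)) * (π ^ (-(3 / 2 : ℝ)) * π ^ (1 / 2 : ℝ)) := by ring
        _ = _ := by rw [← rpow_add (by norm_num), ← rpow_add Real.pi_pos, ← Real.rpow_neg_one]; norm_num
    rw [e3, e4]
    calc _ = ((2 * π) ^ (-(3 / 2 : ℝ)) * 2 ^ (3 / 2 : ℝ) * sqrt π) / 2 * (‖y‖ ^ 3)⁻¹ := by ring
      _ = _ := by rw [e5]; field_simp
  refine ⟨?_, hval⟩; by_contra hn; rw [integral_undef hn] at hval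
  have : 0 < (2 * π)⁻¹ * (‖y‖ ^ 3)⁻¹ := by positivity
  linarith

lemma integral_gexp_Ioi {ξ : E3} (hξ : ξ ≠ 0) :
    IntegrableOn (fun r => gexp r ξ) (Ioi 0) ∧ ∫ r in Ioi 0, gexp r ξ = (2 * π ^ 2 * ‖ξ‖ ^ 2)⁻¹ := by
  have h0 : 0 < ‖ξ‖ := norm_pos_iff.2 hξ
  have ha : -(2 * π ^ 2 * ‖ξ‖ ^ 2) < 0 := by
    have : 0 < 2 * π ^ 2 * ‖ξ‖ ^ 2 := by positivity
    linarith
  have e : (fun r => gexp r ξ) = fun r => exp (-(2 * π ^ 2 * ‖ξ‖ ^ 2) * r) := by funext r; rw [gexp]; congr 1; ring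
  rw [e]; refine ⟨integrableOn_exp_mul_Ioi ha 0, ?_⟩; rw [integral_exp_mul_Ioi ha 0]; simp [neg_div_neg_eq]

/-- The symbol of the mollified Coulomb kernel. -/
noncomputable def coulSymb (j : Fin 3) (M : ℝ) (ξ : E3) : ℂ := -I * ((ξ j / (2 * π * ‖ξ‖ ^ 2) * gexp M ξ : ℝ) : ℂ)

@[fun_prop] lemma measurable_coulSymb (j : Fin 3) (M : ℝ) : Measurable (coulSymb j M) := by unfold coulSymb; fun_prop

lemma norm_coulSymb_mul_le (j : Fin 3) (M : ℝ) (ξ : E3) : ‖ξ‖ * ‖coulSymb j M ξ‖ ≤ (2 * π)⁻¹ * gexp M ξ := by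
  rcases eq_or_ne ξ 0 with rfl | h
  · simp [coulSymb]; exact mul_nonneg (by positivity) (gexp_pos _ _).le
  have h0 : 0 < ‖ξ‖ := norm_pos_iff.2 h
  rw [coulSymb, norm_mul, norm_neg, Complex.norm_I, one_mul, norm_real, norm_mul, norm_div,
    norm_of_nonneg (gexp_pos M ξ).le, norm_of_nonneg (r := 2 * π * ‖ξ‖ ^ 2) (by positivity)]
  have h1 : ‖ξ j‖ ≤ ‖ξ‖ := PiLp.norm_apply_le ξ j
  calc _ ≤ ‖ξ‖ * (‖ξ‖ / (2 * π * ‖ξ‖ ^ 2) * gexp M ξ) := by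
        have := (gexp_pos M ξ).le; gcongr
    _ = _ := by field_simp

lemma enorm_coulSymb_le (j : Fin 3) (M : ℝ) (ξ : E3) :
    ‖coulSymb j M ξ‖ₑ ≤ ofReal (‖0 - ξ‖ ^ (-1 : ℝ)) * ofReal (gexp M ξ) := by
  rw [← ofReal_mul (by positivity), ← ofReal_norm, zero_sub, norm_neg, Real.rpow_neg_one]; apply ofReal_le_ofReal
  rcases eq_or_ne ξ 0 with rfl | h
  · simp [coulSymb]
  have h0 : 0 < ‖ξ‖ := norm_pos_iff.2 h; rw [← mul_le_mul_iff_right₀ h0, mul_inv_cancel_left₀ h0.ne']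
  refine (norm_coulSymb_mul_le j M ξ).trans ?_
  have h1 : (2 * π)⁻¹ ≤ 1 := inv_le_one_of_one_le₀ (by nlinarith [Real.pi_gt_three])
  exact mul_le_of_le_one_left (gexp_pos M ξ).le h1

lemma integrable_coulSymb (j : Fin 3) {M : ℝ} (hM : 0 < M) : Integrable (coulSymb j M) := by
  refine ⟨by fun_prop, lt_of_le_of_lt (lintegral_mono (enorm_coulSymb_le j M)) ?_⟩
  refine lt_of_le_of_lt (lintegral_rpow_mul_le (s := 1) (by norm_num) _ (B := 1)
    (fun y => by simpa using gexp_le_one hM.le y) 0) ?_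
  have h1 := lintegral_ball_rpow_lt_top (s := 1) (by norm_num)
  have h2 : ∫⁻ y, ofReal (gexp M y) < ∞ := (integrable_gexp hM).lintegral_lt_top
  finiteness

/-- The Fourier representation of the mollified Coulomb kernel. -/
lemma integral_coul_mul_gauss (j : Fin 3) {M : ℝ} (hM : 0 < M) (x : E3) :
    ((∫ y, coul j (x - y) * gauss M y : ℝ) : ℂ) = 𝓕⁻ (coulSymb j M) x := by
  set μ := (volume : Measure ℝ).restrict (Ioi 0)
  let A : E3 → ℝ → ℝ := fun y r => (1 / 2 : ℝ) * ((x - y) j / r * gauss r (x - y) * gauss M y)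
  have e : ∀ y r, A y r =
      (1 / 2 : ℝ) * (x - y) j * gauss M y * (r⁻¹ * gauss r (x - y)) := fun y r => by ring
  -- the superposition of Gaussians
  have hrep : ∀ y : E3, x - y ≠ 0 → coul j (x - y) * gauss M y = ∫ r, A y r ∂μ := by
    intro y hy
    simp only [e]; rw [integral_const_mul, (integral_inv_mul_gauss hy).2, coul]; have := Real.pi_ne_zero
    field_simp; norm_num; ring
  have hae : ∀ᵐ y : E3, x - y ≠ 0 := by
    have : ∀ᵐ y : E3, y ≠ x := by simp [ae_iff]
    filter_upwards [this] with y hy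
    exact sub_ne_zero.2 hy.symm
  have hmeas : Measurable fun p : E3 × ℝ => A p.1 p.2 := by
    have h1 : Measurable fun p : E3 × ℝ => gauss p.2 (x - p.1) :=
      measurable_gauss_uncurry.comp (f := fun p : E3 × ℝ => (p.2, x - p.1)) (by fun_prop)
    fun_prop
  have hint1 : Integrable (fun p : E3 × ℝ => A p.1 p.2) (volume.prod μ) := by
    rw [integrable_prod_iff hmeas.aestronglyMeasurable]
    have hn : ∀ y : E3, x - y ≠ 0 → ∫ r, ‖A y r‖ ∂μ = ‖coul j (x - y) * gauss M y‖ := by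
      intro y hy; simp only [e, norm_mul]; rw [integral_const_mul]
      have : ∫ r, ‖r⁻¹‖ * ‖gauss r (x - y)‖ ∂μ = ∫ r, r⁻¹ * gauss r (x - y) ∂μ :=
        setIntegral_congr_fun measurableSet_Ioi fun r hr => by
          have hr : 0 < r := hr; simp only [norm_of_nonneg (inv_pos.2 hr).le, norm_of_nonneg (gauss_pos hr _).le]
      rw [this, (integral_inv_mul_gauss hy).2, coul, norm_mul, norm_mul, norm_of_nonneg (r := (4 * π)⁻¹) (by positivity),
        norm_of_nonneg (r := (‖x - y‖ ^ 3)⁻¹) (by positivity)]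
      have := Real.pi_ne_zero; norm_num
      field_simp; norm_num; ring
    constructor
    · filter_upwards [hae] with y hy
      simp only [e]; exact (integral_inv_mul_gauss hy).1.const_mul _
    · have : Integrable fun y => ‖coul j (x - y) * gauss M y‖ := by
        refine Integrable.norm ⟨by fun_prop, ?_⟩
        refine lt_of_le_of_lt ?_ (riesz_lt_top (f := fun y => ofReal (gauss M y)) (B := ofReal (M ^ (-(3 / 2 : ℝ))))
          (fun y => ofReal_le_ofReal (gauss_le hM y)) ofReal_ne_top (by rw [lintegral_gauss hM]; simp) x)
        refine lintegral_mono fun y => ?_; rw [enorm_mul, enorm_of_nonneg (gauss_pos hM y).le]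
        exact mul_le_mul_left (enorm_coul_le _ _) _
      refine this.congr ?_
      filter_upwards [hae] with y hy
      exact (hn y hy).symm
  have step1 : (∫ y, coul j (x - y) * gauss M y) = ∫ r, (∫ y, A y r) ∂μ := by
    rw [← integral_integral_swap hint1]; refine integral_congr_ae ?_
    filter_upwards [hae] with y hy using hrep y hy
  have step2 : ∀ r ∈ Ioi (0 : ℝ), ((∫ y, A y r : ℝ) : ℂ) =
      ∫ ξ : E3, Complex.exp (((2 * π * inner ℝ ξ x : ℝ) : ℂ) * I) * ((-π * I * ξ j * gexp M ξ) * gexp r ξ) := by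
    intro r hr; have hr : 0 < r := hr
    have hm : Integrable (fun ξ : E3 => -2 * π * I * ξ j * gexp r ξ) := by
      refine ((integrable_norm_mul_exp (b := 2 * π ^ 2 * r) (by positivity)).const_mul (2 * π)).mono'
        (by fun_prop) (ae_of_all _ fun ξ => ?_)
      simp only [norm_mul, norm_neg, norm_real, Complex.norm_I, Complex.norm_ofNat]
      rw [norm_of_nonneg Real.pi_pos.le, norm_of_nonneg (gexp_pos r ξ).le, mul_one, mul_assoc (2 * π)]
      have : ‖ξ j‖ ≤ ‖ξ‖ := PiLp.norm_apply_le ξ j; unfold gexp; gcongr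
    have h := integral_fourierInv_mul hm (integrable_gauss hM).ofReal x (g := fun ξ => (gauss M ξ : ℂ))
    simp only [fourierInv_coord_mul_gexp hr, fourier_gauss hM, ← Complex.ofReal_mul (_ * _) (gauss M _)] at h
    rw [integral_complex_ofReal] at h
    rw [integral_const_mul, Complex.ofReal_mul, h, fourierInv_eq', ← integral_const_mul]; congr 1; ext ξ
    simp only [smul_eq_mul]; push_cast; ring
  have hint2 : Integrable (fun p : E3 × ℝ => Complex.exp (((2 * π * inner ℝ p.1 x : ℝ) : ℂ) * I) *
        ((-π * I * p.1 j * gexp M p.1) * gexp p.2 p.1)) (volume.prod μ) := by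
    have hg1 : Measurable fun p : E3 × ℝ => gexp p.2 p.1 :=
      measurable_gexp_uncurry.comp (f := fun p : E3 × ℝ => (p.2, p.1)) (by fun_prop)
    have hm2 : Measurable fun p : E3 × ℝ => ((-π * I * p.1 j * gexp M p.1) * gexp p.2 p.1 : ℂ) := by fun_prop
    refine Integrable.bdd_mul (c := 1) ?_ (Continuous.aestronglyMeasurable (by fun_prop)) (ae_of_all _ fun p => ?_)
    swap
    · rw [norm_exp_ofReal_mul_I]
    rw [integrable_prod_iff hm2.aestronglyMeasurable]
    have h0 : ∀ᵐ ξ : E3, ξ ≠ 0 := by simp [ae_iff]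
    constructor
    · filter_upwards [h0] with ξ hξ
      exact (integral_gexp_Ioi hξ).1.ofReal.const_mul _
    · refine (integrable_coulSymb j hM).norm.congr ?_
      filter_upwards [h0] with ξ hξ
      have h0 : 0 < ‖ξ‖ := norm_pos_iff.2 hξ
      have e : ∀ r, ‖(-π * I * ξ j * gexp M ξ : ℂ) * gexp r ξ‖ =
          ‖(-π * I * ξ j * gexp M ξ : ℂ)‖ * gexp r ξ := fun r => by
        rw [norm_mul, norm_real, norm_of_nonneg (gexp_pos _ _).le]
      simp only [e]; rw [integral_const_mul, (integral_gexp_Ioi hξ).2, coulSymb]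
      simp only [norm_mul, norm_neg, norm_real, Complex.norm_I, norm_div]
      rw [norm_of_nonneg Real.pi_pos.le, norm_of_nonneg (r := ‖ξ‖ ^ 2) (by positivity)]; norm_num
      have := Real.pi_ne_zero; field_simp
  rw [step1, ← integral_complex_ofReal, setIntegral_congr_fun measurableSet_Ioi step2,
    ← integral_integral_swap hint2, fourierInv_eq']
  have h0 : ∀ᵐ ξ : E3, ξ ≠ 0 := by simp [ae_iff]
  refine integral_congr_ae ?_
  filter_upwards [h0] with ξ hξ
  have h0 : 0 < ‖ξ‖ := norm_pos_iff.2 hξ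
  rw [integral_const_mul, integral_const_mul, integral_complex_ofReal, (integral_gexp_Ioi hξ).2, coulSymb, smul_eq_mul]
  congr 1
  have : (π : ℂ) ≠ 0 := by exact_mod_cast Real.pi_ne_zero
  have : (‖ξ‖ : ℂ) ≠ 0 := by exact_mod_cast h0.ne'
  push_cast; field_simp

end Coulomb

/-! ### The state space -/

section StateSpace

/-- The weight of the state space. -/
noncomputable def wt (z : Phase) : ℝ≥0∞ := ofReal ((1 + ‖z.2‖ ^ 2) ^ 2)

@[fun_prop] lemma measurable_wt : Measurable wt := by unfold wt; fun_prop

lemma one_le_wt (z : Phase) : 1 ≤ wt z := by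
  rw [wt, ENNReal.one_le_ofReal]
  have : 0 ≤ ‖z.2‖ ^ 2 := by positivity
  nlinarith

lemma wt_ne_top (z : Phase) : wt z ≠ ∞ := ofReal_ne_top

lemma wt_ne_zero (z : Phase) : wt z ≠ 0 := (lt_of_lt_of_le one_pos (one_le_wt z)).ne'

lemma lintegral_weightMeasure {f : Phase → ℝ≥0∞} (hf : Measurable f) : ∫⁻ z, f z ∂weightMeasure = ∫⁻ z, wt z * f z :=
  lintegral_withDensity_eq_lintegral_mul _ measurable_wt hf

lemma volume_absolutelyContinuous : (volume : Measure Phase) ≪ weightMeasure :=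
  withDensity_absolutelyContinuous' (by fun_prop) (ae_of_all _ wt_ne_zero)

lemma ae_eq_volume {u g : Phase → ℝ} (h : u =ᵐ[weightMeasure] g) : u =ᵐ[volume] g :=
  volume_absolutelyContinuous.ae_eq h

@[fun_prop]
lemma measurable_coe (u : X) : Measurable u := (Lp.stronglyMeasurable u).measurable

lemma enorm_sq_eq (u : X) : ‖u‖ₑ ^ 2 = ∫⁻ z, wt z * ‖u z‖ₑ ^ 2 := by
  rw [Lp.enorm_def, eLpNorm_eq_lintegral_rpow_enorm_toReal (by norm_num) (by norm_num),
    ← lintegral_weightMeasure (by fun_prop)]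
  simp only [ENNReal.toReal_ofNat, ENNReal.rpow_ofNat]; rw [← rpow_natCast, ← rpow_mul]; norm_num

lemma enorm_eq (u : X) : ‖u‖ₑ = (∫⁻ z, wt z * ‖u z‖ₑ ^ 2) ^ (1 / 2 : ℝ) := by
  rw [← enorm_sq_eq, sq_rpow_half]

/-- The dual norm of a function paired with elements of `X`. -/
noncomputable def dualNorm (φ : Phase → ℝ) : ℝ≥0∞ := (∫⁻ z, ‖φ z‖ₑ ^ 2 * (wt z)⁻¹) ^ (1 / 2 : ℝ)

lemma lintegral_enorm_mul_le' (u : X) {k : Phase → ℝ≥0∞} (hk : AEMeasurable k) :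
    ∫⁻ z, ‖u z‖ₑ * k z ≤ ‖u‖ₑ * (∫⁻ z, k z ^ 2 * (wt z)⁻¹) ^ (1 / 2 : ℝ) := by
  have h := lintegral_mul_le_sqrt (μ := (volume : Measure Phase)) (f := fun z => wt z ^ (1 / 2 : ℝ) * ‖u z‖ₑ)
    (g := fun z => k z * (wt z)⁻¹ ^ (1 / 2 : ℝ)) (by fun_prop) (by fun_prop)
  have e1 : ∀ z, (wt z ^ (1 / 2 : ℝ) * ‖u z‖ₑ) ^ 2 = wt z * ‖u z‖ₑ ^ 2 := fun z => by
    rw [mul_pow, rpow_half_sq]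
  have e2 : ∀ z, (k z * (wt z)⁻¹ ^ (1 / 2 : ℝ)) ^ 2 = k z ^ 2 * (wt z)⁻¹ := fun z => by
    rw [mul_pow, rpow_half_sq]
  have e3 : ∀ z, (wt z ^ (1 / 2 : ℝ) * ‖u z‖ₑ) * (k z * (wt z)⁻¹ ^ (1 / 2 : ℝ)) = ‖u z‖ₑ * k z := fun z => by
    calc _ = (wt z * (wt z)⁻¹) ^ (1 / 2 : ℝ) * (‖u z‖ₑ * k z) := by rw [mul_rpow_of_nonneg _ _ (by norm_num)]; ring
      _ = _ := by rw [ENNReal.mul_inv_cancel (wt_ne_zero z) (wt_ne_top z), ENNReal.one_rpow, one_mul]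
  simp only [e1, e2, e3] at h
  rwa [← enorm_eq] at h

lemma lintegral_enorm_mul_le (u : X) {φ : Phase → ℝ} (hφ : AEMeasurable φ) :
    ∫⁻ z, ‖u z * φ z‖ₑ ≤ ‖u‖ₑ * dualNorm φ := by
  simp only [enorm_mul]; exact lintegral_enorm_mul_le' u hφ.enorm

lemma integrable_mul (u : X) {φ : Phase → ℝ} (hφ : AEMeasurable φ) (h : dualNorm φ < ∞) :
    Integrable (fun z => u z * φ z) :=
  ⟨((measurable_coe u).aemeasurable.mul hφ).aestronglyMeasurable,
    lt_of_le_of_lt (lintegral_enorm_mul_le u hφ) (mul_lt_top enorm_lt_top h)⟩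

lemma coe_add_ae (u g : X) : (u + g) =ᵐ[volume] fun z => u z + g z := ae_eq_volume (Lp.coeFn_add u g)

lemma coe_sub_ae (u g : X) : (u - g) =ᵐ[volume] fun z => u z - g z := ae_eq_volume (Lp.coeFn_sub u g)

lemma coe_smul_ae (c : ℝ) (u : X) : (c • u) =ᵐ[volume] fun z => c * u z := ae_eq_volume (Lp.coeFn_smul c u)

lemma norm_integral_le_toReal {α : Type*} [MeasurableSpace α] {μ : Measure α} {f : α → ℝ} {C : ℝ≥0∞}
    (h : ∫⁻ a, ‖f a‖ₑ ∂μ ≤ C) (hC : C ≠ ∞) : ‖∫ a, f a ∂μ‖ ≤ C.toReal := by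
  rw [← toReal_enorm]; exact toReal_mono hC ((enorm_integral_le_lintegral_enorm _).trans h)

/-- A function of finite dual norm defines a bounded functional on `X`. -/
lemma exists_clm {φ : Phase → ℝ} (hφ : AEMeasurable φ) (h : dualNorm φ < ∞) :
    ∃ L : X →L[ℝ] ℝ, (∀ u : X, L u = ∫ z, u z * φ z) ∧ ‖L‖ ≤ (dualNorm φ).toReal := by
  let L0 : X →ₗ[ℝ] ℝ := {
      toFun := fun u => ∫ z, u z * φ z
      map_add' := fun u g => by
        rw [← integral_add (integrable_mul u hφ h) (integrable_mul g hφ h)]; refine integral_congr_ae ?_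
        filter_upwards [coe_add_ae u g] with z hz
        rw [hz]; ring
      map_smul' := fun c u => by
        rw [RingHom.id_apply, smul_eq_mul, ← integral_const_mul]; refine integral_congr_ae ?_
        filter_upwards [coe_smul_ae c u] with z hz
        rw [hz]; ring }
  have hb : ∀ u, ‖L0 u‖ ≤ (dualNorm φ).toReal * ‖u‖ := fun u => by
    have := norm_integral_le_toReal (lintegral_enorm_mul_le u hφ) (mul_lt_top enorm_lt_top h).ne
    rwa [ENNReal.toReal_mul, toReal_enorm, mul_comm] at this
  exact ⟨L0.mkContinuous _ hb, fun u => rfl, L0.mkContinuous_norm_le toReal_nonneg hb⟩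

lemma norm_pair_le (u : X) {φ : Phase → ℝ} (hφ : AEMeasurable φ) (h : dualNorm φ < ∞) :
    ‖∫ z, u z * φ z‖ ≤ ‖u‖ * (dualNorm φ).toReal := by
  have := norm_integral_le_toReal (lintegral_enorm_mul_le u hφ) (mul_lt_top enorm_lt_top h).ne
  rwa [ENNReal.toReal_mul, toReal_enorm] at this

lemma dualNorm_le (φ : Phase → ℝ) : dualNorm φ ≤ (∫⁻ z, ‖φ z‖ₑ ^ 2) ^ (1 / 2 : ℝ) := by
  unfold dualNorm; gcongr with z; exact mul_le_of_le_one_right' (ENNReal.inv_le_one.2 (one_le_wt z))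

lemma eLpNorm_two_eq {α E : Type*} [MeasurableSpace α] [NormedAddCommGroup E] {μ : Measure α} (f : α → E) :
    eLpNorm f 2 μ = (∫⁻ a, ‖f a‖ₑ ^ 2 ∂μ) ^ (1 / 2 : ℝ) := by
  rw [eLpNorm_eq_lintegral_rpow_enorm_toReal (by norm_num) (by norm_num)]; simp

lemma eLpNorm_two_sq {α E : Type*} [MeasurableSpace α] [NormedAddCommGroup E] {μ : Measure α} (f : α → E) :
    eLpNorm f 2 μ ^ 2 = ∫⁻ a, ‖f a‖ₑ ^ 2 ∂μ := by
  rw [eLpNorm_two_eq, rpow_half_sq]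

lemma eLpNorm_coe_le (u : X) : eLpNorm u 2 volume ≤ ‖u‖ₑ := by
  rw [eLpNorm_two_eq, enorm_eq]; gcongr with z; exact le_mul_of_one_le_left' (one_le_wt z)

lemma memLp_coe (u : X) : MemLp u 2 (volume : Measure Phase) :=
  ⟨(measurable_coe u).aestronglyMeasurable, lt_of_le_of_lt (eLpNorm_coe_le u) enorm_lt_top⟩

/-- The embedding of `X` into `L²` of phase space. -/
noncomputable def toL2 : X →L[ℝ] Lp ℝ 2 (volume : Measure Phase) := LinearMap.mkContinuous
    { toFun := fun u => (memLp_coe u).toLp _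
      map_add' := fun u g => by rw [← MemLp.toLp_add]; exact MemLp.toLp_congr _ _ (coe_add_ae u g)
      map_smul' := fun c u => by
        rw [RingHom.id_apply, ← MemLp.toLp_const_smul]
        exact MemLp.toLp_congr _ _ (coe_smul_ae c u) } 1 (fun u => by
    rw [one_mul, LinearMap.coe_mk, AddHom.coe_mk, Lp.norm_toLp, ← toReal_enorm]
    exact toReal_mono enorm_ne_top (eLpNorm_coe_le u))

lemma coeFn_toL2 (u : X) : (toL2 u) =ᵐ[volume] fun z => u z := (memLp_coe u).coeFn_toLp

lemma norm_toL2 (u : X) : ‖toL2 u‖ = norm2 u := Lp.norm_toLp _ (memLp_coe u)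

lemma norm2_le (u : X) : norm2 u ≤ ‖u‖ := by
  rw [norm2, ← toReal_enorm]; exact toReal_mono enorm_ne_top (eLpNorm_coe_le u)

lemma norm2_nonneg (u : X) : 0 ≤ norm2 u := toReal_nonneg

lemma ofReal_norm2 (u : X) : ofReal (norm2 u) = eLpNorm u 2 volume := ofReal_toReal (memLp_coe u).2.ne

lemma inner_toL2 (u g : X) : inner ℝ (toL2 u) (toL2 g) = ∫ z, u z * g z := by
  rw [L2.inner_def]; refine integral_congr_ae ?_
  filter_upwards [coeFn_toL2 u, coeFn_toL2 g] with z h1 h2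
  rw [h1, h2]; simp [mul_comm]

/-- `∫ (1 + |v|²)⁻² dv`. -/
noncomputable def wtInt : ℝ≥0∞ := ∫⁻ v : E3, (ofReal ((1 + ‖v‖ ^ 2) ^ 2))⁻¹

lemma wtInt_lt_top : wtInt < ∞ := by
  have h := (integrable_rpow_neg_one_add_norm_sq (E := E3) (μ := volume) (r := 4)
    (by rw [finrank_E3]; norm_num)).lintegral_lt_top
  refine lt_of_le_of_lt (lintegral_mono fun v => ?_) h; rw [← ENNReal.ofReal_inv_of_pos (by positivity)]
  apply ofReal_le_ofReal; rw [← Real.rpow_natCast, ← rpow_neg (by positivity)]; norm_num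

lemma lintegral_shear (θ : ℝ) {f : Phase → ℝ≥0∞} (hf : Measurable f) :
    ∫⁻ z : Phase, f (z.1 + θ • z.2, z.2) = ∫⁻ z, f z := by
  rw [volume_eq_prod, lintegral_prod_symm' _ (by fun_prop), lintegral_prod_symm' _ hf]; congr 1; ext v
  exact lintegral_add_right_eq_self (fun x => f (x, v)) (θ • v)

lemma measurePreserving_shear (θ : ℝ) : MeasurePreserving (fun z : Phase => (z.1 + θ • z.2, z.2)) volume volume := by
  refine ⟨by fun_prop, Measure.ext fun s hs => ?_⟩; rw [Measure.map_apply (by fun_prop) hs]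
  have := lintegral_shear θ (f := s.indicator 1) (measurable_one.indicator hs)
  rw [lintegral_indicator_one hs] at this
  rw [← this, ← lintegral_indicator_one ((by fun_prop : Measurable fun z : Phase => (z.1 + θ • z.2, z.2)) hs)]
  rfl

lemma lintegral_comp_shear_mul_inv_wt (θ : ℝ) {h : E3 → ℝ≥0∞} (hh : Measurable h) :
    ∫⁻ z : Phase, h (z.1 + θ • z.2) * (wt z)⁻¹ = (∫⁻ x, h x) * wtInt := by
  refine (lintegral_shear θ (f := fun z => h z.1 * (wt z)⁻¹) (by fun_prop)).trans ?_; rw [volume_eq_prod]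
  exact lintegral_prod_mul (f := h) (g := fun v : E3 => (ofReal ((1 + ‖v‖ ^ 2) ^ 2))⁻¹) hh.aemeasurable (by fun_prop)

lemma lintegral_mul_comp_shear_le (u : X) (θ : ℝ) {h : E3 → ℝ≥0∞} (hh : Measurable h) :
    ∫⁻ z, ‖u z‖ₑ * h (z.1 + θ • z.2) ≤ ‖u‖ₑ * ((∫⁻ x, h x ^ 2) * wtInt) ^ (1 / 2 : ℝ) := by
  refine (lintegral_enorm_mul_le' u (by fun_prop)).trans_eq ?_
  rw [lintegral_comp_shear_mul_inv_wt θ (h := fun x => h x ^ 2) (by fun_prop)]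

lemma dualNorm_comp_shear (θ : ℝ) {h : E3 → ℝ} (hh : Measurable h) :
    dualNorm (fun z => h (z.1 + θ • z.2)) = ((∫⁻ x, ‖h x‖ₑ ^ 2) * wtInt) ^ (1 / 2 : ℝ) := by
  rw [dualNorm, lintegral_comp_shear_mul_inv_wt θ (h := fun x => ‖h x‖ₑ ^ 2) (by fun_prop)]

/-- Velocity averages along `x ↦ x - θ v` are square integrable. -/
lemma lintegral_average_sq (u : X) (θ : ℝ) : ∫⁻ x : E3, (∫⁻ v : E3, ‖u (x - θ • v, v)‖ₑ) ^ 2 ≤ wtInt * ‖u‖ₑ ^ 2 := by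
  have key : ∀ x : E3, (∫⁻ v : E3, ‖u (x - θ • v, v)‖ₑ) ^ 2 ≤
      wtInt * ∫⁻ v : E3, wt (x - θ • v, v) * ‖u (x - θ • v, v)‖ₑ ^ 2 := by
    intro x
    have h := lintegral_mul_sq_le (μ := volume) (k := fun v : E3 => (wt (x - θ • v, v))⁻¹)
      (f := fun v => wt (x - θ • v, v) * ‖u (x - θ • v, v)‖ₑ) (by fun_prop) (by fun_prop)
    have e : ∀ z (a : ℝ≥0∞), (wt z)⁻¹ * (wt z * a) = a := fun z a => by
      rw [← mul_assoc, ENNReal.inv_mul_cancel (wt_ne_zero z) (wt_ne_top z), one_mul]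
    simp only [mul_pow, sq (wt _), mul_assoc, e] at h; exact h
  have hm : Measurable fun x : E3 => ∫⁻ v : E3, wt (x - θ • v, v) * ‖u (x - θ • v, v)‖ₑ ^ 2 :=
    lintegral_prod_right' (f := fun p : E3 × E3 => wt (p.1 - θ • p.2, p.2) * ‖u (p.1 - θ • p.2, p.2)‖ₑ ^ 2)
      (by fun_prop)
  calc _ ≤ ∫⁻ x : E3, wtInt * ∫⁻ v : E3, wt (x - θ • v, v) * ‖u (x - θ • v, v)‖ₑ ^ 2 := lintegral_mono key
    _ = wtInt * ∫⁻ x : E3, ∫⁻ v : E3, wt (x - θ • v, v) * ‖u (x - θ • v, v)‖ₑ ^ 2 := lintegral_const_mul _ hm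
    _ = _ := by
      congr 1; rw [enorm_sq_eq, ← lintegral_shear (-θ) (by fun_prop), volume_eq_prod, lintegral_prod _ (by fun_prop)]
      simp only [neg_smul, ← sub_eq_add_neg]

lemma ae_integrable_slice (u : X) (θ : ℝ) : ∀ᵐ x : E3, Integrable fun v : E3 => u (x - θ • v, v) := by
  have h := ae_lt_top' (f := fun x : E3 => (∫⁻ v : E3, ‖u (x - θ • v, v)‖ₑ) ^ 2)
    (Measurable.aemeasurable (Measurable.pow_const (lintegral_prod_right'
      (f := fun p : E3 × E3 => ‖u (p.1 - θ • p.2, p.2)‖ₑ) (by fun_prop)) 2))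
    (lt_of_le_of_lt (lintegral_average_sq u θ) (mul_lt_top wtInt_lt_top (ENNReal.pow_lt_top enorm_lt_top))).ne
  filter_upwards [h] with x hx
  exact ⟨Measurable.aestronglyMeasurable (by fun_prop), by rw [HasFiniteIntegral]; simpa using hx⟩

lemma ae_integrable_section (u : X) : ∀ᵐ x : E3, Integrable fun v : E3 => u (x, v) := by
  simpa using ae_integrable_slice u 0

lemma measurable_density (u : X) : Measurable (density u) := (integral_prod_right' (f := fun z : E3 × E3 => u z)
    (measurable_coe u).stronglyMeasurable).measurable

lemma measurable_n0th (β : ℝ) (u : X) (t : ℝ) : Measurable (n0th β u t) :=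
  (integral_prod_right' (f := fun p : E3 × E3 => u (p.1 - vth β t • p.2, p.2))
    (Measurable.stronglyMeasurable (by fun_prop))).measurable

lemma lintegral_n0th_sq_le (β : ℝ) (u : X) (t : ℝ) : ∫⁻ x, ‖n0th β u t x‖ₑ ^ 2 ≤ wtInt * ‖u‖ₑ ^ 2 :=
  (lintegral_mono fun _ => pow_le_pow_left' (enorm_integral_le_lintegral_enorm _) 2).trans (lintegral_average_sq u _)

lemma lintegral_density_sq_le (u : X) : ∫⁻ x, ‖density u x‖ₑ ^ 2 ≤ wtInt * ‖u‖ₑ ^ 2 := by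
  refine (lintegral_mono fun _ => pow_le_pow_left' (enorm_integral_le_lintegral_enorm _) 2).trans ?_
  simpa using lintegral_average_sq u 0

lemma memLp_two_of_lintegral {E α : Type*} [NormedAddCommGroup E] [MeasurableSpace α] {μ : Measure α} {f : α → E}
    (hf : AEStronglyMeasurable f μ) (h : ∫⁻ x, ‖f x‖ₑ ^ 2 ∂μ < ∞) : MemLp f 2 μ :=
  ⟨hf, by rw [eLpNorm_two_eq]; finiteness⟩

lemma lintegral_sq_lt_top {E α : Type*} [NormedAddCommGroup E] [MeasurableSpace α] {μ : Measure α} {f : α → E}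
    (h : MemLp f 2 μ) : ∫⁻ x, ‖f x‖ₑ ^ 2 ∂μ < ∞ := by
  rw [← eLpNorm_two_sq]; exact ENNReal.pow_lt_top h.2

lemma memLp_density (u : X) : MemLp (density u) 2 :=
  memLp_two_of_lintegral (measurable_density u).aestronglyMeasurable
    (lt_of_le_of_lt (lintegral_density_sq_le u) (mul_lt_top wtInt_lt_top (ENNReal.pow_lt_top enorm_lt_top)))

lemma memLp_n0th (β : ℝ) (u : X) (t : ℝ) : MemLp (n0th β u t) 2 :=
  memLp_two_of_lintegral (measurable_n0th β u t).aestronglyMeasurable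
    (lt_of_le_of_lt (lintegral_n0th_sq_le β u t) (mul_lt_top wtInt_lt_top (ENNReal.pow_lt_top enorm_lt_top)))

lemma dualNorm_comp_shear_lt_top (θ : ℝ) {h : E3 → ℝ} (hm : Measurable h) (hh : MemLp h 2) :
    dualNorm (fun z => h (z.1 + θ • z.2)) < ∞ := by
  rw [dualNorm_comp_shear θ hm]; have := lintegral_sq_lt_top hh; have := wtInt_lt_top
  finiteness

lemma integrable_mul_comp_shear (u : X) (θ : ℝ) {h : E3 → ℝ} (hm : Measurable h) (hh : MemLp h 2) :
    Integrable fun z : Phase => u z * h (z.1 + θ • z.2) :=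
  integrable_mul u (by fun_prop) (dualNorm_comp_shear_lt_top θ hm hh)

/-- Pairing with a function of the position only. -/
lemma integral_density_mul (u : X) {h : E3 → ℝ} (hm : Measurable h) (hh : MemLp h 2) :
    ∫ z : Phase, u z * h z.1 = ∫ x, density u x * h x := by
  have := integrable_mul_comp_shear u 0 hm hh; simp only [zero_smul, add_zero] at this
  rw [volume_eq_prod] at this ⊢; rw [integral_prod _ this]
  congr 1; ext x; exact integral_mul_const (h x) (fun v : E3 => u (x, v))

end StateSpace

/-! ### `C₀` semigroups -/

section Semigroup

variable {S : ℝ → X →L[ℝ] X}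

lemma IsC0Semigroup.add_apply (hS : IsC0Semigroup S) {s t : ℝ} (hs : 0 ≤ s) (ht : 0 ≤ t) (u : X) :
    S (s + t) u = S s (S t u) := by rw [hS.add s t hs ht]; rfl

lemma IsC0Semigroup.add_apply' (hS : IsC0Semigroup S) {s t : ℝ} (hs : 0 ≤ s) (ht : 0 ≤ t) (u : X) :
    S (s + t) u = S t (S s u) := by rw [add_comm, hS.add_apply ht hs]

lemma IsC0Semigroup.exists_bound_near (hS : IsC0Semigroup S) :
    ∃ δ > 0, ∃ M : ℝ, 1 ≤ M ∧ ∀ t ∈ Icc 0 δ, ‖S t‖ ≤ M := by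
  by_contra! H
  have h1 : ∀ n : ℕ, ∃ t ∈ Icc (0 : ℝ) (1 / (n + 1)), (n + 1 : ℝ) < ‖S t‖ := fun n => by
    obtain ⟨t, ht, h⟩ := H (1 / (n + 1)) (by positivity) (n + 1) (by simp); exact ⟨t, ht, h⟩
  choose t ht hbig using h1
  have htend : Tendsto t atTop (𝓝[≥] 0) := by
    rw [tendsto_nhdsWithin_iff]
    exact ⟨squeeze_zero (fun n => (ht n).1) (fun n => (ht n).2) tendsto_one_div_add_atTop_nhds_zero_nat,
      of_forall fun n => (ht n).1⟩
  have hcont : ∀ u : X, Tendsto (fun t => S t u) (𝓝[≥] 0) (𝓝 u) := fun u => by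
    have h0 : (Ici (0 : ℝ)) = insert 0 (Ioi 0) := by ext x; simp [le_iff_eq_or_lt, eq_comm]
    rw [h0, nhdsWithin_insert, tendsto_sup]; refine ⟨?_, hS.continuous u⟩; rw [tendsto_pure_left]; intro s hs
    rw [hS.zero]; exact mem_of_mem_nhds hs
  obtain ⟨C, hC⟩ := banach_steinhaus (g := fun n => S (t n)) (fun u => by
    obtain ⟨C, hC⟩ := (((hcont u).comp htend).norm).bddAbove_range; exact ⟨C, fun n => hC ⟨n, rfl⟩⟩)
  obtain ⟨n, hn⟩ := exists_nat_gt C; have := hC n; have := hbig n; linarith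

lemma IsC0Semigroup.exists_bound (hS : IsC0Semigroup S) (T : ℝ) : ∃ M : ℝ, 0 ≤ M ∧ ∀ t ∈ Icc 0 T, ‖S t‖ ≤ M := by
  obtain ⟨δ, hδ, M, hM, h⟩ := hS.exists_bound_near
  have key : ∀ n : ℕ, ∀ t ∈ Icc 0 ((n + 1) * δ), ‖S t‖ ≤ M ^ (n + 1) := by
    intro n
    induction n with
    | zero => intro t ht; simpa using h t (by simpa using ht)
    | succ k ih =>
      intro t ht
      by_cases hk : t ≤ (k + 1) * δ
      · exact (ih t ⟨ht.1, hk⟩).trans (pow_le_pow_right₀ hM (by omega))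
      · push Not at hk
        have h1 : 0 ≤ t - δ := by
          have : 0 ≤ (k : ℝ) * δ := by positivity
          linarith
        have e : S t = (S (t - δ)).comp (S δ) := by rw [← hS.add _ _ h1 hδ.le]; congr 1; ring
        rw [e, pow_succ]; refine (ContinuousLinearMap.opNorm_comp_le _ _).trans ?_
        have h2 := ih (t - δ) ⟨h1, by have := ht.2; push_cast at this; linarith⟩
        exact mul_le_mul h2 (h δ ⟨hδ.le, le_rfl⟩) (norm_nonneg _) (by positivity)
  obtain ⟨n, hn⟩ := exists_nat_gt (T / δ)
  refine ⟨M ^ (n + 1), by positivity, fun t ht => key n t ⟨ht.1, ht.2.trans ?_⟩⟩; rw [div_lt_iff₀ hδ] at hn; linarith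

lemma IsC0Semigroup.tendsto_right (hS : IsC0Semigroup S) (u : X) : Tendsto (fun t => S t u) (𝓝[≥] 0) (𝓝 u) := by
  have h0 : (Ici (0 : ℝ)) = insert 0 (Ioi 0) := by ext x; simp [le_iff_eq_or_lt, eq_comm]
  rw [h0, nhdsWithin_insert, tendsto_sup]; refine ⟨?_, hS.continuous u⟩; rw [tendsto_pure_left]; intro s hs
  rw [hS.zero]; exact mem_of_mem_nhds hs

lemma IsC0Semigroup.continuousOn (hS : IsC0Semigroup S) (u : X) : ContinuousOn (fun t => S t u) (Ici 0) := by
  intro t₀ ht₀; have ht₀ : 0 ≤ t₀ := ht₀; obtain ⟨M, hM, hb⟩ := hS.exists_bound (t₀ + 1)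
  have h1 : Tendsto (fun t : ℝ => |t - t₀|) (𝓝[Ici 0] t₀) (𝓝[≥] 0) := by
    rw [tendsto_nhdsWithin_iff]; refine ⟨?_, of_forall fun t => mem_Ici.2 (abs_nonneg _)⟩
    have : Tendsto (fun t : ℝ => |t - t₀|) (𝓝 t₀) (𝓝 |t₀ - t₀|) := Continuous.tendsto (by fun_prop) _
    simpa using this.mono_left nhdsWithin_le_nhds
  have h2 := ((hS.tendsto_right u).comp h1).sub_const u |>.norm.const_mul M
  simp only [sub_self, norm_zero, mul_zero, Function.comp_apply] at h2
  rw [ContinuousWithinAt, tendsto_iff_norm_sub_tendsto_zero]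
  refine squeeze_zero' (of_forall fun _ => norm_nonneg _) ?_ h2
  have hev : ∀ᶠ t in 𝓝[Ici 0] t₀, t < t₀ + 1 := nhdsWithin_le_nhds (gt_mem_nhds (by linarith))
  filter_upwards [hev, self_mem_nhdsWithin] with t ht1 ht0
  have ht0 : 0 ≤ t := ht0
  rcases le_total t₀ t with h | h
  · have e : S t u - S t₀ u = S t₀ (S |t - t₀| u - u) := by
      rw [map_sub, ← hS.add_apply ht₀ (abs_nonneg _), abs_of_nonneg (by linarith)]; congr 3; ring
    rw [e]; exact (le_opNorm _ _).trans (mul_le_mul_of_nonneg_right (hb _ ⟨ht₀, by linarith⟩) (norm_nonneg _))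
  · have e : S t u - S t₀ u = - S t (S |t - t₀| u - u) := by
      rw [map_sub, ← hS.add_apply ht0 (abs_nonneg _), abs_of_nonpos (by linarith), neg_sub]; congr 3; ring
    rw [e, norm_neg]
    exact (le_opNorm _ _).trans (mul_le_mul_of_nonneg_right (hb _ ⟨ht0, by linarith⟩) (norm_nonneg _))

lemma IsC0Semigroup.continuous_max (hS : IsC0Semigroup S) : Continuous fun p : ℝ × X => S (max p.1 0) p.2 := by
  rw [continuous_iff_continuousAt]; rintro ⟨t₀, u₀⟩; obtain ⟨M, hM, hb⟩ := hS.exists_bound (max t₀ 0 + 1)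
  have hc : Continuous fun t : ℝ => S (max t 0) u₀ :=
    (hS.continuousOn u₀).comp_continuous (by fun_prop) fun t => le_max_right t 0
  have h1 : Tendsto (fun p : ℝ × X => M * ‖p.2 - u₀‖ + ‖S (max p.1 0) u₀ - S (max t₀ 0) u₀‖) (𝓝 (t₀, u₀)) (𝓝 0) := by
    have hcc : Continuous fun p : ℝ × X => M * ‖p.2 - u₀‖ + ‖S (max p.1 0) u₀ - S (max t₀ 0) u₀‖ :=
      ((continuous_snd.sub continuous_const).norm.const_mul M).add (((hc.comp continuous_fst).sub continuous_const).norm)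
    simpa using hcc.tendsto (t₀, u₀)
  rw [ContinuousAt, tendsto_iff_norm_sub_tendsto_zero]; refine squeeze_zero' (of_forall fun _ => norm_nonneg _) ?_ h1
  have hev : ∀ᶠ p : ℝ × X in 𝓝 (t₀, u₀), max p.1 0 < max t₀ 0 + 1 :=
    (Continuous.tendsto (by fun_prop : Continuous fun p : ℝ × X => max p.1 0) (t₀, u₀)).eventually_lt_const (by simp)
  filter_upwards [hev] with p hp
  have e : S (max p.1 0) p.2 - S (max t₀ 0) u₀ = S (max p.1 0) (p.2 - u₀) + (S (max p.1 0) u₀ - S (max t₀ 0) u₀) := by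
    rw [map_sub]; abel
  rw [e]; refine (norm_add_le _ _).trans (add_le_add ?_ le_rfl)
  exact (le_opNorm _ _).trans (mul_le_mul_of_nonneg_right (hb _ ⟨le_max_right _ _, hp.le⟩) (norm_nonneg _))

lemma IsC0Semigroup.generator_mem (hS : IsC0Semigroup S) {u g : X} (h : (u, g) ∈ generatorGraph S) {r : ℝ}
    (hr : 0 ≤ r) : (S r u, S r g) ∈ generatorGraph S := by
  have h1 := ((S r).continuous.tendsto g).comp h; refine h1.congr' ?_
  filter_upwards [self_mem_nhdsWithin] with k hk
  have hk : 0 < k := hk; simp only [Function.comp_apply, map_smul, map_sub]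
  rw [← hS.add_apply hr hk.le, hS.add_apply' hr hk.le]

lemma IsC0Semigroup.tendsto_slope (hS : IsC0Semigroup S) {u g : X} (h : (u, g) ∈ generatorGraph S) {r : ℝ}
    (hr : 0 ≤ r) : Tendsto (fun k : ℝ => k⁻¹ • (S (r + k) u - S r u)) (𝓝[>] 0) (𝓝 (S r g)) := by
  have h1 := ((S r).continuous.tendsto g).comp h; refine h1.congr' ?_
  filter_upwards [self_mem_nhdsWithin] with k hk
  have hk : 0 < k := hk; simp only [Function.comp_apply, map_smul, map_sub]; rw [← hS.add_apply hr hk.le]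

lemma IsC0Semigroup.dense_generator (hS : IsC0Semigroup S) : Dense {u : X | ∃ g, (u, g) ∈ generatorGraph S} := by
  intro u; set F : ℝ → X := fun r => S (max r 0) u with hF
  have hFc : Continuous F := hS.continuous_max.comp (by fun_prop : Continuous fun r : ℝ => (r, u))
  have hF0 : F 0 = u := by simp [hF, hS.zero]
  have hFi : ∀ a b, IntervalIntegrable F volume a b := fun a b => hFc.intervalIntegrable a b
  have hder : ∀ a, HasDerivAt (fun h => ∫ r in a..h, F r) (F a) a := fun a =>
    intervalIntegral.integral_hasDerivAt_right (hFi a a) hFc.aestronglyMeasurable.stronglyMeasurableAtFilter hFc.continuousAt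
  have hslope : ∀ a, Tendsto (fun k : ℝ => k⁻¹ • ∫ r in a..(a + k), F r) (𝓝[>] 0) (𝓝 (F a)) := fun a => by
    have := (hder a).tendsto_slope_zero_right; simpa using this
  refine mem_closure_of_tendsto (by simpa [hF0] using hslope 0) ?_
  filter_upwards [self_mem_nhdsWithin] with h hh
  have hh : 0 < h := hh; refine ⟨h⁻¹ • (F h - F 0), ?_⟩
  simp only [generatorGraph, mem_ofPred_eq]; have h1 := ((hslope h).sub (hslope 0)).const_smul h⁻¹
  refine h1.congr' ?_
  filter_upwards [self_mem_nhdsWithin] with k hk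
  have hk : 0 < k := hk
  have e1 : S k (∫ r in (0 : ℝ)..h, F r) = ∫ r in k..(h + k), F r := by
    rw [← ContinuousLinearMap.intervalIntegral_comp_comm _ (hFi 0 h)]
    have := intervalIntegral.integral_comp_add_right (f := F) (a := 0) (b := h) k; rw [zero_add] at this
    rw [← this]; refine intervalIntegral.integral_congr fun r hr => ?_; rw [uIcc_of_le hh.le] at hr; simp only [hF]
    rw [max_eq_left hr.1, max_eq_left (by linarith [hr.1]), hS.add_apply' hr.1 hk.le]
  rw [map_smul, e1, zero_add, ← smul_sub, smul_comm, ← smul_sub]; congr 2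
  have i1 := intervalIntegral.integral_add_adjacent_intervals (hFi 0 k) (hFi k (h + k))
  have i2 := intervalIntegral.integral_add_adjacent_intervals (hFi 0 h) (hFi h (h + k))
  rw [sub_eq_sub_iff_add_eq_add, add_comm (∫ r in h..(h + k), F r), i2, add_comm (∫ r in k..(h + k), F r), i1]

end Semigroup

/-! ### Test functions and the adjoint operator -/

section Test

/-- Smoothness of a function on phase space. -/
abbrev Smooth (φ : Phase → ℝ) : Prop := ContDiff ℝ (⊤ : ℕ∞) φ

lemma IsTest.mul' {φ ψ : Phase → ℝ} (hφ : IsTest φ) (hψ : Smooth ψ) :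
    IsTest (fun z => φ z * ψ z) := ⟨hφ.1.mul hψ, hφ.2.mul_right⟩

lemma IsTest.coord {φ : Phase → ℝ} (hφ : IsTest φ) (i : Fin 3) : IsTest (fun z => z.2 i * φ z) :=
  ⟨ContDiff.mul (by fun_prop) hφ.1, hφ.2.mul_left⟩

lemma IsTest.sum {φ : Fin 3 → Phase → ℝ} (h : ∀ i, IsTest (φ i)) : IsTest (fun z => ∑ i, φ i z) := by
  simp only [Fin.sum_univ_three]; exact ⟨((h 0).1.add (h 1).1).add (h 2).1, ((h 0).2.add (h 1).2).add (h 2).2⟩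

lemma Smooth.fderiv {φ : Phase → ℝ} (h : Smooth φ) (e : Phase) : Smooth (fun z => fderiv ℝ φ z e) :=
  (h.fderiv_right (m := ((⊤ : ℕ∞) : WithTop ℕ∞)) (by simp)).clm_apply contDiff_const

lemma Smooth.dX {φ : Phase → ℝ} (h : Smooth φ) (i : Fin 3) : Smooth (dX i φ) := h.fderiv _
lemma Smooth.dV {φ : Phase → ℝ} (h : Smooth φ) (i : Fin 3) : Smooth (dV i φ) := h.fderiv _
lemma Smooth.diffAt {φ : Phase → ℝ} (h : Smooth φ) (z : Phase) : DifferentiableAt ℝ φ z :=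
  (h.differentiable (by simp)).differentiableAt

lemma IsTest.dX {φ : Phase → ℝ} (h : IsTest φ) (i : Fin 3) : IsTest (dX i φ) := ⟨Smooth.dX h.1 i, h.2.fderiv_apply (𝕜 := ℝ) _⟩
lemma IsTest.dV {φ : Phase → ℝ} (h : IsTest φ) (i : Fin 3) : IsTest (dV i φ) := ⟨Smooth.dV h.1 i, h.2.fderiv_apply (𝕜 := ℝ) _⟩

lemma IsTest.dualNorm_lt_top {φ : Phase → ℝ} (hφ : IsTest φ) : dualNorm φ < ∞ := by
  refine lt_of_le_of_lt (dualNorm_le φ) ?_; rw [← eLpNorm_two_eq]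
  exact (hφ.1.continuous.memLp_of_hasCompactSupport hφ.2).2

lemma IsTest.aemeasurable {φ : Phase → ℝ} (hφ : IsTest φ) : AEMeasurable φ := hφ.1.continuous.measurable.aemeasurable

lemma IsTest.integrable_mul {φ : Phase → ℝ} (hφ : IsTest φ) (u : X) : Integrable (fun z => u z * φ z) :=
  WPFP.integrable_mul u hφ.aemeasurable hφ.dualNorm_lt_top

/-- The formal adjoint of the Fokker–Planck operator. -/
noncomputable def Astar (α β γ σ : ℝ) (φ : Phase → ℝ) (z : Phase) : ℝ :=
  (∑ i, z.2 i * dX i φ z) - β * (∑ i, z.2 i * dV i φ z) + σ * (∑ i, dV i (dV i φ) z) +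
    2 * γ * (∑ i, dV i (dX i φ) z) + α * (∑ i, dX i (dX i φ) z)

lemma Smooth.Astar {φ : Phase → ℝ} (h : Smooth φ) (α β γ σ : ℝ) : Smooth (Astar α β γ σ φ) := by
  have h1 := h.dX; have h2 := h.dV; have h3 := fun i => (h.dV i).dV i; have h4 := fun i => (h.dX i).dV i
  have h5 := fun i => (h.dX i).dX i; unfold WPFP.Astar Smooth at *; fun_prop

lemma IsTest.Astar {φ : Phase → ℝ} (h : IsTest φ) (α β γ σ : ℝ) : IsTest (Astar α β γ σ φ) :=
  ⟨Smooth.Astar h.1 α β γ σ, ((((IsTest.sum fun i => (h.dX i).coord i).2.sub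
    ((IsTest.sum fun i => (h.dV i).coord i).2.mul_left (f := fun _ => β))).add
    ((IsTest.sum fun i => (h.dV i).dV i).2.mul_left (f := fun _ => σ))).add
    ((IsTest.sum fun i => (h.dX i).dV i).2.mul_left (f := fun _ => 2 * γ))).add
    ((IsTest.sum fun i => (h.dX i).dX i).2.mul_left (f := fun _ => α))⟩

lemma dV_coord_mul {φ : Phase → ℝ} (h : Smooth φ) (i : Fin 3) (z : Phase) :
    dV i (fun y => y.2 i * φ y) z = φ z + z.2 i * dV i φ z := by
  have h3 : HasFDerivAt (fun y : Phase => y.2 i * φ y) _ z :=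
    ((proj (𝕜 := ℝ) i).comp (ContinuousLinearMap.snd ℝ E3 E3)).hasFDerivAt.mul (h.diffAt z).hasFDerivAt
  rw [dV, h3.fderiv]; simp [dV]; ring

lemma weak_of_mem_closure {α β γ σ : ℝ} {u g : X} (h : (u, g) ∈ closure (graphA α β γ σ)) {φ : Phase → ℝ}
    (hφ : IsTest φ) : ∫ z, g z * φ z = ∫ z, u z * Astar α β γ σ φ z := by
  have hA := hφ.Astar α β γ σ; obtain ⟨L, hL, -⟩ := exists_clm hφ.aemeasurable hφ.dualNorm_lt_top
  obtain ⟨LA, hLA, -⟩ := exists_clm hA.aemeasurable hA.dualNorm_lt_top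
  suffices H : closure (graphA α β γ σ) ⊆ {p : X × X | L p.2 = LA p.1} by
    have := H h
    rwa [mem_ofPred_eq, hL, hLA] at this
  refine closure_minimal ?_ (isClosed_eq (by fun_prop) (by fun_prop))
  rintro ⟨u, g⟩ ⟨g₁, g₂, g₃, g₄, g₅, h1, h2, h3, h4, h5, hg⟩; simp only at h1 h2 h3 h4 h5 hg
  have i1 := (IsTest.sum fun i => (hφ.dX i).coord i).integrable_mul u
  have t2 := (IsTest.sum fun i => (hφ.dV i).coord i).integrable_mul u; have i2 := t2.const_mul β
  have i3 := ((IsTest.sum fun i => (hφ.dV i).dV i).integrable_mul u).const_mul σ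
  have i4 := ((IsTest.sum fun i => (hφ.dX i).dV i).integrable_mul u).const_mul (2 * γ)
  have i5 := ((IsTest.sum fun i => (hφ.dX i).dX i).integrable_mul u).const_mul α
  have e : LA u = (∫ z, u z * ∑ i, z.2 i * dX i φ z) - β * (∫ z, u z * ∑ i, z.2 i * dV i φ z) +
      σ * (∫ z, u z * ∑ i, dV i (dV i φ) z) + 2 * γ * (∫ z, u z * ∑ i, dV i (dX i φ) z) +
      α * ∫ z, u z * ∑ i, dX i (dX i φ) z := by
    simp only [← integral_const_mul]
    rw [hLA, ← integral_sub i1 i2, ← integral_add (by exact i1.sub i2) i3, ← integral_add (by exact (i1.sub i2).add i3) i4,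
      ← integral_add (by exact ((i1.sub i2).add i3).add i4) i5]
    congr 1; ext z; simp only [WPFP.Astar]; ring
  have e1 : L g₁ = - ∫ z, u z * ∑ i, z.2 i * dX i φ z := by rw [hL, h1 φ hφ, ← integral_neg]; congr 1; ext z; ring
  have e2 : L g₂ = - (3 * L u + ∫ z, u z * ∑ i, z.2 i * dV i φ z) := by
    rw [hL, h2 φ hφ, hL, ← integral_const_mul, ← integral_add ((hφ.integrable_mul u).const_mul 3) t2, ← integral_neg]
    congr 1; ext z; simp only [dV_coord_mul hφ.1, Fin.sum_univ_three]; ring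
  simp only [mem_ofPred_eq, hg, map_add, map_neg, map_smul, smul_eq_mul, e, e1, e2, hL g₃, hL g₄, hL g₅,
    h3 φ hφ, h4 φ hφ, h5 φ hφ]
  ring

lemma fderiv_mul_apply {φ ψ : Phase → ℝ} (hφ : Smooth φ) (hψ : Smooth ψ) (z e : Phase) :
    fderiv ℝ (fun z => φ z * ψ z) z e = fderiv ℝ φ z e * ψ z + φ z * fderiv ℝ ψ z e := by
  rw [fderiv_fun_mul (hφ.diffAt z) (hψ.diffAt z)]
  simp; ring

lemma fderiv_fderiv_mul_apply {φ ψ : Phase → ℝ} (hφ : Smooth φ) (hψ : Smooth ψ) (z e e' : Phase) :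
    fderiv ℝ (fun z => fderiv ℝ φ z e * ψ z + φ z * fderiv ℝ ψ z e) z e' =
      fderiv ℝ (fun z => fderiv ℝ φ z e) z e' * ψ z + fderiv ℝ φ z e * fderiv ℝ ψ z e' +
      fderiv ℝ φ z e' * fderiv ℝ ψ z e + φ z * fderiv ℝ (fun z => fderiv ℝ ψ z e) z e' := by
  rw [fderiv_fun_add (Smooth.diffAt ((hφ.fderiv e).mul hψ) z) (Smooth.diffAt (hφ.mul (hψ.fderiv e)) z),
    ContinuousLinearMap.add_apply, fderiv_mul_apply (hφ.fderiv e) hψ, fderiv_mul_apply hφ (hψ.fderiv e)]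
  ring

/-- The commutator of `Astar` with a multiplication operator. -/
noncomputable def comm (α β γ σ : ℝ) (η φ : Phase → ℝ) (z : Phase) : ℝ :=
  Astar α β γ σ η z * φ z + 2 * σ * (∑ i, dV i η z * dV i φ z) +
    2 * γ * (∑ i, (dX i η z * dV i φ z + dV i η z * dX i φ z)) + 2 * α * (∑ i, dX i η z * dX i φ z)

lemma Astar_mul {α β γ σ : ℝ} {η φ : Phase → ℝ} (hη : Smooth η) (hφ : Smooth φ) (z : Phase) :
    Astar α β γ σ (fun z => η z * φ z) z = η z * Astar α β γ σ φ z + comm α β γ σ η φ z := by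
  simp only [Astar, comm, show dX = fun i φ z => fderiv ℝ φ z (EuclideanSpace.single i 1, 0) from rfl,
    show dV = fun i φ z => fderiv ℝ φ z (0, EuclideanSpace.single i 1) from rfl,
    fderiv_fderiv_mul_apply hη hφ, fderiv_mul_apply hη hφ, Fin.sum_univ_three]
  ring

/-! ### Cutoff functions -/

/-- The anisotropic dilation `(x, v) ↦ (x / k², v / k)`. -/
noncomputable def dil (k : ℝ) : Phase →L[ℝ] Phase :=
  ContinuousLinearMap.prodMap ((k ^ 2)⁻¹ • ContinuousLinearMap.id ℝ E3) (k⁻¹ • ContinuousLinearMap.id ℝ E3)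

lemma dil_apply (k : ℝ) (z : Phase) : dil k z = ((k ^ 2)⁻¹ • z.1, k⁻¹ • z.2) := rfl

lemma fderiv_comp_dil {η : Phase → ℝ} (h : Smooth η) (k : ℝ) (z e : Phase) :
    fderiv ℝ (fun z => η (dil k z)) z e = fderiv ℝ η (dil k z) (dil k e) := by
  have h2 : HasFDerivAt (fun z => η (dil k z)) _ z := (h.diffAt _).hasFDerivAt.comp z (dil k).hasFDerivAt
  rw [h2.fderiv]; rfl

lemma dX_comp_dil {η : Phase → ℝ} (h : Smooth η) (k : ℝ) (i : Fin 3) :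
    dX i (fun z => η (dil k z)) = fun z => (k ^ 2)⁻¹ * dX i η (dil k z) := by
  funext z
  rw [dX, fderiv_comp_dil h, dX, ← smul_eq_mul, ← map_smul]; simp [dil_apply]

lemma dV_comp_dil {η : Phase → ℝ} (h : Smooth η) (k : ℝ) (i : Fin 3) :
    dV i (fun z => η (dil k z)) = fun z => k⁻¹ * dV i η (dil k z) := by
  funext z
  rw [dV, fderiv_comp_dil h, dV, ← smul_eq_mul, ← map_smul]; simp [dil_apply]

lemma dX_const_mul (c : ℝ) {φ : Phase → ℝ} (h : Smooth φ) (i : Fin 3) :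
    dX i (fun z => c * φ z) = fun z => c * dX i φ z := by
  funext z
  rw [dX, fderiv_const_mul (h.diffAt z)]; rfl

lemma dV_const_mul (c : ℝ) {φ : Phase → ℝ} (h : Smooth φ) (i : Fin 3) :
    dV i (fun z => c * φ z) = fun z => c * dV i φ z := by
  funext z
  rw [dV, fderiv_const_mul (h.diffAt z)]; rfl

/-- The size of the commutators with the `k`-th cutoff. -/
noncomputable def cutSize (k : ℝ) (v : E3) : ℝ := k⁻¹ + min 1 (‖v‖ / k)

lemma cutSize_nonneg {k : ℝ} (hk : 0 < k) (v : E3) : 0 ≤ cutSize k v := by unfold cutSize; positivity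

lemma cutSize_le {k : ℝ} (hk : 1 ≤ k) (v : E3) : cutSize k v ≤ 2 := by
  unfold cutSize; have := inv_le_one_of_one_le₀ hk; have := min_le_left 1 (‖v‖ / k); linarith

lemma exists_cutoff (α β γ σ : ℝ) (hα : 0 ≤ α) (hβ : 0 ≤ β) (hγ : 0 ≤ γ) (hσ : 0 ≤ σ) :
    ∃ (η : Phase → ℝ) (C : ℝ), 0 ≤ C ∧ IsTest η ∧ (∀ z, ‖z‖ ≤ 1 → η z = 1) ∧ (∀ z, 0 ≤ η z ∧ η z ≤ 1) ∧
      ∀ (k : ℝ), 1 ≤ k → ∀ (φ : Phase → ℝ) (z : Phase) (a : ℝ), |φ z| ≤ a → (∀ i, |dX i φ z| ≤ a) →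
        (∀ i, |dV i φ z| ≤ a) → |comm α β γ σ (fun z => η (dil k z)) φ z| ≤ C * (a * cutSize k z.2) := by
  let f : ContDiffBump (0 : Phase) := ⟨1, 2, one_pos, by norm_num⟩
  set η : Phase → ℝ := fun z => f z; have hs : Smooth η := f.contDiff; have ht : IsTest η := ⟨hs, f.hasCompactSupport⟩
  have key : ∀ F : Fin 3 → Phase → ℝ, (∀ i, IsTest (F i)) → ∀ᶠ B in atTop, ∀ i w, |F i w| ≤ B := fun F hF =>
    eventually_all.2 fun i => by
      obtain ⟨b, hb⟩ := (hF i).2.exists_bound_of_continuous (hF i).1.continuous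
      exact (eventually_ge_atTop b).mono fun B hB w => (hb w).trans hB
  obtain ⟨B, hB0, b1, b2, b3, b4, b5, b6, b7⟩ := ((eventually_ge_atTop 0).and ((key _ ht.dX).and ((key _ ht.dV).and
    ((key _ fun i => (ht.dV i).dV i).and ((key _ fun i => (ht.dX i).dV i).and ((key _ fun i => (ht.dX i).dX i).and
    ((key _ fun i => (ht.dX i).coord i).and (key _ fun i => (ht.dV i).coord i)))))))).exists
  have sB : ∀ (c : ℝ) (F : Fin 3 → ℝ), (∀ i, |F i| ≤ c) → |∑ i, F i| ≤ 3 * c := fun c F hF =>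
    (abs_sum_le_sum_abs _ _).trans ((sum_le_sum fun i _ => hF i).trans_eq (by simp))
  refine ⟨η, B * (3 + 3 * β + 9 * σ + 18 * γ + 9 * α), by positivity, ht,
    fun z hz => f.one_of_mem_closedBall (by simpa using hz), fun z => ⟨f.nonneg, f.le_one⟩, ?_⟩
  intro k hk φ z a ha haX haV
  have hk0 : 0 < k := by linarith
  have hk1 : k⁻¹ ≤ 1 := inv_le_one_of_one_le₀ hk; have hki : 0 < k⁻¹ := inv_pos.2 hk0
  have hk2 : (k ^ 2)⁻¹ ≤ k⁻¹ := by rw [← inv_pow]; nlinarith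
  have hk2' : 0 < (k ^ 2)⁻¹ := by positivity
  set w := dil k z with hw
  have hw2 : ‖w.2‖ = ‖z.2‖ / k := by rw [hw, dil_apply]; simp only [norm_smul, norm_inv, norm_of_nonneg hk0.le]; ring
  have hz2 : ∀ i, z.2 i = k * w.2 i := fun i => by rw [hw, dil_apply]; simp; field_simp
  set m := cutSize k z.2 with hm; have hm1 : k⁻¹ ≤ m := le_add_of_nonneg_right (by positivity)
  have hm2 : min 1 ‖w.2‖ ≤ m := by rw [hm, cutSize, hw2]; linarith
  have x1 : (∑ i, z.2 i * dX i (fun z => η (dil k z)) z) = k⁻¹ * ∑ i, w.2 i * dX i η w := by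
    simp only [dX_comp_dil hs, mul_sum, hz2]; refine sum_congr rfl fun i _ => ?_
    field_simp; rfl
  have x2 : (∑ i, z.2 i * dV i (fun z => η (dil k z)) z) = ∑ i, w.2 i * dV i η w := by
    simp only [dV_comp_dil hs, hz2]; refine sum_congr rfl fun i _ => ?_
    field_simp; rfl
  have c1 : ∀ i, Smooth (fun z => dV i η (dil k z)) := fun i => (hs.dV i).comp (dil k).contDiff
  have c2 : ∀ i, Smooth (fun z => dX i η (dil k z)) := fun i => (hs.dX i).comp (dil k).contDiff
  have x3 : (∑ i, dV i (dV i (fun z => η (dil k z))) z) = k⁻¹ * k⁻¹ * ∑ i, dV i (dV i η) w := by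
    simp only [dV_comp_dil hs, mul_sum, dV_const_mul _ (c1 _), dV_comp_dil (hs.dV _), mul_assoc, hw]
  have x4 : (∑ i, dV i (dX i (fun z => η (dil k z))) z) = (k ^ 2)⁻¹ * k⁻¹ * ∑ i, dV i (dX i η) w := by
    simp only [dX_comp_dil hs, mul_sum, dV_const_mul _ (c2 _), dV_comp_dil (hs.dX _), mul_assoc, hw]
  have x5 : (∑ i, dX i (dX i (fun z => η (dil k z))) z) = (k ^ 2)⁻¹ * (k ^ 2)⁻¹ * ∑ i, dX i (dX i η) w := by
    simp only [dX_comp_dil hs, mul_sum, dX_const_mul _ (c2 _), dX_comp_dil (hs.dX _), mul_assoc, hw]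
  have cm : ∀ c p b : ℝ, 0 ≤ c → |p| ≤ b → |c * p| ≤ c * b := fun c p b hc h => by
    rw [abs_mul, abs_of_nonneg hc]; gcongr
  have ab : ∀ c S b : ℝ, 0 ≤ c → c ≤ k⁻¹ → |S| ≤ b → |c * S| ≤ b * m := fun c S b h1 h2 h3 =>
    (cm c S b h1 h3).trans (by
      rw [mul_comm]; exact mul_le_mul_of_nonneg_left (h2.trans hm1) ((abs_nonneg _).trans h3))
  have y1 := abs_le.1 (ab _ _ _ hki.le le_rfl (sB _ _ (b6 · w)))
  have y2 : |∑ i, w.2 i * dV i η w| ≤ 3 * B * m := by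
    refine le_trans ?_ (mul_le_mul_of_nonneg_left hm2 (by positivity))
    rw [mul_min_of_nonneg _ _ (by positivity), mul_one]
    refine le_min (sB _ _ (b7 · w)) ((sB (‖w.2‖ * B) _ fun i => ?_).trans_eq (by ring)); rw [abs_mul]
    exact mul_le_mul (PiLp.norm_apply_le w.2 i) (b2 i w) (abs_nonneg _) (norm_nonneg _)
  have y2' := abs_le.1 (cm β _ _ hβ y2)
  have y3 := abs_le.1 (cm σ _ _ hσ (ab (k⁻¹ * k⁻¹) _ _ (by positivity) (by nlinarith) (sB _ _ (b3 · w))))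
  have y4 := abs_le.1 (cm (2 * γ) _ _ (by positivity) (ab ((k ^ 2)⁻¹ * k⁻¹) _ _ (by positivity) (by nlinarith) (sB _ _ (b4 · w))))
  have y5 := abs_le.1 (cm α _ _ hα (ab ((k ^ 2)⁻¹ * (k ^ 2)⁻¹) _ _ (by positivity) (by nlinarith) (sB _ _ (b5 · w))))
  have hA : |Astar α β γ σ (fun z => η (dil k z)) z| ≤ 3 * B * m * (1 + β + σ + 2 * γ + α) := by
    rw [Astar, x1, x2, x3, x4, x5]; exact abs_le.2 ⟨by linarith, by linarith⟩
  have dXb : ∀ i, |dX i (fun z => η (dil k z)) z| ≤ B * m := fun i => by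
    rw [dX_comp_dil hs]; exact ab _ _ _ hk2'.le hk2 (b1 i w)
  have dVb : ∀ i, |dV i (fun z => η (dil k z)) z| ≤ B * m := fun i => by
    rw [dV_comp_dil hs]; exact ab _ _ _ hki.le le_rfl (b2 i w)
  have pr : ∀ {p q b : ℝ}, |p| ≤ b → |q| ≤ a → |p * q| ≤ b * a := fun hp hq => by
    rw [abs_mul]; exact mul_le_mul hp hq (abs_nonneg _) ((abs_nonneg _).trans hp)
  have z1 := abs_le.1 (pr hA ha)
  have z2 := abs_le.1 (cm (2 * σ) _ _ (by positivity) (sB _ _ fun i => pr (dVb i) (haV i)))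
  have z3 := abs_le.1 (cm (2 * γ) _ _ (by positivity) (sB _ _ fun i => (abs_add_le _ _).trans
    (add_le_add (pr (dXb i) (haV i)) (pr (dVb i) (haX i)))))
  have z4 := abs_le.1 (cm (2 * α) _ _ (by positivity) (sB _ _ fun i => pr (dXb i) (haX i))); rw [comm]
  exact abs_le.2 ⟨by linarith, by linarith⟩

/-- The size of the commutators in the dual norm. -/
noncomputable def cutErr (k : ℝ) : ℝ≥0∞ := ∫⁻ v : E3, ofReal (cutSize k v) ^ 2 * (ofReal ((1 + ‖v‖ ^ 2) ^ 2))⁻¹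

lemma cutSize_sq_mul_le (k : ℕ) (v : E3) (a : ℝ≥0∞) : ofReal (cutSize (k + 1) v) ^ 2 * a ≤ 4 * a := by
  refine mul_le_mul_left ?_ _
  calc _ ≤ ofReal 2 ^ 2 := by gcongr; exact cutSize_le (by simp) v
    _ = 4 := by norm_num

lemma lintegral_four_mul_lt_top : ∫⁻ v : E3, 4 * (ofReal ((1 + ‖v‖ ^ 2) ^ 2))⁻¹ < ∞ := by
  rw [lintegral_const_mul _ (by fun_prop)]; exact mul_lt_top (by simp) wtInt_lt_top

lemma cutErr_lt_top (k : ℕ) : cutErr (k + 1) < ∞ :=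
  (lintegral_mono fun v => cutSize_sq_mul_le k v _).trans_lt lintegral_four_mul_lt_top

lemma tendsto_cutErr : Tendsto (fun k : ℕ => cutErr (k + 1)) atTop (𝓝 0) := by
  have h := tendsto_lintegral_of_dominated_convergence (μ := (volume : Measure E3))
    (F := fun (k : ℕ) (v : E3) => ofReal (cutSize (k + 1) v) ^ 2 * (ofReal ((1 + ‖v‖ ^ 2) ^ 2))⁻¹)
    (f := fun _ => 0) _ (fun k => by unfold cutSize; fun_prop)
    (fun k => ae_of_all _ fun v => cutSize_sq_mul_le k v _) lintegral_four_mul_lt_top.ne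
    (ae_of_all _ fun v => by
      have h1 : Tendsto (fun k : ℕ => cutSize ((k : ℝ) + 1) v) atTop (𝓝 0) := by
        have h2 : Tendsto (fun k : ℕ => ((k : ℝ) + 1)⁻¹) atTop (𝓝 0) := by
          simpa using tendsto_one_div_add_atTop_nhds_zero_nat (𝕜 := ℝ)
        have h3 := h2.add ((tendsto_const_nhds (x := (1 : ℝ))).min (h2.const_mul ‖v‖))
        simpa [cutSize, div_eq_mul_inv] using h3
      have h4 := ((ENNReal.continuous_pow 2).tendsto _).comp ((ENNReal.continuous_ofReal.tendsto _).comp h1)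
      have h5 := ENNReal.Tendsto.mul_const (b := (ofReal ((1 + ‖v‖ ^ 2) ^ 2))⁻¹) h4
        (Or.inr (ENNReal.inv_ne_top.2 (by simp; positivity)))
      simpa using h5)
  simpa [cutErr] using h

lemma dualNorm_le_of_cutSize {k θ C : ℝ} (hC : 0 ≤ C) (hk : 0 < k) {f : Phase → ℝ} {h : E3 → ℝ} (hm : Measurable h)
    (hf : ∀ z, |f z| ≤ C * (h (z.1 + θ • z.2) * cutSize k z.2)) :
    dualNorm f ≤ ofReal C * ((∫⁻ x, ‖h x‖ₑ ^ 2) * cutErr k) ^ (1 / 2 : ℝ) := by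
  have h1 : ∫⁻ z, ‖f z‖ₑ ^ 2 * (wt z)⁻¹ ≤ ofReal C ^ 2 * ((∫⁻ x, ‖h x‖ₑ ^ 2) * cutErr k) := by
    have hc : Measurable (cutSize k) := by unfold cutSize; fun_prop
    calc _ ≤ ∫⁻ z : Phase, ofReal C ^ 2 * (‖h (z.1 + θ • z.2)‖ₑ ^ 2 * (ofReal (cutSize k z.2) ^ 2 * (wt z)⁻¹)) := by
          refine lintegral_mono fun z => ?_; rw [← mul_assoc, ← mul_assoc]
          gcongr; rw [← mul_pow, ← mul_pow]
          gcongr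
          rw [← enorm_of_nonneg hC, ← enorm_of_nonneg (cutSize_nonneg hk z.2), ← enorm_mul, ← enorm_mul,
            enorm_le_iff_norm_le, mul_assoc]
          exact (hf z).trans (le_abs_self _)
      _ = ofReal C ^ 2 * ∫⁻ z : Phase, (‖h (z.1 + θ • z.2)‖ₑ ^ 2 * (ofReal (cutSize k z.2) ^ 2 * (wt z)⁻¹)) :=
          lintegral_const_mul _ (by fun_prop)
      _ = _ := by
        congr 1
        refine (lintegral_shear θ (f := fun z => ‖h z.1‖ₑ ^ 2 * (ofReal (cutSize k z.2) ^ 2 * (wt z)⁻¹)) (by fun_prop)).trans ?_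
        rw [volume_eq_prod]
        exact lintegral_prod_mul (f := fun x => ‖h x‖ₑ ^ 2) (g := fun v : E3 => ofReal (cutSize k v) ^ 2 * (ofReal ((1 + ‖v‖ ^ 2) ^ 2))⁻¹)
          (by fun_prop) (by fun_prop)
  calc _ ≤ (ofReal C ^ 2 * ((∫⁻ x, ‖h x‖ₑ ^ 2) * cutErr k)) ^ (1 / 2 : ℝ) := by unfold dualNorm; gcongr
    _ = _ := by rw [mul_rpow_of_nonneg _ _ (by norm_num), ← rpow_natCast, ← rpow_mul]; norm_num

end Test

/-! ### Duality with solutions of the backward equation -/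

section Backward

/-- A solution of the adjoint equation on `[0,t]`, dominated along the shear `θ`. -/
structure IsBackward (α β γ σ t : ℝ) (θ : ℝ → ℝ) (h : E3 → ℝ) (φ : ℝ → Phase → ℝ) : Prop where
  smooth : ∀ s ∈ Icc 0 t, Smooth (φ s)
  deriv : ∀ s ∈ Icc 0 t, ∀ z, HasDerivAt (fun s => φ s z) (Astar α β γ σ (φ s) z) s
  locBound : ∀ ρ : ℝ, ∃ B : ℝ, ∀ s ∈ Icc 0 t, ∀ z : Phase, ‖z‖ ≤ ρ → |Astar α β γ σ (φ s) z| ≤ B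
  meas : Measurable h
  memLp : MemLp h 2
  bound : ∀ s ∈ Icc 0 t, ∀ z : Phase, |φ s z| ≤ h (z.1 + θ s • z.2)
  boundX : ∀ s ∈ Icc 0 t, ∀ z : Phase, ∀ i, |dX i (φ s) z| ≤ h (z.1 + θ s • z.2)
  boundV : ∀ s ∈ Icc 0 t, ∀ z : Phase, ∀ i, |dV i (φ s) z| ≤ h (z.1 + θ s • z.2)

variable {α β γ σ t : ℝ} {θ : ℝ → ℝ} {h : E3 → ℝ} {φ : ℝ → Phase → ℝ}

lemma dualNorm_mono {f g : Phase → ℝ} (hfg : ∀ z, |f z| ≤ |g z|) : dualNorm f ≤ dualNorm g := by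
  unfold dualNorm; gcongr with z; exact enorm_le_iff_norm_le.2 (hfg z)

lemma dualNorm_const_mul (c : ℝ) {f : Phase → ℝ} (hf : Measurable f) :
    dualNorm (fun z => c * f z) = ‖c‖ₑ * dualNorm f := by
  unfold dualNorm
  have : ∀ z, ‖c * f z‖ₑ ^ 2 * (wt z)⁻¹ = ‖c‖ₑ ^ 2 * (‖f z‖ₑ ^ 2 * (wt z)⁻¹) := fun z => by
    rw [enorm_mul, mul_pow, mul_assoc]
  simp only [this]
  rw [lintegral_const_mul _ (by fun_prop), mul_rpow_of_nonneg _ _ (by norm_num), ← rpow_natCast, ← rpow_mul]; norm_num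

lemma IsBackward.dualNorm_lt_top (H : IsBackward α β γ σ t θ h φ) {s : ℝ} (hs : s ∈ Icc 0 t) : dualNorm (φ s) < ∞ :=
  lt_of_le_of_lt (dualNorm_mono (g := fun z => h (z.1 + θ s • z.2)) fun z => (H.bound s hs z).trans (le_abs_self _))
    (dualNorm_comp_shear_lt_top _ H.meas H.memLp)

lemma IsBackward.measurable (H : IsBackward α β γ σ t θ h φ) {s : ℝ} (hs : s ∈ Icc 0 t) : Measurable (φ s) :=
  (H.smooth s hs).continuous.measurable

lemma sub_mem_Icc_zero {r t : ℝ} (h : r ∈ Icc 0 t) : t - r ∈ Icc 0 t := ⟨by linarith [h.2], by linarith [h.1]⟩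

lemma IsBackward.exists_sub_bound (H : IsBackward α β γ σ t θ h φ) {η : Phase → ℝ} (hη : IsTest η) :
    ∃ B : ℝ, ∀ s ∈ Icc 0 t, ∀ s' ∈ Icc 0 t, ∀ z, |η z * (φ s' z - φ s z)| ≤ |s' - s| * |B * η z| := by
  obtain ⟨ρ, hρ⟩ := hη.2.isCompact.isBounded.exists_norm_le; obtain ⟨B, hB⟩ := H.locBound ρ
  refine ⟨max B 0, fun s hs s' hs' z => ?_⟩
  by_cases hz : η z = 0
  · simp [hz]
  have := (convex_Icc 0 t).norm_image_sub_le_of_norm_hasDerivWithin_le (f := fun s => φ s z)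
    (fun r hr => (H.deriv r hr z).hasDerivWithinAt)
    (fun r hr => (hB r hr z (hρ z (subset_tsupport η hz))).trans (le_max_left _ 0)) hs hs'
  rw [abs_mul, abs_mul, abs_of_nonneg (le_max_right B 0)]
  exact (mul_le_mul_of_nonneg_left this (abs_nonneg _)).trans_eq (by rw [Real.norm_eq_abs]; ring)

lemma IsBackward.exists_pair_sub_le (H : IsBackward α β γ σ t θ h φ) {η : Phase → ℝ} (hη : IsTest η) :
    ∃ B : ℝ, 0 ≤ B ∧ ∀ s ∈ Icc 0 t, ∀ s' ∈ Icc 0 t, ∀ u : X,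
      ‖∫ z, u z * (η z * (φ s' z - φ s z))‖ ≤ ‖u‖ * (B * |s' - s|) := by
  obtain ⟨B, hB⟩ := H.exists_sub_bound hη
  refine ⟨(dualNorm fun z => B * η z).toReal, toReal_nonneg, fun s hs s' hs' u => ?_⟩
  have hBη : IsTest (fun z => B * η z) := ⟨contDiff_const.mul hη.1, hη.2.mul_left⟩
  have hd : dualNorm (fun z => η z * (φ s' z - φ s z)) ≤ ‖s' - s‖ₑ * dualNorm fun z => B * η z := by
    rw [← dualNorm_const_mul _ hBη.1.continuous.measurable]
    exact dualNorm_mono fun z => (hB s hs s' hs' z).trans_eq (abs_mul _ _).symm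
  have hlt := mul_lt_top (enorm_lt_top (x := s' - s)) hBη.dualNorm_lt_top
  refine (norm_pair_le u (hη.mul' ((H.smooth _ hs').sub (H.smooth _ hs))).aemeasurable (hd.trans_lt hlt)).trans
    (mul_le_mul_of_nonneg_left ((toReal_mono hlt.ne hd).trans_eq ?_) (norm_nonneg _))
  rw [ENNReal.toReal_mul, toReal_enorm, Real.norm_eq_abs, mul_comm]

lemma IsBackward.hasDerivWithinAt (H : IsBackward α β γ σ t θ h φ) {S : ℝ → X →L[ℝ] X}
    (hS : IsWFPSemigroup α β γ σ S) {u g : X} (hu : (u, g) ∈ generatorGraph S) {η : Phase → ℝ} (hη : IsTest η)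
    {r : ℝ} (hr : r ∈ Ico 0 t) :
    HasDerivWithinAt (fun r => ∫ z, S r u z * (η z * φ (t - r) z))
      (∫ z, S r u z * comm α β γ σ η (φ (t - r)) z) (Ici r) r := by
  have hr0 : 0 ≤ r := hr.1; have hst := sub_mem_Icc_zero ⟨hr0, hr.2.le⟩
  set s := t - r with hs; obtain ⟨B, hB⟩ := H.exists_sub_bound hη; obtain ⟨B', -, hB'⟩ := H.exists_pair_sub_le hη
  have hgen : (S r u, S r g) ∈ closure (graphA α β γ σ) := by rw [← hS.2]; exact hS.1.generator_mem hu hr0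
  have hts : IsTest (fun z => η z * φ s z) := hη.mul' (H.smooth s hst)
  have hval : (∫ z, S r u z * comm α β γ σ η (φ s) z) =
      (∫ z, S r g z * (η z * φ s z)) + ∫ z, S r u z * (η z * -Astar α β γ σ (φ s) z) := by
    rw [weak_of_mem_closure hgen hts, ← integral_add ((hts.Astar α β γ σ).integrable_mul _)
      ((hη.mul' ((H.smooth s hst).Astar α β γ σ).neg).integrable_mul _)]
    congr 1; ext z; rw [Astar_mul hη.1 (H.smooth s hst)]; ring
  rw [← hasDerivWithinAt_Ioi_iff_Ici, hasDerivWithinAt_iff_tendsto_slope' (by simp)]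
  have hshift : Tendsto (fun y : ℝ => y - r) (𝓝[>] r) (𝓝[>] 0) := by
    refine tendsto_nhdsWithin_iff.2 ⟨?_, ?_⟩
    · have : Tendsto (fun y : ℝ => y - r) (𝓝 r) (𝓝 (r - r)) := Continuous.tendsto (by fun_prop) _
      rw [sub_self] at this; exact this.mono_left nhdsWithin_le_nhds
    · filter_upwards [self_mem_nhdsWithin] with y hy using mem_Ioi.2 (sub_pos.2 hy)
  have hev : ∀ᶠ y in 𝓝[>] r, y ∈ Ioc r t := Ioc_mem_nhdsGT hr.2
  have hmem : ∀ {y}, y ∈ Ioc r t → t - y ∈ Icc 0 t := fun hy => sub_mem_Icc_zero ⟨hr0.trans hy.1.le, hy.2⟩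
  have hdiff : ∀ {y}, y ∈ Ioc r t → Smooth (fun z => φ (t - y) z - φ s z) := fun hy =>
    (H.smooth _ (hmem hy)).sub (H.smooth _ hst)
  obtain ⟨L, hL, -⟩ := exists_clm hts.aemeasurable hts.dualNorm_lt_top
  have l0 := (hS.1.tendsto_slope hu hr0).comp hshift
  have l1 : Tendsto (fun y => L ((y - r)⁻¹ • (S (r + (y - r)) u - S r u))) (𝓝[>] r) (𝓝 (L (S r g))) :=
    (L.continuous.tendsto _).comp l0
  have l3 : Tendsto (fun y => ∫ z, S r u z * (η z * ((y - r)⁻¹ * (φ (t - y) z - φ s z)))) (𝓝[>] r)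
      (𝓝 (∫ z, S r u z * (η z * -Astar α β γ σ (φ s) z))) := by
    refine tendsto_integral_filter_of_dominated_convergence (fun z => |S r u z * (B * η z)|) ?_ ?_ ?_ ?_
    · filter_upwards [hev] with y hy
      exact ((hη.mul' (contDiff_const.mul (hdiff hy))).integrable_mul _).1
    · filter_upwards [hev] with y hy
      refine ae_of_all _ fun z => ?_; have h1 := hB s hst (t - y) (hmem hy) z; have hpos : 0 < y - r := sub_pos.2 hy.1
      have h2 : |t - y - s| = y - r := by rw [hs, sub_sub_sub_cancel_left, abs_sub_comm, abs_of_pos hpos]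
      rw [h2] at h1; rw [Real.norm_eq_abs, abs_mul, mul_left_comm, abs_mul _ (_ * _), abs_mul (S r u z)]
      refine mul_le_mul_of_nonneg_left ?_ (abs_nonneg _)
      rw [abs_inv, abs_of_pos hpos, inv_mul_le_iff₀ hpos]; exact h1
    · have : IsTest (fun z => B * η z) := ⟨contDiff_const.mul hη.1, hη.2.mul_left⟩
      exact (this.integrable_mul (S r u)).abs
    · refine ae_of_all _ fun z => ?_; have h1 := (H.deriv s hst z).tendsto_slope_zero_left
      have h2 : Tendsto (fun y : ℝ => r - y) (𝓝[>] r) (𝓝[<] 0) := by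
        have := tendsto_neg_nhdsGT_neg (a := (0 : ℝ)); rw [neg_zero] at this
        exact (this.comp hshift).congr fun y => by simp
      refine (((h1.comp h2).neg.const_mul (η z)).const_mul (S r u z)).congr fun y => ?_
      simp only [Function.comp_apply, smul_eq_mul]
      have : s + (r - y) = t - y := by rw [hs]; ring
      rw [this, ← neg_sub y r, inv_neg]; ring
  have l2 : Tendsto (fun y => ∫ z, ((y - r)⁻¹ • (S (r + (y - r)) u - S r u)) z * (η z * (φ (t - y) z - φ s z)))
      (𝓝[>] r) (𝓝 0) := by
    have h2 : Tendsto (fun y : ℝ => B' * |t - y - s|) (𝓝 r) (𝓝 (B' * |t - r - s|)) :=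
      Continuous.tendsto (by fun_prop) _
    rw [← hs, sub_self, abs_zero, mul_zero] at h2; have hb := l0.norm.mul (h2.mono_left nhdsWithin_le_nhds)
    rw [mul_zero] at hb; exact squeeze_zero_norm' (hev.mono fun y hy => hB' s hst _ (hmem hy) _) hb
  have l4 := (l1.add l2).add l3; rw [hval, ← hL, ← add_zero (L (S r g))]; refine l4.congr' ?_
  filter_upwards [hev] with y hy
  rw [hL, slope_def_field, div_eq_inv_mul, add_sub_cancel]; set c := (y - r)⁻¹
  have hty : IsTest (fun z => η z * φ (t - y) z) := hη.mul' (H.smooth _ (hmem hy))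
  rw [← integral_add (hts.integrable_mul _) ((hη.mul' (hdiff hy)).integrable_mul _)]
  have e1 : ∫ z, ((c • (S y u - S r u)) z * (η z * φ s z) + (c • (S y u - S r u)) z * (η z * (φ (t - y) z - φ s z))) =
      c * ((∫ z, S y u z * (η z * φ (t - y) z)) - ∫ z, S r u z * (η z * φ (t - y) z)) := by
    rw [← integral_sub (hty.integrable_mul _) (hty.integrable_mul _), ← integral_const_mul]
    refine integral_congr_ae ?_
    filter_upwards [coe_smul_ae c (S y u - S r u), coe_sub_ae (S y u) (S r u)] with z h1 h2
    rw [h1, h2]; ring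
  have e2 : ∫ z, S r u z * (η z * (c * (φ (t - y) z - φ s z))) =
      c * ((∫ z, S r u z * (η z * φ (t - y) z)) - ∫ z, S r u z * (η z * φ s z)) := by
    rw [← integral_sub (hty.integrable_mul _) (hts.integrable_mul _), ← integral_const_mul]; congr 1; ext z; ring
  rw [e1, e2]; ring

lemma tendsto_cut_pairing {η : Phase → ℝ} (hη : IsTest η) (h1 : ∀ z, ‖z‖ ≤ 1 → η z = 1) (h01 : ∀ z, 0 ≤ η z ∧ η z ≤ 1)
    (u : X) {ψ : Phase → ℝ} (hm : Measurable ψ) (hψ : dualNorm ψ < ∞) :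
    Tendsto (fun k : ℕ => ∫ z, u z * (η (dil (k + 1) z) * ψ z)) atTop (𝓝 (∫ z, u z * ψ z)) := by
  refine tendsto_integral_of_dominated_convergence (fun z => |u z * ψ z|) ?_ (integrable_mul u hm.aemeasurable hψ).abs ?_ ?_
  · intro k; have := hη.1.continuous.measurable.comp (dil (k + 1)).continuous.measurable
    exact Measurable.aestronglyMeasurable ((measurable_coe u).mul (this.mul hm))
  · intro k; refine ae_of_all _ fun z => ?_
    rw [Real.norm_eq_abs, abs_mul, abs_mul, abs_mul]; refine mul_le_mul_of_nonneg_left ?_ (abs_nonneg _)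
    rw [abs_of_nonneg (h01 _).1]; exact mul_le_of_le_one_left (abs_nonneg _) (h01 _).2
  · refine ae_of_all _ fun z => ?_; refine tendsto_const_nhds.congr' ?_; obtain ⟨N, hN⟩ := exists_nat_ge ‖z‖
    filter_upwards [eventually_ge_atTop N] with k hk
    have hk' : ‖z‖ ≤ (k : ℝ) + 1 := hN.trans (by have : (N : ℝ) ≤ k := by exact_mod_cast hk
                                                 linarith)
    have hk0 : (0 : ℝ) < (k : ℝ) + 1 := by positivity
    rw [h1, one_mul]; rw [dil_apply, Prod.norm_def, max_le_iff]
    have n1 : ‖z.1‖ ≤ k + 1 := (norm_fst_le z).trans hk'; have n2 : ‖z.2‖ ≤ k + 1 := (norm_snd_le z).trans hk'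
    constructor
    · rw [norm_smul, norm_inv, norm_of_nonneg (by positivity), inv_mul_le_iff₀ (by positivity)]
      nlinarith [(Nat.cast_nonneg k : (0 : ℝ) ≤ k)]
    · rw [norm_smul, norm_inv, norm_of_nonneg (by positivity), inv_mul_le_iff₀ (by positivity)]; linarith

/-- The semigroup is dual to the backward equation. -/
theorem IsBackward.integral_eq (H : IsBackward α β γ σ t θ h φ) (hα : 0 ≤ α) (hβ : 0 ≤ β) (hγ : 0 ≤ γ) (hσ : 0 ≤ σ)
    (ht : 0 ≤ t) {S : ℝ → X →L[ℝ] X} (hS : IsWFPSemigroup α β γ σ S) (u : X) :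
    ∫ z, S t u z * φ 0 z = ∫ z, u z * φ t z := by
  have m0 : (0 : ℝ) ∈ Icc 0 t := ⟨le_rfl, ht⟩; have mt : t ∈ Icc 0 t := ⟨ht, le_rfl⟩
  obtain ⟨L0, hL0, -⟩ := exists_clm (H.measurable m0).aemeasurable (H.dualNorm_lt_top m0)
  obtain ⟨Lt, hLt, -⟩ := exists_clm (H.measurable mt).aemeasurable (H.dualNorm_lt_top mt)
  suffices hd : ∀ u ∈ {u : X | ∃ g, (u, g) ∈ generatorGraph S}, L0 (S t u) = Lt u by
    have hcl : IsClosed {u : X | L0 (S t u) = Lt u} := isClosed_eq (by fun_prop) (by fun_prop)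
    have := hcl.closure_subset_iff.2 hd (hS.1.dense_generator u); rw [← hL0, ← hLt]; exact this
  rintro u ⟨g, hu⟩; obtain ⟨η, C, hC, hη, hη1, hη01, hcomm⟩ := exists_cutoff α β γ σ hα hβ hγ hσ
  obtain ⟨M, hM0, hM⟩ := hS.1.exists_bound t; set N : ℝ≥0∞ := ∫⁻ x, ‖h x‖ₑ ^ 2
  have hNt : N < ∞ := lintegral_sq_lt_top H.memLp
  have hSM : ∀ y ∈ Icc 0 t, ‖S y u‖ ≤ M * ‖u‖ := fun y hy =>
    (le_opNorm _ _).trans (mul_le_mul_of_nonneg_right (hM y hy) (norm_nonneg _))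
  have main : ∀ k : ℕ, ofReal
      |(∫ z, S t u z * (η (dil (k + 1) z) * φ 0 z)) - ∫ z, u z * (η (dil (k + 1) z) * φ t z)| ≤
      ofReal (M * ‖u‖ * t) * (ofReal C * (N * cutErr (k + 1)) ^ (1 / 2 : ℝ)) := by
    intro k
    have hk0 : (0 : ℝ) < (k : ℝ) + 1 := by positivity
    have hχ : IsTest (fun z => η (dil (k + 1) z)) := by
      refine ⟨hη.1.comp (dil _).contDiff, hη.2.comp_isClosedEmbedding
        (LinearMap.isClosedEmbedding_of_injective (f := (dil (k + 1)).toLinearMap) (LinearMap.ker_eq_bot.2 ?_))⟩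
      intro a b hab; have h1 := congrArg Prod.fst hab; have h2 := congrArg Prod.snd hab
      exact Prod.ext (smul_right_injective E3 (r := (((k : ℝ) + 1) ^ 2)⁻¹) (by positivity) h1)
        (smul_right_injective E3 (r := ((k : ℝ) + 1)⁻¹) (by positivity) h2)
    have hcomm' := hcomm (k + 1) (by simp); set χ : Phase → ℝ := fun z => η (dil (k + 1) z)
    have hfin : ofReal C * (N * cutErr (k + 1)) ^ (1 / 2 : ℝ) ≠ ∞ := by
      have := cutErr_lt_top k
      finiteness
    set D := (ofReal C * (N * cutErr (k + 1)) ^ (1 / 2 : ℝ)).toReal with hD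
    have hbound : ∀ r ∈ Ico 0 t, ‖∫ z, S r u z * comm α β γ σ χ (φ (t - r)) z‖ ≤ M * ‖u‖ * D := by
      intro r hr; have hst := sub_mem_Icc_zero ⟨hr.1, hr.2.le⟩
      have hmeas : Measurable (comm α β γ σ χ (φ (t - r))) := by
        have h1 := fun i => ((H.smooth _ hst).dX i).continuous; have h2 := fun i => ((H.smooth _ hst).dV i).continuous
        have h0 := (H.smooth _ hst).continuous; have k1 := fun i => (Smooth.dX hχ.1 i).continuous
        have k2 := fun i => (Smooth.dV hχ.1 i).continuous; have k3 := (Smooth.Astar hχ.1 α β γ σ).continuous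
        refine Continuous.measurable ?_; unfold comm; fun_prop
      have hd := dualNorm_le_of_cutSize (θ := θ (t - r)) hC hk0 H.meas
        (fun z => hcomm' (φ (t - r)) z _ (H.bound _ hst z) (H.boundX _ hst z) (H.boundV _ hst z))
      exact (norm_pair_le _ hmeas.aemeasurable (lt_of_le_of_lt hd hfin.lt_top)).trans
        (mul_le_mul (hSM r ⟨hr.1, hr.2.le⟩) (toReal_mono hfin hd) toReal_nonneg (by positivity))
    have hcont : ContinuousOn (fun r => ∫ z, S r u z * (χ z * φ (t - r) z)) (Icc 0 t) := by
      obtain ⟨B, hB0, hB⟩ := H.exists_pair_sub_le hχ; intro r hr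
      have hst := sub_mem_Icc_zero hr; have htr : IsTest (fun z => χ z * φ (t - r) z) := hχ.mul' (H.smooth _ hst)
      obtain ⟨L, hL, -⟩ := exists_clm htr.aemeasurable htr.dualNorm_lt_top
      have l1 : Tendsto (fun y => L (S y u)) (𝓝[Icc 0 t] r) (𝓝 (L (S r u))) :=
        (L.continuous.tendsto _).comp (((hS.1.continuousOn u) r hr.1).mono_left (nhdsWithin_mono _ Icc_subset_Ici_self))
      have l2 : Tendsto (fun y => ∫ z, S y u z * (χ z * (φ (t - y) z - φ (t - r) z))) (𝓝[Icc 0 t] r) (𝓝 0) := by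
        have hb : Tendsto (fun y : ℝ => M * ‖u‖ * (B * |t - y - (t - r)|)) (𝓝 r)
            (𝓝 (M * ‖u‖ * (B * |t - r - (t - r)|))) := Continuous.tendsto (by fun_prop) _
        rw [sub_self, abs_zero, mul_zero, mul_zero] at hb
        refine squeeze_zero_norm' ?_ (hb.mono_left nhdsWithin_le_nhds)
        filter_upwards [self_mem_nhdsWithin] with y hy
        exact (hB _ hst _ (sub_mem_Icc_zero hy) _).trans (mul_le_mul_of_nonneg_right (hSM y hy) (by positivity))
      have l3 := l1.add l2; rw [add_zero, hL] at l3; refine l3.congr' ?_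
      filter_upwards [self_mem_nhdsWithin] with y hy
      rw [hL, ← integral_add (htr.integrable_mul _)
        ((hχ.mul' ((H.smooth _ (sub_mem_Icc_zero hy)).sub (H.smooth _ hst))).integrable_mul _)]
      congr 1; ext z; ring
    have hfin2 := norm_image_sub_le_of_norm_deriv_right_le_segment hcont
      (fun r hr => H.hasDerivWithinAt hS hu hχ hr) hbound t mt
    simp only [sub_zero, sub_self, hS.1.zero, ContinuousLinearMap.id_apply, Real.norm_eq_abs] at hfin2
    refine (ofReal_le_ofReal hfin2).trans_eq ?_
    rw [mul_right_comm, ofReal_mul (by positivity), hD, ofReal_toReal hfin]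
  have lhs := (((tendsto_cut_pairing hη hη1 hη01 (S t u) (H.measurable m0) (H.dualNorm_lt_top m0)).sub
    (tendsto_cut_pairing hη hη1 hη01 u (H.measurable mt) (H.dualNorm_lt_top mt))).abs)
  have lhs' := (ENNReal.continuous_ofReal.tendsto _).comp lhs
  have rhs : Tendsto (fun k : ℕ => ofReal (M * ‖u‖ * t) * (ofReal C * (N * cutErr (k + 1)) ^ (1 / 2 : ℝ)))
      atTop (𝓝 0) := by
    have h1 := ENNReal.Tendsto.const_mul (a := N) tendsto_cutErr (Or.inr hNt.ne)
    have h2 := (ENNReal.continuous_rpow_const (y := (1 / 2 : ℝ))).tendsto _ |>.comp h1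
    have h3 := ENNReal.Tendsto.const_mul (a := ofReal C) h2 (Or.inr ofReal_ne_top)
    have h4 := ENNReal.Tendsto.const_mul (a := ofReal (M * ‖u‖ * t)) h3 (Or.inr ofReal_ne_top); simpa using h4
  have h0 := le_of_tendsto_of_tendsto' lhs' rhs main; have h1 := ENNReal.ofReal_eq_zero.1 (nonpos_iff_eq_zero.1 h0)
  have h2 := abs_nonpos_iff.1 h1; rw [hL0, hLt]; linarith

end Backward

/-! ### Gaussian solutions of the backward equation -/

section GaussFam

/-- The quadratic form of a Gaussian in the variables `a`, `b`. -/
noncomputable def qform (A B C : ℝ) (a b : E3) : ℝ := A * ‖a‖ ^ 2 + 2 * B * inner ℝ a b + C * ‖b‖ ^ 2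

/-- Gaussians in the sheared variables `x + θ v - x₀`, `e v - v₀`. -/
noncomputable def gaussFam (θ e A B C c : ℝ) (x₀ v₀ : E3) (z : Phase) : ℝ :=
  exp (-(qform A B C (z.1 + θ • z.2 - x₀) (e • z.2 - v₀) / 2 + c))

variable (θ e A B C c : ℝ) (x₀ v₀ : E3)

local notation "𝒢" => gaussFam θ e A B C c x₀ v₀

lemma contDiff_gaussFam : Smooth 𝒢 := by
  unfold gaussFam qform
  have h1 : ContDiff ℝ (⊤ : ℕ∞) fun z : Phase => z.1 + θ • z.2 - x₀ := by fun_prop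
  have h2 : ContDiff ℝ (⊤ : ℕ∞) fun z : Phase => e • z.2 - v₀ := by fun_prop
  exact ((((contDiff_const.mul (h1.norm_sq ℝ)).add (contDiff_const.mul (h1.inner ℝ h2))).add
    (contDiff_const.mul (h2.norm_sq ℝ))).div_const 2 |>.add contDiff_const).neg.exp

/-- The linear forms appearing in the gradient of the Gaussian. -/
noncomputable def gp (θ e A B : ℝ) (x₀ v₀ : E3) (i : Fin 3) (z : Phase) : ℝ :=
  A * (z.1 i + θ * z.2 i - x₀ i) + B * (e * z.2 i - v₀ i)

local notation "𝔭" => gp θ e A B x₀ v₀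
local notation "𝔮" => gp θ e B C x₀ v₀

lemma hasFDerivAt_gp (i : Fin 3) (z : Phase) : HasFDerivAt (𝔭 i)
      (A • ((proj (𝕜 := ℝ) i).comp (ContinuousLinearMap.fst ℝ E3 E3) +
        θ • (proj (𝕜 := ℝ) i).comp (ContinuousLinearMap.snd ℝ E3 E3)) +
        B • (e • (proj (𝕜 := ℝ) i).comp (ContinuousLinearMap.snd ℝ E3 E3))) z := by
  have h1 := ((proj (𝕜 := ℝ) i).comp (ContinuousLinearMap.fst ℝ E3 E3)).hasFDerivAt (x := z)
  have h2 := ((proj (𝕜 := ℝ) i).comp (ContinuousLinearMap.snd ℝ E3 E3)).hasFDerivAt (x := z)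
  exact (((h1.add (h2.const_mul θ)).sub_const (x₀ i)).const_mul A).add (((h2.const_mul e).sub_const (v₀ i)).const_mul B)

lemma qform_eq_sum (a b : E3) : qform A B C a b = ∑ i, (A * a i ^ 2 + 2 * B * (a i * b i) + C * b i ^ 2) := by
  rw [qform, EuclideanSpace.real_norm_sq_eq, EuclideanSpace.real_norm_sq_eq, PiLp.inner_apply]
  simp only [Fin.sum_univ_three, RCLike.inner_apply, conj_trivial]; ring

lemma fderiv_gaussFam (z w : Phase) : fderiv ℝ 𝒢 z w = -(𝒢 z *
      ∑ i, (𝔭 i z * (w.1 i + θ * w.2 i) + 𝔮 i z * (e * w.2 i))) := by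
  have hrep : 𝒢 = fun z => exp (-((∑ i, (𝔭 i z * gp θ e 1 0 x₀ v₀ i z + 𝔮 i z * gp θ e 0 1 x₀ v₀ i z)) / 2 + c)) := by
    funext z
    rw [gaussFam, qform_eq_sum]; congr 5; ext i; simp [gp]; ring
  have hs : ∀ i, HasFDerivAt (𝕜 := ℝ) (fun z => 𝔭 i z * gp θ e 1 0 x₀ v₀ i z +
      𝔮 i z * gp θ e 0 1 x₀ v₀ i z) _ z := fun i =>
    ((hasFDerivAt_gp θ e A B x₀ v₀ i z).mul (hasFDerivAt_gp θ e 1 0 x₀ v₀ i z)).add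
      ((hasFDerivAt_gp θ e B C x₀ v₀ i z).mul (hasFDerivAt_gp θ e 0 1 x₀ v₀ i z))
  have hsum : HasFDerivAt (𝕜 := ℝ) (fun z => ∑ i, (𝔭 i z * gp θ e 1 0 x₀ v₀ i z +
      𝔮 i z * gp θ e 0 1 x₀ v₀ i z)) _ z := HasFDerivAt.fun_sum fun i (_ : i ∈ Finset.univ) => hs i
  have hd1 : HasFDerivAt (𝕜 := ℝ) (fun z => (∑ i, (𝔭 i z * gp θ e 1 0 x₀ v₀ i z +
      𝔮 i z * gp θ e 0 1 x₀ v₀ i z)) * (2⁻¹ : ℝ) + c) _ z := (hsum.mul_const (2⁻¹ : ℝ)).add_const c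
  have hd := hd1.fun_neg.exp; simp only [← div_eq_mul_inv] at hd
  have hp : ∀ (i : Fin 3) (x : E3), (proj (𝕜 := ℝ) i) x = x i := fun _ _ => rfl; rw [hrep, hd.fderiv]
  simp only [Fin.sum_univ_three, ContinuousLinearMap.smul_apply, ContinuousLinearMap.neg_apply,
    ContinuousLinearMap.add_apply, ContinuousLinearMap.comp_apply, ContinuousLinearMap.coe_fst', ContinuousLinearMap.coe_snd',
    hp, smul_eq_mul, gp]
  ring

lemma dX_gaussFam (i : Fin 3) (z : Phase) : dX i 𝒢 z = -(𝒢 z * 𝔭 i z) := by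
  rw [dX, fderiv_gaussFam, Finset.sum_eq_single i]
  · simp
  · intro j _ hj; simp [hj]
  · simp

lemma dV_gaussFam (i : Fin 3) (z : Phase) : dV i 𝒢 z = -(𝒢 z * (θ * 𝔭 i z + e * 𝔮 i z)) := by
  rw [dV, fderiv_gaussFam, Finset.sum_eq_single i]
  · simp; ring_nf; simp
  · intro j _ hj; simp [hj]
  · simp

lemma contDiff_gp (i : Fin 3) : Smooth (𝔭 i) := by unfold gp Smooth; fun_prop

lemma dX_gp (i : Fin 3) (z : Phase) : dX i (𝔭 i) z = A := by rw [dX, (hasFDerivAt_gp θ e A B x₀ v₀ i z).fderiv]; simp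

lemma dV_gp (i : Fin 3) (z : Phase) : dV i (𝔭 i) z = θ * A + e * B := by
  rw [dV, (hasFDerivAt_gp θ e A B x₀ v₀ i z).fderiv]; simp; ring

lemma fderiv_neg_mul {φ ψ : Phase → ℝ} (hφ : Smooth φ) (hψ : Smooth ψ) (z e : Phase) :
    fderiv ℝ (fun z => -(φ z * ψ z)) z e = -(fderiv ℝ φ z e * ψ z + φ z * fderiv ℝ ψ z e) := by
  rw [fderiv_fun_neg, ContinuousLinearMap.neg_apply, fderiv_mul_apply hφ hψ]

lemma dX_dX_gaussFam (i : Fin 3) (z : Phase) : dX i (dX i 𝒢) z = 𝒢 z * (𝔭 i z ^ 2 - A) := by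
  rw [funext (dX_gaussFam θ e A B C c x₀ v₀ i), dX, fderiv_neg_mul (contDiff_gaussFam ..) (contDiff_gp ..), ← dX, ← dX,
    dX_gaussFam, dX_gp]
  ring

lemma dV_dX_gaussFam (i : Fin 3) (z : Phase) :
    dV i (dX i 𝒢) z = 𝒢 z * (𝔭 i z * (θ * 𝔭 i z + e * 𝔮 i z) - (θ * A + e * B)) := by
  rw [funext (dX_gaussFam θ e A B C c x₀ v₀ i), dV, fderiv_neg_mul (contDiff_gaussFam ..) (contDiff_gp ..), ← dV, ← dV,
    dV_gaussFam, dV_gp]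
  ring

lemma dV_dV_gaussFam (i : Fin 3) (z : Phase) : dV i (dV i 𝒢) z =
      𝒢 z * ((θ * 𝔭 i z + e * 𝔮 i z) ^ 2 - (θ * (θ * A + e * B) + e * (θ * B + e * C))) := by
  have hc : Smooth fun z => θ * 𝔭 i z + e * 𝔮 i z :=
    (contDiff_const.mul (contDiff_gp ..)).add (contDiff_const.mul (contDiff_gp ..))
  have hd : dV i (fun z => θ * 𝔭 i z + e * 𝔮 i z) z = θ * (θ * A + e * B) + e * (θ * B + e * C) := by
    have h1 : HasFDerivAt (fun z => θ * 𝔭 i z + e * 𝔮 i z) _ z :=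
      ((hasFDerivAt_gp θ e A B x₀ v₀ i z).const_mul θ).add ((hasFDerivAt_gp θ e B C x₀ v₀ i z).const_mul e)
    rw [dV, h1.fderiv]
    simp; ring
  rw [funext (dV_gaussFam θ e A B C c x₀ v₀ i), dV, fderiv_neg_mul (contDiff_gaussFam ..) hc, ← dV, ← dV, dV_gaussFam, hd]
  ring

/-- The logarithmic drift of the Gaussian under the adjoint operator. -/
noncomputable def drift (α β γ σ θ e A B C : ℝ) (x₀ v₀ : E3) (z : Phase) : ℝ :=
  ∑ i, (-(z.2 i * gp θ e A B x₀ v₀ i z) + β * (z.2 i * (θ * gp θ e A B x₀ v₀ i z + e * gp θ e B C x₀ v₀ i z)) +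
    σ * ((θ * gp θ e A B x₀ v₀ i z + e * gp θ e B C x₀ v₀ i z) ^ 2 - (θ * (θ * A + e * B) + e * (θ * B + e * C))) +
    2 * γ * (gp θ e A B x₀ v₀ i z * (θ * gp θ e A B x₀ v₀ i z + e * gp θ e B C x₀ v₀ i z) - (θ * A + e * B)) +
    α * (gp θ e A B x₀ v₀ i z ^ 2 - A))

lemma Astar_gaussFam (α β γ σ : ℝ) (z : Phase) : Astar α β γ σ 𝒢 z = 𝒢 z * drift α β γ σ θ e A B C x₀ v₀ z := by
  simp only [Astar, drift, dX_gaussFam, dV_gaussFam, dX_dX_gaussFam, dV_dX_gaussFam, dV_dV_gaussFam, Fin.sum_univ_three]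
  ring

variable {θ e A B C c}

lemma sqrt_mul_exp_le {F : ℝ} (hF : 0 ≤ F) : sqrt F * exp (-(F / 2)) ≤ exp (-(F / 4)) := by
  have h1 : sqrt F ≤ exp (F / 4) := by
    have h2 := Real.add_one_le_exp (F / 4)
    have h3 : sqrt F ≤ F / 4 + 1 := by rw [Real.sqrt_le_left (by positivity)]; nlinarith [sq_nonneg (F / 4 - 1)]
    linarith
  have h4 : exp (-(F / 4)) = exp (F / 4) * exp (-(F / 2)) := by rw [← exp_add]; congr 1; ring
  rw [h4]; gcongr

lemma qform_nonneg (hA : 0 ≤ A) (hC : 0 ≤ C) (hD : B ^ 2 ≤ A * C) (a b : E3) : 0 ≤ qform A B C a b := by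
  have h1 := abs_real_inner_le_norm a b
  have h2 : |B| ≤ sqrt A * sqrt C := by rw [← Real.sqrt_mul hA, ← Real.sqrt_sq_eq_abs]; exact Real.sqrt_le_sqrt hD
  have h3 : |B * inner ℝ a b| ≤ sqrt A * sqrt C * (‖a‖ * ‖b‖) := by
    rw [abs_mul]; exact mul_le_mul h2 h1 (abs_nonneg _) (by positivity)
  have h4 := (abs_le.1 h3).1
  have h5 : A * ‖a‖ ^ 2 + C * ‖b‖ ^ 2 - 2 * (sqrt A * sqrt C * (‖a‖ * ‖b‖)) = (sqrt A * ‖a‖ - sqrt C * ‖b‖) ^ 2 := by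
    nlinarith [Real.sq_sqrt hA, Real.sq_sqrt hC]
  rw [qform]; nlinarith [sq_nonneg (sqrt A * ‖a‖ - sqrt C * ‖b‖)]

lemma gp_sq_le (hD : B ^ 2 ≤ A * C) (i : Fin 3) (z : Phase) :
    𝔭 i z ^ 2 ≤ A * qform A B C (z.1 + θ • z.2 - x₀) (e • z.2 - v₀) ∧
    𝔮 i z ^ 2 ≤ C * qform A B C (z.1 + θ • z.2 - x₀) (e • z.2 - v₀) := by
  set a := z.1 + θ • z.2 - x₀ with ha; set b := e • z.2 - v₀ with hb
  have key : ∀ (D : ℝ) (g : Fin 3 → ℝ), (∀ j, g j ^ 2 ≤ D * (A * a j ^ 2 + 2 * B * (a j * b j) + C * b j ^ 2)) →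
      g i ^ 2 ≤ D * qform A B C a b := fun D g hg => by
    rw [qform_eq_sum, mul_sum]
    exact (Finset.single_le_sum (f := fun j => g j ^ 2) (fun j _ => sq_nonneg _) (Finset.mem_univ i)).trans
      (sum_le_sum fun j _ => hg j)
  refine ⟨key A (𝔭 · z) fun j => ?_, key C (𝔮 · z) fun j => ?_⟩ <;> simp only [gp, ha, hb, PiLp.sub_apply,
    PiLp.add_apply, PiLp.smul_apply, smul_eq_mul]
  · nlinarith [mul_le_mul_of_nonneg_right hD (sq_nonneg (e * z.2 j - v₀ j))]
  · nlinarith [mul_le_mul_of_nonneg_right hD (sq_nonneg (z.1 j + θ * z.2 j - x₀ j))]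

/-- Gaussian domination. -/
lemma gaussFam_bounds {κ ρ : ℝ} (hκ : 1 ≤ κ) (hA : 0 ≤ A) (hA' : A ≤ κ) (hC : 0 ≤ C) (hC' : C ≤ κ)
    (hD : B ^ 2 ≤ A * C) (hc : -κ ≤ c) (hθ : 0 ≤ θ) (hθ' : θ ≤ κ) (he : 0 ≤ e) (he' : e ≤ κ)
    (hlow : ∀ a b : E3, ‖a‖ ^ 2 / ρ ≤ qform A B C a b) (z : Phase) :
    let K := 2 * κ ^ 2 * exp κ * exp (-(‖z.1 + θ • z.2 - x₀‖ ^ 2 / (4 * ρ)))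
    |𝒢 z| ≤ K ∧ (∀ i, |dX i 𝒢 z| ≤ K) ∧ ∀ i, |dV i 𝒢 z| ≤ K := by
  intro K; have hgp := fun i => gp_sq_le (θ := θ) (e := e) x₀ v₀ hD i z
  set F := qform A B C (z.1 + θ • z.2 - x₀) (e • z.2 - v₀); have hF0 : 0 ≤ F := qform_nonneg hA hC hD _ _
  have hE : exp (-(F / 4)) ≤ exp (-(‖z.1 + θ • z.2 - x₀‖ ^ 2 / (4 * ρ))) := by
    apply Real.exp_le_exp.2; have := hlow (z.1 + θ • z.2 - x₀) (e • z.2 - v₀)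
    have h2 : ‖z.1 + θ • z.2 - x₀‖ ^ 2 / (4 * ρ) = ‖z.1 + θ • z.2 - x₀‖ ^ 2 / ρ / 4 := by rw [div_div]; ring_nf
    rw [h2]; linarith
  set G := exp (-(‖z.1 + θ • z.2 - x₀‖ ^ 2 / (4 * ρ)))
  have hg : 𝒢 z ≤ exp κ * exp (-(F / 2)) := by rw [gaussFam, ← exp_add]; apply Real.exp_le_exp.2; linarith
  have hg0 : 0 ≤ 𝒢 z := (exp_pos _).le
  have hk2 : 1 ≤ κ ^ 2 := by nlinarith
  have hsq : ∀ {D q : ℝ}, 0 ≤ D → D ≤ κ → q ^ 2 ≤ D * F → |𝒢 z * q| ≤ κ * exp κ * G := by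
    intro D q hD0 hD1 hq
    have h1 : |q| ≤ κ * sqrt F := by
      rw [← Real.sqrt_sq_eq_abs]
      calc _ ≤ sqrt (κ ^ 2 * F) := Real.sqrt_le_sqrt (hq.trans (by gcongr; nlinarith))
        _ = _ := by rw [Real.sqrt_mul (by positivity), Real.sqrt_sq (by positivity)]
    rw [abs_mul, abs_of_nonneg hg0]
    calc _ ≤ (exp κ * exp (-(F / 2))) * (κ * sqrt F) := by gcongr
      _ = κ * exp κ * (sqrt F * exp (-(F / 2))) := by ring
      _ ≤ κ * exp κ * G := by gcongr; exact (sqrt_mul_exp_le hF0).trans hE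
  refine ⟨?_, fun i => ?_, fun i => ?_⟩
  · rw [abs_of_nonneg hg0]
    calc _ ≤ exp κ * exp (-(F / 4)) := hg.trans (by gcongr <;> linarith)
      _ ≤ exp κ * G := by gcongr
      _ ≤ 2 * κ ^ 2 * exp κ * G := by gcongr; exact le_mul_of_one_le_left (exp_pos _).le (by linarith)
  · rw [dX_gaussFam, abs_neg]; refine (hsq hA hA' (hgp i).1).trans ?_; change _ ≤ 2 * κ ^ 2 * exp κ * G; gcongr
    nlinarith
  · rw [dV_gaussFam, abs_neg]
    have e1 : 𝒢 z * (θ * 𝔭 i z + e * 𝔮 i z) = θ * (𝒢 z * 𝔭 i z) + e * (𝒢 z * 𝔮 i z) := by ring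
    rw [e1]; refine (abs_add_le _ _).trans ?_; rw [abs_mul, abs_mul e, abs_of_nonneg hθ, abs_of_nonneg he]
    have h1 := mul_le_mul hθ' (hsq hA hA' (hgp i).1) (abs_nonneg _) (by linarith)
    have h2 := mul_le_mul he' (hsq hC hC' (hgp i).2) (abs_nonneg _) (by linarith)
    calc _ ≤ κ * (κ * exp κ * G) + κ * (κ * exp κ * G) := add_le_add h1 h2
      _ = _ := by ring

end GaussFam

/-- Coefficient functions whose Gaussians solve the backward equation. -/
structure IsGaussData (α β γ σ t κ ρ : ℝ) (θ e A B C c : ℝ → ℝ) : Prop where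
  one_le : 1 ≤ κ
  rho_pos : 0 < ρ
  e_eq : ∀ s, e s = 1 - β * θ s
  dθ : ∀ s ∈ Icc 0 t, HasDerivAt θ (e s) s
  dA : ∀ s ∈ Icc 0 t, HasDerivAt A (-(A s ^ 2 * (2 * (α + 2 * γ * θ s + σ * θ s ^ 2)) +
    2 * (A s * B s) * (2 * γ * e s + 2 * σ * θ s * e s) + B s ^ 2 * (2 * σ * e s ^ 2))) s
  dB : ∀ s ∈ Icc 0 t, HasDerivAt B (-(A s * B s * (2 * (α + 2 * γ * θ s + σ * θ s ^ 2)) +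
    (A s * C s + B s ^ 2) * (2 * γ * e s + 2 * σ * θ s * e s) + B s * C s * (2 * σ * e s ^ 2))) s
  dC : ∀ s ∈ Icc 0 t, HasDerivAt C (-(B s ^ 2 * (2 * (α + 2 * γ * θ s + σ * θ s ^ 2)) +
    2 * (B s * C s) * (2 * γ * e s + 2 * σ * θ s * e s) + C s ^ 2 * (2 * σ * e s ^ 2))) s
  dc : ∀ s ∈ Icc 0 t, HasDerivAt c (3 / 2 * (A s * (2 * (α + 2 * γ * θ s + σ * θ s ^ 2)) +
    2 * B s * (2 * γ * e s + 2 * σ * θ s * e s) + C s * (2 * σ * e s ^ 2))) s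
  hA : ∀ s ∈ Icc 0 t, 0 ≤ A s ∧ A s ≤ κ
  hC : ∀ s ∈ Icc 0 t, 0 ≤ C s ∧ C s ≤ κ
  hD : ∀ s ∈ Icc 0 t, B s ^ 2 ≤ A s * C s
  hc : ∀ s ∈ Icc 0 t, -κ ≤ c s
  hθ : ∀ s ∈ Icc 0 t, 0 ≤ θ s ∧ θ s ≤ κ
  he : ∀ s ∈ Icc 0 t, 0 ≤ e s ∧ e s ≤ κ
  low : ∀ s ∈ Icc 0 t, ∀ a b : E3, ‖a‖ ^ 2 / ρ ≤ qform (A s) (B s) (C s) a b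

lemma IsGaussData.isBackward {α β γ σ t κ ρ : ℝ} {θ e A B C c : ℝ → ℝ}
    (H : IsGaussData α β γ σ t κ ρ θ e A B C c) (x₀ v₀ : E3) :
    IsBackward α β γ σ t θ (fun y => 2 * κ ^ 2 * exp κ * exp (-(‖y - x₀‖ ^ 2 / (4 * ρ))))
      (fun s => gaussFam (θ s) (e s) (A s) (B s) (C s) (c s) x₀ v₀) := by
  have hb := fun s (hs : s ∈ Icc 0 t) z => gaussFam_bounds (c := c s) x₀ v₀ H.one_le (H.hA s hs).1 (H.hA s hs).2 (H.hC s hs).1 (H.hC s hs).2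
    (H.hD s hs) (H.hc s hs) (H.hθ s hs).1 (H.hθ s hs).2 (H.he s hs).1 (H.he s hs).2 (H.low s hs) z
  have hde : ∀ s ∈ Icc 0 t, HasDerivAt e (-β * e s) s := fun s hs => by
    have := ((H.dθ s hs).const_mul β).const_sub 1
    have h2 : HasDerivAt e (-(β * e s)) s := this.congr_of_eventuallyEq (of_forall H.e_eq); rw [neg_mul]; exact h2
  refine ⟨fun s _ => contDiff_gaussFam .., fun s hs z => ?_, fun r => ?_, by fun_prop, ?_, fun s hs z => (hb s hs z).1,
    fun s hs z => (hb s hs z).2.1, fun s hs z => (hb s hs z).2.2⟩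
  · rw [Astar_gaussFam]
    have hexp : (fun s => gaussFam (θ s) (e s) (A s) (B s) (C s) (c s) x₀ v₀ z) = fun s =>
        exp (-((∑ i, (A s * (z.1 i + θ s * z.2 i - x₀ i) ^ 2 +
          2 * B s * ((z.1 i + θ s * z.2 i - x₀ i) * (e s * z.2 i - v₀ i)) + C s * (e s * z.2 i - v₀ i) ^ 2)) * 2⁻¹ + c s)) := by
      funext s
      rw [gaussFam, qform_eq_sum]; simp [div_eq_mul_inv]
    have ha : ∀ i, HasDerivAt (fun s => z.1 i + θ s * z.2 i - x₀ i) (e s * z.2 i) s := fun i =>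
      (((H.dθ s hs).mul_const (z.2 i)).const_add (z.1 i)).sub_const (x₀ i)
    have hbd : ∀ i, HasDerivAt (fun s => e s * z.2 i - v₀ i) (-β * e s * z.2 i) s := fun i =>
      ((hde s hs).mul_const (z.2 i)).sub_const (v₀ i)
    have hi : ∀ i, HasDerivAt (fun s => A s * (z.1 i + θ s * z.2 i - x₀ i) ^ 2 +
          2 * B s * ((z.1 i + θ s * z.2 i - x₀ i) * (e s * z.2 i - v₀ i)) + C s * (e s * z.2 i - v₀ i) ^ 2) _ s := fun i =>
      (((H.dA s hs).mul ((ha i).fun_pow 2)).add ((((H.dB s hs).const_mul 2)).mul ((ha i).fun_mul (hbd i)))).add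
        ((H.dC s hs).mul ((hbd i).fun_pow 2))
    have hd := ((((HasDerivAt.fun_sum fun i (_ : i ∈ Finset.univ) => hi i).mul_const (2⁻¹ : ℝ)).fun_add (H.dc s hs)).fun_neg).exp
    rw [congrFun hexp s, hexp]; refine HasDerivAt.congr_deriv hd ?_
    simp only [Fin.sum_univ_three, drift, gp, Nat.cast_ofNat, Nat.add_one_sub_one, pow_one]; have he := H.e_eq s
    generalize z.1 0 + θ s * z.2 0 - x₀ 0 = a0
    generalize z.1 1 + θ s * z.2 1 - x₀ 1 = a1
    generalize z.1 2 + θ s * z.2 2 - x₀ 2 = a2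
    generalize e s * z.2 0 - v₀ 0 = b0
    generalize e s * z.2 1 - v₀ 1 = b1
    generalize e s * z.2 2 - v₀ 2 = b2
    congr 1
    linear_combination (z.2 0 * (A s * a0 + B s * b0) + z.2 1 * (A s * a1 + B s * b1) + z.2 2 * (A s * a2 + B s * b2)) * (-he)
  · have hc : Continuous fun p : (ℝ × ℝ × ℝ × ℝ × ℝ × ℝ) × Phase =>
        gaussFam p.1.1 p.1.2.1 p.1.2.2.1 p.1.2.2.2.1 p.1.2.2.2.2.1 p.1.2.2.2.2.2 x₀ v₀ p.2 *
          drift α β γ σ p.1.1 p.1.2.1 p.1.2.2.1 p.1.2.2.2.1 p.1.2.2.2.2.1 x₀ v₀ p.2 := by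
      unfold gaussFam drift gp qform; fun_prop
    have hpar : ContinuousOn (fun q : ℝ × Phase => (((θ q.1, e q.1, A q.1, B q.1, C q.1, c q.1), q.2) : (ℝ × ℝ × ℝ × ℝ × ℝ × ℝ) × Phase))
        (Icc 0 t ×ˢ closedBall 0 r) := by
      have hco : ∀ {f f' : ℝ → ℝ}, (∀ s ∈ Icc 0 t, HasDerivAt f (f' s) s) → ContinuousOn (fun q : ℝ × Phase => f q.1) (Icc 0 t ×ˢ closedBall 0 r) :=
        fun {f f'} h => ContinuousOn.comp (t := Icc 0 t) (fun s hs => (h s hs).continuousAt.continuousWithinAt) continuousOn_fst (fun q hq => hq.1)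
      exact ((hco H.dθ).prodMk ((hco hde).prodMk ((hco H.dA).prodMk ((hco H.dB).prodMk ((hco H.dC).prodMk (hco H.dc)))))).prodMk continuousOn_snd
    obtain ⟨K, hK⟩ := (isCompact_Icc.prod (isCompact_closedBall (0 : Phase) r)).exists_bound_of_continuousOn (hc.comp_continuousOn hpar)
    refine ⟨K, fun s hs z hz => ?_⟩; rw [Astar_gaussFam]; exact hK (s, z) ⟨hs, by simpa using hz⟩
  · refine memLp_two_of_lintegral (by fun_prop) ?_
    have hi := (integrable_exp_neg_mul_norm_sq (b := 1 / (2 * ρ)) (by have := H.rho_pos; positivity)).comp_sub_right x₀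
    have hi2 := (hi.const_mul ((2 * κ ^ 2 * exp κ) ^ 2)).2; refine lt_of_le_of_lt (lintegral_mono fun y => ?_) hi2
    rw [← enorm_pow]; apply le_of_eq; congr 1; rw [mul_pow, ← Real.exp_nat_mul]; congr 2; field_simp; ring

/-! ### The coefficient functions -/

section Coefficients

variable {α β γ σ : ℝ}

lemma exp_eq_one_sub_vth (β t : ℝ) : exp (-(β * t)) = 1 - β * vth β t := by
  unfold vth
  split_ifs with h
  · simp [h]
  · field_simp; ring

lemma hasDerivAt_vth (β t : ℝ) : HasDerivAt (vth β) (exp (-(β * t))) t := by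
  unfold vth
  split_ifs with h
  · simpa [h] using hasDerivAt_id' t
  · have h1 : HasDerivAt (fun t => exp (-(β * t))) (exp (-(β * t)) * (-(β * 1))) t :=
      (((hasDerivAt_id t).const_mul β).neg).exp
    refine ((h1.const_sub 1).div_const β).congr_deriv ?_; field_simp

lemma hasDerivAt_R (α β γ σ t : ℝ) : HasDerivAt (R α β γ σ) (2 * (α + 2 * γ * vth β t + σ * vth β t ^ 2)) t := by
  have hR : R α β γ σ = fun t => if β = 0 then 2 * α * t + 2 * γ * t ^ 2 + (2 / 3) * σ * t ^ 3
    else 2 * α * t + σ * ((4 * exp (-(β * t)) - exp (-(2 * β * t)) + 2 * β * t - 3) / β ^ 3) +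
    4 * γ * ((exp (-(β * t)) + β * t - 1) / β ^ 2) := rfl
  rw [hR]; unfold vth
  split_ifs with h
  · have h2 : HasDerivAt (fun t : ℝ => t ^ 2) (2 * t) t := by simpa using hasDerivAt_pow 2 t
    have h3 : HasDerivAt (fun t : ℝ => t ^ 3) (3 * t ^ 2) t := by simpa using hasDerivAt_pow 3 t
    refine ((((hasDerivAt_id t).const_mul (2 * α)).add (h2.const_mul (2 * γ))).add (h3.const_mul (2 / 3 * σ))).congr_deriv ?_
    ring
  · have h1 : HasDerivAt (fun t => exp (-(β * t))) (exp (-(β * t)) * (-(β * 1))) t :=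
      (((hasDerivAt_id t).const_mul β).neg).exp
    have h2 : HasDerivAt (fun t => exp (-(2 * β * t))) (exp (-(2 * β * t)) * (-(2 * β * 1))) t :=
      (((hasDerivAt_id t).const_mul (2 * β)).neg).exp
    have h3 : HasDerivAt (fun t : ℝ => 2 * β * t) (2 * β * 1) t := (hasDerivAt_id t).const_mul (2 * β)
    have h4 : HasDerivAt (fun t : ℝ => β * t) (β * 1) t := (hasDerivAt_id t).const_mul β
    have h5 : HasDerivAt (fun t : ℝ => 2 * α * t) (2 * α * 1) t := (hasDerivAt_id t).const_mul (2 * α)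
    have he : exp (-(2 * β * t)) = exp (-(β * t)) ^ 2 := by rw [← Real.exp_nat_mul]; congr 1; push_cast; ring
    refine ((h5.add ((((((h1.const_mul 4).sub h2).add h3).sub_const 3).div_const (β ^ 3)).const_mul σ)).add
      (((((h1.add h4).sub_const 1).div_const (β ^ 2))).const_mul (4 * γ))).congr_deriv ?_
    rw [he]; field_simp; ring

lemma vth_zero (β : ℝ) : vth β 0 = 0 := by unfold vth; split_ifs <;> simp

lemma R_zero (α β γ σ : ℝ) : R α β γ σ 0 = 0 := by unfold R; split_ifs <;> norm_num

lemma continuous_vth (β : ℝ) : Continuous (vth β) :=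
  continuous_iff_continuousAt.2 fun t => (hasDerivAt_vth β t).continuousAt

@[fun_prop]
lemma measurable_vth (β : ℝ) : Measurable (vth β) := (continuous_vth β).measurable

lemma continuous_R (α β γ σ : ℝ) : Continuous (R α β γ σ) :=
  continuous_iff_continuousAt.2 fun t => (hasDerivAt_R α β γ σ t).continuousAt

@[fun_prop]
lemma measurable_R (α β γ σ : ℝ) : Measurable (R α β γ σ) := (continuous_R α β γ σ).measurable

local notation "ℛ" => R α β γ σ

lemma mul_exp_le_vth (hβ : 0 ≤ β) {t : ℝ} (ht : 0 ≤ t) : exp (-(β * t)) * t ≤ vth β t := by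
  unfold vth
  split_ifs with h
  · simp [h]
  · have hβ' : 0 < β := lt_of_le_of_ne hβ (Ne.symm h); rw [le_div_iff₀ hβ']; have h1 := Real.add_one_le_exp (β * t)
    have h2 : exp (-(β * t)) * exp (β * t) = 1 := by rw [← exp_add]; simp
    nlinarith [exp_pos (-(β * t))]

lemma vth_nonneg (hβ : 0 ≤ β) {t : ℝ} (ht : 0 ≤ t) : 0 ≤ vth β t := le_trans (by positivity) (mul_exp_le_vth hβ ht)

lemma vth_pos (hβ : 0 ≤ β) {t : ℝ} (ht : 0 < t) : 0 < vth β t :=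
  lt_of_lt_of_le (by positivity) (mul_exp_le_vth hβ ht.le)

lemma vth_le (hβ : 0 ≤ β) {t : ℝ} : vth β t ≤ t := by
  unfold vth
  split_ifs with h
  · exact le_rfl
  · have hβ' : 0 < β := lt_of_le_of_ne hβ (Ne.symm h); rw [div_le_iff₀ hβ']
    have h1 := Real.add_one_le_exp (-(β * t)); linarith

lemma exp_mul_le_vth (hβ : 0 ≤ β) {s T : ℝ} (hs : 0 ≤ s) (hsT : s ≤ T) : exp (-(β * T)) * s ≤ vth β s :=
  le_trans (by gcongr) (mul_exp_le_vth hβ hs)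

lemma le_R (hβ : 0 ≤ β) (hγ : 0 ≤ γ) (hσ : 0 ≤ σ) {t : ℝ} (ht : 0 ≤ t) : 2 * α * t ≤ ℛ t := by
  have hd : ∀ s, HasDerivAt (fun s => ℛ s - 2 * α * s) (2 * (2 * γ * vth β s + σ * vth β s ^ 2)) s := fun s =>
    ((hasDerivAt_R α β γ σ s).sub ((hasDerivAt_id s).const_mul (2 * α))).congr_deriv (by ring)
  have hm : MonotoneOn (fun s => ℛ s - 2 * α * s) (Ici 0) := by
    refine monotoneOn_of_deriv_nonneg (convex_Ici 0) (fun s _ => (hd s).continuousAt.continuousWithinAt)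
      (fun s _ => (hd s).differentiableAt.differentiableWithinAt) fun s hs => ?_
    rw [(hd s).deriv]; have := vth_nonneg hβ (interior_subset hs : (0 : ℝ) ≤ s); positivity
  have := hm self_mem_Ici ht ht; simp only [R_zero] at this; linarith

lemma R_mono (hα : 0 ≤ α) (hβ : 0 ≤ β) (hγ : 0 ≤ γ) (hσ : 0 ≤ σ) : MonotoneOn ℛ (Ici 0) := by
  refine monotoneOn_of_deriv_nonneg (convex_Ici 0) (continuous_R α β γ σ).continuousOn
    (fun s _ => (hasDerivAt_R α β γ σ s).differentiableAt.differentiableWithinAt) fun s hs => ?_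
  rw [(hasDerivAt_R α β γ σ s).deriv]; have := vth_nonneg hβ (interior_subset hs : (0 : ℝ) ≤ s); positivity

lemma R_nonneg (hα : 0 ≤ α) (hβ : 0 ≤ β) (hγ : 0 ≤ γ) (hσ : 0 ≤ σ) {t : ℝ} (ht : 0 ≤ t) : 0 ≤ ℛ t :=
  le_trans (by positivity) (le_R hβ hγ hσ ht)

lemma R_pos (hα : 0 < α) (hβ : 0 ≤ β) (hγ : 0 ≤ γ) (hσ : 0 ≤ σ) {t : ℝ} (ht : 0 < t) : 0 < ℛ t :=
  lt_of_lt_of_le (by positivity) (le_R hβ hγ hσ ht.le)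

/-- The position–velocity covariance. -/
noncomputable def covQ (β γ σ t : ℝ) : ℝ := 2 * γ * vth β t + σ * vth β t ^ 2

/-- The velocity variance. -/
noncomputable def covP (β σ t : ℝ) : ℝ := σ * (2 * vth β t - β * vth β t ^ 2)

lemma hasDerivAt_covQ (β γ σ t : ℝ) :
    HasDerivAt (covQ β γ σ) (2 * γ * exp (-(β * t)) + 2 * σ * vth β t * exp (-(β * t))) t := by
  unfold covQ
  refine (((hasDerivAt_vth β t).const_mul (2 * γ)).add (((hasDerivAt_vth β t).fun_pow 2).const_mul σ)).congr_deriv ?_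
  simp; ring

lemma hasDerivAt_covP (β σ t : ℝ) : HasDerivAt (covP β σ) (2 * σ * exp (-(β * t)) ^ 2) t := by
  unfold covP
  refine ((((hasDerivAt_vth β t).const_mul 2).sub (((hasDerivAt_vth β t).fun_pow 2).const_mul β)).const_mul σ).congr_deriv ?_
  have := exp_eq_one_sub_vth β t; simp only [Nat.cast_ofNat, Nat.add_one_sub_one, pow_one]
  linear_combination (2 * σ * exp (-(β * t))) * (-this)

lemma covP_nonneg (hβ : 0 ≤ β) (hσ : 0 ≤ σ) {t : ℝ} (ht : 0 ≤ t) : 0 ≤ covP β σ t := by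
  unfold covP; have h1 := exp_eq_one_sub_vth β t; have h2 := exp_pos (-(β * t)); have h3 := vth_nonneg hβ ht
  have : 0 ≤ 2 * vth β t - β * vth β t ^ 2 := by nlinarith
  positivity

lemma covQ_sq_le (hβ : 0 ≤ β) (hσ : 0 < σ) (hell : γ ^ 2 < α * σ) {t : ℝ} (ht : 0 ≤ t) :
    covQ β γ σ t ^ 2 ≤ ℛ t * covP β σ t := by
  have key : ∀ l : ℝ, 0 ≤ ℛ t + 2 * l * covQ β γ σ t + l ^ 2 * covP β σ t := by
    intro l
    have hd : ∀ s, HasDerivAt (fun s => ℛ s + 2 * l * covQ β γ σ s + l ^ 2 * covP β σ s)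
        (2 * (α + 2 * γ * (vth β s + l * exp (-(β * s))) + σ * (vth β s + l * exp (-(β * s))) ^ 2)) s := fun s =>
      (((hasDerivAt_R α β γ σ s).add ((hasDerivAt_covQ β γ σ s).const_mul (2 * l))).add
        ((hasDerivAt_covP β σ s).const_mul (l ^ 2))).congr_deriv (by ring)
    have hm : MonotoneOn (fun s => ℛ s + 2 * l * covQ β γ σ s + l ^ 2 * covP β σ s) (Ici 0) := by
      refine monotoneOn_of_deriv_nonneg (convex_Ici 0) (fun s _ => (hd s).continuousAt.continuousWithinAt)
        (fun s _ => (hd s).differentiableAt.differentiableWithinAt) fun s hs => ?_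
      rw [(hd s).deriv]; set q := vth β s + l * exp (-(β * s))
      have : 0 ≤ σ * (α + 2 * γ * q + σ * q ^ 2) := by nlinarith [sq_nonneg (σ * q + γ)]
      have := nonneg_of_mul_nonneg_right this hσ; linarith
    have := hm self_mem_Ici ht ht; simp only [R_zero, covQ, covP, vth_zero] at this; simpa [covQ, covP] using this
  have := discrim_le_zero (a := covP β σ t) (b := 2 * covQ β γ σ t) (c := ℛ t) fun l => by
    have := key l; nlinarith
  rw [discrim] at this; nlinarith

lemma exists_bound_gauss_params (hβ : 0 ≤ β) (t : ℝ) (b : ℝ) :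
    ∃ κ : ℝ, 1 ≤ κ ∧ b ≤ κ ∧ (∀ s ∈ Icc 0 t, 0 ≤ vth β s ∧ vth β s ≤ κ) ∧
      (∀ s ∈ Icc 0 t, 0 ≤ exp (-(β * s)) ∧ exp (-(β * s)) ≤ κ) := by
  refine ⟨max 1 (max b t), le_max_left _ _, (le_max_left _ _).trans (le_max_right _ _),
    fun s hs => ⟨vth_nonneg hβ hs.1, ?_⟩, fun s hs => ⟨(exp_pos _).le, ?_⟩⟩
  · exact (vth_le hβ).trans (hs.2.trans ((le_max_right _ _).trans (le_max_right _ _)))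
  · refine le_trans (Real.exp_le_one_iff.2 ?_) (le_max_left _ _); have := mul_nonneg hβ hs.1; linarith

lemma gaussData_position (hα : 0 ≤ α) (hβ : 0 ≤ β) (hγ : 0 ≤ γ) (hσ : 0 ≤ σ) {ε t : ℝ} (hε : 0 < ε) (ht : 0 ≤ t) :
    ∃ κ, IsGaussData α β γ σ t κ (ℛ t + ε) (vth β) (fun s => exp (-(β * s)))
      (fun s => (ℛ s + ε)⁻¹) (fun _ => 0) (fun _ => 0) (fun s => 3 / 2 * log (ℛ s + ε)) := by
  have hpos : ∀ s ∈ Icc 0 t, 0 < ℛ s + ε := fun s hs => by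
    have := R_nonneg hα hβ hγ hσ hs.1; linarith
  obtain ⟨κ, h1, h2, h3, h4⟩ := exists_bound_gauss_params hβ t (max ε⁻¹ (-(3 / 2 * log ε)))
  refine ⟨κ, h1, hpos t ⟨ht, le_rfl⟩, exp_eq_one_sub_vth β, fun s _ => hasDerivAt_vth β s, ?_, ?_, ?_, ?_, ?_, ?_, ?_, ?_, h3, h4, ?_⟩
  · intro s hs; refine (((hasDerivAt_R α β γ σ s).add_const ε).inv (hpos s hs).ne').congr_deriv ?_
    have := (hpos s hs).ne'; field_simp; ring
  · intro s hs; exact (hasDerivAt_const s 0).congr_deriv (by ring)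
  · intro s hs; exact (hasDerivAt_const s 0).congr_deriv (by ring)
  · intro s hs; refine ((((hasDerivAt_R α β γ σ s).add_const ε).log (hpos s hs).ne').const_mul (3 / 2)).congr_deriv ?_
    have := (hpos s hs).ne'; field_simp; ring
  · intro s hs; refine ⟨(inv_pos.2 (hpos s hs)).le, le_trans ?_ ((le_max_left _ _).trans h2)⟩
    apply inv_anti₀ hε; linarith [R_nonneg hα hβ hγ hσ hs.1]
  · intro s _; exact ⟨le_rfl, by linarith⟩
  · intro s _; simp
  · intro s hs; have h5 : -(3 / 2 * log ε) ≤ κ := (le_max_right _ _).trans h2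
    have h6 : log ε ≤ log (ℛ s + ε) := Real.log_le_log hε (by linarith [R_nonneg hα hβ hγ hσ hs.1]); linarith
  · intro s hs a b; simp only [qform, mul_zero, zero_mul, add_zero]; rw [div_eq_inv_mul]; have := hpos s hs
    have hmono := R_mono hα hβ hγ hσ hs.1 ht hs.2; gcongr

lemma qform_inverse {p q r : ℝ} (hr : 0 < r) (hD : 0 < r * p - q ^ 2) (a b : E3) :
    qform (p / (r * p - q ^ 2)) (-q / (r * p - q ^ 2)) (r / (r * p - q ^ 2)) a b =
      ‖a‖ ^ 2 / r + ‖b - (q / r) • a‖ ^ 2 / ((r * p - q ^ 2) / r) := by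
  rw [qform, norm_sub_sq_real, inner_smul_right, norm_smul, mul_pow, Real.norm_eq_abs, sq_abs, real_inner_comm]
  set D := r * p - q ^ 2 with hDdef
  have : p = (D + q ^ 2) / r := by rw [hDdef]; field_simp; ring
  rw [this]; field_simp; ring

/-- The determinant of the regularized covariance matrix. -/
noncomputable def covD (α β γ σ ε s : ℝ) : ℝ := (R α β γ σ s + ε) * (covP β σ s + ε) - covQ β γ σ s ^ 2

lemma covD_ge (hβ : 0 ≤ β) (hσ : 0 < σ) (hell : γ ^ 2 < α * σ) {ε s : ℝ} (hs : 0 ≤ s) :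
    ε * (ε + ℛ s + covP β σ s) ≤ covD α β γ σ ε s := by
  have := covQ_sq_le (α := α) hβ hσ hell hs; rw [covD]; nlinarith

lemma covD_pos (hα : 0 ≤ α) (hβ : 0 ≤ β) (hγ : 0 ≤ γ) (hσ : 0 < σ) (hell : γ ^ 2 < α * σ) {ε s : ℝ} (hε : 0 < ε)
    (hs : 0 ≤ s) : 0 < covD α β γ σ ε s := by
  refine lt_of_lt_of_le ?_ (covD_ge hβ hσ hell hs)
  have := R_nonneg hα hβ hγ hσ.le hs; have := covP_nonneg hβ hσ.le hs; positivity

lemma gaussData_phase (hα : 0 ≤ α) (hβ : 0 ≤ β) (hγ : 0 ≤ γ) (hσ : 0 < σ) (hell : γ ^ 2 < α * σ) {ε t : ℝ}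
    (hε : 0 < ε) (ht : 0 ≤ t) :
    ∃ κ, IsGaussData α β γ σ t κ (ℛ t + ε) (vth β) (fun s => exp (-(β * s)))
      (fun s => (covP β σ s + ε) / covD α β γ σ ε s) (fun s => -covQ β γ σ s / covD α β γ σ ε s)
      (fun s => (ℛ s + ε) / covD α β γ σ ε s) (fun s => 3 / 2 * log (covD α β γ σ ε s)) := by
  have hR0 : ∀ s ∈ Icc 0 t, 0 ≤ ℛ s := fun s hs => R_nonneg hα hβ hγ hσ.le hs.1
  have hP0 : ∀ s ∈ Icc 0 t, 0 ≤ covP β σ s := fun s hs => covP_nonneg hβ hσ.le hs.1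
  have hD' : ∀ s ∈ Icc 0 t, _ := fun s hs => covD_ge (ε := ε) hβ hσ hell hs.1
  have hDp : ∀ s ∈ Icc 0 t, 0 < covD α β γ σ ε s := fun s hs => covD_pos hα hβ hγ hσ hell hε hs.1
  obtain ⟨κ, h1, h2, h3, h4⟩ := exists_bound_gauss_params hβ t (max ε⁻¹ (-(3 / 2 * log (ε * ε))))
  have dR := fun s => (hasDerivAt_R α β γ σ s).add_const ε; have dP := fun s => (hasDerivAt_covP β σ s).add_const ε
  have dQ := hasDerivAt_covQ β γ σ
  have dD := fun s : ℝ => show HasDerivAt (covD α β γ σ ε) _ s from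
    (((dR s).mul (dP s)).sub ((dQ s).fun_pow 2)).congr_deriv (by simp only [Nat.cast_ofNat, Nat.add_one_sub_one, pow_one]; rfl)
  have hb : ∀ s ∈ Icc 0 t, ∀ a, 0 ≤ a → a ≤ ε + ℛ s + covP β σ s →
      0 ≤ a / covD α β γ σ ε s ∧ a / covD α β γ σ ε s ≤ κ := fun s hs a ha h => by
    have := hDp s hs; refine ⟨by positivity, le_trans ?_ ((le_max_left _ _).trans h2)⟩
    rw [div_le_iff₀ this, inv_mul_eq_div, le_div_iff₀ hε]; exact le_trans (by nlinarith) (hD' s hs)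
  refine ⟨κ, h1, by have := hR0 t ⟨ht, le_rfl⟩; linarith, exp_eq_one_sub_vth β, fun s _ => hasDerivAt_vth β s,
    fun s hs => ?_, fun s hs => ?_, fun s hs => ?_, fun s hs => ?_, fun s hs => ?_, fun s hs => ?_, fun s hs => ?_,
    fun s hs => ?_, h3, h4, fun s hs a b => ?_⟩ <;> have h0 := (hDp s hs).ne'
  · refine ((dP s).div (dD s) h0).congr_deriv ?_; field_simp; rw [covD]; ring
  · refine ((dQ s).neg.div (dD s) h0).congr_deriv ?_; simp only [Pi.neg_apply]
    field_simp; rw [covD]; ring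
  · refine ((dR s).div (dD s) h0).congr_deriv ?_; field_simp; rw [covD]; ring
  · refine (((dD s).log h0).const_mul (3 / 2)).congr_deriv ?_; field_simp; ring
  · have := hR0 s hs; have := hP0 s hs; exact hb s hs _ (by linarith) (by linarith)
  · have := hR0 s hs; have := hP0 s hs; exact hb s hs _ (by linarith) (by linarith)
  · have := hDp s hs; rw [div_pow, div_mul_div_comm, ← sq]
    gcongr; rw [covD] at this; linarith
  · have h6 : log (ε * ε) ≤ log (covD α β γ σ ε s) := by
      refine Real.log_le_log (by positivity) (le_trans ?_ (hD' s hs)); have := hR0 s hs; have := hP0 s hs; nlinarith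
    linarith [(le_max_right _ _).trans h2]
  · have h5 := hDp s hs
    have h6 : 0 < ℛ s + ε := by linarith [hR0 s hs]
    simp only [covD] at h5 ⊢; rw [qform_inverse h6 h5]; have hmono := R_mono hα hβ hγ hσ.le hs.1 ht hs.2
    exact (show ‖a‖ ^ 2 / (ℛ t + ε) ≤ ‖a‖ ^ 2 / (ℛ s + ε) by gcongr).trans
      (le_add_of_nonneg_right (by positivity))

lemma gauss_eq_exp {r : ℝ} (hr : 0 < r) (x : E3) :
    gauss r x = (2 * π) ^ (-(3 / 2 : ℝ)) * exp (-(‖x‖ ^ 2 / r / 2 + 3 / 2 * log r)) := by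
  rw [gauss, Real.rpow_def_of_pos hr, neg_add, exp_add]
  have e1 : ‖x‖ ^ 2 / r / 2 = ‖x‖ ^ 2 / (2 * r) := by rw [div_div]; ring_nf
  have e2 : log r * -(3 / 2) = -(3 / 2 * log r) := by ring
  rw [e1, e2]; ring

/-- The position marginal of the semigroup, tested with a Gaussian. -/
lemma integral_semigroup_mul_gauss (hα : 0 ≤ α) (hβ : 0 ≤ β) (hγ : 0 ≤ γ) (hσ : 0 ≤ σ)
    {S : ℝ → X →L[ℝ] X} (hS : IsWFPSemigroup α β γ σ S) (u : X) {ε t : ℝ} (hε : 0 < ε) (ht : 0 ≤ t) (y : E3) :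
    ∫ z, S t u z * gauss ε (z.1 - y) = ∫ z, u z * gauss (ℛ t + ε) (z.1 + vth β t • z.2 - y) := by
  obtain ⟨κ, H⟩ := gaussData_position hα hβ hγ hσ hε ht; have h := (H.isBackward y 0).integral_eq hα hβ hγ hσ ht hS u
  have hpos : 0 < ℛ t + ε := by linarith [R_nonneg hα hβ hγ hσ ht]
  simp only [gaussFam, qform, vth_zero, R_zero, zero_smul, add_zero, zero_add, mul_zero, zero_mul] at h
  simp only [gauss_eq_exp hε, gauss_eq_exp hpos]
  simp only [mul_left_comm _ ((2 * π) ^ (-(3 / 2) : ℝ)), integral_const_mul]; congr 1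
  simpa only [div_eq_inv_mul _ ε, div_eq_inv_mul _ (ℛ t + ε)] using h

/-- The semigroup tested with a Gaussian in phase space. -/
lemma integral_semigroup_mul_gauss_mul_gauss (hα : 0 ≤ α) (hβ : 0 ≤ β) (hγ : 0 ≤ γ) (hσ : 0 < σ) (hell : γ ^ 2 < α * σ)
    {S : ℝ → X →L[ℝ] X} (hS : IsWFPSemigroup α β γ σ S) {ε t : ℝ} (hε : 0 < ε) (ht : 0 ≤ t) :
    ∃ r d q : ℝ, 0 < r ∧ 0 < d ∧ ∀ (u : X) (y : Phase), ∫ z, S t u z * (gauss ε (z.1 - y.1) * gauss ε (z.2 - y.2)) =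
        ∫ z, u z * (gauss r (z.1 + vth β t • z.2 - y.1) *
          gauss d ((exp (-(β * t)) • z.2 - y.2) - q • (z.1 + vth β t • z.2 - y.1))) := by
  obtain ⟨κ, H⟩ := gaussData_phase hα hβ hγ hσ hell hε ht; set r := ℛ t + ε
  set p := covP β σ t + ε; set D := r * p - covQ β γ σ t ^ 2 with hD
  have hr0 : 0 < r := by linarith [R_nonneg hα hβ hγ hσ.le ht]
  have hD0 : 0 < D := covD_pos hα hβ hγ hσ hell hε ht
  have hd0 : 0 < D / r := by positivity
  refine ⟨r, D / r, covQ β γ σ t / r, hr0, hd0, fun u y => ?_⟩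
  have h := (H.isBackward y.1 y.2).integral_eq hα hβ hγ hσ.le ht hS u
  have cQ0 : covQ β γ σ 0 = 0 := by simp [covQ, vth_zero]
  have cP0 : covP β σ 0 = 0 := by simp [covP, vth_zero]
  simp only [gaussFam, covD, R_zero, cQ0, cP0, zero_add, vth_zero, zero_smul, add_zero, mul_zero, neg_zero, Real.exp_zero, one_smul] at h
  have key : ∀ a b : E3, gauss r a * gauss (D / r) (b - (covQ β γ σ t / r) • a) = ((2 * π) ^ (-(3 / 2 : ℝ))) ^ 2 *
      exp (-(qform (p / D) (-covQ β γ σ t / D) (r / D) a b / 2 + 3 / 2 * log D)) := by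
    intro a b
    rw [gauss_eq_exp hr0, gauss_eq_exp hd0, qform_inverse hr0 hD0, mul_mul_mul_comm, ← sq, ← exp_add,
      Real.log_div hD0.ne' hr0.ne']
    congr 2; ring
  have key0 : ∀ a b : E3, gauss ε a * gauss ε b = ((2 * π) ^ (-(3 / 2 : ℝ))) ^ 2 *
      exp (-(qform (ε / (ε * ε - 0 ^ 2)) (0 / (ε * ε - 0 ^ 2)) (ε / (ε * ε - 0 ^ 2)) a b / 2 + 3 / 2 * log (ε * ε - 0 ^ 2))) := by
    intro a b; rw [gauss_eq_exp hε, gauss_eq_exp hε, mul_mul_mul_comm, ← sq, ← exp_add]; congr 2; rw [qform]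
    simp only [ne_eq, OfNat.ofNat_ne_zero, not_false_eq_true, zero_pow, sub_zero, zero_div, mul_zero, zero_mul, add_zero]
    rw [Real.log_mul hε.ne' hε.ne']; field_simp; ring
  simp only [key, key0]; simp only [mul_left_comm _ (((2 * π) ^ (-(3 / 2) : ℝ)) ^ 2), integral_const_mul, h]
  rfl

end Coefficients

section Average

variable {V : Type*} [NormedAddCommGroup V] [MeasurableSpace V] [BorelSpace V] [NormedSpace ℝ V]
  [FiniteDimensional ℝ V] {μ : Measure V}

lemma enorm_average_sub_le {ρ : V → ℝ} (hρ : Measurable ρ) (h0 : ∀ y, 0 ≤ ρ y)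
    (h1 : ∫⁻ y, ofReal (ρ y) ∂μ = 1) {h : V → ℝ} (hm : Measurable h) (x : V) :
    ‖(∫ y, ρ y * h (x - y) ∂μ) - h x‖ₑ ≤ ∫⁻ y, ofReal (ρ y) * ‖h (x - y) - h x‖ₑ ∂μ := by
  have hρi : Integrable ρ μ := by
    refine ⟨hρ.aestronglyMeasurable, ?_⟩
    simp_rw [HasFiniteIntegral, enorm_of_nonneg (h0 _), h1]; exact ENNReal.one_lt_top
  have hρ1 : ∫ y, ρ y ∂μ = 1 := by
    rw [integral_eq_lintegral_of_nonneg_ae (of_forall h0) hρ.aestronglyMeasurable, h1]; rfl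
  have e1 : ∀ y, ofReal (ρ y) * ‖h (x - y) - h x‖ₑ = ‖ρ y * (h (x - y) - h x)‖ₑ := fun y => by
    rw [enorm_mul, enorm_of_nonneg (h0 y)]
  simp_rw [e1]
  by_cases hi : Integrable (fun y => ρ y * (h (x - y) - h x)) μ
  · have hi2 : Integrable (fun y => ρ y * h (x - y)) μ :=
      (hi.add (hρi.mul_const (h x))).congr (of_forall fun y => by simp only [Pi.add_apply]; ring)
    have : (∫ y, ρ y * h (x - y) ∂μ) - h x = ∫ y, ρ y * (h (x - y) - h x) ∂μ := by
      simp_rw [mul_sub]; rw [integral_sub hi2 (hρi.mul_const _), integral_mul_const, hρ1, one_mul]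
    rw [this]; exact enorm_integral_le_lintegral_enorm _
  · have : ∫⁻ y, ‖ρ y * (h (x - y) - h x)‖ₑ ∂μ = ∞ := by
      by_contra hne; exact hi ⟨by fun_prop, lt_top_iff_ne_top.2 hne⟩
    rw [this]; exact le_top

end Average

/-- A sequence of variances tending to `0`. -/
noncomputable def eps (n : ℕ) : ℝ := (1 / ((n : ℝ) + 1)) ^ 2

lemma eps_pos (n : ℕ) : 0 < eps n := by unfold eps; positivity

lemma lintegral_gauss_mul_norm_lt_top : ∫⁻ y : E3, ofReal (gauss 1 y) * ‖y‖ₑ < ∞ := by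
  have h := ((integrable_norm_mul_exp (b := 1 / (2 * 1)) (by norm_num)).const_mul
    ((1 : ℝ) ^ (-(3 / 2 : ℝ)) * (2 * π) ^ (-(3 / 2 : ℝ)))).2
  refine lt_of_eq_of_lt (lintegral_congr fun y => ?_) h
  rw [← enorm_of_nonneg (gauss_pos one_pos y).le, ← enorm_norm y, ← enorm_mul, gauss_eq]; congr 1; ring

lemma gauss_smul {s : ℝ} (hs : 0 < s) (y : E3) : s ^ 3 * gauss (s ^ 2) (s • y) = gauss 1 y := by
  rw [gauss_eq, gauss_eq, norm_smul, norm_of_nonneg hs.le, ← Real.rpow_natCast s 2, ← Real.rpow_natCast s 3,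
    ← Real.rpow_mul hs.le, Real.one_rpow, ← mul_assoc, ← mul_assoc, ← rpow_add hs]
  norm_num; exact Or.inl (by field_simp)

lemma lintegral_gauss_sq_mul_norm {s : ℝ} (hs : 0 < s) : ∫⁻ y : E3, ofReal (gauss (s ^ 2) y) * ‖y‖ₑ =
    ofReal s * ∫⁻ y : E3, ofReal (gauss 1 y) * ‖y‖ₑ := by
  rw [lintegral_comp_smul _ hs, ← lintegral_const_mul' _ _ (by finiteness), ← lintegral_const_mul' _ _ (by finiteness)]
  refine lintegral_congr fun y => ?_
  rw [← gauss_smul hs y, ofReal_mul (by positivity), enorm_smul, enorm_of_nonneg hs.le]; ring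

lemma tendsto_lintegral_gauss_mul_norm :
    Tendsto (fun n => ∫⁻ y : E3, ofReal (gauss (eps n) y) * ‖y‖ₑ) atTop (𝓝 0) := by
  have h1 : Tendsto (fun n : ℕ => ofReal (1 / ((n : ℝ) + 1))) atTop (𝓝 0) := by
    simpa [Function.comp_def] using (ENNReal.continuous_ofReal.tendsto 0).comp tendsto_one_div_add_atTop_nhds_zero_nat
  have h2 := ENNReal.Tendsto.mul_const (b := ∫⁻ y : E3, ofReal (gauss 1 y) * ‖y‖ₑ) h1
    (Or.inr lintegral_gauss_mul_norm_lt_top.ne)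
  rw [zero_mul] at h2; refine h2.congr fun n => (lintegral_gauss_sq_mul_norm (by positivity)).symm

lemma lintegral_gauss_prod {r s : ℝ} (hr : 0 < r) (hs : 0 < s) :
    ∫⁻ y : Phase, ofReal (gauss r y.1 * gauss s y.2) = 1 := by
  simp_rw [ofReal_mul (gauss_pos hr _).le]
  rw [volume_eq_prod, lintegral_prod_mul (continuous_gauss r).measurable.ennreal_ofReal.aemeasurable
    (continuous_gauss s).measurable.ennreal_ofReal.aemeasurable, lintegral_gauss hr, lintegral_gauss hs, one_mul]

lemma tendsto_lintegral_gauss_prod_mul_norm :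
    Tendsto (fun n => ∫⁻ y : Phase, ofReal (gauss (eps n) y.1 * gauss (eps n) y.2) * ‖y‖ₑ) atTop (𝓝 0) := by
  have h := tendsto_lintegral_gauss_mul_norm.add tendsto_lintegral_gauss_mul_norm; rw [add_zero] at h
  refine tendsto_of_tendsto_of_tendsto_of_le_of_le tendsto_const_nhds h (fun _ => zero_le) fun n => ?_
  have hm : Measurable fun y : E3 => ofReal (gauss (eps n) y) := (continuous_gauss _).measurable.ennreal_ofReal
  calc _ ≤ ∫⁻ y : Phase, (ofReal (gauss (eps n) y.1) * ‖y.1‖ₑ * ofReal (gauss (eps n) y.2) +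
        ofReal (gauss (eps n) y.1) * (ofReal (gauss (eps n) y.2) * ‖y.2‖ₑ)) := by
        refine lintegral_mono fun y => ?_
        have : ‖y‖ₑ ≤ ‖y.1‖ₑ + ‖y.2‖ₑ := by
          rw [← enorm_norm y, ← enorm_norm y.1, ← enorm_norm y.2]; simp_rw [enorm_of_nonneg (norm_nonneg _)]
          rw [← ofReal_add (norm_nonneg _) (norm_nonneg _)]
          exact ofReal_le_ofReal (by rw [Prod.norm_def]; exact max_le_add_of_nonneg (norm_nonneg _) (norm_nonneg _))
        simp only [ofReal_mul (gauss_pos (eps_pos n) _).le]; refine (mul_le_mul_right this _).trans (le_of_eq ?_)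
        ring
    _ = _ := by
      rw [volume_eq_prod, lintegral_add_left (by fun_prop),
        lintegral_prod_mul (f := fun y => ofReal (gauss (eps n) y) * ‖y‖ₑ) (by fun_prop) hm.aemeasurable,
        lintegral_prod_mul (g := fun y => ofReal (gauss (eps n) y) * ‖y‖ₑ) hm.aemeasurable
          (by fun_prop), lintegral_gauss (eps_pos n)]
      ring

/-- The convolution of `ψ` with the Gaussian of variance `r`. -/
noncomputable def conv (r : ℝ) (ψ : E3 → ℝ) (x : E3) : ℝ := ∫ y, gauss r (x - y) * ψ y

lemma measurable_conv (r : ℝ) {ψ : E3 → ℝ} (hψ : Measurable ψ) : Measurable (conv r ψ) := by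
  have := continuous_gauss r
  exact (integral_prod_right' (f := fun p : E3 × E3 => gauss r (p.1 - p.2) * ψ p.2) (by fun_prop)).measurable

lemma conv_eq (r : ℝ) (ψ : E3 → ℝ) (x : E3) : conv r ψ x = ∫ y, gauss r y * ψ (x - y) := by
  rw [← integral_sub_left_eq_self (fun y => gauss r y * ψ (x - y)) volume x]; simp only [sub_sub_cancel]; rfl

lemma enorm_conv_le {r : ℝ} (hr : 0 < r) (ψ : E3 → ℝ) (x : E3) :
    ‖conv r ψ x‖ₑ ≤ ∫⁻ y, ofReal (gauss r y) * ‖ψ (x - y)‖ₑ := by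
  rw [conv_eq]; refine (enorm_integral_le_lintegral_enorm _).trans (le_of_eq (lintegral_congr fun y => ?_))
  rw [enorm_mul, enorm_of_nonneg (gauss_pos hr y).le]

lemma lintegral_average_rpow_le {r : ℝ} (hr : 0 < r) {f : E3 → ℝ≥0∞} (hf : Measurable f) {p : ℝ} (hp : 1 < p) :
    ∫⁻ x, (∫⁻ y, ofReal (gauss r y) * f (x - y)) ^ p ≤ ∫⁻ x, f x ^ p := by
  have hg := (continuous_gauss r).measurable
  calc _ ≤ ∫⁻ x, ∫⁻ y, ofReal (gauss r y) * f (x - y) ^ p :=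
        lintegral_mono fun x => lintegral_mul_rpow_le hg.ennreal_ofReal (by fun_prop) (lintegral_gauss hr) hp
    _ = ∫⁻ y, ∫⁻ x, ofReal (gauss r y) * f (x - y) ^ p :=
        lintegral_swap (by fun_prop)
    _ = ∫⁻ y, ofReal (gauss r y) * ∫⁻ x, f x ^ p := by
      congr 1; ext y; rw [lintegral_const_mul _ (by fun_prop), lintegral_sub_right_eq_self (fun x => f x ^ p) y]
    _ = _ := by rw [lintegral_mul_const _ hg.ennreal_ofReal, lintegral_gauss hr, one_mul]

lemma lintegral_conv_rpow_le {r : ℝ} (hr : 0 < r) {ψ : E3 → ℝ} (hψ : Measurable ψ) {p : ℝ} (hp : 1 < p) :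
    ∫⁻ x, ‖conv r ψ x‖ₑ ^ p ≤ ∫⁻ x, ‖ψ x‖ₑ ^ p :=
  (lintegral_mono fun x => rpow_le_rpow (enorm_conv_le hr ψ x) (by linarith)).trans
    (lintegral_average_rpow_le hr hψ.enorm hp)

lemma memLp_conv {r : ℝ} (hr : 0 < r) {ψ : E3 → ℝ} (hψ : Measurable ψ) (h2 : MemLp ψ 2) : MemLp (conv r ψ) 2 := by
  refine memLp_two_of_lintegral (measurable_conv r hψ).aestronglyMeasurable ?_
  have := lintegral_conv_rpow_le hr hψ (p := 2) (by norm_num); simp only [rpow_two] at this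
  exact this.trans_lt (lintegral_sq_lt_top h2)

lemma memLp_gauss {r : ℝ} (hr : 0 < r) : MemLp (gauss r) 2 := by
  refine (memLp_two_iff_integrable_sq (continuous_gauss r).aestronglyMeasurable).2 ?_
  refine ((integrable_gauss hr).const_mul (r ^ (-(3 / 2 : ℝ)))).mono' (by have := continuous_gauss r; fun_prop)
    (of_forall fun y => ?_)
  rw [norm_of_nonneg (sq_nonneg _), sq]; exact mul_le_mul_of_nonneg_right (gauss_le hr y) (gauss_pos hr y).le

lemma integrable_gauss_mul {r : ℝ} (hr : 0 < r) {ψ : E3 → ℝ} (hψ : MemLp ψ 2) (x : E3) :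
    Integrable fun y => gauss r (x - y) * ψ y :=
  MemLp.integrable_mul (p := 2) (q := 2) ((memLp_gauss hr).comp_measurePreserving (measurePreserving_sub_left x)) hψ

lemma lintegral_mul_gauss_le (u : X) (θ : ℝ) {r : ℝ} (hr : 0 < r) {ψ : E3 → ℝ} (hψ : Measurable ψ) :
    ∫⁻ p : E3 × Phase, ‖ψ p.1 * (u p.2 * gauss r (p.2.1 + θ • p.2.2 - p.1))‖ₑ ≤
      ‖u‖ₑ * ((∫⁻ x, ‖ψ x‖ₑ ^ 2) * wtInt) ^ (1 / 2 : ℝ) := by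
  have hg := (continuous_gauss r).measurable; have hu := measurable_coe u
  set A : E3 → ℝ≥0∞ := fun x => ∫⁻ y, ofReal (gauss r y) * ‖ψ (x - y)‖ₑ
  have hA : Measurable A := lintegral_prod_right'
    (f := fun p : E3 × E3 => ofReal (gauss r p.2) * ‖ψ (p.1 - p.2)‖ₑ) (by fun_prop)
  rw [volume_eq_prod, lintegral_prod_symm _ (by fun_prop)]
  calc _ = ∫⁻ z : Phase, ‖u z‖ₑ * A (z.1 + θ • z.2) := by
        refine lintegral_congr fun z => ?_
        rw [← lintegral_const_mul' _ _ enorm_ne_top,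
          ← lintegral_sub_left_eq_self (fun y => ‖u z‖ₑ * _) (z.1 + θ • z.2)]
        refine lintegral_congr fun y => ?_
        rw [enorm_mul, enorm_mul, sub_sub_cancel, enorm_of_nonneg (gauss_pos hr _).le]; ring
    _ ≤ _ := lintegral_mul_comp_shear_le u θ hA
    _ ≤ _ := by
      have := lintegral_average_rpow_le hr hψ.enorm (p := 2) (by norm_num); simp only [rpow_two] at this; gcongr

lemma integral_mul_conv (u : X) (θ : ℝ) {r : ℝ} (hr : 0 < r) {ψ : E3 → ℝ} (hψ : Measurable ψ) (h2 : MemLp ψ 2) :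
    Integrable (fun p : E3 × Phase => ψ p.1 * (u p.2 * gauss r (p.2.1 + θ • p.2.2 - p.1))) ∧
    ∫ y, ψ y * ∫ z, u z * gauss r (z.1 + θ • z.2 - y) = ∫ z, u z * conv r ψ (z.1 + θ • z.2) := by
  have hg := (continuous_gauss r).measurable; have hu := measurable_coe u
  have hi : Integrable (fun p : E3 × Phase => ψ p.1 * (u p.2 * gauss r (p.2.1 + θ • p.2.2 - p.1))) :=
    ⟨by fun_prop, (lintegral_mul_gauss_le u θ hr hψ).trans_lt (mul_lt_top enorm_lt_top
      (rpow_lt_top_of_nonneg (by norm_num) (mul_lt_top (lintegral_sq_lt_top h2) wtInt_lt_top).ne))⟩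
  refine ⟨hi, ?_⟩; simp_rw [← integral_const_mul]; rw [integral_integral_swap hi]; refine integral_congr fun z => ?_
  simp only [conv]; rw [← integral_const_mul]; exact integral_congr (fun y => by ring)

lemma conv_conv {r s : ℝ} (hr : 0 < r) (hs : 0 < s) {ψ : E3 → ℝ} (hψ : Measurable ψ) (h2 : MemLp ψ 2) (x : E3) :
    conv r (conv s ψ) x = conv (r + s) ψ x := by
  have hgr := (continuous_gauss r).measurable; have hgs := (continuous_gauss s).measurable
  have habs : MemLp (fun y => |ψ y|) 2 := h2.norm
  have hi : Integrable (uncurry fun y z => gauss r (x - y) * (gauss s (y - z) * ψ z)) (volume.prod volume) := by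
    refine (integrable_prod_iff (by unfold uncurry; fun_prop)).2
      ⟨of_forall fun y => (integrable_gauss_mul hs h2 y).const_mul (gauss r (x - y)), ?_⟩
    refine (integrable_gauss_mul hr (memLp_conv hs (by fun_prop) habs) x).congr (of_forall fun y => ?_)
    simp only [uncurry, conv]; rw [← integral_const_mul]
    refine integral_congr fun z => ?_; simp [abs_of_pos (gauss_pos hr _), abs_of_pos (gauss_pos hs _)]
  calc conv r (conv s ψ) x = ∫ y, ∫ z, gauss r (x - y) * (gauss s (y - z) * ψ z) := by
        simp_rw [integral_const_mul]; rfl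
    _ = ∫ z, ∫ y, gauss r (x - y) * (gauss s (y - z) * ψ z) := integral_integral_swap hi
    _ = ∫ z, gauss (r + s) (x - z) * ψ z := by
      refine integral_congr fun z => ?_; simp_rw [← mul_assoc]
      rw [integral_mul_const, ← gauss_add hr hs,
        ← integral_sub_right_eq_self (fun y => gauss r (x - z - y) * gauss s y) z]
      simp only [sub_sub_sub_cancel_right]

/-- Gaussian averages converge when tested against an element of `X`. -/
lemma tendsto_integral_mul_conv (u : X) (θ : ℝ) {ψ : E3 → ℝ} (hψ : Measurable ψ) (h2 : MemLp ψ 2) :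
    Tendsto (fun n => ∫ z : Phase, u z * conv (eps n) ψ (z.1 + θ • z.2)) atTop
      (𝓝 (∫ z : Phase, u z * ψ (z.1 + θ • z.2))) := by
  have hρm : ∀ n, Measurable (gauss (eps n)) := fun n => (continuous_gauss _).measurable
  have hAI := tendsto_lintegral_average_sq (ρ := fun n y => ofReal (gauss (eps n) y))
    (fun n => (hρm n).ennreal_ofReal) (fun n => lintegral_gauss (eps_pos n)) tendsto_lintegral_gauss_mul_norm hψ h2
  have hd : Tendsto (fun n => ‖u‖ₑ * ((∫⁻ x, (∫⁻ y, ofReal (gauss (eps n) y) * ‖ψ (x - y) - ψ x‖ₑ) ^ 2) *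
      wtInt) ^ (1 / 2 : ℝ)) atTop (𝓝 (‖u‖ₑ * (0 * wtInt) ^ (1 / 2 : ℝ))) :=
    ENNReal.Tendsto.const_mul ((ENNReal.continuous_rpow_const.tendsto _).comp
      (ENNReal.Tendsto.mul_const hAI (Or.inr wtInt_lt_top.ne))) (Or.inr enorm_ne_top)
  rw [zero_mul, ENNReal.zero_rpow_of_pos (by norm_num), mul_zero] at hd; rw [tendsto_iff_edist_tendsto_0]
  refine tendsto_of_tendsto_of_tendsto_of_le_of_le tendsto_const_nhds hd (fun _ => zero_le) fun n => ?_
  have hc := measurable_conv (eps n) hψ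
  rw [edist_eq_enorm_sub, ← integral_sub (integrable_mul_comp_shear u θ hc (memLp_conv (eps_pos n) hψ h2))
    (integrable_mul_comp_shear u θ hψ h2)]
  refine (enorm_integral_le_lintegral_enorm _).trans ?_
  calc _ ≤ ∫⁻ z : Phase, ‖u z‖ₑ * (fun x => ∫⁻ y, ofReal (gauss (eps n) y) * ‖ψ (x - y) - ψ x‖ₑ) (z.1 + θ • z.2) := by
        refine lintegral_mono fun z => ?_; rw [← mul_sub, enorm_mul, conv_eq]
        exact mul_le_mul_right (enorm_average_sub_le (hρm n) (fun y => (gauss_pos (eps_pos n) y).le)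
          (lintegral_gauss (eps_pos n)) hψ _) _
    _ ≤ _ := lintegral_mul_comp_shear_le u θ (lintegral_prod_right'
      (f := fun p : E3 × E3 => ofReal (gauss (eps n) p.2) * ‖ψ (p.1 - p.2) - ψ p.1‖ₑ) (by have := hρm n; fun_prop))

section Semigroup

variable {α β γ σ : ℝ} {S : ℝ → X →L[ℝ] X}

/-- The density of `S t u` is the Gaussian average of the sheared density of `u`. -/
lemma integral_semigroup_mul (hα : 0 < α) (hβ : 0 ≤ β) (hγ : 0 ≤ γ) (hσ : 0 ≤ σ)
    (hS : IsWFPSemigroup α β γ σ S) (u : X) {t : ℝ} (ht : 0 < t) {ψ : E3 → ℝ} (hψ : Measurable ψ) (h2 : MemLp ψ 2) :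
    ∫ z, S t u z * ψ z.1 = ∫ z, u z * conv (R α β γ σ t) ψ (z.1 + vth β t • z.2) := by
  have hR : 0 < R α β γ σ t := R_pos hα hβ hγ hσ ht; have h1 := tendsto_integral_mul_conv (S t u) 0 hψ h2
  have h3 := tendsto_integral_mul_conv u (vth β t) (measurable_conv _ hψ) (memLp_conv hR hψ h2)
  simp only [zero_smul, add_zero] at h1; refine tendsto_nhds_unique (h1.congr fun n => ?_) h3
  have e1 := (integral_mul_conv (S t u) 0 (eps_pos n) hψ h2).2
  have e2 := (integral_mul_conv u (vth β t) (r := R α β γ σ t + eps n) (by linarith [eps_pos n]) hψ h2).2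
  simp only [zero_smul, add_zero] at e1; simp_rw [conv_conv (eps_pos n) hR hψ h2, ← e1, add_comm (eps n)]
  rw [← e2]; refine integral_congr fun y => ?_
  simp only [integral_semigroup_mul_gauss hα.le hβ hγ hσ hS u (eps_pos n) ht.le y]

end Semigroup

instance : (volume : Measure Phase).IsAddHaarMeasure := by
  rw [volume_eq_prod]; infer_instance

instance : (volume : Measure Phase).IsNegInvariant :=
  Measure.IsAddHaarMeasure.isNegInvariant_of_regular _

section Semigroup

variable {α β γ σ : ℝ} {S : ℝ → X →L[ℝ] X}

lemma eLpNorm_semigroup_le (hα : 0 ≤ α) (hβ : 0 ≤ β) (hγ : 0 ≤ γ) (hσ : 0 < σ) (hell : γ ^ 2 < α * σ)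
    (hS : IsWFPSemigroup α β γ σ S) (u : X) {t : ℝ} (ht : 0 ≤ t) :
    eLpNorm (S t u) 2 volume ≤ ofReal (exp (3 * β * t / 2)) * eLpNorm u 2 volume := by
  set f : Phase → ℝ := fun z => S t u z with hf; have hfm : Measurable f := measurable_coe _
  have hum := measurable_coe u; have hg : ∀ r, Measurable (gauss r) := fun r => (continuous_gauss r).measurable
  set v : ℕ → Phase → ℝ := fun n y => ∫ z, f z * (gauss (eps n) (z.1 - y.1) * gauss (eps n) (z.2 - y.2)) with hv
  have hvm : ∀ n, Measurable (v n) := fun n => by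
    have := hg (eps n)
    exact (integral_prod_right' (f := fun p : Phase × Phase =>
      f p.2 * (gauss (eps n) (p.2.1 - p.1.1) * gauss (eps n) (p.2.2 - p.1.2))) (by fun_prop)).measurable
  have hbound : ∀ n, eLpNorm (v n) 2 volume ≤ ofReal (exp (3 * β * t / 2)) * eLpNorm u 2 volume := by
    intro n; obtain ⟨r, d, q, hr, hd, H⟩ := integral_semigroup_mul_gauss_mul_gauss hα hβ hγ hσ hell hS (eps_pos n) ht
    set e := exp (-(β * t)) with he; have he0 : 0 < e := exp_pos _
    set k : Phase → Phase → ℝ≥0∞ := fun z y => ofReal (gauss r (z.1 + vth β t • z.2 - y.1)) *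
      ofReal (gauss d ((e • z.2 - y.2) - q • (z.1 + vth β t • z.2 - y.1))) with hk
    have hkm : Measurable (uncurry k) := by
      have := hg r; have := hg d; unfold uncurry; fun_prop
    have hk1 : ∀ z, ∫⁻ y, k z y = 1 := by
      intro z; rw [volume_eq_prod, lintegral_prod _ (by have := hg r; have := hg d; fun_prop)]
      have : ∀ y₁ : E3, ∫⁻ y₂, k z (y₁, y₂) = ofReal (gauss r (z.1 + vth β t • z.2 - y₁)) := fun y₁ => by
        simp only [hk]; rw [lintegral_const_mul' _ _ ofReal_ne_top]; simp_rw [sub_right_comm _ _ (q • _)]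
        rw [lintegral_sub_left_eq_self (fun y => ofReal (gauss d y)), lintegral_gauss hd, mul_one]
      simp_rw [this]; rw [lintegral_sub_left_eq_self (fun y => ofReal (gauss r y)), lintegral_gauss hr]
    have hk2 : ∀ y, ∫⁻ z, k z y = ofReal (exp (3 * β * t)) := by
      intro y
      rw [lintegral_shear (vth β t) (f := fun z => ofReal (gauss r (z.1 - y.1)) *
        ofReal (gauss d ((e • z.2 - y.2) - q • (z.1 - y.1)))) (by have := hg r; have := hg d; fun_prop),
        volume_eq_prod, lintegral_prod _ (by have := hg r; have := hg d; fun_prop)]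
      have : ∀ z₁ : E3, ∫⁻ z₂ : E3, ofReal (gauss r (z₁ - y.1)) * ofReal (gauss d ((e • z₂ - y.2) - q • (z₁ - y.1))) =
          ofReal (gauss r (z₁ - y.1)) * ofReal (exp (3 * β * t)) := fun z₁ => by
        rw [lintegral_const_mul' _ _ ofReal_ne_top, lintegral_comp_smul _ (inv_pos.2 he0)]
        simp_rw [smul_inv_smul₀ he0.ne', sub_sub]
        rw [lintegral_sub_right_eq_self (fun y => ofReal (gauss d y)), lintegral_gauss hd, mul_one, he,
          ← Real.exp_neg, ← Real.exp_nat_mul]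
        congr 3; push_cast; ring
      simp_rw [this]
      rw [lintegral_mul_const _ (by have := hg r; fun_prop),
        lintegral_sub_right_eq_self (fun y => ofReal (gauss r y)), lintegral_gauss hr, one_mul]
    have hsq : ∫⁻ y, ‖v n y‖ₑ ^ 2 ≤ ofReal (exp (3 * β * t)) * ∫⁻ z, ‖u z‖ₑ ^ 2 := by
      calc _ ≤ ∫⁻ y, ofReal (exp (3 * β * t)) * ∫⁻ z, k z y * ‖u z‖ₑ ^ 2 := by
            refine lintegral_mono fun y => ?_
            have h2 := lintegral_mul_sq_le (μ := volume) (hkm.of_uncurry_right (y := y)) hum.enorm; rw [hk2 y] at h2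
            refine le_trans (pow_le_pow_left' ?_ 2) h2; simp only [hv, hf]
            rw [H u y]; refine (enorm_integral_le_lintegral_enorm _).trans (le_of_eq (lintegral_congr fun z => ?_))
            rw [enorm_mul, enorm_mul, enorm_of_nonneg (gauss_pos hr _).le,
              enorm_of_nonneg (gauss_pos hd _).le, mul_comm]
        _ = ofReal (exp (3 * β * t)) * ∫⁻ z, ∫⁻ y, k z y * ‖u z‖ₑ ^ 2 := by
          rw [lintegral_const_mul' _ _ ofReal_ne_top, lintegral_lintegral_swap]
          exact ((hkm.comp measurable_swap).mul ((hum.comp measurable_snd).enorm.pow_const 2)).aemeasurable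
        _ = _ := by
          congr 1; refine lintegral_congr fun z => ?_; rw [lintegral_mul_const' _ _ (by finiteness), hk1, one_mul]
    rw [eLpNorm_two_eq, eLpNorm_two_eq]; refine (rpow_le_rpow hsq (by norm_num)).trans (le_of_eq ?_)
    rw [mul_rpow_of_nonneg _ _ (by norm_num), ENNReal.ofReal_rpow_of_pos (exp_pos _), ← Real.exp_mul]; congr 3; ring
  have hf2 : MemLp f 2 := memLp_coe _
  have hAI := tendsto_lintegral_average_sq (ρ := fun n (y : Phase) => ofReal (gauss (eps n) y.1 * gauss (eps n) y.2))
    (fun n => by have := hg (eps n); fun_prop) (fun n => lintegral_gauss_prod (eps_pos n) (eps_pos n))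
    tendsto_lintegral_gauss_prod_mul_norm hfm hf2
  have hlim : Tendsto (fun n => eLpNorm (v n - f) 2 volume) atTop (𝓝 0) := by
    have h0 := (ENNReal.continuous_rpow_const (y := 1 / 2)).tendsto _ |>.comp hAI
    rw [ENNReal.zero_rpow_of_pos (by norm_num)] at h0
    refine tendsto_of_tendsto_of_tendsto_of_le_of_le tendsto_const_nhds h0 (fun _ => zero_le) fun n => ?_
    rw [eLpNorm_two_eq]; refine rpow_le_rpow (lintegral_mono fun x => pow_le_pow_left' ?_ 2) (by norm_num)
    refine le_trans (le_of_eq ?_) (enorm_average_sub_le (μ := volume) (ρ := fun y : Phase => gauss (eps n) y.1 * gauss (eps n) y.2)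
      (by have := hg (eps n); fun_prop)
      (fun y => (mul_pos (gauss_pos (eps_pos n) _) (gauss_pos (eps_pos n) _)).le)
      (lintegral_gauss_prod (eps_pos n) (eps_pos n)) hfm x)
    simp only [Pi.sub_apply, hv]; rw [← integral_sub_left_eq_self _ volume x]; congr 3; ext y
    simp only [Prod.fst_sub, Prod.snd_sub, sub_sub_cancel_left, gauss_neg]; ring
  have hfin : Tendsto (fun n => ofReal (exp (3 * β * t / 2)) * eLpNorm u 2 volume +
      eLpNorm (v n - f) 2 volume) atTop (𝓝 (ofReal (exp (3 * β * t / 2)) * eLpNorm u 2 volume + 0)) :=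
    tendsto_const_nhds.add hlim
  rw [add_zero] at hfin; refine ge_of_tendsto' hfin fun n => ?_
  calc eLpNorm f 2 volume = eLpNorm (v n - (v n - f)) 2 volume := by rw [sub_sub_cancel]
    _ ≤ _ := eLpNorm_sub_le (hvm n).aestronglyMeasurable ((hvm n).sub hfm).aestronglyMeasurable (by norm_num)
    _ ≤ _ := add_le_add_left (hbound n) _

lemma norm2_semigroup_le (hα : 0 ≤ α) (hβ : 0 ≤ β) (hγ : 0 ≤ γ) (hσ : 0 < σ) (hell : γ ^ 2 < α * σ)
    (hS : IsWFPSemigroup α β γ σ S) (u : X) {t : ℝ} (ht : 0 ≤ t) :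
    norm2 (S t u) ≤ exp (3 * β * t / 2) * norm2 u := by
  rw [← ENNReal.ofReal_le_ofReal_iff (mul_nonneg (exp_pos _).le (norm2_nonneg u)), ofReal_norm2,
    ofReal_mul (exp_pos _).le, ofReal_norm2]
  exact eLpNorm_semigroup_le hα hβ hγ hσ hell hS u ht

end Semigroup

open scoped FourierTransform

/-- A component of the field of the density `n`. -/
noncomputable def comp (j : Fin 3) (n : E3 → ℝ) (x : E3) : ℝ := ∫ y, coul j y * n (x - y)

lemma measurable_comp (j : Fin 3) {n : E3 → ℝ} (hn : Measurable n) : Measurable (comp j n) := by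
  have := measurable_coul j
  exact (integral_prod_right' (f := fun p : E3 × E3 => coul j p.2 * n (p.1 - p.2)) (by fun_prop)).measurable

lemma riesz_eq (f : E3 → ℝ≥0∞) (x : E3) : riesz f x = ∫⁻ y, kern y * f (x - y) := by
  rw [riesz, ← lintegral_sub_left_eq_self _ x]; simp only [sub_sub_cancel]

lemma lintegral_coul_le (j : Fin 3) (n : E3 → ℝ) (x : E3) :
    ∫⁻ y, ‖coul j y * n (x - y)‖ₑ ≤ riesz (fun y => ‖n y‖ₑ) x := by
  rw [riesz_eq]; refine lintegral_mono fun y => ?_; rw [enorm_mul]; exact mul_le_mul_left (enorm_coul_le j y) _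

lemma enorm_comp_le (j : Fin 3) (n : E3 → ℝ) (x : E3) : ‖comp j n x‖ₑ ≤ riesz (fun y => ‖n y‖ₑ) x :=
  (enorm_integral_le_lintegral_enorm _).trans (lintegral_coul_le j n x)

lemma integrable_coul_mul (j : Fin 3) {n : E3 → ℝ} (hn : Measurable n) {x : E3}
    (hx : riesz (fun y => ‖n y‖ₑ) x < ∞) : Integrable fun y => coul j y * n (x - y) := by
  have := measurable_coul j; exact ⟨by fun_prop, (lintegral_coul_le j n x).trans_lt hx⟩

lemma lintegral_field_kernel (n : E3 → ℝ) (x : E3) :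
    ∫⁻ y, ‖(n (x - y) * (‖y‖ ^ 3)⁻¹) • y‖ₑ = riesz (fun y => ‖n y‖ₑ) x := by
  rw [riesz_eq]; refine lintegral_congr fun y => ?_
  have : kern y = ‖(‖y‖ ^ 3)⁻¹‖ₑ * ‖y‖ₑ := by
    rw [kern, ← enorm_norm y, enorm_of_nonneg (by positivity), enorm_of_nonneg (norm_nonneg _),
      ← ofReal_mul (by positivity)]
    rcases eq_or_ne y 0 with rfl | hy
    · simp
    have hy' : 0 < ‖y‖ := norm_pos_iff.2 hy; rw [rpow_neg hy'.le]
    norm_cast; field_simp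
  rw [this, enorm_smul, enorm_mul]; ring

lemma integrable_field_kernel {n : E3 → ℝ} (hn : Measurable n) {x : E3}
    (hx : riesz (fun y => ‖n y‖ₑ) x < ∞) : Integrable fun y => (n (x - y) * (‖y‖ ^ 3)⁻¹) • y :=
  ⟨by fun_prop, (lintegral_field_kernel n x).trans_lt hx⟩

lemma field_apply {n : E3 → ℝ} (hn : Measurable n) {x : E3} (hx : riesz (fun y => ‖n y‖ₑ) x < ∞) (j : Fin 3) :
    field n x j = comp j n x := by
  have h := ((proj j : E3 →L[ℝ] ℝ).integral_comp_comm (integrable_field_kernel hn hx)).symm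
  simp only [PiLp.proj_apply] at h; rw [field, PiLp.smul_apply, h, smul_eq_mul, ← integral_const_mul, comp]
  refine integral_congr fun y => ?_; simp only [PiLp.smul_apply, smul_eq_mul, coul]; ring

lemma enorm_field_le (n : E3 → ℝ) (x : E3) : ‖field n x‖ₑ ≤ riesz (fun y => ‖n y‖ₑ) x := by
  rw [field, enorm_smul, ← lintegral_field_kernel, ← one_mul (∫⁻ y, _)]
  refine mul_le_mul' ?_ (enorm_integral_le_lintegral_enorm _); rw [enorm_of_nonneg (by positivity), ← ofReal_one]
  exact ofReal_le_ofReal (inv_le_one_of_one_le₀ (by nlinarith [Real.pi_gt_three]))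

lemma measurable_field {n : E3 → ℝ} (hn : Measurable n) : Measurable (field n) := by
  have h : Measurable fun x => ∫ y, (n (x - y) * (‖y‖ ^ 3)⁻¹) • y :=
    (integral_prod_right' (f := fun p : E3 × E3 => (n (p.1 - p.2) * (‖p.2‖ ^ 3)⁻¹) • p.2) (by fun_prop)).measurable
  exact h.const_smul (4 * π)⁻¹

lemma enorm_complex_ofReal (r : ℝ) : ‖(r : ℂ)‖ₑ = ‖r‖ₑ := by rw [← ofReal_norm, norm_real, ofReal_norm]

section Congr

variable {n n' : E3 → ℝ}

lemma ae_eq_comp_sub (h : n =ᵐ[volume] n') (x : E3) : ∀ᵐ y, n (x - y) = n' (x - y) :=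
  (measurePreserving_sub_left x).quasiMeasurePreserving.ae_eq_comp h

lemma field_congr (h : n =ᵐ[volume] n') : field n = field n' := by
  ext1 x
  simp only [field]; congr 1; refine integral_congr_ae ?_
  filter_upwards [ae_eq_comp_sub h x] with y hy
  rw [hy]

lemma fieldConverges_congr (h : n =ᵐ[volume] n') (hn : FieldConverges n) : FieldConverges n' := by
  filter_upwards [hn] with x hx
  refine hx.congr ?_
  filter_upwards [ae_eq_comp_sub h x] with y hy
  rw [hy]

lemma eLpNorm_riesz_six : ∃ C : ℝ≥0∞, C ≠ ∞ ∧ ∀ n : E3 → ℝ, Measurable n →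
    eLpNorm (riesz fun y => ‖n y‖ₑ) (ofReal 6) volume ≤ C * eLpNorm n 2 volume := by
  obtain ⟨C, hC, H⟩ := exists_lintegral_riesz_pow_six_le; refine ⟨C, hC, fun n hn => ?_⟩
  have := H _ hn.enorm; rw [eLpNorm_eq_lintegral_rpow_enorm_toReal (by norm_num) (by norm_num), eLpNorm_two_eq]
  simpa using this

lemma ae_riesz_lt_top (hn : Measurable n) (h2 : MemLp n 2) : ∀ᵐ x, riesz (fun y => ‖n y‖ₑ) x < ∞ := by
  obtain ⟨C, hC, H⟩ := exists_lintegral_riesz_pow_six_le; have h1 := H _ hn.enorm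
  have h3 : C * (∫⁻ x, ‖n x‖ₑ ^ (2 : ℝ)) ^ (1 / 2 : ℝ) < ∞ :=
    mul_lt_top hC.lt_top (rpow_lt_top_of_nonneg (by norm_num) (by simpa using (lintegral_sq_lt_top h2).ne))
  have h4 := (ENNReal.rpow_lt_top_iff_of_pos (by norm_num)).1 (h1.trans_lt h3)
  filter_upwards [ae_lt_top ((measurable_riesz hn.enorm).pow_const _) h4.ne] with x hx
  exact (ENNReal.rpow_lt_top_iff_of_pos (by norm_num)).1 hx

lemma fieldConverges (hn : Measurable n) (h2 : MemLp n 2) : FieldConverges n := by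
  filter_upwards [ae_riesz_lt_top hn h2] with x hx using integrable_field_kernel hn hx

lemma field_add_ae (h : FieldConverges n) (h' : FieldConverges n') :
    field (fun x => n x + n' x) =ᵐ[volume] fun x => field n x + field n' x := by
  filter_upwards [h, h'] with x hx hx'
  simp only [field, add_mul, add_smul]; rw [integral_add hx hx', smul_add]

end Congr

lemma exists_eLpNorm_field_six_le : ∃ C : ℝ≥0∞, C ≠ ∞ ∧ ∀ n : E3 → ℝ, Measurable n →
    eLpNorm (field n) (ofReal 6) volume ≤ C * eLpNorm n 2 volume := by
  obtain ⟨C, hC, H⟩ := eLpNorm_riesz_six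
  refine ⟨C, hC, fun n hn => le_trans (eLpNorm_mono_enorm fun x => ?_) (H n hn)⟩; simpa using enorm_field_le n x

lemma exists_eLpNorm_field_two_le : ∃ C : ℝ≥0∞, C ≠ ∞ ∧ ∀ n : E3 → ℝ, Measurable n →
    eLpNorm (field n) 2 volume ≤ C * eLpNorm n (ofReal (6 / 5)) volume := by
  obtain ⟨C, hC, H⟩ := exists_lintegral_riesz_sq_le; refine ⟨C ^ (1 / 2 : ℝ), by finiteness, fun n hn => ?_⟩
  have h := H (fun x => ‖n x‖) hn.norm fun _ => norm_nonneg _; simp_rw [ofReal_norm] at h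
  have h2 := (lintegral_mono fun x => pow_le_pow_left' (enorm_field_le n x) 2).trans h
  rw [eLpNorm_two_eq, eLpNorm_eq_lintegral_rpow_enorm_toReal (by norm_num) (by norm_num)]
  refine (rpow_le_rpow h2 (by norm_num)).trans (le_of_eq ?_)
  rw [mul_rpow_of_nonneg _ _ (by norm_num), ← rpow_mul, ENNReal.toReal_ofReal (by norm_num)]; congr 2
  · refine lintegral_congr fun x => ?_; rw [← ofReal_rpow_of_nonneg (norm_nonneg _) (by norm_num), ofReal_norm]
  · norm_num

/-- A test density: measurable, bounded and of bounded support. -/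
structure IsBdd (g : E3 → ℝ) : Prop where
  meas : Measurable g
  bdd : ∃ N : ℝ, ∀ x, |g x| ≤ N
  supp : ∃ N : ℝ, ∀ x, N < ‖x‖ → g x = 0

namespace IsBdd

variable {g : E3 → ℝ}

lemma memLp (hg : IsBdd g) (p : ℝ≥0∞) : MemLp g p := by
  obtain ⟨N, hN⟩ := hg.bdd; obtain ⟨M, hM⟩ := hg.supp
  have h1 : MemLp ((closedBall (0 : E3) M).indicator g) p := by
    refine MemLp.mono' (g := (closedBall (0 : E3) M).indicator fun _ => N)
      (memLp_indicator_const p measurableSet_closedBall N (Or.inr (measure_closedBall_lt_top).ne))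
      (hg.meas.indicator measurableSet_closedBall).aestronglyMeasurable (of_forall fun x => ?_)
    rw [norm_indicator_eq_indicator_norm]; exact indicator_le_indicator (hN x)
  convert h1 using 1
  ext x
  by_cases hx : x ∈ closedBall (0 : E3) M
  · rw [indicator_of_mem hx]
  · rw [indicator_of_notMem hx]; exact hM x (by simpa using hx)

lemma integrable (hg : IsBdd g) : Integrable g := memLp_one_iff_integrable.1 (hg.memLp 1)

lemma lintegral_riesz_sq (hg : IsBdd g) : ∫⁻ x, riesz (fun y => ‖g y‖ₑ) x ^ 2 < ∞ := by
  obtain ⟨C, hC, H⟩ := exists_lintegral_riesz_sq_le; have h := H (fun x => ‖g x‖) hg.meas.norm fun _ => norm_nonneg _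
  simp_rw [ofReal_norm] at h; refine h.trans_lt (mul_lt_top hC.lt_top (rpow_lt_top_of_nonneg (by norm_num) ?_))
  have h2 := lintegral_rpow_enorm_lt_top_of_eLpNorm_lt_top (by norm_num) (by norm_num) (hg.memLp (ofReal (6 / 5))).2
  rw [ENNReal.toReal_ofReal (by norm_num)] at h2; refine (lt_of_eq_of_lt (lintegral_congr fun x => ?_) h2).ne
  rw [← ofReal_rpow_of_nonneg (norm_nonneg _) (by norm_num), ofReal_norm]

lemma riesz_lt_top (hg : IsBdd g) (x : E3) : riesz (fun y => ‖g y‖ₑ) x < ∞ := by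
  obtain ⟨N, hN⟩ := hg.bdd; refine WPFP.riesz_lt_top (B := ofReal N) (fun y => ?_) ofReal_ne_top hg.integrable.2.ne x
  rw [← ofReal_norm]; exact ofReal_le_ofReal (hN y)

lemma memLp_comp (hg : IsBdd g) (j : Fin 3) : MemLp (comp j g) 2 :=
  memLp_two_of_lintegral (measurable_comp j hg.meas).aestronglyMeasurable
    ((lintegral_mono fun x => pow_le_pow_left' (enorm_comp_le j g x) 2).trans_lt hg.lintegral_riesz_sq)

end IsBdd

/-- The Coulomb kernel is odd. -/
lemma integral_comp_mul (j : Fin 3) {n g : E3 → ℝ} (hn : Measurable n) (h2 : MemLp n 2) (hg : IsBdd g) :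
    ∫ x, comp j n x * g x = -∫ x, n x * comp j g x := by
  have hc := measurable_coul j; have hgm := hg.meas
  have e1 : ∀ (n : E3 → ℝ) (x : E3), comp j n x = ∫ y, coul j (x - y) * n y := fun n x => by
    rw [comp, ← integral_sub_left_eq_self _ volume x]; simp only [sub_sub_cancel]
  have hi : Integrable (uncurry fun x y => coul j (x - y) * n y * g x) (volume.prod volume) := by
    have hm : Measurable (uncurry fun x y => coul j (x - y) * n y * g x) := by unfold uncurry; fun_prop
    refine ⟨hm.aestronglyMeasurable, ?_⟩; rw [HasFiniteIntegral, lintegral_prod_symm _ (by fun_prop)]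
    calc _ ≤ ∫⁻ y, ‖n y‖ₑ * riesz (fun y => ‖g y‖ₑ) y := by
          refine lintegral_mono fun y => ?_; rw [riesz, ← lintegral_const_mul' _ _ enorm_ne_top]
          refine lintegral_mono fun x => ?_; simp only [uncurry, enorm_mul]; rw [← neg_sub, coul_neg, enorm_neg]
          calc _ = ‖n y‖ₑ * (‖coul j (y - x)‖ₑ * ‖g x‖ₑ) := by ring
            _ ≤ _ := by gcongr; exact enorm_coul_le _ _
      _ ≤ _ := lintegral_mul_le_sqrt (by fun_prop) (measurable_riesz hgm.enorm).aemeasurable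
      _ < ∞ := mul_lt_top
          (rpow_lt_top_of_nonneg (by norm_num) (lintegral_sq_lt_top h2).ne)
          (rpow_lt_top_of_nonneg (by norm_num) hg.lintegral_riesz_sq.ne)
  calc _ = ∫ x, ∫ y, coul j (x - y) * n y * g x := by simp_rw [e1, integral_mul_const]
    _ = ∫ y, ∫ x, coul j (x - y) * n y * g x := integral_integral_swap hi
    _ = _ := by
      rw [← integral_neg]; refine integral_congr fun y => ?_
      simp only [e1]; rw [← mul_neg, ← integral_neg, ← integral_const_mul]
      refine integral_congr fun x => ?_; rw [← neg_sub, coul_neg]; ring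

/-- The smoothed field of a test density on the Fourier side. -/
lemma conv_comp (j : Fin 3) {M : ℝ} (hM : 0 < M) {g : E3 → ℝ} (hg : IsBdd g) (x : E3) :
    ((conv M (comp j g) x : ℝ) : ℂ) = 𝓕⁻ (fun ξ => coulSymb j M ξ * 𝓕 (fun y => (g y : ℂ)) ξ) x := by
  have hc := measurable_coul j; have hgm := hg.meas; have hG := (continuous_gauss M).measurable
  rw [← integral_fourierInv_mul (integrable_coulSymb j hM) (hg.integrable.ofReal : Integrable fun y => (g y : ℂ))]
  simp_rw [← integral_coul_mul_gauss j hM, ← Complex.ofReal_mul]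
  rw [integral_complex_ofReal, Complex.ofReal_inj, conv_eq]
  have hi : Integrable (uncurry fun y z => gauss M y * (coul j (x - y - z) * g z)) (volume.prod volume) := by
    have hm : Measurable (uncurry fun y z => gauss M y * (coul j (x - y - z) * g z)) := by unfold uncurry; fun_prop
    refine ⟨hm.aestronglyMeasurable, ?_⟩; rw [HasFiniteIntegral, lintegral_prod _ (by fun_prop)]
    calc _ ≤ ∫⁻ y, ofReal (gauss M (x - y)) * riesz (fun y => ‖g y‖ₑ) y := by
          rw [← lintegral_sub_left_eq_self (fun y => ofReal (gauss M (x - y)) * riesz (fun y => ‖g y‖ₑ) y) x]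
          refine lintegral_mono fun y => ?_; rw [riesz, ← lintegral_const_mul' _ _ ofReal_ne_top]
          refine lintegral_mono fun z => ?_; simp only [uncurry, enorm_mul, sub_sub_cancel]
          rw [enorm_of_nonneg (gauss_pos hM y).le]
          gcongr; exact enorm_coul_le _ _
      _ ≤ _ := lintegral_mul_le_sqrt (by fun_prop) (measurable_riesz hgm.enorm).aemeasurable
      _ < ∞ := by
        refine mul_lt_top (rpow_lt_top_of_nonneg (by norm_num) (ne_of_lt ?_))
          (rpow_lt_top_of_nonneg (by norm_num) hg.lintegral_riesz_sq.ne)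
        rw [lintegral_sub_left_eq_self (fun y => ofReal (gauss M y) ^ 2)]
        calc _ ≤ ∫⁻ y, ofReal (M ^ (-(3 / 2 : ℝ))) * ofReal (gauss M y) := by
              refine lintegral_mono fun y => ?_; rw [sq]; gcongr; exact gauss_le hM y
          _ < ∞ := by rw [lintegral_const_mul' _ _ ofReal_ne_top, lintegral_gauss hM, mul_one]; exact ofReal_lt_top
  calc ∫ y, gauss M y * comp j g (x - y) = ∫ y, ∫ z, gauss M y * (coul j (x - y - z) * g z) := by
        refine integral_congr fun y => ?_; rw [integral_const_mul, comp, ← integral_sub_left_eq_self _ volume (x - y)]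
        simp only [sub_sub_cancel]
    _ = ∫ z, ∫ y, gauss M y * (coul j (x - y - z) * g z) := integral_integral_swap hi
    _ = _ := by
      refine integral_congr fun z => ?_; rw [← integral_mul_const]
      refine integral_congr fun y => ?_; rw [sub_right_comm]; ring

/-- The field of a square integrable density is the sum of a bounded and a square integrable part. -/
lemma exists_comp_decomposition : ∃ C : ℝ≥0∞, C ≠ ∞ ∧ ∀ (j : Fin 3) (n : E3 → ℝ), Measurable n → MemLp n 2 →
    ∃ (a : E3 → ℂ) (b : E3 → ℝ), Measurable a ∧ Integrable a ∧ Measurable b ∧ ∫⁻ k, ‖a k‖ₑ ≤ C * eLpNorm n 2 volume ∧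
      eLpNorm b 2 volume ≤ C * eLpNorm n 2 volume ∧ ∀ᵐ x, (comp j n x : ℂ) = 𝓕⁻ a x + b x := by
  set B := ball (0 : E3) 1; have hB : MeasurableSet B := measurableSet_ball
  set K : Fin 3 → E3 → ℂ := fun j y => Bᶜ.indicator (fun y => (coul j y : ℂ)) y with hK
  have hKm : ∀ j, Measurable (K j) := fun j => by
    have := measurable_coul j; exact Measurable.indicator (by fun_prop) hB.compl
  have hK2 : ∀ j, MemLp (K j) 2 := fun j => by
    refine memLp_two_of_lintegral (hKm j).aestronglyMeasurable ?_
    refine lt_of_le_of_lt ?_ (lintegral_ball_compl_rpow_lt_top (s := 4) (by norm_num))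
    rw [← lintegral_indicator hB.compl]; refine lintegral_mono fun y => ?_
    by_cases hy : y ∈ Bᶜ
    · simp only [hK, indicator_of_mem hy, enorm_complex_ofReal]
      refine (pow_le_pow_left' (enorm_coul_le j y) 2).trans (le_of_eq ?_)
      rw [kern, ← ENNReal.ofReal_pow (by positivity), ← Real.rpow_natCast, ← Real.rpow_mul (norm_nonneg _)]; norm_num
    · simp [hK, indicator_of_notMem hy]
  set c₀ := ∫⁻ y in B, kern y; have hc₀ : c₀ ≠ ∞ := (lintegral_ball_rpow_lt_top (s := 2) (by norm_num)).ne
  set C : ℝ≥0∞ := ∑ j, eLpNorm (K j) 2 volume + c₀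
  refine ⟨C, ENNReal.add_ne_top.2 ⟨(ENNReal.sum_lt_top.2 fun j _ => (hK2 j).2).ne, hc₀⟩, fun j n hn h2 => ?_⟩
  obtain ⟨a₀, ha₀, ha1, haf⟩ := exists_integrable_fourierInv_eq (hK2 j) (h2.ofReal (K := ℂ)); set a := ha₀.1.mk a₀
  have hae := ha₀.1.ae_eq_mk; have ha : Integrable a := ha₀.congr hae
  rw [lintegral_congr_ae (g := fun k => ‖a k‖ₑ) (by filter_upwards [hae] with k hk; rw [hk])] at ha1
  have hF : 𝓕⁻ a₀ = 𝓕⁻ a := by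
    ext x; simp only [fourierInv_eq']; refine integral_congr_ae ?_
    filter_upwards [hae] with k hk
    rw [hk]
  have hc := measurable_coul j; have hnear : Measurable (B.indicator (coul j)) := hc.indicator hB
  refine ⟨a, fun x => ∫ y, B.indicator (coul j) y * n (x - y), ha₀.1.stronglyMeasurable_mk.measurable, ha, ?_, ?_, ?_, ?_⟩
  · exact (integral_prod_right' (f := fun p : E3 × E3 => B.indicator (coul j) p.2 * n (p.1 - p.2))
      (by fun_prop)).measurable
  · refine ha1.trans (mul_le_mul' ((Finset.single_le_sum (f := fun j => eLpNorm (K j) 2 volume) (fun _ _ => zero_le) (Finset.mem_univ j)).trans le_self_add)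
      (le_of_eq (eLpNorm_congr_norm_ae (of_forall fun x => by simp))))
  · have hkm : Measurable (B.indicator kern) := measurable_kern.indicator hB
    have hsq : ∫⁻ x, ‖∫ y, B.indicator (coul j) y * n (x - y)‖ₑ ^ 2 ≤ c₀ ^ 2 * ∫⁻ x, ‖n x‖ₑ ^ 2 := by
      calc _ ≤ ∫⁻ x, (∫⁻ y, B.indicator kern y * ‖n (x - y)‖ₑ) ^ 2 := by
            refine lintegral_mono fun x => pow_le_pow_left' ((enorm_integral_le_lintegral_enorm _).trans
              (lintegral_mono fun y => ?_)) 2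
            rw [enorm_mul, enorm_indicator_eq_indicator_enorm]; gcongr; exact enorm_coul_le j y
        _ ≤ ∫⁻ x, c₀ * ∫⁻ y, B.indicator kern y * ‖n (x - y)‖ₑ ^ 2 := by
          refine lintegral_mono fun x => (lintegral_mul_sq_le hkm (by fun_prop)).trans (le_of_eq ?_)
          rw [lintegral_indicator hB]
        _ = c₀ * ∫⁻ y, ∫⁻ x, B.indicator kern y * ‖n (x - y)‖ₑ ^ 2 := by
          rw [lintegral_const_mul' _ _ hc₀, lintegral_swap (by fun_prop)]
        _ = c₀ * ∫⁻ y, B.indicator kern y * ∫⁻ x, ‖n x‖ₑ ^ 2 := by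
          congr 2; ext y
          rw [lintegral_const_mul _ (by fun_prop), lintegral_sub_right_eq_self (fun x => ‖n x‖ₑ ^ 2) y]
        _ = _ := by rw [lintegral_mul_const _ hkm, lintegral_indicator hB, sq, mul_assoc]
    rw [eLpNorm_two_eq, eLpNorm_two_eq]; refine (rpow_le_rpow hsq (by norm_num)).trans ?_
    rw [mul_rpow_of_nonneg _ _ (by norm_num), ← rpow_natCast, ← rpow_mul]; norm_num
    gcongr; exact le_add_self
  · filter_upwards [ae_riesz_lt_top hn h2] with x hx
    have hi := integrable_coul_mul j hn hx
    have e1 : ∀ (A : Set E3) y, A.indicator (coul j) y * n (x - y) = A.indicator (fun y => coul j y * n (x - y)) y :=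
      fun A y => by by_cases hy : y ∈ A <;> simp [hy]
    have e2 : 𝓕⁻ a x = ((∫ y, Bᶜ.indicator (coul j) y * n (x - y) : ℝ) : ℂ) := by
      rw [← hF, ← haf, ← integral_complex_ofReal]; refine integral_congr fun y => ?_
      by_cases hy : y ∈ Bᶜ
      · simp only [hK, indicator_of_mem hy, Complex.ofReal_mul]; rfl
      · simp [hK, indicator_of_notMem hy]
    rw [e2, ← Complex.ofReal_add, Complex.ofReal_inj]; simp_rw [e1]
    rw [integral_indicator hB, integral_indicator hB.compl, add_comm, integral_add_compl hB hi, comp]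

open scoped FourierTransform

/-- The inverse Fourier transform of `ξⱼ m(ξ)`. -/
local notation:max "𝓕∂[" j "," m "]" => (𝓕⁻ (fun ξ : E3 => (ξ j : ℂ) * m ξ) : E3 → ℂ)

/-- The interval `(-1/2, 1/2]` parametrising a segment. -/
noncomputable def seg : Measure ℝ := volume.restrict (Ioc (-(1 / 2)) (1 / 2))

instance : IsProbabilityMeasure seg := ⟨by rw [seg, Measure.restrict_apply_univ, Real.volume_Ioc]; norm_num⟩

lemma ae_segment {P : E3 → Prop} (hP : ∀ᵐ x, P x) : ∀ᵐ p : Phase, ∀ᵐ r ∂seg, P (p.1 - r • p.2) := by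
  have h : Measure.QuasiMeasurePreserving (fun q : Phase × ℝ => q.1.1 - q.2 • q.1.2) (volume.prod seg) volume := by
    refine QuasiMeasurePreserving.prod_of_left (by fun_prop) (of_forall fun r => ?_)
    convert Measure.quasiMeasurePreserving_fst.comp (measurePreserving_shear (-r)).quasiMeasurePreserving using 1
    ext1 p
    simp [sub_eq_add_neg]
  exact Measure.ae_ae_of_ae_prod (h.ae hP)

lemma ae_lintegral_segment {f : E3 → ℝ≥0∞} (hf : Measurable f) (h6 : ∫⁻ x, f x ^ (6 : ℝ) < ∞) :
    ∀ᵐ p : Phase, ∫⁻ r, f (p.1 - r • p.2) ∂seg < ∞ := by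
  have hm : Measurable fun p : Phase => ∫⁻ r, f (p.1 - r • p.2) ∂seg :=
    lintegral_prod_right' (f := fun q : Phase × ℝ => f (q.1.1 - q.2 • q.1.2)) (by fun_prop)
  have hset : MeasurableSet {p : Phase | ∫⁻ r, f (p.1 - r • p.2) ∂seg < ∞} := measurableSet_lt hm measurable_const
  rw [volume_eq_prod]; refine (Measure.ae_prod_iff_ae_ae hset).2 ((Measure.ae_ae_comm hset).2 (of_forall fun η => ?_))
  have h1 : ∫⁻ x, (∫⁻ r, f (x - r • η) ∂seg) ^ (6 : ℝ) < ∞ := by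
    calc _ ≤ ∫⁻ x, ∫⁻ r, f (x - r • η) ^ (6 : ℝ) ∂seg := by
          refine lintegral_mono fun x => ?_
          simpa using lintegral_mul_rpow_le (μ := seg) (ρ := fun _ => 1) (f := fun r => f (x - r • η))
            measurable_const (by fun_prop) (by simp) (p := 6) (by norm_num)
      _ = ∫⁻ r, (∫⁻ x, f (x - r • η) ^ (6 : ℝ)) ∂seg :=
          lintegral_swap (by fun_prop)
      _ = ∫⁻ r, (∫⁻ x, f x ^ (6 : ℝ)) ∂seg := by
        congr 1; ext r; exact lintegral_sub_right_eq_self (fun x => f x ^ (6 : ℝ)) _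
      _ < ∞ := by simpa using h6
  have hm2 : Measurable fun x : E3 => ∫⁻ r, f (x - r • η) ∂seg := hm.comp (by fun_prop : Measurable fun x : E3 => ((x, η) : Phase))
  filter_upwards [ae_lt_top (hm2.pow_const _) h1.ne] with x hx
  exact (ENNReal.rpow_lt_top_iff_of_pos (by norm_num)).1 hx

lemma ae_lintegral_riesz_segment {n : E3 → ℝ} (hn : Measurable n) (h2 : MemLp n 2) :
    ∀ᵐ p : Phase, ∫⁻ r, riesz (fun y => ‖n y‖ₑ) (p.1 - r • p.2) ∂seg < ∞ := by
  obtain ⟨C, hC, H⟩ := exists_lintegral_riesz_pow_six_le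
  have h3 : C * (∫⁻ x, ‖n x‖ₑ ^ (2 : ℝ)) ^ (1 / 2 : ℝ) < ∞ :=
    mul_lt_top hC.lt_top (rpow_lt_top_of_nonneg (by norm_num) (by simpa using (lintegral_sq_lt_top h2).ne))
  exact ae_lintegral_segment (measurable_riesz hn.enorm)
    ((ENNReal.rpow_lt_top_iff_of_pos (by norm_num)).1 ((H _ hn.enorm).trans_lt h3))

lemma dipole_eq {y η : E3} (h : ∀ r : ℝ, y - r • η ≠ 0) :
    (4 * π)⁻¹ * (‖y - (1 / 2 : ℝ) • η‖⁻¹ - ‖y + (1 / 2 : ℝ) • η‖⁻¹) = ∫ r, ∑ j, η j * coul j (y - r • η) ∂seg := by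
  have hd : ∀ r : ℝ, HasDerivAt (fun r : ℝ => (4 * π)⁻¹ * ‖y - r • η‖⁻¹) (∑ j, η j * coul j (y - r • η)) r := by
    intro r; have h0 : 0 < ‖y - r • η‖ := norm_pos_iff.2 (h r)
    have h1 : HasDerivAt (fun r : ℝ => y - r • η) (-η) r := by
      simpa using ((hasDerivAt_id r).smul_const η).const_sub y
    have h2 : HasDerivAt (fun r : ℝ => ‖y - r • η‖) (inner ℝ (y - r • η) (-η) / ‖y - r • η‖) r := by
      have h3 := (h1.norm_sq).sqrt (by positivity); simp only [Real.sqrt_sq (norm_nonneg _)] at h3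
      exact h3.congr_deriv (by ring)
    refine ((h2.inv h0.ne').const_mul (4 * π)⁻¹).congr_deriv ?_
    have e : inner ℝ (y - r • η) (-η) = -∑ j, η j * (y - r • η) j := by rw [inner_neg_right, PiLp.inner_apply]; simp
    have e2 : ∑ j, η j * coul j (y - r • η) = (4 * π)⁻¹ * (‖y - r • η‖ ^ 3)⁻¹ * ∑ j, η j * (y - r • η) j := by
      rw [mul_sum]
      exact sum_congr rfl fun j _ => by rw [coul]; ring
    rw [e2, e]; field_simp
  have hc : Continuous fun r : ℝ => ∑ j, η j * coul j (y - r • η) := by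
    unfold coul; have : ∀ r : ℝ, ‖y - r • η‖ ^ 3 ≠ 0 := fun r => pow_ne_zero _ (norm_ne_zero_iff.2 (h r))
    fun_prop (disch := assumption)
  have := intervalIntegral.integral_eq_sub_of_hasDerivAt (a := -(1 / 2)) (b := 1 / 2) (fun r _ => hd r)
    (hc.intervalIntegrable _ _)
  rw [intervalIntegral.integral_of_le (by norm_num)] at this; rw [seg, this, neg_smul, sub_neg_eq_add]; ring

/-- The potential difference is the line integral of the field. -/
lemma deltaV_eq_integral {n : E3 → ℝ} (hn : Measurable n) (h2 : MemLp n 2) :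
    ∀ᵐ p : Phase, deltaV n p.1 p.2 = ∫ r, ∑ j, p.2 j * comp j n (p.1 - r • p.2) ∂seg := by
  filter_upwards [ae_lintegral_riesz_segment hn h2] with p hp
  obtain ⟨x, η⟩ := p; simp only at hp ⊢
  have hline : ∀ᵐ y : E3, ∀ r : ℝ, y - r • η ≠ 0 := by
    have hs : (volume : Measure E3) (Submodule.span ℝ {η} : Set E3) = 0 := by
      refine Measure.addHaar_submodule _ _ fun htop => ?_; have h1 := finrank_span_le_card (R := ℝ) ({η} : Set E3)
      simp only [toFinset_singleton, Finset.card_singleton] at h1; rw [htop, finrank_top, finrank_E3] at h1; omega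
    filter_upwards [measure_eq_zero_iff_ae_notMem.1 hs] with y hy r hr
    exact hy (by rw [sub_eq_zero.1 hr]; exact Submodule.smul_mem _ _ (Submodule.mem_span_singleton_self η))
  have hcm : ∀ j, Measurable (coul j) := measurable_coul
  set F : ℝ → E3 → ℝ := fun r y => ∑ j, η j * (coul j (y - r • η) * n (x - y)) with hF
  have hi : Integrable (uncurry F) (seg.prod volume) := by
    refine integrable_finsetSum _ fun j _ => Integrable.const_mul ?_ _; have := hcm j
    refine ⟨by fun_prop, ?_⟩; rw [HasFiniteIntegral, lintegral_prod _ (by fun_prop)]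
    refine lt_of_le_of_lt (lintegral_mono fun r => ?_) hp; rw [riesz, ← lintegral_sub_left_eq_self _ x]
    refine lintegral_mono fun y => ?_; simp only [enorm_mul, sub_sub_cancel]
    refine mul_le_mul_left ((enorm_coul_le _ _).trans (le_of_eq ?_)) _; congr 1; abel
  calc deltaV n x η = ∫ y, ∫ r, F r y ∂seg := by
        rw [deltaV, ← integral_const_mul]; refine integral_congr_ae ?_
        filter_upwards [hline] with y hy
        rw [← mul_assoc, dipole_eq hy, ← integral_mul_const]; refine integral_congr fun r => ?_
        simp only [hF, Finset.sum_mul, mul_assoc]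
    _ = ∫ r, (∫ y, F r y) ∂seg := (integral_integral_swap hi).symm
    _ = _ := by
      refine integral_congr_ae ?_
      have hfin := ae_lt_top ((measurable_riesz hn.enorm).comp (by fun_prop : Measurable fun r : ℝ => x - r • η)) hp.ne
      filter_upwards [hfin] with r hr
      have e : ∀ j y, coul j (y + r • η - r • η) * n (x - (y + r • η)) = coul j y * n (x - r • η - y) :=
        fun j y => by rw [add_sub_cancel_right]; congr 2; abel
      have hint : ∀ j, Integrable fun y => coul j (y - r • η) * n (x - y) := fun j => by
        refine ((integrable_coul_mul j hn hr).comp_sub_right (r • η)).congr (of_forall fun y => ?_); simp only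
        congr 2; abel
      simp only [hF]; rw [integral_finset_sum _ fun j _ => (hint j).const_mul _]
      refine sum_congr rfl fun j _ => ?_; rw [integral_const_mul, ← integral_add_right_eq_self _ (r • η)]
      simp_rw [e]; rfl

/-- The plane wave `e^{2πit}`. -/
noncomputable def pw (t : ℝ) : ℂ := Complex.exp (((2 * π * t : ℝ) : ℂ) * I)

@[fun_prop] lemma continuous_pw : Continuous pw := by unfold pw; fun_prop

lemma norm_pw (t : ℝ) : ‖pw t‖ = 1 := norm_exp_ofReal_mul_I _

lemma enorm_pw (t : ℝ) : ‖pw t‖ₑ = 1 := by rw [← ofReal_norm, norm_pw, ofReal_one]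

lemma pw_add (s t : ℝ) : pw (s + t) = pw s * pw t := by
  simp only [pw, mul_add, Complex.ofReal_add, add_mul, Complex.exp_add]

lemma fourierInv_pw (f : E3 → ℂ) (x : E3) : 𝓕⁻ f x = ∫ ξ, pw (inner ℝ ξ x) * f ξ := by rw [fourierInv_eq']; rfl

lemma fourier_pw (f : E3 → ℂ) (ξ : E3) : 𝓕 f ξ = ∫ v, pw (-inner ℝ ξ v) * f v := by
  rw [Real.fourier_eq']; refine integral_congr fun v => ?_
  simp only [pw, smul_eq_mul, real_inner_comm ξ v]; congr 3; push_cast; ring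

lemma enorm_fourier_le (f : E3 → ℂ) (ξ : E3) : ‖𝓕 f ξ‖ₑ ≤ ∫⁻ v, ‖f v‖ₑ := by
  rw [fourier_pw]; refine (enorm_integral_le_lintegral_enorm _).trans (le_of_eq (lintegral_congr fun v => ?_))
  rw [enorm_mul, enorm_pw, one_mul]

/-- Parseval's identity on a velocity slice. -/
lemma integral_mul_fourierInv {g m : E3 → ℂ} (hg : Integrable g) (hm : Integrable m) (θ : ℝ) (y : E3) :
    ∫ v, g v * 𝓕⁻ m (y + θ • v) = ∫ ξ, m ξ * pw (inner ℝ ξ y) * 𝓕 g (-θ • ξ) := by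
  have hi : Integrable (uncurry fun v ξ => pw (inner ℝ ξ (y + θ • v)) * (g v * m ξ)) (volume.prod volume) := by
    refine (hg.mul_prod hm).bdd_mul (c := 1) (Continuous.aestronglyMeasurable (by fun_prop)) (ae_of_all _ fun p => ?_)
    rw [norm_pw]
  calc _ = ∫ v, ∫ ξ, pw (inner ℝ ξ (y + θ • v)) * (g v * m ξ) := by
        simp_rw [fourierInv_pw, ← integral_const_mul]; refine integral_congr fun v => integral_congr fun ξ => ?_; ring
    _ = ∫ ξ, ∫ v, pw (inner ℝ ξ (y + θ • v)) * (g v * m ξ) := integral_integral_swap hi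
    _ = _ := by
      refine integral_congr fun ξ => ?_; rw [fourier_pw, ← integral_const_mul]
      refine integral_congr fun v => ?_; rw [inner_add_right, pw_add, inner_smul_right, inner_smul_left]
      simp only [RCLike.conj_to_real, neg_mul, neg_neg]; ring

/-- A plane wave superposition acts on a velocity slice by shifts. -/
lemma enorm_integral_planeWaves_le {g m a : E3 → ℂ} (hg : Integrable g) (hm : Measurable m) (j : Fin 3)
    (hm1 : Integrable fun ξ => (ξ j : ℂ) * m ξ) (ha : Integrable a) (θ c : ℝ) (x : E3) :
    Integrable (fun ξ => m ξ * pw (inner ℝ ξ x) * 𝓕 g (-θ • ξ) * (ξ j * ∫ r, 𝓕⁻ a (x + (c * r) • ξ) ∂seg)) ∧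
    ‖∫ ξ, m ξ * pw (inner ℝ ξ x) * 𝓕 g (-θ • ξ) * (ξ j * ∫ r, 𝓕⁻ a (x + (c * r) • ξ) ∂seg)‖ₑ ≤
      ∫⁻ r, (∫⁻ k, ‖a k‖ₑ * ∫⁻ v, ‖g v‖ₑ * ‖𝓕∂[j,m] (x + (c * r) • k + θ • v)‖ₑ) ∂seg := by
  set m' : E3 → ℂ := fun ξ => (ξ j : ℂ) * m ξ; set N := ∫ v, ‖g v‖
  have hFg : Continuous (𝓕 g) := continuous_fourier hg
  have hFN : ∀ ξ, ‖𝓕 g ξ‖ ≤ N := fun ξ => by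
    rw [fourier_pw]; refine (norm_integral_le_integral_norm _).trans (le_of_eq ?_)
    simp only [norm_mul, norm_pw, one_mul]; rfl
  set H : E3 → ℝ × E3 → ℂ := fun ξ q => (pw (inner ℝ ξ x) * 𝓕 g (-θ • ξ) * pw (inner ℝ q.2 (x + (c * q.1) • ξ))) *
    (m' ξ * a q.2) with hH
  have ha' : Integrable (fun q : ℝ × E3 => a q.2) (seg.prod volume) := ha.comp_snd seg
  have hi : Integrable (uncurry H) (volume.prod (seg.prod volume)) := by
    refine (hm1.mul_prod ha').bdd_mul (c := N) (Continuous.aestronglyMeasurable (by fun_prop)) (ae_of_all _ fun p => ?_)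
    rw [norm_mul, norm_mul, norm_pw, norm_pw, one_mul, mul_one]; exact hFN _
  have e1 : ∀ ξ, m ξ * pw (inner ℝ ξ x) * 𝓕 g (-θ • ξ) * (ξ j * ∫ r, 𝓕⁻ a (x + (c * r) • ξ) ∂seg) =
      ∫ q, H ξ q ∂(seg.prod volume) := by
    intro ξ
    have hi2 : Integrable (fun q : ℝ × E3 => pw (inner ℝ q.2 (x + (c * q.1) • ξ)) * a q.2) (seg.prod volume) := by
      refine ha'.bdd_mul (c := 1) (Continuous.aestronglyMeasurable (by fun_prop)) (ae_of_all _ fun p => ?_)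
      rw [norm_pw]
    simp only [fourierInv_pw]; rw [← integral_prod _ hi2, ← integral_const_mul, ← integral_const_mul]
    refine integral_congr fun q => ?_; simp only [hH, m']; ring
  simp_rw [e1]; refine ⟨hi.integral_prod_left, ?_⟩; rw [integral_integral_swap hi]
  have e2 : ∀ q : ℝ × E3, ∫ ξ, H ξ q = a q.2 * pw (inner ℝ q.2 x) * ∫ v, g v * 𝓕⁻ m' (x + (c * q.1) • q.2 + θ • v) := by
    intro q; rw [integral_mul_fourierInv hg hm1, ← integral_const_mul]
    refine integral_congr fun ξ => ?_; simp only [hH]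
    rw [inner_add_right, inner_add_right, pw_add, pw_add, inner_smul_right, inner_smul_right, real_inner_comm q.2 ξ]
    ring
  simp_rw [e2]; refine (enorm_integral_le_lintegral_enorm _).trans ?_; have hma : AEMeasurable a := ha.1.aemeasurable
  refine (lintegral_mono (g := fun q : ℝ × E3 => ‖a q.2‖ₑ * ∫⁻ v, ‖g v‖ₑ * ‖𝓕⁻ m' (x + (c * q.1) • q.2 + θ • v)‖ₑ) fun q => ?_).trans ?_
  · simp only [enorm_mul, enorm_pw, mul_one]
    refine mul_le_mul_right ((enorm_integral_le_lintegral_enorm _).trans (le_of_eq ?_)) _; simp_rw [enorm_mul]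
  · refine le_of_eq (lintegral_prod _ ?_); have hFm := continuous_fourierInv hm1
    have hinner : AEMeasurable (fun q : ℝ × E3 => ∫⁻ v, ‖g v‖ₑ * ‖𝓕⁻ m' (x + (c * q.1) • q.2 + θ • v)‖ₑ) (seg.prod volume) := by
      have hgm := hg.1.aemeasurable
      refine AEMeasurable.lintegral_prod_right' (f := fun s : (ℝ × E3) × E3 =>
        ‖g s.2‖ₑ * ‖𝓕⁻ m' (x + (c * s.1.1) • s.1.2 + θ • s.2)‖ₑ) ?_
      exact (hgm.comp_quasiMeasurePreserving Measure.quasiMeasurePreserving_snd).enorm.mul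
        (Continuous.measurable (by fun_prop)).aemeasurable.enorm
    exact (hma.comp_quasiMeasurePreserving Measure.quasiMeasurePreserving_snd).enorm.mul hinner

open scoped FourierTransform

/-- The Fourier transform in velocity, in Mathlib's normalisation. -/
noncomputable def ft (u : X) (x ξ : E3) : ℂ := 𝓕 (fun v => (u (x, v) : ℂ)) ξ

lemma measurable_ft (u : X) : Measurable fun p : Phase => ft u p.1 p.2 := by
  have hu := measurable_coe u; simp only [ft, fourier_pw]
  exact (integral_prod_right' (f := fun q : Phase × E3 =>
    pw (-inner ℝ q.1.2 q.2) * (u (q.1.1, q.2) : ℂ)) (Measurable.stronglyMeasurable (by fun_prop))).measurable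

lemma quasiMeasurePreserving_scale {s : ℝ} (hs : s ≠ 0) :
    Measure.QuasiMeasurePreserving (fun p : Phase => (p.1, s • p.2)) volume volume := by
  have h : Measure.QuasiMeasurePreserving (fun ξ : E3 => s • ξ) volume volume := ⟨measurable_const_smul s, by
      rw [Measure.map_addHaar_smul _ hs]; exact Measure.smul_absolutelyContinuous⟩
  exact MeasureTheory.QuasiMeasurePreserving.prodMap (Measure.QuasiMeasurePreserving.id _) h

lemma fourierV_eq (u : X) (x ξ : E3) : fourierV (fun q => u q) x ((2 * π) • ξ) =
    (((2 * π) ^ (-(3 / 2 : ℝ)) : ℝ) : ℂ) * ft u x ξ := by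
  rw [fourierV, ft, fourier_pw]; congr 1
  refine integral_congr fun v => ?_; simp only [pw, inner_smul_right, real_inner_comm v ξ]; rw [mul_comm]; congr 2
  push_cast; ring

lemma IsTheta.ae_ft {z u f : X} (h : IsTheta z u f) {c : ℝ} (hc : c ≠ 0) : ∀ᵐ p : Phase, ft f p.1 (c • p.2) =
    I * (deltaV (density fun q => z q) p.1 ((2 * π * c) • p.2) : ℂ) * ft u p.1 (c • p.2) := by
  have := (quasiMeasurePreserving_scale (s := 2 * π * c) (by positivity)).ae h
  filter_upwards [this] with p hp
  simp only [mul_smul (2 * π) c, fourierV_eq] at hp ⊢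
  have h0 : (((2 * π) ^ (-(3 / 2 : ℝ)) : ℝ) : ℂ) ≠ 0 :=
    Complex.ofReal_ne_zero.2 (rpow_pos_of_pos (by positivity) _).ne'
  exact mul_left_cancel₀ h0 (by rw [hp]; ring)

lemma ae_section_memLp (u : X) : ∀ᵐ x : E3, MemLp (fun v : E3 => u (x, v)) 2 := by
  have hu := measurable_coe u; have h := lintegral_sq_lt_top (memLp_coe u)
  rw [volume_eq_prod, lintegral_prod _ (by fun_prop)] at h
  filter_upwards [ae_lt_top (lintegral_prod_right' (f := fun p : E3 × E3 => ‖u p‖ₑ ^ 2) (by fun_prop)) h.ne] with x hx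
  exact memLp_two_of_lintegral (hu.comp measurable_prodMk_left).aestronglyMeasurable hx

lemma lintegral_ft_sq (u : X) {θ : ℝ} (hθ : 0 < θ) :
    ofReal (θ ^ 3) * ∫⁻ p : Phase, ‖ft u p.1 (-θ • p.2)‖ₑ ^ 2 = ∫⁻ z, ‖u z‖ₑ ^ 2 := by
  have hm := measurable_ft u; have hu := measurable_coe u
  have hm' : Measurable fun p : Phase => ft u p.1 (-θ • p.2) :=
    hm.comp (g := fun p : Phase => ft u p.1 p.2) (f := fun p : Phase => (p.1, -θ • p.2)) (by fun_prop)
  rw [volume_eq_prod, lintegral_prod _ (by fun_prop), lintegral_prod _ (by fun_prop),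
    ← lintegral_const_mul' _ _ ofReal_ne_top]
  refine lintegral_congr_ae ?_
  filter_upwards [ae_integrable_section u, ae_section_memLp u] with x h1 h2
  simp only [neg_smul]
  rw [← lintegral_comp_smul (fun ξ => ‖ft u x (-ξ)‖ₑ ^ 2) hθ, lintegral_neg_eq_self (fun ξ => ‖ft u x ξ‖ₑ ^ 2),
    ← eLpNorm_two_sq]
  unfold ft; rw [eLpNorm_fourier (f := fun v => (u (x, v) : ℂ)) h1.ofReal h2.ofReal, eLpNorm_two_sq]
  simp_rw [enorm_complex_ofReal]

/-- The quantum operator is skew-symmetric. -/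
lemma IsTheta.integral_mul_eq_zero {z u f : X} (h : IsTheta z u f) : ∫ p, f p * u p = 0 := by
  have hi : Integrable (fun p => f p * u p) (volume : Measure (E3 × E3)) := by
    exact MemLp.integrable_mul (memLp_coe f) (memLp_coe u)
  have hF := h.ae_ft one_ne_zero; rw [volume_eq_prod] at hF ⊢
  rw [integral_prod _ hi]; refine integral_eq_zero_of_ae ?_
  filter_upwards [ae_integrable_section u, ae_section_memLp u, ae_integrable_section f, ae_section_memLp f,
    Measure.ae_ae_of_ae_prod hF] with x u1 u2 f1 f2 hx
  simp only [one_smul, mul_one] at hx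
  have e := integral_conj_fourier_mul (f := fun v => (u (x, v) : ℂ)) (g := fun v => (f (x, v) : ℂ))
    u1.ofReal u2.ofReal f1.ofReal f2.ofReal
  have e2 : ∫ ξ, (starRingEnd ℂ) (ft u x ξ) * ft f x ξ =
      I * ((∫ ξ, deltaV (density fun q => z q) x ((2 * π) • ξ) * Complex.normSq (ft u x ξ) : ℝ) : ℂ) := by
    rw [← integral_complex_ofReal, ← integral_const_mul]; refine integral_congr_ae ?_
    filter_upwards [hx] with ξ hξ
    rw [hξ, Complex.ofReal_mul, Complex.normSq_eq_conj_mul_self]; ring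
  unfold ft at e2; rw [e2] at e
  simp only [Complex.conj_ofReal, ← Complex.ofReal_mul] at e; rw [integral_complex_ofReal] at e
  have := congrArg Complex.re e
  simp only [Complex.mul_re, Complex.I_re, Complex.I_im, Complex.ofReal_re, Complex.ofReal_im] at this
  simp only [Pi.zero_apply]; rw [show ∫ y, f (x, y) * u (x, y) = ∫ y, u (x, y) * f (x, y) by simp_rw [mul_comm]]
  linarith

lemma enorm_integral_add_le {α : Type*} [MeasurableSpace α] {μ : Measure α} {F G : α → ℂ} (hF : Integrable F μ)
    (hG : AEStronglyMeasurable G μ) : ‖∫ a, (F a + G a) ∂μ‖ₑ ≤ ‖∫ a, F a ∂μ‖ₑ + ∫⁻ a, ‖G a‖ₑ ∂μ := by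
  by_cases h : Integrable G μ
  · rw [integral_add hF h]; exact (enorm_add_le _ _).trans (by gcongr; exact enorm_integral_le_lintegral_enorm _)
  · have : ∫⁻ a, ‖G a‖ₑ ∂μ = ∞ := by by_contra hne; exact h ⟨hG, lt_top_iff_ne_top.2 hne⟩
    rw [this]; simp

lemma enorm_integral_sum_add_le {α : Type*} [MeasurableSpace α] {μ : Measure α} {F G : Fin 3 → α → ℂ}
    (hF : ∀ j, Integrable (F j) μ) (hG : ∀ j, Measurable (G j)) :
    ‖∫ a, ∑ j, (F j a + G j a) ∂μ‖ₑ ≤ ∑ j, (‖∫ a, F j a ∂μ‖ₑ + ∫⁻ a, ‖G j a‖ₑ ∂μ) := by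
  simp_rw [Finset.sum_add_distrib]
  refine (enorm_integral_add_le (integrable_finsetSum _ fun j _ => hF j)
    (Finset.measurable_fun_sum _ fun j _ => hG j).aestronglyMeasurable).trans (add_le_add ?_ ?_)
  · rw [integral_finset_sum _ fun j _ => hF j]; exact enorm_sum_le _ _
  · rw [← lintegral_finsetSum _ fun j _ => (hG j).enorm]; exact lintegral_mono fun ξ => enorm_sum_le _ _

lemma enorm_integral_slice_le {g φ m : E3 → ℂ} {a : Fin 3 → E3 → ℂ} {B : Fin 3 → E3 → ℂ} (hg : Integrable g)
    (hφ : Integrable φ) (hm : Measurable m) (hmi : Integrable m)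
    (hm1 : ∀ j : Fin 3, Integrable fun ξ => (ξ j : ℂ) * m ξ) (ha : ∀ j, Integrable (a j))
    (hB : ∀ j, Measurable (B j)) {θ c : ℝ} (hc : 0 < c) {x : E3}
    (h : ∀ᵐ ξ, 𝓕 φ (-θ • ξ) = I * (-c * ∑ j, (ξ j * ∫ r, 𝓕⁻ (a j) (x + (c * r) • ξ) ∂seg + ξ j * B j ξ)) *
      𝓕 g (-θ • ξ)) :
    ‖∫ v, φ v * 𝓕⁻ m (x + θ • v)‖ₑ ≤ ofReal c * ∑ j, ((∫⁻ r, (∫⁻ k, ‖a j k‖ₑ * ∫⁻ v, ‖g v‖ₑ *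
          ‖𝓕∂[j,m] (x + (c * r) • k + θ • v)‖ₑ) ∂seg) +
        ∫⁻ ξ, ‖(ξ j : ℂ) * m ξ‖ₑ * ‖𝓕 g (-θ • ξ)‖ₑ * ‖B j ξ‖ₑ) := by
  have hF := (continuous_fourier hg).measurable
  have hQm : ∀ j, Measurable fun ξ => m ξ * pw (inner ℝ ξ x) * 𝓕 g (-θ • ξ) * (ξ j * B j ξ) := fun j => by
    have := hB j; fun_prop
  have key := enorm_integral_sum_add_le (fun j => (enorm_integral_planeWaves_le hg hm j (hm1 j) (ha j) θ c x).1) hQm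
  have e : ∫ v, φ v * 𝓕⁻ m (x + θ • v) = (-c * I) * ∫ ξ, ∑ j,
      (m ξ * pw (inner ℝ ξ x) * 𝓕 g (-θ • ξ) * (ξ j * ∫ r, 𝓕⁻ (a j) (x + (c * r) • ξ) ∂seg) +
        m ξ * pw (inner ℝ ξ x) * 𝓕 g (-θ • ξ) * (ξ j * B j ξ)) := by
    rw [← integral_const_mul, integral_mul_fourierInv hφ hmi]; refine integral_congr_ae ?_
    filter_upwards [h] with ξ h3
    rw [h3]; simp only [← mul_add, ← mul_sum]; ring
  have hnc : ‖(-c * I : ℂ)‖ₑ = ofReal c := by rw [← ofReal_norm]; simp [abs_of_pos hc]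
  rw [e, enorm_mul, hnc]
  refine mul_le_mul_right (key.trans (sum_le_sum fun j _ => add_le_add
    (enorm_integral_planeWaves_le hg hm j (hm1 j) (ha j) θ c x).2 (le_of_eq (lintegral_congr fun ξ => ?_)))) _
  simp only [enorm_mul, enorm_pw, mul_one]; ring

section Core

variable {n : E3 → ℝ} {a : Fin 3 → E3 → ℂ} {b : Fin 3 → E3 → ℝ}

lemma ae_deltaV_decomposition (hn : Measurable n) (h2 : MemLp n 2) (ha : ∀ j, Integrable (a j))
    (hdec : ∀ᵐ x, ∀ j, (comp j n x : ℂ) = 𝓕⁻ (a j) x + b j x) {c : ℝ} (hc : 0 < c) :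
    ∀ᵐ p : Phase, (deltaV n p.1 ((-c) • p.2) : ℂ) =
      -c * ∑ j, (p.2 j * ∫ r, 𝓕⁻ (a j) (p.1 + (c * r) • p.2) ∂seg + p.2 j * ∫ r, (b j (p.1 + (c * r) • p.2) : ℂ) ∂seg) := by
  have hQ := quasiMeasurePreserving_scale (s := -c) (by simpa using hc.ne')
  filter_upwards [hQ.ae (deltaV_eq_integral hn h2), hQ.ae (ae_lintegral_riesz_segment hn h2),
    hQ.ae (ae_segment hdec)] with p h1 h3 h4
  have e : ∀ r : ℝ, p.1 - r • (-c) • p.2 = p.1 + (c * r) • p.2 := fun r => by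
    rw [smul_smul, mul_neg, neg_smul, sub_neg_eq_add, mul_comm]
  simp only [e] at h1 h3 h4
  have hia : ∀ j, Integrable (fun r => 𝓕⁻ (a j) (p.1 + (c * r) • p.2)) seg := fun j => by
    have := continuous_fourierInv (ha j)
    refine (integrable_const (∫ k, ‖a j k‖)).mono' (Continuous.aestronglyMeasurable (by fun_prop))
      (of_forall fun r => ?_)
    rw [fourierInv_pw]; refine (norm_integral_le_integral_norm _).trans (le_of_eq ?_)
    simp only [norm_mul, norm_pw, one_mul]
  have hic : ∀ j, Integrable (fun r => comp j n (p.1 + (c * r) • p.2)) seg := fun j => by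
    have := measurable_comp j hn
    refine ⟨(this.comp (by fun_prop)).aestronglyMeasurable, (lintegral_mono fun r => ?_).trans_lt h3⟩
    exact enorm_comp_le j n _
  rw [h1, ← integral_complex_ofReal]
  simp only [Complex.ofReal_sum, Complex.ofReal_mul, PiLp.smul_apply, smul_eq_mul, Complex.ofReal_neg]
  rw [integral_finset_sum _ fun j _ => (hic j).ofReal.const_mul _, mul_sum]; refine sum_congr rfl fun j _ => ?_
  rw [integral_const_mul, ← mul_add, ← mul_assoc]; congr 1
  have hb : ∫ r, (b j (p.1 + (c * r) • p.2) : ℂ) ∂seg =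
      ∫ r, ((comp j n (p.1 + (c * r) • p.2) : ℂ) - 𝓕⁻ (a j) (p.1 + (c * r) • p.2)) ∂seg := by
    refine integral_congr_ae ?_
    filter_upwards [h4] with r hr
    rw [hr j]; ring
  have hic' : Integrable (fun r => (comp j n (p.1 + (c * r) • p.2) : ℂ)) seg := (hic j).ofReal
  rw [hb, integral_sub hic' (hia j)]; ring

lemma measurable_ft_scale (u : X) (θ : ℝ) : Measurable fun p : Phase => ft u p.1 (-θ • p.2) :=
  (measurable_ft u).comp (g := fun p : Phase => ft u p.1 p.2) (f := fun p : Phase => (p.1, -θ • p.2)) (by fun_prop)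

lemma measurable_segment_lintegral {b : E3 → ℝ} (hb : Measurable b) (c : ℝ) :
    Measurable fun p : Phase => ∫⁻ r, ‖b (p.1 + (c * r) • p.2)‖ₑ ∂seg :=
  lintegral_prod_right' (f := fun q : Phase × ℝ => ‖b (q.1.1 + (c * q.2) • q.1.2)‖ₑ) (by fun_prop)

lemma core_slice_bound {u f : X} (hn : Measurable n) (h2 : MemLp n 2)
    (ha : ∀ j, Integrable (a j)) (hb : ∀ j, Measurable (b j))
    (hdec : ∀ᵐ x, ∀ j, (comp j n x : ℂ) = 𝓕⁻ (a j) x + b j x) {θ : ℝ} (hθ : 0 < θ)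
    (hf : ∀ᵐ p : Phase, ft f p.1 (-θ • p.2) = I * (deltaV n p.1 ((2 * π * -θ) • p.2) : ℂ) * ft u p.1 (-θ • p.2))
    {m : E3 → ℂ} (hm : Measurable m) (hmi : Integrable m) (hm1 : ∀ j : Fin 3, Integrable fun ξ => (ξ j : ℂ) * m ξ)
    {ψ : E3 → ℝ} (hψ : ∀ x, (ψ x : ℂ) = 𝓕⁻ m x) {c : ℝ} (hc : c = 2 * π * θ) :
    ∀ᵐ x : E3, ‖∫ v, f (x, v) * ψ (x + θ • v)‖ₑ ≤ ofReal c * ∑ j, ((∫⁻ r, (∫⁻ k, ‖a j k‖ₑ * ∫⁻ v, ‖u (x, v)‖ₑ *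
          ‖𝓕∂[j,m] (x + (c * r) • k + θ • v)‖ₑ) ∂seg) +
        ∫⁻ ξ, ‖(ξ j : ℂ) * m ξ‖ₑ * ‖ft u x (-θ • ξ)‖ₑ * ∫⁻ r, ‖b j (x + (c * r) • ξ)‖ₑ ∂seg) := by
  have hc0 : 0 < c := by rw [hc]; positivity
  have hft := measurable_ft_scale u θ
  have hbm : ∀ j, Measurable fun p : Phase => ∫ r, (b j (p.1 + (c * r) • p.2) : ℂ) ∂seg := fun j => by
    have := hb j
    exact (integral_prod_right' (f := fun q : Phase × ℝ => (b j (q.1.1 + (c * q.2) • q.1.2) : ℂ))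
      (Measurable.stronglyMeasurable (by fun_prop))).measurable
  have hbm' := fun j => measurable_segment_lintegral (hb j) c; have hdV := ae_deltaV_decomposition hn h2 ha hdec hc0
  rw [volume_eq_prod] at hdV hf
  filter_upwards [ae_integrable_section u, ae_integrable_section f, Measure.ae_ae_of_ae_prod hdV,
    Measure.ae_ae_of_ae_prod hf] with x u1 f1 hV hF
  have key := enorm_integral_slice_le (g := fun v => (u (x, v) : ℂ)) (φ := fun v => (f (x, v) : ℂ)) u1.ofReal f1.ofReal
    hm hmi hm1 ha (B := fun j ξ => ∫ r, (b j (x + (c * r) • ξ) : ℂ) ∂seg)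
    (fun j => (hbm j).comp measurable_prodMk_left) (θ := θ) hc0 (x := x) (by
      filter_upwards [hV, hF] with ξ h3 h4
      have h5 : 2 * π * -θ = -c := by rw [hc]; ring
      simp only [h5] at h4; rw [h3] at h4; exact h4)
  simp only [← hψ, ← Complex.ofReal_mul] at key; rw [integral_complex_ofReal, enorm_complex_ofReal] at key
  simp only [enorm_complex_ofReal] at key
  refine key.trans (mul_le_mul_right (sum_le_sum fun j _ => add_le_add le_rfl
    (lintegral_mono fun ξ => mul_le_mul_right ?_ _)) _)
  exact (enorm_integral_le_lintegral_enorm _).trans (le_of_eq (by simp_rw [enorm_complex_ofReal]))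

lemma core_bound {u f : X} (hn : Measurable n) (h2 : MemLp n 2) (ham : ∀ j, Measurable (a j))
    (ha : ∀ j, Integrable (a j)) (hb : ∀ j, Measurable (b j))
    (hdec : ∀ᵐ x, ∀ j, (comp j n x : ℂ) = 𝓕⁻ (a j) x + b j x) {θ : ℝ} (hθ : 0 < θ)
    (hf : ∀ᵐ p : Phase, ft f p.1 (-θ • p.2) = I * (deltaV n p.1 ((2 * π * -θ) • p.2) : ℂ) * ft u p.1 (-θ • p.2))
    {m : E3 → ℂ} (hm : Measurable m) (hmi : Integrable m) (hm1 : ∀ j : Fin 3, Integrable fun ξ => (ξ j : ℂ) * m ξ)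
    (hm2 : ∀ j : Fin 3, MemLp (fun ξ => (ξ j : ℂ) * m ξ) 2) {ψ : E3 → ℝ} (hψm : Measurable ψ) (hψ2 : MemLp ψ 2)
    (hψ : ∀ x, (ψ x : ℂ) = 𝓕⁻ m x) :
    ‖∫ z : Phase, f z * ψ (z.1 + θ • z.2)‖ₑ ≤ ofReal (2 * π * θ) *
      ∑ j, ((∫⁻ k, ‖a j k‖ₑ) * (‖u‖ₑ * ((∫⁻ ξ, ‖(ξ j : ℂ) * m ξ‖ₑ ^ 2) * wtInt) ^ (1 / 2 : ℝ)) +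
        ∫⁻ p : Phase, ‖(p.2 j : ℂ) * m p.2‖ₑ * ‖ft u p.1 (-θ • p.2)‖ₑ *
          ∫⁻ r, ‖b j (p.1 + (2 * π * θ * r) • p.2)‖ₑ ∂seg) := by
  set c := 2 * π * θ with hc
  have hc0 : 0 < c := by positivity
  have hum := measurable_coe u; have hft := measurable_ft_scale u θ
  have hi := integrable_mul_comp_shear f θ hψm hψ2; have hbm' := fun j => measurable_segment_lintegral (hb j) c
  have hΨ : ∀ j : Fin 3, Continuous (𝓕⁻ fun ξ : E3 => (ξ j : ℂ) * m ξ) := fun j => continuous_fourierInv (hm1 j)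
  have hslice := core_slice_bound hn h2 ha hb hdec hθ hf hm hmi hm1 hψ hc
  have hmA : ∀ j, Measurable fun s : (E3 × ℝ) × E3 => ‖a j s.2‖ₑ * ∫⁻ v, ‖u (s.1.1, v)‖ₑ *
      ‖𝓕∂[j,m] (s.1.1 + (c * s.1.2) • s.2 + θ • v)‖ₑ := fun j => by
    have := ham j; have := (hΨ j).measurable
    exact Measurable.mul (by fun_prop) (lintegral_prod_right' (f := fun s : ((E3 × ℝ) × E3) × E3 =>
      ‖u (s.1.1.1, s.2)‖ₑ * ‖𝓕∂[j,m] (s.1.1.1 + (c * s.1.1.2) • s.1.2 + θ • s.2)‖ₑ) (by fun_prop))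
  calc _ ≤ ∫⁻ x, ‖∫ v, f (x, v) * ψ (x + θ • v)‖ₑ := by
        rw [volume_eq_prod, integral_prod _ hi]; exact enorm_integral_le_lintegral_enorm _
    _ ≤ _ := lintegral_mono_ae hslice
    _ = ofReal c * ∑ j, ((∫⁻ x, ∫⁻ r, (∫⁻ k, ‖a j k‖ₑ * ∫⁻ v, ‖u (x, v)‖ₑ *
          ‖𝓕∂[j,m] (x + (c * r) • k + θ • v)‖ₑ) ∂seg) +
        ∫⁻ x, ∫⁻ ξ, ‖(ξ j : ℂ) * m ξ‖ₑ * ‖ft u x (-θ • ξ)‖ₑ * ∫⁻ r, ‖b j (x + (c * r) • ξ)‖ₑ ∂seg) := by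
        have hm3 : ∀ j, Measurable fun x : E3 => ∫⁻ r, (∫⁻ k, ‖a j k‖ₑ * ∫⁻ v, ‖u (x, v)‖ₑ *
            ‖𝓕∂[j,m] (x + (c * r) • k + θ • v)‖ₑ) ∂seg := fun j =>
          (hmA j).lintegral_prod_right'.lintegral_prod_right'
        have hm4 : ∀ j, Measurable fun x : E3 => ∫⁻ ξ, ‖(ξ j : ℂ) * m ξ‖ₑ * ‖ft u x (-θ • ξ)‖ₑ *
            ∫⁻ r, ‖b j (x + (c * r) • ξ)‖ₑ ∂seg := fun j => by
          have := hbm' j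
          exact lintegral_prod_right' (f := fun p : Phase => ‖(p.2 j : ℂ) * m p.2‖ₑ * ‖ft u p.1 (-θ • p.2)‖ₑ *
            ∫⁻ r, ‖b j (p.1 + (c * r) • p.2)‖ₑ ∂seg) (by fun_prop)
        rw [lintegral_const_mul' _ _ ofReal_ne_top, lintegral_finsetSum _ fun j _ => (hm3 j).fun_add (hm4 j)]; congr 1
        exact sum_congr rfl fun j _ => lintegral_add_left (hm3 j) _
    _ ≤ _ := by
      refine mul_le_mul_right (sum_le_sum fun j _ => add_le_add ?_ (le_of_eq ?_)) _
      · have hΨ2 : ∫⁻ x, ‖𝓕∂[j,m] x‖ₑ ^ 2 = ∫⁻ ξ, ‖(ξ j : ℂ) * m ξ‖ₑ ^ 2 := by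
          rw [← eLpNorm_two_sq, ← eLpNorm_two_sq, eLpNorm_fourierInv (hm1 j) (hm2 j)]
        have hin : ∀ (r : ℝ) (k : E3), ∫⁻ x, ∫⁻ v, ‖u (x, v)‖ₑ *
            ‖𝓕∂[j,m] (x + (c * r) • k + θ • v)‖ₑ ≤
            ‖u‖ₑ * ((∫⁻ ξ, ‖(ξ j : ℂ) * m ξ‖ₑ ^ 2) * wtInt) ^ (1 / 2 : ℝ) := fun r k => by
          have hΨm := (hΨ j).measurable
          have h5 := lintegral_mul_comp_shear_le u θ (h := fun y => ‖𝓕∂[j,m] (y + (c * r) • k)‖ₑ)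
            (by fun_prop)
          rw [lintegral_add_right_eq_self (fun y : E3 => ‖𝓕∂[j,m] y‖ₑ ^ 2), hΨ2,
            volume_eq_prod, lintegral_prod _ (by fun_prop)] at h5
          simp only [add_right_comm _ _ (θ • _)]; exact h5
        calc _ = ∫⁻ r, (∫⁻ x, ∫⁻ k, ‖a j k‖ₑ * ∫⁻ v, ‖u (x, v)‖ₑ *
              ‖𝓕∂[j,m] (x + (c * r) • k + θ • v)‖ₑ) ∂seg :=
              lintegral_lintegral_swap (hmA j).lintegral_prod_right'.aemeasurable
          _ = ∫⁻ r, (∫⁻ k, ‖a j k‖ₑ * ∫⁻ x, ∫⁻ v, ‖u (x, v)‖ₑ *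
              ‖𝓕∂[j,m] (x + (c * r) • k + θ • v)‖ₑ) ∂seg := by
              refine lintegral_congr fun r => ?_
              rw [lintegral_lintegral_swap (f := fun x k => ‖a j k‖ₑ * ∫⁻ v, ‖u (x, v)‖ₑ *
                ‖𝓕∂[j,m] (x + (c * r) • k + θ • v)‖ₑ)
                ((hmA j).comp (f := fun p : E3 × E3 => ((p.1, r), p.2)) (by fun_prop)).aemeasurable]
              exact lintegral_congr fun k => lintegral_const_mul' _ _ enorm_ne_top
          _ ≤ ∫⁻ r, (∫⁻ k, ‖a j k‖ₑ * (‖u‖ₑ * ((∫⁻ ξ, ‖(ξ j : ℂ) * m ξ‖ₑ ^ 2) * wtInt) ^ (1 / 2 : ℝ))) ∂seg :=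
              lintegral_mono fun r => lintegral_mono fun k => mul_le_mul_right (hin r k) _
          _ = _ := by rw [lintegral_const, measure_univ, mul_one, lintegral_mul_const _ (ham j).enorm]
      · have := hbm' j; rw [volume_eq_prod, lintegral_prod _ (by fun_prop)]

end Core

open scoped FourierTransform

lemma lintegral_segment_sq_le {b : E3 → ℝ} (hb : Measurable b) (c : ℝ) (ξ : E3) :
    ∫⁻ x, (∫⁻ r, ‖b (x + (c * r) • ξ)‖ₑ ∂seg) ^ 2 ≤ ∫⁻ x, ‖b x‖ₑ ^ 2 := by
  calc _ ≤ ∫⁻ x, ∫⁻ r, ‖b (x + (c * r) • ξ)‖ₑ ^ 2 ∂seg := by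
        refine lintegral_mono fun x => ?_
        simpa using lintegral_mul_sq_le (μ := seg) (k := fun _ => 1) (f := fun r => ‖b (x + (c * r) • ξ)‖ₑ)
          measurable_const (by fun_prop)
    _ = ∫⁻ r, (∫⁻ x, ‖b (x + (c * r) • ξ)‖ₑ ^ 2) ∂seg :=
        lintegral_swap (by fun_prop)
    _ = _ := by simp_rw [lintegral_add_right_eq_self (fun x => ‖b x‖ₑ ^ 2)]; simp

lemma lintegral_highFreq_le (u : X) {m : E3 → ℂ} (hm : Measurable m) {b : E3 → ℝ} (hb : Measurable b) {θ : ℝ}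
    (hθ : 0 < θ) (c : ℝ) :
    ∫⁻ p : Phase, ‖m p.2‖ₑ * ‖ft u p.1 (-θ • p.2)‖ₑ * ∫⁻ r, ‖b (p.1 + (c * r) • p.2)‖ₑ ∂seg ≤
      ofReal (θ ^ (-(3 / 2 : ℝ))) * eLpNorm u 2 volume * eLpNorm m 2 volume * eLpNorm b 2 volume := by
  have hft := measurable_ft_scale u θ; have hbm := measurable_segment_lintegral hb c
  have h1 := lintegral_mul_le_sqrt (μ := volume) (f := fun p : Phase => ‖m p.2‖ₑ * ∫⁻ r, ‖b (p.1 + (c * r) • p.2)‖ₑ ∂seg)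
    (g := fun p => ‖ft u p.1 (-θ • p.2)‖ₑ) (by fun_prop) hft.enorm.aemeasurable
  have h2 : ∫⁻ p : Phase, (‖m p.2‖ₑ * ∫⁻ r, ‖b (p.1 + (c * r) • p.2)‖ₑ ∂seg) ^ 2 ≤
      (eLpNorm m 2 volume * eLpNorm b 2 volume) ^ 2 := by
    rw [mul_pow, eLpNorm_two_sq, eLpNorm_two_sq, volume_eq_prod, lintegral_prod_symm _ (by fun_prop),
      ← lintegral_mul_const _ (by fun_prop)]
    refine lintegral_mono fun ξ => ?_; simp_rw [mul_pow]
    rw [lintegral_const_mul' _ _ (by finiteness)]; exact mul_le_mul_right (lintegral_segment_sq_le hb c ξ) _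
  have h3 : ∫⁻ p : Phase, ‖ft u p.1 (-θ • p.2)‖ₑ ^ 2 = (ofReal (θ ^ (-(3 / 2 : ℝ))) * eLpNorm u 2 volume) ^ 2 := by
    rw [mul_pow, eLpNorm_two_sq, ← lintegral_ft_sq u hθ, ← mul_assoc, ← ENNReal.ofReal_pow (by positivity),
      ← ofReal_mul (by positivity), ← Real.rpow_natCast, ← Real.rpow_natCast, ← Real.rpow_mul hθ.le,
      ← rpow_add hθ]
    norm_num
  rw [h3, sq_rpow_half] at h1
  calc _ = ∫⁻ p : Phase, ‖m p.2‖ₑ * (∫⁻ r, ‖b (p.1 + (c * r) • p.2)‖ₑ ∂seg) * ‖ft u p.1 (-θ • p.2)‖ₑ :=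
        lintegral_congr fun p => by ring
    _ ≤ _ := h1
    _ ≤ (eLpNorm m 2 volume * eLpNorm b 2 volume) * (ofReal (θ ^ (-(3 / 2 : ℝ))) * eLpNorm u 2 volume) :=
        mul_le_mul_left ((rpow_le_rpow h2 (by norm_num)).trans_eq (sq_rpow_half _)) _
    _ = _ := by ring

lemma lintegral_lowFreq_le (u : X) {m : E3 → ℂ} (hm : Measurable m) {b : E3 → ℝ} (hb : Measurable b) (θ c : ℝ) :
    ∫⁻ p : Phase, ‖m p.2‖ₑ * ‖ft u p.1 (-θ • p.2)‖ₑ * ∫⁻ r, ‖b (p.1 + (c * r) • p.2)‖ₑ ∂seg ≤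
      (∫⁻ ξ, ‖m ξ‖ₑ) * ((wtInt * ‖u‖ₑ ^ 2) ^ (1 / 2 : ℝ) * eLpNorm b 2 volume) := by
  have hft := measurable_ft_scale u θ; have hbm := measurable_segment_lintegral hb c; have hu := measurable_coe u
  rw [volume_eq_prod, lintegral_prod_symm _ (by fun_prop), ← lintegral_mul_const _ (by fun_prop)]
  refine lintegral_mono fun ξ => ?_; simp_rw [mul_assoc]
  rw [lintegral_const_mul' _ _ enorm_ne_top]; refine mul_le_mul_right ?_ _
  set N : E3 → ℝ≥0∞ := fun x => ∫⁻ v, ‖u (x, v)‖ₑ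
  have hN : Measurable N := lintegral_prod_right' (f := fun p : E3 × E3 => ‖u p‖ₑ) (by fun_prop)
  calc _ ≤ ∫⁻ x, N x * ∫⁻ r, ‖b (x + (c * r) • ξ)‖ₑ ∂seg := by
        refine lintegral_mono fun x => mul_le_mul_left ((enorm_fourier_le _ _).trans (le_of_eq ?_)) _
        simp_rw [enorm_complex_ofReal]; rfl
    _ ≤ _ := lintegral_mul_le_sqrt hN.aemeasurable (hbm.comp measurable_prodMk_right).aemeasurable
    _ ≤ _ := by
      rw [eLpNorm_two_eq]; have := lintegral_average_sq u 0; simp only [zero_smul, sub_zero] at this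
      exact mul_le_mul' (rpow_le_rpow this (by norm_num))
        (rpow_le_rpow (lintegral_segment_sq_le hb c ξ) (by norm_num))

/-! ### The symbol of the smoothed field of a test density -/

section Symbol

variable {g : E3 → ℝ}

lemma IsBdd.memLp_fourier (hg : IsBdd g) : MemLp (𝓕 fun y => (g y : ℂ)) 2 :=
  WPFP.memLp_fourier hg.integrable.ofReal (hg.memLp 2).ofReal

lemma IsBdd.continuous_fourier (hg : IsBdd g) : Continuous (𝓕 fun y => (g y : ℂ)) :=
  WPFP.continuous_fourier hg.integrable.ofReal

lemma IsBdd.norm_fourier_le (hg : IsBdd g) (ξ : E3) : ‖𝓕 (fun y => (g y : ℂ)) ξ‖ ≤ (∫⁻ y, ‖g y‖ₑ).toReal := by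
  rw [← toReal_enorm]; refine toReal_mono hg.integrable.2.ne ((enorm_fourier_le _ ξ).trans (le_of_eq ?_))
  simp_rw [enorm_complex_ofReal]

lemma integrable_mul_fourier (hg : IsBdd g) {m : E3 → ℂ} (hm : Integrable m) :
    Integrable fun ξ => m ξ * 𝓕 (fun y => (g y : ℂ)) ξ :=
  (hm.bdd_mul (c := (∫⁻ y, ‖g y‖ₑ).toReal) hg.continuous_fourier.aestronglyMeasurable
    (of_forall hg.norm_fourier_le)).congr (of_forall fun ξ => mul_comm _ _)

lemma integrable_gexp_mul_fourier {M : ℝ} (hM : 0 < M) (hg : IsBdd g) :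
    Integrable fun ξ => (gexp M ξ : ℂ) * 𝓕 (fun y => (g y : ℂ)) ξ :=
  integrable_mul_fourier hg (integrable_gexp hM).ofReal

lemma memLp_gexp_mul_fourier {M : ℝ} (hM : 0 < M) (hg : IsBdd g) :
    MemLp (fun ξ => (gexp M ξ : ℂ) * 𝓕 (fun y => (g y : ℂ)) ξ) 2 := by
  refine hg.memLp_fourier.mono (integrable_gexp_mul_fourier hM hg).1 (of_forall fun ξ => ?_)
  rw [norm_mul, norm_real, norm_of_nonneg (gexp_pos M ξ).le]
  exact mul_le_of_le_one_left (norm_nonneg _) (gexp_le_one hM.le ξ)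

lemma eLpNorm_gexp_mul_fourier {M : ℝ} (hM : 0 < M) (hg : IsBdd g) :
    eLpNorm (fun ξ => (gexp M ξ : ℂ) * 𝓕 (fun y => (g y : ℂ)) ξ) 2 volume = eLpNorm (conv M g) 2 volume := by
  rw [← eLpNorm_fourierInv (integrable_gexp_mul_fourier hM hg) (memLp_gexp_mul_fourier hM hg)]
  refine eLpNorm_congr_norm_ae (of_forall fun x => ?_)
  rw [← integral_fourierInv_mul (m := fun ξ => (gexp M ξ : ℂ)) (g := fun y => (g y : ℂ)) (integrable_gexp hM).ofReal
    hg.integrable.ofReal]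
  have : ∀ y, 𝓕⁻ (fun ξ => ((gexp M ξ : ℝ) : ℂ)) (x - y) * (g y : ℂ) = ((gauss M (x - y) * g y : ℝ) : ℂ) := fun y => by
    rw [fourierInv_gexp hM, Complex.ofReal_mul]
  simp only [Complex.coe_algebraMap, this]; rw [integral_complex_ofReal, norm_real]; rfl

lemma norm_coord_mul_coulSymb_le (j k : Fin 3) {M : ℝ} (ξ : E3) (w : ℂ) :
    ‖(ξ k : ℂ) * (coulSymb j M ξ * w)‖ ≤ ‖(gexp M ξ : ℂ) * w‖ := by
  rw [norm_mul, norm_mul, norm_mul, ← mul_assoc, norm_real, norm_real, norm_of_nonneg (gexp_pos M ξ).le]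
  refine mul_le_mul_of_nonneg_right ?_ (norm_nonneg _)
  have h1 : (2 * π)⁻¹ ≤ 1 := inv_le_one_of_one_le₀ (by nlinarith [Real.pi_gt_three])
  calc _ ≤ ‖ξ‖ * ‖coulSymb j M ξ‖ := mul_le_mul_of_nonneg_right (PiLp.norm_apply_le ξ k) (norm_nonneg _)
    _ ≤ _ := norm_coulSymb_mul_le j M ξ
    _ ≤ _ := mul_le_of_le_one_left (gexp_pos M ξ).le h1

end Symbol

lemma eLpNorm_comp_le_field {n : E3 → ℝ} (hn : Measurable n) (h2 : MemLp n 2) (j : Fin 3) (p : ℝ≥0∞) :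
    eLpNorm (comp j n) p volume ≤ eLpNorm (field n) p volume := by
  refine eLpNorm_mono_ae ?_
  filter_upwards [ae_riesz_lt_top hn h2] with x hx
  rw [← field_apply hn hx j]; exact PiLp.norm_apply_le _ j

section Theta

variable {u f : X} {g : E3 → ℝ}

/-- The pairing of the nonlinear term with the smoothed field of a test density. -/
lemma IsTheta.core_bound (h : IsTheta u u f) (hg : IsBdd g) (j : Fin 3) {θ M : ℝ} (hθ : 0 < θ) (hM : 0 < M)
    {a : Fin 3 → E3 → ℂ} {b : Fin 3 → E3 → ℝ} (ham : ∀ j, Measurable (a j))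
    (ha : ∀ j, Integrable (a j)) (hb : ∀ j, Measurable (b j))
    (hdec : ∀ᵐ x, ∀ j, (comp j (density u) x : ℂ) = 𝓕⁻ (a j) x + b j x) :
    ‖∫ z : Phase, f z * conv M (comp j g) (z.1 + θ • z.2)‖ₑ ≤ ofReal (2 * π * θ) *
      ∑ k, ((∫⁻ y, ‖a k y‖ₑ) * (‖u‖ₑ * (eLpNorm (conv M g) 2 volume * wtInt ^ (1 / 2 : ℝ))) +
        min (ofReal (θ ^ (-(3 / 2 : ℝ))) * eLpNorm u 2 volume * eLpNorm (conv M g) 2 volume * eLpNorm (b k) 2 volume)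
          ((∫⁻ ξ, ‖(gexp M ξ : ℂ) * 𝓕 (fun y => (g y : ℂ)) ξ‖ₑ) *
            ((wtInt * ‖u‖ₑ ^ 2) ^ (1 / 2 : ℝ) * eLpNorm (b k) 2 volume))) := by
  set m : E3 → ℂ := fun ξ => coulSymb j M ξ * 𝓕 (fun y => (g y : ℂ)) ξ; have hc := hg.continuous_fourier.measurable
  have hmm : Measurable m := (measurable_coulSymb j M).mul hc
  have hle : ∀ k ξ, ‖(ξ k : ℂ) * m ξ‖ ≤ ‖(gexp M ξ : ℂ) * 𝓕 (fun y => (g y : ℂ)) ξ‖ :=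
    fun k ξ => norm_coord_mul_coulSymb_le j k ξ _
  have hkm : ∀ k : Fin 3, Measurable fun ξ : E3 => (ξ k : ℂ) * m ξ := fun k => by fun_prop
  have hL2 : ∀ k : Fin 3, eLpNorm (fun ξ => (ξ k : ℂ) * m ξ) 2 volume ≤ eLpNorm (conv M g) 2 volume := fun k =>
    (eLpNorm_mono (hle k)).trans_eq (eLpNorm_gexp_mul_fourier hM hg)
  have hL1 : ∀ k : Fin 3, ∫⁻ ξ, ‖(ξ k : ℂ) * m ξ‖ₑ ≤ ∫⁻ ξ, ‖(gexp M ξ : ℂ) * 𝓕 (fun y => (g y : ℂ)) ξ‖ₑ := fun k =>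
    lintegral_mono fun ξ => by rw [← ofReal_norm, ← ofReal_norm]; exact ofReal_le_ofReal (hle k ξ)
  have key := WPFP.core_bound (measurable_density u) (memLp_density u) ham ha hb hdec hθ
    (h.ae_ft (c := -θ) (by simpa using hθ.ne')) hmm (integrable_mul_fourier hg (integrable_coulSymb j hM))
    (fun k => (integrable_gexp_mul_fourier hM hg).mono (hkm k).aestronglyMeasurable (of_forall (hle k)))
    (fun k => (memLp_gexp_mul_fourier hM hg).mono (hkm k).aestronglyMeasurable (of_forall (hle k)))
    (measurable_conv M (measurable_comp j hg.meas)) (memLp_conv hM (measurable_comp j hg.meas) (hg.memLp_comp j))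
    (conv_comp j hM hg)
  refine key.trans (mul_le_mul_right (sum_le_sum fun k _ => add_le_add ?_ (le_min ?_ ?_)) _)
  · rw [← eLpNorm_two_sq, mul_rpow_of_nonneg _ _ (by norm_num), ← rpow_natCast, ← rpow_mul]; norm_num
    gcongr; exact hL2 k
  · refine (lintegral_highFreq_le u (hkm k) (hb k) hθ _).trans ?_; gcongr; exact hL2 k
  · refine (lintegral_lowFreq_le u (hkm k) (hb k) θ _).trans (mul_le_mul_left (hL1 k) _)

lemma fourierInv_zero : 𝓕⁻ (fun _ : E3 => (0 : ℂ)) = fun _ => 0 := by ext x; simp [fourierInv_pw]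

lemma IsTheta.enorm_integral_le (h : IsTheta u u f) (hg : IsBdd g) (j : Fin 3) {θ M : ℝ} (hθ : 0 < θ) (hM : 0 < M) :
    ‖∫ z : Phase, f z * conv M (comp j g) (z.1 + θ • z.2)‖ₑ ≤ ofReal (6 * π * θ ^ (-(1 / 2 : ℝ))) *
      (eLpNorm u 2 volume * eLpNorm (field (density u)) 2 volume * eLpNorm (conv M g) 2 volume) := by
  have hd := measurable_density u; have hd2 := memLp_density u
  refine (h.core_bound hg j hθ hM (a := fun _ _ => 0) (b := fun k => comp k (density u))
    (fun _ => measurable_const) (fun _ => integrable_zero _ _ _) (fun k => measurable_comp k hd)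
    (by simp [fourierInv_zero])).trans ?_
  calc _ ≤ ofReal (2 * π * θ) * ∑ k : Fin 3, (ofReal (θ ^ (-(3 / 2 : ℝ))) *
        eLpNorm u 2 volume * eLpNorm (conv M g) 2 volume * eLpNorm (field (density u)) 2 volume) := by
        refine mul_le_mul_right (sum_le_sum fun k _ => ?_) _
        simp only [enorm_zero, lintegral_zero, zero_mul, zero_add]
        exact (min_le_left _ _).trans (mul_le_mul_right (eLpNorm_comp_le_field hd hd2 k 2) _)
    _ = (ofReal (2 * π * θ) * 3 * ofReal (θ ^ (-(3 / 2 : ℝ)))) *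
        (eLpNorm u 2 volume * eLpNorm (field (density u)) 2 volume *
        eLpNorm (conv M g) 2 volume) := by simp; ring
    _ = _ := by
      congr 1
      rw [show (3 : ℝ≥0∞) = ofReal 3 by simp, ← ofReal_mul (by positivity),
        ← ofReal_mul (by positivity)]
      congr 1
      have : θ ^ (-(1 / 2 : ℝ)) = θ * θ ^ (-(3 / 2 : ℝ)) := by rw [← Real.rpow_one_add' hθ.le (by norm_num)]; norm_num
      rw [this]; ring

/-- The low frequency bound, uniform in the smoothing time up to the decay of the symbol. -/
lemma IsTheta.enorm_integral_lowFreq_le (h : IsTheta u u f) (hg : IsBdd g) (j : Fin 3) {θ M : ℝ} (hθ : 0 < θ) (hM : 0 < M) :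
    ‖∫ z : Phase, f z * conv M (comp j g) (z.1 + θ • z.2)‖ₑ ≤ ofReal (6 * π * θ) *
      ((∫⁻ ξ, ofReal (gexp (2 * M) ξ)) ^ (1 / 2 : ℝ) * eLpNorm g 2 volume *
        ((wtInt * ‖u‖ₑ ^ 2) ^ (1 / 2 : ℝ) * eLpNorm (field (density u)) 2 volume)) := by
  have hd := measurable_density u; have hd2 := memLp_density u
  have hF : ∫⁻ ξ, ‖(gexp M ξ : ℂ) * 𝓕 (fun y => (g y : ℂ)) ξ‖ₑ ≤
      (∫⁻ ξ, ofReal (gexp (2 * M) ξ)) ^ (1 / 2 : ℝ) * eLpNorm g 2 volume := by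
    have h1 := lintegral_mul_le_sqrt (μ := volume) (f := fun ξ => ‖gexp M ξ‖ₑ) (g := fun ξ => ‖𝓕 (fun y => (g y : ℂ)) ξ‖ₑ)
      (continuous_gexp M).measurable.enorm.aemeasurable hg.continuous_fourier.measurable.enorm.aemeasurable
    rw [← eLpNorm_two_eq (f := 𝓕 fun y => (g y : ℂ)), eLpNorm_fourier (f := fun y => (g y : ℂ)) hg.integrable.ofReal (hg.memLp 2).ofReal] at h1
    simp_rw [enorm_mul, enorm_complex_ofReal]; refine h1.trans (le_of_eq ?_); congr 1
    · congr 1; refine lintegral_congr fun ξ => ?_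
      rw [enorm_of_nonneg (gexp_pos M ξ).le, sq, ← ofReal_mul (gexp_pos M ξ).le, ← gexp_add, two_mul]
    · exact eLpNorm_congr_norm_ae (of_forall fun x => by simp)
  refine (h.core_bound hg j hθ hM (a := fun _ _ => 0) (b := fun k => comp k (density u))
    (fun _ => measurable_const) (fun _ => integrable_zero _ _ _) (fun k => measurable_comp k hd)
    (by simp [fourierInv_zero])).trans ?_
  calc _ ≤ ofReal (2 * π * θ) * ∑ _k : Fin 3,
        ((∫⁻ ξ, ofReal (gexp (2 * M) ξ)) ^ (1 / 2 : ℝ) * eLpNorm g 2 volume *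
        ((wtInt * ‖u‖ₑ ^ 2) ^ (1 / 2 : ℝ) * eLpNorm (field (density u)) 2 volume)) := by
        refine mul_le_mul_right (sum_le_sum fun k _ => ?_) _
        simp only [enorm_zero, lintegral_zero, zero_mul, zero_add]
        refine (min_le_right _ _).trans (mul_le_mul' hF (mul_le_mul_right (eLpNorm_comp_le_field hd hd2 k 2) _))
    _ = _ := by
      rw [show 6 * π * θ = 2 * π * θ * 3 by ring, ofReal_mul (p := 2 * π * θ) (by positivity)]
      simp; ring

/-- The a priori bound, which does not require the field to be square integrable. -/
lemma IsTheta.exists_enorm_integral_apriori_le : ∃ C : ℝ≥0∞, C ≠ ∞ ∧ ∀ (u f : X), IsTheta u u f → ∀ (g : E3 → ℝ),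
    IsBdd g → ∀ (j : Fin 3) (θ M : ℝ), 0 < θ → 0 < M → ‖∫ z : Phase, f z * conv M (comp j g) (z.1 + θ • z.2)‖ₑ ≤
      C * ofReal (θ + θ ^ (-(1 / 2 : ℝ))) * (‖u‖ₑ ^ 2 * eLpNorm (conv M g) 2 volume) := by
  obtain ⟨C, hC, H⟩ := exists_comp_decomposition
  refine ⟨6 * ofReal π * C * (wtInt + wtInt ^ (1 / 2 : ℝ)), by have := wtInt_lt_top.ne; finiteness,
    fun u f h g hg j θ M hθ hM => ?_⟩
  have hd := measurable_density u; have hd2 := memLp_density u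
  choose a b ham ha hb ha1 hb2 hdec using fun k => H k _ hd hd2
  have hn2 : eLpNorm (density u) 2 volume ≤ wtInt ^ (1 / 2 : ℝ) * ‖u‖ₑ := by
    rw [eLpNorm_two_eq]; refine (rpow_le_rpow (lintegral_density_sq_le u) (by norm_num)).trans (le_of_eq ?_)
    rw [mul_rpow_of_nonneg _ _ (by norm_num), sq_rpow_half]
  refine (h.core_bound hg j hθ hM ham ha hb (ae_all_iff.2 hdec)).trans ?_; set G := eLpNorm (conv M g) 2 volume
  set w := wtInt ^ (1 / 2 : ℝ) with hw
  have hww : w * w = wtInt := by rw [hw, ← sq, rpow_half_sq]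
  calc _ ≤ ofReal (2 * π * θ) * ∑ _k : Fin 3, (C * (w * ‖u‖ₑ) * (‖u‖ₑ * (G * w)) +
        ofReal (θ ^ (-(3 / 2 : ℝ))) * ‖u‖ₑ * G * (C * (w * ‖u‖ₑ))) := by
        refine mul_le_mul_right (sum_le_sum fun k _ => add_le_add ?_ ((min_le_left _ _).trans ?_)) _
        · exact mul_le_mul_left ((ha1 k).trans (mul_le_mul_right hn2 _)) _
        · exact mul_le_mul' (mul_le_mul_left (mul_le_mul_right (eLpNorm_coe_le u) _) _)
            ((hb2 k).trans (mul_le_mul_right hn2 _))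
    _ = (6 * ofReal π * C) * (ofReal θ * wtInt +
          ofReal (θ * θ ^ (-(3 / 2 : ℝ))) * w) * (‖u‖ₑ ^ 2 * G) := by
        rw [← hww, ofReal_mul (by positivity), ofReal_mul (by positivity), ofReal_mul hθ.le]
        simp; ring
    _ ≤ (6 * ofReal π * C) * (ofReal (θ + θ ^ (-(1 / 2 : ℝ))) * wtInt +
          ofReal (θ + θ ^ (-(1 / 2 : ℝ))) * w) * (‖u‖ₑ ^ 2 * G) := by
        have h1 : θ * θ ^ (-(3 / 2 : ℝ)) = θ ^ (-(1 / 2 : ℝ)) := by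
          rw [← Real.rpow_one_add' hθ.le (by norm_num)]; norm_num
        have h2 : 0 ≤ θ ^ (-(1 / 2 : ℝ)) := by positivity
        rw [h1]; gcongr <;> linarith
    _ = _ := by ring

end Theta

/-- `w` solves `w(t) = S(t) w₀ + ∫₀ᵗ S(t-s) F(s) ds` with the nonlinear forcing `F = Θ[V[w]] w`. -/
structure IsDuhamel (S : ℝ → X →L[ℝ] X) (T : ℝ) (w₀ : X) (w F : ℝ → X) : Prop where
  cont : ContinuousOn w (Icc 0 T)
  theta : ∀ s ∈ Ioc 0 T, IsTheta (w s) (w s) (F s)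
  int : IntegrableOn F (Ioc 0 T)
  eq : ∀ t ∈ Icc 0 T, w t = S t w₀ + ∫ s in Ioc 0 t, S (t - s) (F s)

namespace IsDuhamel

variable {α β γ σ : ℝ} {S : ℝ → X →L[ℝ] X} {T : ℝ} {w₀ : X} {w F : ℝ → X}

lemma integrableOn (h : IsDuhamel S T w₀ w F) (hS : IsC0Semigroup S) {b : ℝ} (hb : b ≤ T) :
    IntegrableOn (fun s => S (b - s) (F s)) (Ioc 0 b) := by
  obtain ⟨M, hM0, hM⟩ := hS.exists_bound b; have hF := h.int.mono_set (Ioc_subset_Ioc_right hb)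
  have hm : AEStronglyMeasurable (fun s => S (max (b - s) 0) (F s)) (volume.restrict (Ioc 0 b)) :=
    hS.continuous_max.comp_aestronglyMeasurable
      ((by fun_prop : Continuous fun s : ℝ => b - s).aestronglyMeasurable.prodMk hF.1)
  refine (hF.norm.const_mul M).mono' (hm.congr ?_) ?_
  · filter_upwards [ae_restrict_mem measurableSet_Ioc] with s hs
    rw [max_eq_left (by linarith [hs.2])]
  · filter_upwards [ae_restrict_mem measurableSet_Ioc] with s hs
    exact (le_opNorm _ _).trans
      (mul_le_mul_of_nonneg_right (hM _ ⟨by linarith [hs.2], by linarith [hs.1]⟩) (norm_nonneg _))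

lemma eq_restart (h : IsDuhamel S T w₀ w F) (hS : IsC0Semigroup S) {a b : ℝ} (ha : 0 ≤ a) (hab : a ≤ b)
    (hb : b ≤ T) : w b = S (b - a) (w a) + ∫ s in Ioc a b, S (b - s) (F s) := by
  have hi := h.integrableOn hS hb
  rw [h.eq b ⟨ha.trans hab, hb⟩, h.eq a ⟨ha, hab.trans hb⟩, map_add, ← hS.add_apply (by linarith) ha,
    sub_add_cancel, ← integral_comp_comm _ (h.integrableOn hS (hab.trans hb)), add_assoc]
  congr 1
  rw [← Ioc_union_Ioc_eq_Ioc ha hab, setIntegral_union (Ioc_disjoint_Ioc_of_le le_rfl) measurableSet_Ioc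
    (hi.mono_set (Ioc_subset_Ioc_right hab)) (hi.mono_set (Ioc_subset_Ioc_left ha))]
  congr 1; refine setIntegral_congr_fun measurableSet_Ioc fun s hs => ?_
  rw [← hS.add_apply (by linarith) (by linarith [hs.2])]; congr 2; ring

lemma norm2_sq_step (h : IsDuhamel S T w₀ w F) (hα : 0 ≤ α) (hβ : 0 ≤ β) (hγ : 0 ≤ γ) (hσ : 0 < σ)
    (hell : γ ^ 2 < α * σ) (hS : IsWFPSemigroup α β γ σ S) {a b : ℝ} (ha : 0 ≤ a) (hab : a ≤ b) (hb : b ≤ T) :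
    norm2 (w b) ^ 2 ≤ exp (3 * β * (b - a)) * norm2 (w a) ^ 2 +
      2 * ∫ s in Ioc a b, inner ℝ (toL2 (w b)) (toL2 (S (b - s) (F s))) := by
  have hi := (h.integrableOn hS.1 hb).mono_set (Ioc_subset_Ioc_left ha); set B := ∫ s in Ioc a b, S (b - s) (F s)
  have e : toL2 (S (b - a) (w a)) = toL2 (w b) - toL2 B := by
    rw [h.eq_restart hS.1 ha hab hb, map_add, add_sub_cancel_right]
  have h1 : norm2 (S (b - a) (w a)) ^ 2 = norm2 (w b) ^ 2 - 2 * inner ℝ (toL2 (w b)) (toL2 B) + ‖toL2 B‖ ^ 2 := by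
    rw [← norm_toL2, e, norm_sub_sq_real, norm_toL2]
  have h2 : inner ℝ (toL2 (w b)) (toL2 B) = ∫ s in Ioc a b, inner ℝ (toL2 (w b)) (toL2 (S (b - s) (F s))) := by
    rw [integral_inner (toL2.integrable_comp hi), integral_comp_comm _ hi]
  have h3 : norm2 (S (b - a) (w a)) ^ 2 ≤ exp (3 * β * (b - a)) * norm2 (w a) ^ 2 := by
    refine (pow_le_pow_left₀ (norm2_nonneg _) (norm2_semigroup_le hα hβ hγ hσ hell hS _ (by linarith)) 2).trans
      (le_of_eq ?_)
    rw [mul_pow, ← Real.exp_nat_mul]; congr 2; push_cast; ring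
  rw [← h2]; nlinarith [sq_nonneg ‖toL2 B‖]

lemma exists_bound (h : IsDuhamel S T w₀ w F) : ∃ W : ℝ, ∀ t ∈ Icc 0 T, ‖w t‖ ≤ W :=
  (isCompact_Icc.exists_bound_of_continuousOn h.cont)

/-- The `L²` norm grows at most exponentially: the nonlinear term does not contribute. -/
lemma norm2_le_exp (h : IsDuhamel S T w₀ w F) (hα : 0 ≤ α) (hβ : 0 ≤ β) (hγ : 0 ≤ γ) (hσ : 0 < σ)
    (hell : γ ^ 2 < α * σ) (hS : IsWFPSemigroup α β γ σ S) {t : ℝ} (ht : t ∈ Ioc 0 T) :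
    norm2 (w t) ≤ exp (3 * β * t / 2) * norm2 w₀ := by
  obtain ⟨ht0, htT⟩ := ht
  have hw0 : w 0 = w₀ := by
    have := h.eq 0 ⟨le_rfl, ht0.le.trans htT⟩; simpa [hS.1.zero] using this
  obtain ⟨W, hW⟩ := h.exists_bound; obtain ⟨M, hM0, hM⟩ := hS.1.exists_bound t
  set τ : ℕ → ℝ := fun N => t / (N + 1) with hτ
  have hτ0 : ∀ N, 0 < τ N := fun N => by positivity
  set c : ℕ → ℝ → ℝ := fun N s => ⌈s / τ N⌉₊ * τ N with hc
  have hτN : ∀ N : ℕ, ((N + 1 : ℕ) : ℝ) * τ N = t := fun N => by simp only [hτ]; push_cast; field_simp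
  have hc1 : ∀ N s, s ≤ c N s := fun N s => by
    have := Nat.le_ceil (s / τ N)
    rwa [div_le_iff₀ (hτ0 N)] at this
  have hc2 : ∀ N s, 0 ≤ s → c N s ≤ s + τ N := fun N s hs => by
    have := (Nat.ceil_lt_add_one (div_nonneg hs (hτ0 N).le)).le
    calc c N s ≤ (s / τ N + 1) * τ N := mul_le_mul_of_nonneg_right this (hτ0 N).le
      _ = _ := by have := (hτ0 N).ne'; field_simp
  have hc3 : ∀ N s, s ≤ t → c N s ≤ t := fun N s hs => by
    rw [← hτN N]; refine mul_le_mul_of_nonneg_right (Nat.cast_le.2 (Nat.ceil_le.2 ?_)) (hτ0 N).le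
    rw [div_le_iff₀ (hτ0 N), hτN]; exact hs
  set G : ℕ → ℝ → ℝ := fun N s => inner ℝ (toL2 (w (c N s))) (toL2 (S (c N s - s) (F s))) with hG
  -- the discrete energy inequality
  have hstep : ∀ N k : ℕ, k ≤ N + 1 → ofReal (exp (-(3 * β * (k * τ N))) * norm2 (w (k * τ N)) ^ 2) ≤
      ofReal (norm2 w₀ ^ 2) + 2 * ∫⁻ s in Ioc 0 (k * τ N), ‖G N s‖ₑ := by
    intro N k
    induction k with
    | zero => intro _; simp [hw0]
    | succ k ih =>
      intro hk
      have hkt : ((k + 1 : ℕ) : ℝ) * τ N ≤ t := by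
        rw [← hτN N]; exact mul_le_mul_of_nonneg_right (by exact_mod_cast hk) (hτ0 N).le
      set a := (k : ℝ) * τ N; set b := ((k + 1 : ℕ) : ℝ) * τ N
      have hab : a ≤ b := mul_le_mul_of_nonneg_right (by push_cast; linarith) (hτ0 N).le
      have ha0 : 0 ≤ a := mul_nonneg (Nat.cast_nonneg _) (hτ0 N).le
      have h1 := h.norm2_sq_step hα hβ hγ hσ hell hS ha0 hab (hkt.trans htT)
      have hcb : ∀ s ∈ Ioc a b, c N s = b := fun s hs => by
        have : ⌈s / τ N⌉₊ = k + 1 := (Nat.ceil_eq_iff (by omega)).2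
          ⟨by rw [lt_div_iff₀ (hτ0 N)]; simpa using hs.1, by rw [div_le_iff₀ (hτ0 N)]; exact hs.2⟩
        simp only [hc, this]; rfl
      set I := ∫ s in Ioc a b, inner ℝ (toL2 (w b)) (toL2 (S (b - s) (F s)))
      have h2 : ‖I‖ₑ ≤ ∫⁻ s in Ioc a b, ‖G N s‖ₑ := (enorm_integral_le_lintegral_enorm _).trans_eq
        (setLIntegral_congr_fun measurableSet_Ioc fun s hs => by simp only [hG, hcb s hs])
      rw [← Ioc_union_Ioc_eq_Ioc ha0 hab, lintegral_union measurableSet_Ioc (Ioc_disjoint_Ioc_of_le le_rfl), mul_add,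
        ← add_assoc]
      refine le_trans ?_ (add_le_add (ih (by omega)) (mul_le_mul_right h2 2))
      rw [← ofReal_norm, Real.norm_eq_abs, ← ofReal_ofNat 2, ← ofReal_mul (by norm_num),
        ← ofReal_add (by positivity) (by positivity)]
      refine ofReal_le_ofReal ?_
      have he : exp (-(3 * β * b)) ≤ 1 := Real.exp_le_one_iff.2 (by have := ha0.trans hab; nlinarith [mul_nonneg hβ this])
      have he2 : exp (-(3 * β * b)) * exp (3 * β * (b - a)) = exp (-(3 * β * a)) := by rw [← exp_add]; congr 1; ring
      calc _ ≤ exp (-(3 * β * b)) * (exp (3 * β * (b - a)) * norm2 (w a) ^ 2 + 2 * I) :=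
            mul_le_mul_of_nonneg_left h1 (exp_pos _).le
        _ = exp (-(3 * β * a)) * norm2 (w a) ^ 2 + 2 * (exp (-(3 * β * b)) * I) := by rw [← he2]; ring
        _ ≤ _ := by
          have : exp (-(3 * β * b)) * I ≤ |I| := by
            calc _ ≤ exp (-(3 * β * b)) * |I| := mul_le_mul_of_nonneg_left (le_abs_self I) (exp_pos _).le
              _ ≤ _ := mul_le_of_le_one_left (abs_nonneg I) he
          linarith
  -- the error vanishes as the mesh is refined
  have hlim : Tendsto (fun N => ∫⁻ s in Ioc 0 t, ‖G N s‖ₑ) atTop (𝓝 (∫⁻ _ in Ioc (0 : ℝ) t, 0)) := by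
    have hF := h.int.mono_set (Ioc_subset_Ioc_right htT)
    have hW0 : 0 ≤ W := (norm_nonneg _).trans (hW 0 ⟨le_rfl, ht0.le.trans htT⟩)
    refine tendsto_lintegral_of_dominated_convergence' (fun s => ofReal (W * M) * ‖F s‖ₑ) (fun N => ?_) (fun N => ?_)
      ?_ ?_
    · have hcm : Measurable (c N) := by
        have : Measurable fun s : ℝ => ⌈s / τ N⌉₊ := Nat.measurable_ceil.comp (by fun_prop)
        exact (measurable_from_top.comp this : Measurable fun s : ℝ => ((⌈s / τ N⌉₊ : ℕ) : ℝ)).mul_const _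
      have hT : (0 : ℝ) ≤ T := ht0.le.trans htT
      have h1 : StronglyMeasurable fun s => IccExtend hT ((Icc 0 T).restrict w) (c N s) :=
        (continuous_IccExtend_iff.2 (continuousOn_iff_continuous_restrict.1 h.cont)).comp_stronglyMeasurable
          hcm.stronglyMeasurable
      have h2 : AEStronglyMeasurable (fun s => S (max (c N s - s) 0) (F s)) (volume.restrict (Ioc 0 t)) :=
        hS.1.continuous_max.comp_aestronglyMeasurable ((hcm.sub measurable_id).aestronglyMeasurable.prodMk hF.1)
      refine ((toL2.continuous.comp_aestronglyMeasurable h1.aestronglyMeasurable).inner (𝕜 := ℝ)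
        (toL2.continuous.comp_aestronglyMeasurable h2)).enorm.congr ?_
      filter_upwards [ae_restrict_mem measurableSet_Ioc] with s hs
      rw [IccExtend_of_mem hT _ ⟨hs.1.le.trans (hc1 N s), (hc3 N s hs.2).trans htT⟩,
        max_eq_left (by linarith [hc1 N s])]
      rfl
    · filter_upwards [ae_restrict_mem measurableSet_Ioc] with s hs
      simp only [hG]; rw [← ofReal_norm, ← ofReal_norm (F s), ← ofReal_mul (by positivity)]
      refine ofReal_le_ofReal ((norm_inner_le_norm _ _).trans ?_); rw [norm_toL2, norm_toL2, mul_assoc]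
      refine mul_le_mul ((norm2_le _).trans (hW _ ⟨hs.1.le.trans (hc1 N s), (hc3 N s hs.2).trans htT⟩))
        ((norm2_le _).trans ((le_opNorm _ _).trans (mul_le_mul_of_nonneg_right
          (hM _ ⟨by linarith [hc1 N s], by linarith [hc3 N s hs.2, hs.1]⟩) (norm_nonneg _)))) (norm2_nonneg _) hW0
    · rw [lintegral_const_mul' _ _ ofReal_ne_top]; exact (mul_lt_top ofReal_lt_top hF.2).ne
    · filter_upwards [ae_restrict_mem measurableSet_Ioc] with s hs
      have hcs : Tendsto (fun N => c N s) atTop (𝓝 s) := by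
        have h0 : Tendsto (fun N : ℕ => s + τ N) atTop (𝓝 (s + 0)) :=
          tendsto_const_nhds.add (by simpa [hτ, div_eq_mul_inv] using tendsto_one_div_add_atTop_nhds_zero_nat.const_mul t)
        rw [add_zero] at h0
        exact tendsto_of_tendsto_of_tendsto_of_le_of_le tendsto_const_nhds h0 (fun N => hc1 N s)
          (fun N => hc2 N s hs.1.le)
      have h1 : Tendsto (fun N => w (c N s)) atTop (𝓝 (w s)) :=
        (h.cont s ⟨hs.1.le, hs.2.trans htT⟩).tendsto.comp (tendsto_nhdsWithin_iff.2 ⟨hcs, of_forall fun N =>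
          ⟨hs.1.le.trans (hc1 N s), (hc3 N s hs.2).trans htT⟩⟩)
      have h2 : Tendsto (fun N => S (c N s - s) (F s)) atTop (𝓝 (F s)) :=
        (hS.1.tendsto_right (F s)).comp (tendsto_nhdsWithin_iff.2
          ⟨by simpa using hcs.sub_const s, of_forall fun N => sub_nonneg.2 (hc1 N s)⟩)
      have h3 := ((toL2.continuous.tendsto _).comp h1).inner (𝕜 := ℝ) ((toL2.continuous.tendsto _).comp h2)
      have h4 : inner ℝ (toL2 (w s)) (toL2 (F s)) = 0 := by
        rw [inner_toL2, ← (h.theta s ⟨hs.1, hs.2.trans htT⟩).integral_mul_eq_zero]; simp_rw [mul_comm]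
      rw [h4] at h3; simpa using h3.enorm
  have hfin : ofReal (exp (-(3 * β * t)) * norm2 (w t) ^ 2) ≤ ofReal (norm2 w₀ ^ 2) := by
    have h5 := (ENNReal.Tendsto.const_mul hlim (Or.inr ENNReal.ofNat_ne_top : _ ∨ (2 : ℝ≥0∞) ≠ ∞)).const_add (ofReal (norm2 w₀ ^ 2))
    simp only [lintegral_zero, mul_zero, add_zero] at h5; refine ge_of_tendsto' h5 fun N => ?_
    have := hstep N (N + 1) le_rfl
    rwa [hτN] at this
  rw [ENNReal.ofReal_le_ofReal_iff (by positivity)] at hfin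
  refine le_of_sq_le_sq ?_ (by have := norm2_nonneg w₀; positivity)
  have e2 : exp (3 * β * t / 2) ^ 2 * exp (-(3 * β * t)) = 1 := by
    rw [← Real.exp_nat_mul, ← exp_add]
    simp; ring
  calc norm2 (w t) ^ 2 = exp (3 * β * t / 2) ^ 2 * (exp (-(3 * β * t)) * norm2 (w t) ^ 2) := by
        rw [← mul_assoc, e2, one_mul]
    _ ≤ exp (3 * β * t / 2) ^ 2 * norm2 w₀ ^ 2 := by gcongr
    _ = _ := by ring

end IsDuhamel

instance : SigmaFinite weightMeasure := SigmaFinite.withDensity_ofReal _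

instance : Fact ((2 : ℝ≥0∞) ≠ ∞) := ⟨ENNReal.ofNat_ne_top⟩

lemma ae_eq_of_integral_mul {f g : E3 → ℝ} (hg : MemLp g 2) (H : ∀ ψ : E3 → ℝ, Measurable ψ → MemLp ψ 2 →
    Integrable (fun x => ψ x * f x) ∧ ∫ x, ψ x * f x = ∫ x, g x * ψ x) : f =ᵐ[volume] g := by
  have key : ∀ s, MeasurableSet s → volume s < ∞ → IntegrableOn f s ∧ IntegrableOn g s ∧ ∫ x in s, f x = ∫ x in s, g x := by
    intro s hs hf
    obtain ⟨h1, h3⟩ := H (s.indicator fun _ => (1 : ℝ)) (measurable_const.indicator hs)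
      (memLp_indicator_const 2 hs 1 (Or.inr hf.ne))
    have e : ∀ f : E3 → ℝ, (fun x => s.indicator (fun _ => (1 : ℝ)) x * f x) = s.indicator f := fun f => by
      ext x; by_cases hx : x ∈ s <;> simp [hx]
    have : IsFiniteMeasure (volume.restrict s) := isFiniteMeasure_restrict.2 hf.ne; simp_rw [mul_comm (g _)] at h3
    rw [e, integrable_indicator_iff hs] at h1; rw [e, e, integral_indicator hs, integral_indicator hs] at h3
    exact ⟨h1, (hg.restrict s).integrable one_le_two, h3⟩
  have := ae_eq_zero_of_forall_setIntegral_eq_of_sigmaFinite (f := fun x => f x - g x)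
    (fun s hs hf => (key s hs hf).1.sub (key s hs hf).2.1)
    (fun s hs hf => by obtain ⟨h1, h2, h3⟩ := key s hs hf; rw [integral_sub h1 h2, h3, sub_self])
  filter_upwards [this] with x hx using sub_eq_zero.1 hx

/-- The average of `u` against the Gaussian of variance `r` along the shear `θ`. -/
noncomputable def smear (r θ : ℝ) (u : X) (x : E3) : ℝ := ∫ z : Phase, gauss r (x - z.1 - θ • z.2) * u z

lemma smear_eq (r θ : ℝ) (u : X) (x : E3) : smear r θ u x = ∫ z : Phase, u z * gauss r (z.1 + θ • z.2 - x) := by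
  refine integral_congr fun z => ?_; rw [mul_comm, ← gauss_neg]; congr 2; abel

lemma lintegral_mul_smear_le (u : X) (θ : ℝ) {r : ℝ} (hr : 0 < r) {ψ : E3 → ℝ} (hψ : Measurable ψ) :
    ∫⁻ x, ‖ψ x * smear r θ u x‖ₑ ≤ ‖u‖ₑ * ((∫⁻ x, ‖ψ x‖ₑ ^ 2) * wtInt) ^ (1 / 2 : ℝ) := by
  have hg := (continuous_gauss r).measurable; have hu := measurable_coe u
  refine le_trans ?_ (lintegral_mul_gauss_le u θ hr hψ); rw [volume_eq_prod, lintegral_prod _ (by fun_prop)]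
  refine lintegral_mono fun x => ?_; simp_rw [smear_eq, ← integral_const_mul]
  exact enorm_integral_le_lintegral_enorm _

lemma integral_mul_smear (u : X) (θ : ℝ) {r : ℝ} (hr : 0 < r) {ψ : E3 → ℝ} (hψ : Measurable ψ) (h2 : MemLp ψ 2) :
    Integrable (fun x => ψ x * smear r θ u x) ∧ ∫ x, ψ x * smear r θ u x = ∫ z, u z * conv r ψ (z.1 + θ • z.2) := by
  obtain ⟨h1, h3⟩ := integral_mul_conv u θ hr hψ h2; simp_rw [smear_eq]
  refine ⟨?_, h3⟩; have := h1.integral_prod_left; simpa only [integral_const_mul] using this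

lemma n0_eq_smear {α β γ σ : ℝ} (w₀ : X) {t : ℝ} (hR : 0 < R α β γ σ t) (x : E3) :
    n0 α β γ σ w₀ t x = smear (R α β γ σ t) (vth β t) w₀ x := by
  have hg := (continuous_gauss (R α β γ σ t)).measurable
  have hi : Integrable fun z : Phase => w₀ z * gauss (R α β γ σ t) (x - (z.1 + vth β t • z.2)) :=
    integrable_mul_comp_shear w₀ (vth β t) (h := fun y => gauss (R α β γ σ t) (x - y)) (by fun_prop)
      ((memLp_gauss hR).comp_measurePreserving (measurePreserving_sub_left x))
  have hp := measurePreserving_shear (-vth β t); have hi' := hp.integrable_comp_of_integrable hi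
  have he : MeasurableEmbedding fun z : Phase => (z.1 + (-vth β t) • z.2, z.2) :=
    (show Function.LeftInverse (fun z : Phase => (z.1 + vth β t • z.2, z.2)) _ from fun z => by simp).injective
      |> (by fun_prop : Measurable fun z : Phase => (z.1 + (-vth β t) • z.2, z.2)).measurableEmbedding
  have e : smear (R α β γ σ t) (vth β t) w₀ x = ∫ z : Phase, w₀ z * gauss (R α β γ σ t) (x - (z.1 + vth β t • z.2)) :=
    integral_congr (fun z => by simp only [mul_comm, sub_sub])
  rw [e, ← hp.integral_comp he]; rw [volume_eq_prod] at hi' ⊢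
  refine Eq.trans ?_ (integral_prod _ hi').symm; refine integral_congr fun y => ?_
  simp only [n0th]; rw [← integral_const_mul]; refine integral_congr fun v => ?_; simp [mul_comm, sub_eq_add_neg]

/-- A solution of the Duhamel equation for the semigroup `e^{tĀ}` under the ellipticity condition. -/
structure IsSol (α β γ σ : ℝ) (S : ℝ → X →L[ℝ] X) (T : ℝ) (w₀ : X) (w F : ℝ → X) : Prop
    extends IsDuhamel S T w₀ w F where
  hα : 0 < α
  hβ : 0 ≤ β
  hγ : 0 ≤ γ
  hσ : 0 < σ
  hell : γ ^ 2 < α * σ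
  hS : IsWFPSemigroup α β γ σ S

namespace IsSol

variable {α β γ σ : ℝ} {S : ℝ → X →L[ℝ] X} {T : ℝ} {w₀ : X} {w F : ℝ → X} {t : ℝ} {ψ : E3 → ℝ}

local notation "ℛ" => R α β γ σ

lemma R_pos (h : IsSol α β γ σ S T w₀ w F) {s : ℝ} (hs : 0 < s) : 0 < ℛ s :=
  WPFP.R_pos h.hα h.hβ h.hγ h.hσ.le hs

lemma n0_ae (h : IsSol α β γ σ S T w₀ w F) (ht : 0 < t) : n0 α β γ σ w₀ t =ᵐ[volume] density (S t w₀) := by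
  refine ae_eq_of_integral_mul (memLp_density _) fun ψ hψ h2 => ?_; simp_rw [n0_eq_smear w₀ (h.R_pos ht)]
  obtain ⟨h1, h3⟩ := integral_mul_smear w₀ (vth β t) (h.R_pos ht) hψ h2
  exact ⟨h1, by rw [h3, ← integral_density_mul _ hψ h2, integral_semigroup_mul h.hα h.hβ h.hγ h.hσ.le h.hS w₀ ht hψ h2]⟩

lemma aestronglyMeasurable_smear (h : IsSol α β γ σ S T w₀ w F) (hF : AEStronglyMeasurable F (volume.restrict (Ioo 0 t))) :
    AEStronglyMeasurable (fun p : ℝ × E3 => smear (ℛ (t - p.1)) (vth β (t - p.1)) (F p.1) p.2)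
      ((volume.restrict (Ioo 0 t)).prod volume) := by
  borelize X
  have hc : ∀ q : ℝ × E3, Continuous fun u => if 0 < q.1 then smear (ℛ q.1) (vth β q.1) u q.2 else 0 := by
    intro q
    split_ifs with hq
    · have hg := (continuous_gauss (ℛ q.1)).measurable
      obtain ⟨L, hL, -⟩ := exists_clm (φ := fun z : Phase => gauss (ℛ q.1) (z.1 + vth β q.1 • z.2 - q.2))
        (by fun_prop) (dualNorm_comp_shear_lt_top (vth β q.1) (h := fun y => gauss (ℛ q.1) (y - q.2)) (by fun_prop)
          ((memLp_gauss (h.R_pos hq)).comp_measurePreserving (measurePreserving_sub_right volume q.2)))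
      simp_rw [smear_eq, ← hL]; exact L.continuous
    · exact continuous_const
  have hm : ∀ u : X, Measurable fun q : ℝ × E3 => if 0 < q.1 then smear (ℛ q.1) (vth β q.1) u q.2 else 0 := by
    intro u; refine Measurable.ite (measurableSet_lt measurable_const measurable_fst) ?_ measurable_const
    have h1 := measurable_gauss_uncurry; have h2 := measurable_R α β γ σ
    have h3 := measurable_vth β; have h4 := measurable_coe u
    refine (integral_prod_right' (f := fun p : (ℝ × E3) × Phase =>
      gauss (ℛ p.1.1) (p.1.2 - p.2.1 - vth β p.1.1 • p.2.2) * u p.2) (Measurable.stronglyMeasurable ?_)).measurable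
    refine Measurable.mul (h1.comp (f := fun p : (ℝ × E3) × Phase => (ℛ p.1.1, p.1.2 - p.2.1 - vth β p.1.1 • p.2.2)) ?_)
      (by fun_prop)
    fun_prop
  have hK := measurable_uncurry_of_continuous_of_measurable hc hm; have hG := hF.stronglyMeasurable_mk.measurable
  refine ⟨_, (hK.comp ((hG.comp measurable_fst).prodMk (by fun_prop : Measurable fun p : ℝ × E3 =>
    (t - p.1, p.2)))).stronglyMeasurable, ?_⟩
  have h1 := (Measure.quasiMeasurePreserving_fst (ν := (volume : Measure E3))).ae
    (hF.ae_eq_mk.and (ae_restrict_mem measurableSet_Ioo))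
  filter_upwards [h1] with p hp
  simp [uncurry, sub_pos.2 hp.2.2, ← hp.1]

lemma integral_mul_forcing (h : IsSol α β γ σ S T w₀ w F) (ht : t ≤ T) (hψ : Measurable ψ) (h2 : MemLp ψ 2) :
    Integrable (fun x => ψ x * ∫ s in Ioo 0 t, smear (ℛ (t - s)) (vth β (t - s)) (F s) x) ∧
      ∫ x, ψ x * ∫ s in Ioo 0 t, smear (ℛ (t - s)) (vth β (t - s)) (F s) x =
        ∫ s in Ioo 0 t, ∫ z, F s z * conv (ℛ (t - s)) ψ (z.1 + vth β (t - s) • z.2) := by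
  have hF : IntegrableOn F (Ioo 0 t) := h.int.mono_set (Ioo_subset_Ioc_self.trans (Ioc_subset_Ioc_right ht))
  have hm : AEStronglyMeasurable (uncurry fun s x => ψ x * smear (ℛ (t - s)) (vth β (t - s)) (F s) x)
      ((volume.restrict (Ioo 0 t)).prod volume) :=
    (hψ.comp measurable_snd).aestronglyMeasurable.mul (h.aestronglyMeasurable_smear hF.1)
  have hi : Integrable (uncurry fun s x => ψ x * smear (ℛ (t - s)) (vth β (t - s)) (F s) x)
      ((volume.restrict (Ioo 0 t)).prod volume) := by
    refine ⟨hm, ?_⟩; rw [HasFiniteIntegral, lintegral_prod _ hm.enorm]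
    refine (lintegral_mono_ae (g := fun s => ‖F s‖ₑ * ((∫⁻ x, ‖ψ x‖ₑ ^ 2) * wtInt) ^ (1 / 2 : ℝ)) ?_).trans_lt ?_
    · filter_upwards [ae_restrict_mem measurableSet_Ioo] with s hs
      simp only [Function.uncurry_apply_pair]
      exact lintegral_mul_smear_le (F s) (vth β (t - s)) (h.R_pos (sub_pos.2 hs.2)) hψ
    · have hc : ((∫⁻ x, ‖ψ x‖ₑ ^ 2) * wtInt) ^ (1 / 2 : ℝ) < ∞ :=
        rpow_lt_top_of_nonneg (by norm_num) (mul_lt_top (lintegral_sq_lt_top h2) wtInt_lt_top).ne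
      rw [lintegral_mul_const' _ _ hc.ne]; exact mul_lt_top hF.2 hc
  simp_rw [← integral_const_mul]; refine ⟨hi.integral_prod_right, ?_⟩; rw [← integral_integral_swap hi]
  exact setIntegral_congr_fun measurableSet_Ioo fun s hs =>
    (integral_mul_smear (F s) _ (h.R_pos (sub_pos.2 hs.2)) hψ h2).2

lemma integral_density_duhamel_mul (h : IsSol α β γ σ S T w₀ w F) (ht : t ∈ Ioc 0 T) (hψ : Measurable ψ)
    (h2 : MemLp ψ 2) : ∫ x, density (w t - S t w₀ : X) x * ψ x =
      ∫ s in Ioo 0 t, ∫ z, F s z * conv (ℛ (t - s)) ψ (z.1 + vth β (t - s) • z.2) := by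
  have hd := dualNorm_comp_shear_lt_top 0 hψ h2; simp only [zero_smul, add_zero] at hd
  obtain ⟨L, hL, -⟩ := exists_clm (φ := fun z : Phase => ψ z.1) (by fun_prop) hd
  rw [← integral_density_mul _ hψ h2, ← hL, h.eq t ⟨ht.1.le, ht.2⟩, add_sub_cancel_left,
    ← integral_comp_comm _ (h.integrableOn h.hS.1 ht.2), integral_Ioc_eq_integral_Ioo]
  refine setIntegral_congr_fun measurableSet_Ioo fun s hs => ?_; simp only [hL]
  exact integral_semigroup_mul h.hα h.hβ h.hγ h.hσ.le h.hS _ (sub_pos.2 hs.2) hψ h2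

lemma n1_ae (h : IsSol α β γ σ S T w₀ w fun s => Theta (w s) (w s)) (ht : t ∈ Ioc 0 T) :
    n1 α β γ σ w t =ᵐ[volume] density (w t - S t w₀ : X) := by
  refine ae_eq_of_integral_mul (memLp_density _) fun ψ hψ h2 => ?_
  have e : ∀ x, n1 α β γ σ w t x =
      ∫ s in Ioo 0 t, smear (ℛ (t - s)) (vth β (t - s)) (Theta (w s) (w s)) x := fun x => by
    have := intervalIntegral.integral_comp_sub_left (a := 0) (b := t)
      (fun s => smear (ℛ (t - s)) (vth β (t - s)) (Theta (w s) (w s)) x) t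
    simp only [sub_sub_cancel, sub_self, sub_zero] at this
    rw [← integral_Ioc_eq_integral_Ioo, ← intervalIntegral.integral_of_le ht.1.le, ← this]; rfl
  simp_rw [e, h.integral_density_duhamel_mul ht hψ h2]; exact h.integral_mul_forcing ht.2 hψ h2

end IsSol

lemma lintegral_rpow_Ioo {b : ℝ} (hb : -1 < b) {t : ℝ} (ht : 0 < t) :
    ∫⁻ s in Ioo 0 t, ofReal (s ^ b) = ofReal (t ^ (b + 1) / (b + 1)) := by
  have h := intervalIntegral.intervalIntegrable_rpow' hb (a := 0) (b := t)
  have h2 := integral_rpow (a := 0) (b := t) (Or.inl hb)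
  rw [Real.zero_rpow (by linarith), sub_zero, intervalIntegral.integral_of_le ht.le] at h2
  rw [← h2, ofReal_integral_eq_lintegral_ofReal ((intervalIntegrable_iff_integrableOn_Ioc_of_le ht.le).1 h)
    ((ae_restrict_mem measurableSet_Ioc).mono fun s hs => rpow_nonneg hs.1.le b)]
  exact setLIntegral_congr Ioo_ae_eq_Ioc

lemma lintegral_Ioo_sub (f : ℝ → ℝ≥0∞) (t : ℝ) : ∫⁻ s in Ioo 0 t, f (t - s) = ∫⁻ s in Ioo 0 t, f s := by
  rw [← lintegral_indicator measurableSet_Ioo, ← lintegral_indicator measurableSet_Ioo, ← lintegral_sub_left_eq_self _ t]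
  refine lintegral_congr fun s => ?_; simp [indicator, and_comm]

lemma rpow_le_of_half_le (a : ℝ) {x t : ℝ} (ht : 0 < t) (h1 : t / 2 ≤ x) (h2 : x ≤ t) :
    x ^ a ≤ (1 + (1 / 2) ^ a) * t ^ a := by
  have h0 : 0 < t ^ a := rpow_pos_of_pos ht a
  have h3 : (0 : ℝ) < (1 / 2) ^ a := by positivity
  rcases le_total 0 a with ha | ha
  · nlinarith [Real.rpow_le_rpow (by linarith) h2 ha]
  · have := Real.rpow_le_rpow_of_nonpos (by linarith) h1 ha
    rw [show t / 2 = 1 / 2 * t by ring, mul_rpow (by norm_num) ht.le] at this; nlinarith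

lemma exists_lintegral_rpow_mul_rpow_le {a b : ℝ} (ha : -1 < a) (hb : -1 < b) : ∃ C : ℝ, 0 ≤ C ∧ ∀ t : ℝ, 0 < t →
    ∫⁻ s in Ioo 0 t, ofReal ((t - s) ^ a) * ofReal (s ^ b) ≤ ofReal (C * t ^ (a + b + 1)) := by
  set A : ℝ := 1 + (1 / 2) ^ a; set B : ℝ := 1 + (1 / 2) ^ b
  have hA : 0 ≤ A := by positivity
  have hB : 0 ≤ B := by positivity
  have ha' : 0 < a + 1 := by linarith
  have hb' : 0 < b + 1 := by linarith
  refine ⟨A / (b + 1) + B / (a + 1), by positivity, fun t ht => ?_⟩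
  calc _ ≤ ∫⁻ s in Ioo 0 t, (ofReal (A * t ^ a) * ofReal (s ^ b) +
        ofReal (B * t ^ b) * ofReal ((t - s) ^ a)) := by
        refine setLIntegral_mono' measurableSet_Ioo fun s hs => ?_
        rcases le_total s (t / 2) with h | h
        · refine le_add_right ?_; gcongr; exact rpow_le_of_half_le a ht (by linarith) (by linarith [hs.1])
        · refine le_add_left ?_; rw [mul_comm]
          gcongr; exact rpow_le_of_half_le b ht h hs.2.le
    _ = ofReal (A * t ^ a) * ofReal (t ^ (b + 1) / (b + 1)) +
        ofReal (B * t ^ b) * ofReal (t ^ (a + 1) / (a + 1)) := by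
        rw [lintegral_add_left (by fun_prop), lintegral_const_mul' _ _ ofReal_ne_top,
          lintegral_const_mul' _ _ ofReal_ne_top, lintegral_rpow_Ioo hb ht,
          lintegral_Ioo_sub (fun s => ofReal (s ^ a)), lintegral_rpow_Ioo ha ht]
    _ ≤ _ := by
      rw [← ofReal_mul (by positivity), ← ofReal_mul (by positivity),
        ← ofReal_add (by positivity) (by positivity), add_assoc, add_comm b 1, add_comm a 1,
        rpow_add ht a, rpow_add ht 1 b, rpow_add ht 1 a, Real.rpow_one]
      refine ofReal_le_ofReal (le_of_eq ?_); field_simp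

lemma eLpNorm_ofReal {α E : Type*} [MeasurableSpace α] {μ : Measure α} [NormedAddCommGroup E] (f : α → E) {p : ℝ}
    (hp : 0 < p) : eLpNorm f (ofReal p) μ = (∫⁻ x, ‖f x‖ₑ ^ p ∂μ) ^ (1 / p) := by
  rw [eLpNorm_eq_lintegral_rpow_enorm_toReal (by simpa) ofReal_ne_top, ENNReal.toReal_ofReal hp.le]

/-- Young's inequality for convolution with a Gaussian. -/
lemma eLpNorm_conv_two_le {r : ℝ} (hr : 0 < r) {g : E3 → ℝ} (hg : Measurable g) {q : ℝ} (h1 : 1 < q) (h2 : q ≤ 2) :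
    eLpNorm (conv r g) 2 volume ≤ ofReal (r ^ (-(3 / 4 * (2 / q - 1)))) * eLpNorm g (ofReal q) volume := by
  have hq : 0 < q := by linarith
  have hk : 0 ≤ 2 / q - 1 := by rw [sub_nonneg, one_le_div hq]; exact h2
  have hG := (continuous_gauss r).measurable.ennreal_ofReal
  set J : E3 → ℝ≥0∞ := fun x => ∫⁻ y, ofReal (gauss r y) * ‖g (x - y)‖ₑ ^ q; set I := ∫⁻ x, ‖g x‖ₑ ^ q
  set L := ofReal (r ^ (-(3 / 2 : ℝ))) * I
  have hL : ∀ x, J x ≤ L := fun x => by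
    calc J x ≤ ∫⁻ y, ofReal (r ^ (-(3 / 2 : ℝ))) * ‖g (x - y)‖ₑ ^ q :=
          lintegral_mono fun y => by gcongr; exact gauss_le hr y
      _ = L := by rw [lintegral_const_mul' _ _ ofReal_ne_top, lintegral_sub_left_eq_self (fun y => ‖g y‖ₑ ^ q)]
  have hJ : ∫⁻ x, J x = I := by
    calc _ = ∫⁻ y, ∫⁻ x, ofReal (gauss r y) * ‖g (x - y)‖ₑ ^ q :=
          lintegral_swap (by fun_prop)
      _ = ∫⁻ y, ofReal (gauss r y) * I := by
        congr 1; ext y; rw [lintegral_const_mul _ (by fun_prop), lintegral_sub_right_eq_self (fun x => ‖g x‖ₑ ^ q) y]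
      _ = _ := by rw [lintegral_mul_const _ hG, lintegral_gauss hr, one_mul]
  have key : ∫⁻ x, ‖conv r g x‖ₑ ^ 2 ≤ L ^ (2 / q - 1) * I := by
    rw [← hJ, ← lintegral_const_mul _ (lintegral_prod_right'
      (f := fun p : E3 × E3 => ofReal (gauss r p.2) * ‖g (p.1 - p.2)‖ₑ ^ q) (by fun_prop))]
    refine lintegral_mono fun x => ?_
    calc ‖conv r g x‖ₑ ^ 2 ≤ (((∫⁻ y, ofReal (gauss r y) * ‖g (x - y)‖ₑ) ^ q)) ^ (2 / q) := by
          rw [← rpow_mul, mul_div_cancel₀ _ hq.ne', rpow_two]; exact pow_le_pow_left' (enorm_conv_le hr g x) 2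
      _ ≤ J x ^ (2 / q) := by gcongr; exact lintegral_mul_rpow_le hG (by fun_prop) (lintegral_gauss hr) h1
      _ = J x ^ (2 / q - 1) * J x := by
        conv_rhs => rw [← rpow_one (J x), ← rpow_mul, one_mul, ← rpow_add_of_nonneg _ _ hk zero_le_one]
        congr 1; ring
      _ ≤ _ := by gcongr; exact hL x
  rw [eLpNorm_two_eq, eLpNorm_ofReal _ hq]; refine (rpow_le_rpow key (by norm_num)).trans (le_of_eq ?_)
  rw [mul_rpow_of_nonneg _ _ hk, mul_assoc, mul_rpow_of_nonneg _ _ (by norm_num), ← rpow_mul,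
    ENNReal.ofReal_rpow_of_pos (by positivity), ← Real.rpow_mul hr.le]
  congr 1
  · congr 2; ring
  · nth_rw 2 [← rpow_one I]
    rw [← rpow_add_of_nonneg _ _ hk zero_le_one, ← rpow_mul]; congr 1; ring

/-- The norm of a field by duality. -/
lemma eLpNorm_field_le_of_forall {n : E3 → ℝ} (hn : Measurable n) (h2 : MemLp n 2) {p q : ℝ} (hpq : p.HolderConjugate q)
    {B : ℝ≥0∞} (H : ∀ (j : Fin 3) (g : E3 → ℝ), IsBdd g →
      ‖∫ x, n x * comp j g x‖ₑ ≤ B * eLpNorm g (ofReal q) volume) :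
    eLpNorm (field n) (ofReal p) volume ≤ 3 * B := by
  have hj : ∀ j, eLpNorm (comp j n) (ofReal p) volume ≤ B := by
    intro j; have hc := measurable_comp j hn
    have h3 : ∫⁻ x, ‖comp j n x‖ₑ ^ p ≤ B ^ p := by
      refine lintegral_rpow_le_of_forall_mul_le hc.enorm hpq fun g hgm hg0 ⟨N, hN⟩ hs => ?_
      set g' : E3 → ℝ := fun x => (if 0 ≤ comp j n x then 1 else -1) * g x
      have hs1 : ∀ x, |(if 0 ≤ comp j n x then 1 else -1 : ℝ)| ≤ 1 := fun x => by split_ifs <;> simp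
      have hb : ∀ x, ‖g' x‖ₑ ≤ ofReal (g x) := fun x => by
        rw [← ofReal_norm, norm_mul, norm_of_nonneg (hg0 x), Real.norm_eq_abs]
        exact ofReal_le_ofReal (mul_le_of_le_one_left (hg0 x) (hs1 x))
      have hg : IsBdd g' := by
        refine ⟨?_, ⟨N, fun x => ?_⟩, hs.imp fun M h x hx => by simp [g', h x hx]⟩
        · exact (Measurable.ite (measurableSet_le measurable_const hc) measurable_const measurable_const).mul hgm
        · rw [abs_mul, abs_of_nonneg (hg0 x)]; exact (mul_le_of_le_one_left (hg0 x) (hs1 x)).trans (hN x)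
      have e : ∀ x, comp j n x * g' x = |comp j n x| * g x := fun x => by
        simp only [g']
        split_ifs with h
        · rw [abs_of_nonneg h, one_mul]
        · rw [abs_of_neg (not_le.1 h)]; ring
      have hi : Integrable fun x => comp j n x * g' x := by
        refine ⟨(hc.mul hg.meas).aestronglyMeasurable, ?_⟩
        calc _ ≤ ∫⁻ x, riesz (fun y => ‖n y‖ₑ) x * ‖g' x‖ₑ := lintegral_mono fun x => by
              rw [enorm_mul]; gcongr; exact enorm_comp_le j n x
          _ = ∫⁻ x, ‖n x‖ₑ * riesz (fun y => ‖g' y‖ₑ) x := lintegral_riesz_mul _ _ hn.enorm hg.meas.enorm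
          _ ≤ _ := lintegral_mul_le_sqrt hn.enorm.aemeasurable (measurable_riesz hg.meas.enorm).aemeasurable
          _ < ∞ := mul_lt_top (rpow_lt_top_of_nonneg (by norm_num) (lintegral_sq_lt_top h2).ne)
              (rpow_lt_top_of_nonneg (by norm_num) hg.lintegral_riesz_sq.ne)
      have e2 : ∫⁻ x, ‖comp j n x‖ₑ * ofReal (g x) = ‖∫ x, comp j n x * g' x‖ₑ := by
        have h0 : 0 ≤ᵐ[volume] fun x => comp j n x * g' x :=
          of_forall fun x => by simp only [Pi.zero_apply, e]; have := hg0 x; positivity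
        rw [enorm_of_nonneg (integral_nonneg_of_ae h0), ofReal_integral_eq_lintegral_ofReal hi h0]
        refine lintegral_congr fun x => ?_; rw [e, ofReal_mul (abs_nonneg _), ← Real.norm_eq_abs, ofReal_norm]
      rw [e2, integral_comp_mul j hn h2 hg, enorm_neg]; refine (H j g' hg).trans ?_
      rw [eLpNorm_ofReal _ hpq.symm.pos]; simp_rw [← ofReal_rpow_of_nonneg (hg0 _) hpq.symm.nonneg]
      have := hpq.symm.nonneg; gcongr with x; exact hb x
    rw [eLpNorm_ofReal _ hpq.pos]; refine (rpow_le_rpow h3 (by have := hpq.pos; positivity)).trans (le_of_eq ?_)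
    rw [← rpow_mul, mul_one_div_cancel hpq.ne_zero, rpow_one]
  calc _ ≤ eLpNorm (fun x => ∑ j : Fin 3, ‖comp j n x‖) (ofReal p) volume := by
        refine eLpNorm_mono_ae ?_
        filter_upwards [ae_riesz_lt_top hn h2] with x hx
        rw [norm_of_nonneg (Finset.sum_nonneg fun _ _ => norm_nonneg _)]; simp_rw [← field_apply hn hx]
        rw [EuclideanSpace.norm_eq]; refine Real.sqrt_le_iff.2 ⟨Finset.sum_nonneg fun _ _ => norm_nonneg _, ?_⟩
        exact Finset.sum_sq_le_sq_sum_of_nonneg fun _ _ => norm_nonneg _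
    _ ≤ ∑ j : Fin 3, eLpNorm (fun x => ‖comp j n x‖) (ofReal p) volume := by
      have := eLpNorm_sum_le (f := fun (j : Fin 3) x => ‖comp j n x‖) (s := Finset.univ) (μ := volume)
        (p := ofReal p) (fun j _ => (measurable_comp j hn).norm.aestronglyMeasurable)
        (by simpa using ofReal_le_ofReal hpq.lt.le)
      refine le_trans (le_of_eq ?_) this; congr 1
    _ ≤ ∑ _j : Fin 3, B := sum_le_sum fun j _ => by rw [eLpNorm_norm]; exact hj j
    _ = _ := by simp

/-- A weakly singular Volterra inequality. -/
lemma exists_volterra_bound {ω D k T : ℝ} (hω0 : 0 ≤ ω) (hω : ω < 1) (hD : 0 ≤ D) (hk : 0 ≤ k) (hT : 0 < T) :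
    ∃ C : ℝ, 0 ≤ C ∧ ∀ (T' : ℝ) (e : ℝ → ℝ≥0∞) (Q : ℝ≥0∞), T' ≤ T → Q ≠ ∞ →
      (∀ t ∈ Ioc 0 T', ofReal (t ^ ω) * e t ≤ Q) →
      (∀ t ∈ Ioc 0 T', e t ≤ ofReal (D * t ^ (-ω)) +
        ofReal k * ∫⁻ s in Ioo 0 t, ofReal ((t - s) ^ (-(1 / 2 : ℝ))) * e s) →
      ∀ t ∈ Ioc 0 T', e t ≤ ofReal (C * t ^ (-ω)) := by
  obtain ⟨c, hc0, hc⟩ := exists_lintegral_rpow_mul_rpow_le (a := -(3 / 4)) (b := -ω) (by norm_num) (by linarith)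
  set l : ℝ := (2 * (k * c * T ^ (1 / 4 : ℝ)) + 1) ^ 4
  have hl : 0 < l := by positivity
  have hl4 : k * c * T ^ (1 / 4 : ℝ) * l ^ (-(1 / 4 : ℝ)) ≤ 1 / 2 := by
    have h1 : l ^ (-(1 / 4 : ℝ)) = (2 * (k * c * T ^ (1 / 4 : ℝ)) + 1)⁻¹ := by
      simp only [l]; rw [rpow_neg (by positivity), ← Real.rpow_natCast, ← Real.rpow_mul (by positivity)]; norm_num
    have h0 : 0 ≤ k * c * T ^ (1 / 4 : ℝ) := by positivity
    rw [h1, ← div_eq_mul_inv, div_le_iff₀ (by positivity)]; linarith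
  refine ⟨2 * D * exp (l * T), by positivity, fun T' e Q hT' hQ hb he => ?_⟩
  set M : ℝ≥0∞ := ⨆ t ∈ Ioc 0 T', ofReal (t ^ ω * exp (-(l * t))) * e t
  have hMle : ∀ t ∈ Ioc 0 T', ofReal (t ^ ω * exp (-(l * t))) * e t ≤ M := fun t ht =>
    le_iSup₂ (f := fun t (_ : t ∈ Ioc 0 T') => ofReal (t ^ ω * exp (-(l * t))) * e t) t ht
  have hM : M ≤ Q := iSup₂_le fun t ht => le_trans (by
    gcongr
    exact mul_le_of_le_one_right (rpow_nonneg ht.1.le _) (Real.exp_le_one_iff.2 (by nlinarith [ht.1]))) (hb t ht)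
  have hMt : M ≠ ∞ := (hM.trans_lt hQ.lt_top).ne
  have heM : ∀ s ∈ Ioc 0 T', e s ≤ ofReal (s ^ (-ω) * exp (l * s)) * M := fun s hs => by
    have h1 : s ^ (-ω) * exp (l * s) * (s ^ ω * exp (-(l * s))) = 1 := by
      rw [Real.exp_neg, rpow_neg hs.1.le]; have := rpow_pos_of_pos hs.1 ω; field_simp
    have h2 := mul_le_mul_right (hMle s hs) (ofReal (s ^ (-ω) * exp (l * s)))
    rwa [← mul_assoc, ← ofReal_mul (mul_nonneg (rpow_nonneg hs.1.le _) (exp_pos _).le), h1, ofReal_one, one_mul] at h2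
  have key : M ≤ ofReal D + ofReal (1 / 2) * M := by
    refine iSup₂_le fun t ht => ?_; have htω := rpow_pos_of_pos ht.1 ω
    have hpt : ∀ s ∈ Ioo 0 t, ofReal ((t - s) ^ (-(1 / 2 : ℝ))) * e s ≤
        ofReal (l ^ (-(1 / 4 : ℝ)) * exp (l * t)) * M * (ofReal ((t - s) ^ (-(3 / 4) : ℝ)) * ofReal (s ^ (-ω))) := by
      intro s hs; have hts : 0 < t - s := sub_pos.2 hs.2
      have hx : 0 < l * (t - s) := by positivity
      have hexp : exp (l * s) ≤ l ^ (-(1 / 4 : ℝ)) * (t - s) ^ (-(1 / 4 : ℝ)) * exp (l * t) := by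
        rw [← mul_rpow hl.le hts.le, rpow_neg hx.le, ← div_eq_inv_mul, le_div_iff₀ (by positivity)]
        have h4 : (l * (t - s)) ^ (1 / 4 : ℝ) ≤ exp (l * (t - s)) := by
          refine le_trans ?_ (Real.add_one_le_exp _)
          rcases le_total (l * (t - s)) 1 with h | h
          · have := Real.rpow_le_one hx.le h (z := 1 / 4) (by norm_num); linarith
          · have := Real.rpow_le_rpow_of_exponent_le h (show (1 / 4 : ℝ) ≤ 1 by norm_num)
            rw [Real.rpow_one] at this; linarith
        calc _ ≤ exp (l * s) * exp (l * (t - s)) := by gcongr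
          _ = _ := by rw [← exp_add]; congr 1; ring
      have h5 : (t - s) ^ (-(3 / 4) : ℝ) = (t - s) ^ (-(1 / 2 : ℝ)) * (t - s) ^ (-(1 / 4 : ℝ)) := by
        rw [← rpow_add hts]; norm_num
      have hsω := rpow_nonneg hs.1.le (-ω); refine (mul_le_mul_right (heM s ⟨hs.1, hs.2.le.trans ht.2⟩) _).trans ?_
      rw [← mul_assoc, mul_right_comm _ M, ← ofReal_mul (by positivity), ← ofReal_mul (by positivity),
        ← ofReal_mul (by positivity)]
      gcongr ofReal ?_ * M; rw [h5]
      calc _ = (t - s) ^ (-(1 / 2 : ℝ)) * s ^ (-ω) * exp (l * s) := by ring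
        _ ≤ (t - s) ^ (-(1 / 2 : ℝ)) * s ^ (-ω) * (l ^ (-(1 / 4 : ℝ)) * (t - s) ^ (-(1 / 4 : ℝ)) * exp (l * t)) := by
          gcongr
        _ = _ := by ring
    have hint := (setLIntegral_mono' (μ := volume) measurableSet_Ioo hpt).trans (le_of_eq
      (lintegral_const_mul' _ _ (ENNReal.mul_ne_top ofReal_ne_top hMt)))
    refine (mul_le_mul_right ((he t ht).trans (add_le_add le_rfl (mul_le_mul_right
      (hint.trans (mul_le_mul_right (hc t ht.1) _)) _))) _).trans ?_
    have hexp0 : 0 < exp (-(l * t)) := exp_pos _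
    rw [mul_add, mul_right_comm _ M, ← mul_assoc, ← mul_assoc, ← ofReal_mul (by positivity),
      ← ofReal_mul (by positivity), ← ofReal_mul (by positivity), ← ofReal_mul (by positivity)]
    have hc1 : t ^ ω * t ^ (-ω) = 1 := by rw [rpow_neg ht.1.le, mul_inv_cancel₀ htω.ne']
    have hc2 : exp (-(l * t)) * exp (l * t) = 1 := by rw [← exp_add]; simp
    gcongr
    · calc _ = D * exp (-(l * t)) * (t ^ ω * t ^ (-ω)) := by ring
        _ ≤ _ := by rw [hc1, mul_one]; exact mul_le_of_le_one_right hD (Real.exp_le_one_iff.2 (by nlinarith [ht.1]))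
    · have e1 : t ^ (-(3 / 4) + -ω + 1) = t ^ (-ω) * t ^ (1 / 4 : ℝ) := by rw [← rpow_add ht.1]; congr 1; ring
      rw [e1]
      calc _ = k * c * t ^ (1 / 4 : ℝ) * l ^ (-(1 / 4 : ℝ)) * (t ^ ω * t ^ (-ω)) *
            (exp (-(l * t)) * exp (l * t)) := by ring
        _ ≤ k * c * T ^ (1 / 4 : ℝ) * l ^ (-(1 / 4 : ℝ)) := by
          rw [hc1, hc2, mul_one, mul_one]; have := ht.1.le
          gcongr; exact ht.2.trans hT'
        _ ≤ _ := hl4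
  have hM2 : M ≤ ofReal (2 * D) := by
    lift M to NNReal using hMt with m
    rw [← ENNReal.ofReal_coe_nnreal, ← ofReal_mul (by norm_num), ← ofReal_add hD (by positivity),
      ENNReal.ofReal_le_ofReal_iff (by positivity)] at key
    rw [← ENNReal.ofReal_coe_nnreal]; exact ofReal_le_ofReal (by linarith)
  intro t ht; refine (heM t ht).trans ((mul_le_mul_right hM2 _).trans ?_)
  have htω := rpow_nonneg ht.1.le (-ω); rw [← ofReal_mul (by positivity)]; refine ofReal_le_ofReal ?_
  calc _ = 2 * D * exp (l * t) * t ^ (-ω) := by ring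
    _ ≤ _ := by gcongr; exact ht.2.trans hT'

namespace IsSol

variable {α β γ σ : ℝ} {S : ℝ → X →L[ℝ] X} {T : ℝ} {w₀ : X} {w F : ℝ → X} {t : ℝ}

lemma eLpNorm_field_duhamel_le (h : IsSol α β γ σ S T w₀ w F) (ht : t ∈ Ioc 0 T) {p q : ℝ} (hpq : p.HolderConjugate q)
    (hp : 2 ≤ p) {A : ℝ → ℝ≥0∞} (H : ∀ s ∈ Ioo 0 t, ∀ (j : Fin 3) (g : E3 → ℝ), IsBdd g →
      ‖∫ z : Phase, F s z * conv (R α β γ σ (t - s)) (comp j g) (z.1 + vth β (t - s) • z.2)‖ₑ ≤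
        A s * eLpNorm (conv (R α β γ σ (t - s)) g) 2 volume) :
    eLpNorm (field (density (w t - S t w₀ : X))) (ofReal p) volume ≤
      3 * ∫⁻ s in Ioo 0 t, A s * ofReal (R α β γ σ (t - s) ^ (-(3 / 4 * (1 - 2 / p)))) := by
  refine eLpNorm_field_le_of_forall (measurable_density _) (memLp_density _) hpq fun j g hg => ?_
  have hq : q ≤ 2 ∧ 2 / q - 1 = 1 - 2 / p := by
    have h1 := hpq.inv_add_inv_eq_one; have hq0 := hpq.symm.pos
    have h2 : p⁻¹ ≤ 2⁻¹ := inv_anti₀ (by norm_num) hp; refine ⟨(inv_le_inv₀ (by norm_num) hq0).1 (by linarith), ?_⟩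
    rw [div_eq_mul_inv, div_eq_mul_inv]; linarith
  rw [h.integral_density_duhamel_mul ht (measurable_comp j hg.meas) (hg.memLp_comp j),
    ← lintegral_mul_const' _ _ (hg.memLp _).2.ne]
  refine (enorm_integral_le_lintegral_enorm _).trans (setLIntegral_mono' measurableSet_Ioo fun s hs => ?_)
  have hy := eLpNorm_conv_two_le (h.R_pos (sub_pos.2 hs.2)) hg.meas hpq.symm.lt hq.1; rw [hq.2] at hy
  rw [mul_assoc]; exact (H s hs j g hg).trans (mul_le_mul_right hy _)

lemma vth_rpow_le (h : IsSol α β γ σ S T w₀ w F) {s T₀ κ : ℝ} (hs : 0 < s) (hsT : s ≤ T₀) (hκ : 0 ≤ κ) :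
    vth β s ^ (-κ) ≤ exp (-(β * T₀)) ^ (-κ) * s ^ (-κ) := by
  rw [← mul_rpow (exp_pos _).le hs.le]
  exact Real.rpow_le_rpow_of_nonpos (by positivity) (exp_mul_le_vth h.hβ hs.le hsT) (by linarith)

lemma exists_apriori_bound (h : IsSol α β γ σ S T w₀ w F) : ∃ Q : ℝ≥0∞, Q ≠ ∞ ∧ ∀ t ∈ Ioc 0 T,
    eLpNorm (field (density (w t - S t w₀ : X))) 2 volume ≤ Q := by
  obtain ⟨C, hC, HC⟩ := IsTheta.exists_enorm_integral_apriori_le; obtain ⟨W, hW⟩ := h.exists_bound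
  set k : ℝ := T ^ (3 / 2 : ℝ) + exp (-(β * T)) ^ (-(1 / 2 : ℝ)); set c : ℝ≥0∞ := C * ofReal k * ofReal W ^ 2
  have hc : c ≠ ∞ := by finiteness
  refine ⟨3 * (c * ofReal (T ^ (-(1 / 2 : ℝ) + 1) / (-(1 / 2 : ℝ) + 1))), by finiteness, fun t ht => ?_⟩
  have hT := ht.1.trans_le ht.2
  have h1 := h.eLpNorm_field_duhamel_le ht (p := 2) (q := 2) Real.HolderConjugate.two_two le_rfl
    (A := fun s => c * ofReal ((t - s) ^ (-(1 / 2 : ℝ)))) fun s hs j g hg => by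
      have hts := sub_pos.2 hs.2
      have htsT : t - s ≤ T := by linarith [hs.1, ht.2]
      refine (HC _ _ (h.theta s ⟨hs.1, hs.2.le.trans ht.2⟩) g hg j _ _ (vth_pos h.hβ hts) (h.R_pos hts)).trans ?_
      have h2 : vth β (t - s) + vth β (t - s) ^ (-(1 / 2 : ℝ)) ≤ k * (t - s) ^ (-(1 / 2 : ℝ)) := by
        rw [add_mul]; refine add_le_add ?_ (h.vth_rpow_le hts htsT (by norm_num))
        calc vth β (t - s) ≤ (t - s) ^ (3 / 2 : ℝ) * (t - s) ^ (-(1 / 2 : ℝ)) := by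
              rw [← rpow_add hts]; norm_num; exact vth_le h.hβ
          _ ≤ _ := by gcongr
      have h3 : ‖w s‖ₑ ≤ ofReal W := by
        rw [← ofReal_norm]; exact ofReal_le_ofReal (hW s ⟨hs.1.le, hs.2.le.trans ht.2⟩)
      calc _ ≤ C * ofReal (k * (t - s) ^ (-(1 / 2 : ℝ))) * (ofReal W ^ 2 *
            eLpNorm (conv (R α β γ σ (t - s)) g) 2 volume) := by gcongr
        _ = _ := by rw [ofReal_mul (by positivity)]; ring
  rw [ofReal_ofNat] at h1; refine h1.trans ?_
  have h5 : t ^ (-(1 / 2 : ℝ) + 1) / (-(1 / 2 : ℝ) + 1) ≤ T ^ (-(1 / 2 : ℝ) + 1) / (-(1 / 2 : ℝ) + 1) :=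
    div_le_div_of_nonneg_right (Real.rpow_le_rpow ht.1.le ht.2 (by norm_num)) (by norm_num)
  simp only [show (3 / 4 * (1 - 2 / 2) : ℝ) = 0 by norm_num, neg_zero, Real.rpow_zero, ofReal_one, mul_one]
  rw [lintegral_const_mul' _ _ hc, lintegral_Ioo_sub (fun s => ofReal (s ^ (-(1 / 2 : ℝ)))),
    lintegral_rpow_Ioo (by norm_num) ht.1]
  exact mul_le_mul_right (mul_le_mul_right (ofReal_le_ofReal h5) _) _

/-- The constant in the integral inequality for the field. -/
noncomputable def volterraConst (α β κ T a : ℝ) : ℝ :=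
  18 * π * exp (-(β * T)) ^ (-(1 / 2 : ℝ)) * (exp (3 * β * T / 2) * a) * (2 * α) ^ (-κ)

lemma eLpNorm_field_duhamel_le_volterra (h : IsSol α β γ σ S T w₀ w F) (ht : t ∈ Ioc 0 T) {p T₀ a : ℝ} (hp : 2 ≤ p)
    (hT : T ≤ T₀) (ha : norm2 w₀ ≤ a) :
    eLpNorm (field (density (w t - S t w₀ : X))) (ofReal p) volume ≤
      ofReal (volterraConst α β (3 / 4 * (1 - 2 / p)) T₀ a) *
        ∫⁻ s in Ioo 0 t, ofReal ((t - s) ^ (-(1 / 2 + 3 / 4 * (1 - 2 / p)))) *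
          eLpNorm (field (density (w s))) 2 volume := by
  set κ := 3 / 4 * (1 - 2 / p)
  have hκ : 0 ≤ κ := by
    have : 2 / p ≤ 1 := by rw [div_le_one (by linarith)]; exact hp
    simp only [κ]; nlinarith
  have ha0 := (norm2_nonneg w₀).trans ha; have hα := h.hα
  have h1 := h.eLpNorm_field_duhamel_le ht (Real.HolderConjugate.conjExponent (by linarith : 1 < p)) hp
    (A := fun s => ofReal (6 * π * vth β (t - s) ^ (-(1 / 2 : ℝ))) * (eLpNorm (w s) 2 volume *
      eLpNorm (field (density (w s))) 2 volume)) fun s hs j g hg => by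
    refine ((h.theta s ⟨hs.1, hs.2.le.trans ht.2⟩).enorm_integral_le hg j (vth_pos h.hβ (sub_pos.2 hs.2))
      (h.R_pos (sub_pos.2 hs.2))).trans (le_of_eq ?_)
    ring
  refine h1.trans ?_; rw [← lintegral_const_mul' _ _ ofReal_ne_top, ← lintegral_const_mul' _ _ (by finiteness)]
  refine setLIntegral_mono' measurableSet_Ioo fun s hs => ?_; have hts := sub_pos.2 hs.2
  have h2 := h.vth_rpow_le (κ := 1 / 2) hts (T₀ := T₀) (by linarith [hs.1, ht.2]) (by norm_num)
  have h3 : R α β γ σ (t - s) ^ (-κ) ≤ (2 * α) ^ (-κ) * (t - s) ^ (-κ) := by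
    rw [← mul_rpow (by positivity) hts.le]
    exact Real.rpow_le_rpow_of_nonpos (by positivity) (le_R h.hβ h.hγ h.hσ.le hts.le) (by linarith)
  have h4 : norm2 (w s) ≤ exp (3 * β * T₀ / 2) * a := by
    refine (h.norm2_le_exp hα.le h.hβ h.hγ h.hσ h.hell h.hS ⟨hs.1, hs.2.le.trans ht.2⟩).trans ?_; have := h.hβ
    have := norm2_nonneg w₀; gcongr; linarith [hs.2, ht.2]
  rw [← ofReal_norm2]
  calc _ ≤ 3 * (ofReal (6 * π * (exp (-(β * T₀)) ^ (-(1 / 2 : ℝ)) * (t - s) ^ (-(1 / 2 : ℝ)))) *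
        (ofReal (exp (3 * β * T₀ / 2) * a) * eLpNorm (field (density (w s))) 2 volume) *
        ofReal ((2 * α) ^ (-κ) * (t - s) ^ (-κ))) := by gcongr
    _ = ofReal (3 * (6 * π * (exp (-(β * T₀)) ^ (-(1 / 2 : ℝ)) * (t - s) ^ (-(1 / 2 : ℝ)))) *
        (exp (3 * β * T₀ / 2) * a) * ((2 * α) ^ (-κ) * (t - s) ^ (-κ))) *
        eLpNorm (field (density (w s))) 2 volume := by
      have e : ∀ x y z : ℝ, ∀ E : ℝ≥0∞, 0 ≤ x → 0 ≤ y → 3 * (ofReal x * (ofReal y * E) * ofReal z) =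
          ofReal (3 * x * y * z) * E := fun x y z E hx hy => by
        rw [ofReal_mul (by positivity), ofReal_mul (by positivity), ofReal_mul (by norm_num), ofReal_ofNat]; ring
      exact e _ _ _ _ (by positivity) (by positivity)
    _ = _ := by
      conv_rhs => rw [← mul_assoc, ← ofReal_mul (by unfold volterraConst; positivity)]
      congr 2; rw [neg_add, rpow_add hts, volterraConst]; ring

end IsSol

lemma eLpNorm_interpolation {f : E3 → E3} (hf : Measurable f) {p θ : ℝ} (h2 : 2 ≤ p) (h6 : p ≤ 6)
    (hθ : θ = 3 * (p - 2) / (2 * p)) : eLpNorm f (ofReal p) volume ≤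
      eLpNorm f 2 volume ^ (1 - θ) * eLpNorm f (ofReal 6) volume ^ θ := by
  have hp : 0 < p := by linarith
  have e2 : eLpNorm f 2 volume = eLpNorm f (ofReal 2) volume := by rw [ofReal_ofNat]
  rw [e2, eLpNorm_ofReal _ hp, eLpNorm_ofReal _ (by norm_num), eLpNorm_ofReal _ (by norm_num)]
  have h := ENNReal.lintegral_mul_norm_pow_le (μ := volume) (f := fun x => ‖f x‖ₑ ^ (2 : ℝ)) (g := fun x => ‖f x‖ₑ ^ (6 : ℝ))
    (by fun_prop) (by fun_prop) (p := (6 - p) / 4) (q := (p - 2) / 4) (by linarith) (by linarith) (by ring)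
  have e : ∀ x, (‖f x‖ₑ ^ (2 : ℝ)) ^ ((6 - p) / 4) * (‖f x‖ₑ ^ (6 : ℝ)) ^ ((p - 2) / 4) = ‖f x‖ₑ ^ p := fun x => by
    rw [← rpow_mul, ← rpow_mul, ← rpow_add_of_nonneg _ _ (by linarith) (by linarith)]; congr 1; ring
  simp_rw [e] at h; refine (rpow_le_rpow h (by positivity)).trans (le_of_eq ?_)
  rw [mul_rpow_of_nonneg _ _ (by positivity), ← rpow_mul, ← rpow_mul, ← rpow_mul, ← rpow_mul, hθ]
  congr 2 <;> field_simp <;> ring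

lemma exists_E0_bounds : ∃ C : ℝ, 0 ≤ C ∧ ∀ (α β γ σ : ℝ) (w₀ : X) (t : ℝ), 0 < R α β γ σ t →
    eLpNorm (E0 α β γ σ w₀ t) 2 volume ≤ ofReal C * n0thNorm β w₀ t ∧
      eLpNorm (E0 α β γ σ w₀ t) (ofReal 6) volume ≤ ofReal C * ‖w₀‖ₑ := by
  obtain ⟨A, hA, HA⟩ := exists_eLpNorm_field_two_le; obtain ⟨B, hB, HB⟩ := exists_eLpNorm_field_six_le
  have hD : A + B * wtInt ^ (1 / 2 : ℝ) ≠ ∞ := by have := wtInt_lt_top.ne; finiteness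
  refine ⟨(A + B * wtInt ^ (1 / 2 : ℝ)).toReal, toReal_nonneg, fun α β γ σ w₀ t hR => ?_⟩
  have hm := measurable_n0th β w₀ t; have hn : Measurable (n0 α β γ σ w₀ t) := measurable_conv _ hm
  have hc : ∀ p : ℝ, 1 < p →
      eLpNorm (n0 α β γ σ w₀ t) (ofReal p) volume ≤ eLpNorm (n0th β w₀ t) (ofReal p) volume := by
    intro p hp; rw [eLpNorm_ofReal _ (by linarith), eLpNorm_ofReal _ (by linarith)]
    exact rpow_le_rpow (lintegral_conv_rpow_le hR hm hp) (by positivity)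
  rw [ofReal_toReal hD]
  constructor
  · exact (HA _ hn).trans (mul_le_mul' le_self_add (hc (6 / 5) (by norm_num)))
  · have h1 := hc 2 (by norm_num); rw [ofReal_ofNat] at h1
    have h2 := rpow_le_rpow (lintegral_n0th_sq_le β w₀ t) (z := 1 / 2) (by norm_num)
    rw [← eLpNorm_two_eq, mul_rpow_of_nonneg _ _ (by norm_num), ← rpow_two, ← rpow_mul,
      show (2 : ℝ) * (1 / 2) = 1 by norm_num, rpow_one] at h2
    calc _ ≤ B * (wtInt ^ (1 / 2 : ℝ) * ‖w₀‖ₑ) := (HB _ hn).trans (mul_le_mul_right (h1.trans h2) _)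
      _ = B * wtInt ^ (1 / 2 : ℝ) * ‖w₀‖ₑ := by ring
      _ ≤ _ := by gcongr; exact le_add_self

lemma ConditionA.n0thNorm_le {β ω T T₀ b t : ℝ} {w₀ : X} (hA : ConditionA β ω w₀) (hβ : 0 ≤ β) (hω : 0 ≤ ω)
    (ht : t ∈ Ioc 0 T) (hT : T ≤ T₀) (hb : supA β ω T w₀ ≤ b) :
    n0thNorm β w₀ t ≤ ofReal (b * exp (-(β * T₀)) ^ (-ω) * t ^ (-ω)) := by
  obtain ⟨C, hC⟩ := hA T (ht.1.trans_le ht.2)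
  have hle : ∀ s ∈ Ioc 0 T, ofReal (vth β s ^ ω) * n0thNorm β w₀ s ≤ ofReal C := fun s hs => by
    have h0 := rpow_pos_of_pos (vth_pos hβ hs.1) ω; refine (mul_le_mul_right (hC s hs) _).trans (le_of_eq ?_)
    rw [← ofReal_mul h0.le, rpow_neg (vth_pos hβ hs.1).le]; congr 1; field_simp
  have h1 := le_iSup₂ (f := fun s (_ : s ∈ Ioc 0 T) => ofReal (vth β s ^ ω) * n0thNorm β w₀ s) t ht
  have h2 : (⨆ s ∈ Ioc 0 T, ofReal (vth β s ^ ω) * n0thNorm β w₀ s) ≠ ∞ := ((iSup₂_le hle).trans_lt ofReal_lt_top).ne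
  have h3 := h1.trans ((ofReal_toReal h2).symm.le.trans (ofReal_le_ofReal hb)); have h0 := vth_pos hβ ht.1
  have hb0 : 0 ≤ b := toReal_nonneg.trans hb; have h4 := mul_le_mul_right h3 (ofReal (vth β t ^ (-ω)))
  rw [← mul_assoc, ← ofReal_mul (by positivity), ← rpow_add h0, neg_add_cancel, Real.rpow_zero,
    ofReal_one, one_mul, ← ofReal_mul (by positivity)] at h4
  refine h4.trans (ofReal_le_ofReal ?_)
  have h5 : vth β t ^ (-ω) ≤ exp (-(β * T₀)) ^ (-ω) * t ^ (-ω) := by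
    rw [← mul_rpow (exp_pos _).le ht.1.le]
    exact Real.rpow_le_rpow_of_nonpos (mul_pos (exp_pos _) ht.1) (exp_mul_le_vth hβ ht.1.le (ht.2.trans hT)) (by linarith)
  calc _ ≤ exp (-(β * T₀)) ^ (-ω) * t ^ (-ω) * b := by gcongr
    _ = _ := by ring

lemma density_sub_ae (u g : X) : density (u - g : X) =ᵐ[volume] fun x => density u x - density g x := by
  have h := coe_sub_ae u g; rw [volume_eq_prod] at h
  filter_upwards [Measure.ae_ae_of_ae_prod h, ae_integrable_section u, ae_integrable_section g] with x hx h1 h2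
  rw [density, integral_congr_ae hx, integral_sub h1 h2]; rfl

namespace IsSol

variable {α β γ σ : ℝ} {S : ℝ → X →L[ℝ] X} {T : ℝ} {w₀ : X} {w F : ℝ → X} {t : ℝ}

lemma memLp_n0 (h : IsSol α β γ σ S T w₀ w F) (ht : 0 < t) : MemLp (n0 α β γ σ w₀ t) 2 :=
  memLp_conv (h.R_pos ht) (measurable_n0th β w₀ t) (memLp_n0th β w₀ t)

lemma density_ae (h : IsSol α β γ σ S T w₀ w F) (ht : 0 < t) : (density (w t)) =ᵐ[volume]
    fun x => n0 α β γ σ w₀ t x + density (w t - S t w₀ : X) x := by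
  filter_upwards [h.n0_ae ht, density_sub_ae (w t) (S t w₀)] with x h1 h2
  rw [h1, h2]; ring

lemma field_ae (h : IsSol α β γ σ S T w₀ w F) (ht : 0 < t) : field (density (w t)) =ᵐ[volume]
    fun x => E0 α β γ σ w₀ t x + field (density (w t - S t w₀ : X)) x := by
  rw [field_congr (h.density_ae ht)]
  exact field_add_ae (fieldConverges (measurable_conv _ (measurable_n0th β w₀ t)) (h.memLp_n0 ht))
    (fieldConverges (measurable_density _) (memLp_density _))

lemma eLpNorm_field_le (h : IsSol α β γ σ S T w₀ w F) (ht : 0 < t) : eLpNorm (field (density (w t))) 2 volume ≤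
    eLpNorm (E0 α β γ σ w₀ t) 2 volume + eLpNorm (field (density (w t - S t w₀ : X))) 2 volume := by
  rw [eLpNorm_congr_ae (h.field_ae ht)]
  exact eLpNorm_add_le (measurable_field (measurable_conv _ (measurable_n0th β w₀ t))).aestronglyMeasurable
    (measurable_field (measurable_density _)).aestronglyMeasurable one_le_two

lemma exists_field_bound (α β γ σ : ℝ) {ω T₀ a b : ℝ} (hα : 0 < α) (hβ : 0 ≤ β) (hω0 : 0 ≤ ω) (hω : ω < 1) (hT₀ : 0 < T₀)
    (ha : 0 ≤ a) (hb : 0 ≤ b) : ∃ C : ℝ, 0 ≤ C ∧ ∀ (S : ℝ → X →L[ℝ] X) (T : ℝ) (w₀ : X) (w F : ℝ → X),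
      IsSol α β γ σ S T w₀ w F → ConditionA β ω w₀ → T ≤ T₀ → norm2 w₀ ≤ a → supA β ω T w₀ ≤ b → ∀ t ∈ Ioc 0 T,
      eLpNorm (field (density (w t))) 2 volume ≤ ofReal (C * t ^ (-ω)) := by
  obtain ⟨A, hA, HA⟩ := exists_E0_bounds; set D := A * (b * exp (-(β * T₀)) ^ (-ω))
  have hD : 0 ≤ D := by positivity
  set k := volterraConst α β (3 / 4 * (1 - 2 / 2)) T₀ a
  have hk : 0 ≤ k := by unfold k volterraConst; positivity
  obtain ⟨C, hC, H⟩ := exists_volterra_bound hω0 hω hD hk hT₀; refine ⟨C, hC, fun S T w₀ w F h hA' hT ha' hb' => ?_⟩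
  have h0 : ∀ t ∈ Ioc 0 T, eLpNorm (E0 α β γ σ w₀ t) 2 volume ≤ ofReal (D * t ^ (-ω)) := fun t ht => by
    refine (HA α β γ σ w₀ t (h.R_pos ht.1)).1.trans ((mul_le_mul_right (hA'.n0thNorm_le hβ hω0 ht hT hb') _).trans (le_of_eq ?_))
    rw [← ofReal_mul hA]; congr 1; simp only [D]; ring
  obtain ⟨Q, hQ, HQ⟩ := h.exists_apriori_bound
  refine H T _ (ofReal D + ofReal (T₀ ^ ω) * Q) hT (by finiteness) (fun t ht => ?_) (fun t ht => ?_)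
  · refine (mul_le_mul_right ((h.eLpNorm_field_le ht.1).trans (add_le_add (h0 t ht) (HQ t ht))) _).trans ?_
    have htω := rpow_pos_of_pos ht.1 ω; rw [mul_add, ← ofReal_mul htω.le, rpow_neg ht.1.le]
    refine add_le_add (ofReal_le_ofReal (le_of_eq (by field_simp))) ?_; have := ht.1.le
    gcongr; exact ht.2.trans hT
  · refine (h.eLpNorm_field_le ht.1).trans (add_le_add (h0 t ht) ?_)
    have h1 := h.eLpNorm_field_duhamel_le_volterra ht (p := 2) le_rfl hT ha'; rw [ofReal_ofNat] at h1
    refine h1.trans (le_of_eq ?_); simp only [k]; norm_num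

lemma exists_E1_bound (α β γ σ : ℝ) {ω T₀ a b p : ℝ} (hα : 0 < α) (hβ : 0 ≤ β) (hω0 : 0 ≤ ω) (hω : ω < 1) (hT₀ : 0 < T₀)
    (ha : 0 ≤ a) (hb : 0 ≤ b) (hp : 2 ≤ p) (hp6 : p < 6) :
    ∃ C : ℝ, 0 ≤ C ∧ ∀ (S : ℝ → X →L[ℝ] X) (T : ℝ) (w₀ : X) (w F : ℝ → X),
      IsSol α β γ σ S T w₀ w F → ConditionA β ω w₀ → T ≤ T₀ → norm2 w₀ ≤ a → supA β ω T w₀ ≤ b → ∀ t ∈ Ioc 0 T,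
      eLpNorm (field (density (w t - S t w₀ : X))) (ofReal p) volume ≤
        ofReal (C * t ^ (3 / (2 * p) - 1 / 4 - ω)) := by
  obtain ⟨C, hC, H⟩ := exists_field_bound α β γ σ hα hβ hω0 hω hT₀ ha hb
  have hκ : -1 < -(1 / 2 + 3 / 4 * (1 - 2 / p)) := by
    have : 1 / 3 < 2 / p := by rw [div_lt_div_iff₀ (by norm_num) (by linarith)]; linarith
    linarith
  obtain ⟨c, hc, Hc⟩ := exists_lintegral_rpow_mul_rpow_le hκ (show -1 < -ω by linarith)
  set k := volterraConst α β (3 / 4 * (1 - 2 / p)) T₀ a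
  have hk : 0 ≤ k := by unfold k volterraConst; positivity
  refine ⟨k * C * c, by positivity, fun S T w₀ w F h hA hT ha' hb' t ht => ?_⟩
  refine (h.eLpNorm_field_duhamel_le_volterra ht hp hT ha').trans ?_
  calc _ ≤ ofReal k * ∫⁻ s in Ioo 0 t, ofReal C *
        (ofReal ((t - s) ^ (-(1 / 2 + 3 / 4 * (1 - 2 / p)))) * ofReal (s ^ (-ω))) := by
        refine mul_le_mul_right (setLIntegral_mono' measurableSet_Ioo fun s hs => ?_) _
        have := H S T w₀ w F h hA hT ha' hb' s ⟨hs.1, hs.2.le.trans ht.2⟩; rw [ofReal_mul hC] at this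
        exact (mul_le_mul_right this _).trans (le_of_eq (by ring))
    _ ≤ ofReal k * (ofReal C * ofReal (c * t ^ (-(1 / 2 + 3 / 4 * (1 - 2 / p)) + -ω + 1))) := by
      rw [lintegral_const_mul' _ _ ofReal_ne_top]; exact mul_le_mul_right (mul_le_mul_right (Hc t ht.1) _) _
    _ = _ := by
      rw [← ofReal_mul hC, ← ofReal_mul hk, ← mul_assoc, ← mul_assoc]; congr 3
      field_simp; ring

end IsSol

open scoped FourierTransform

lemma norm_coulSymb_mul_one_sub_gexp_le (j : Fin 3) {ε M : ℝ} (hε : 0 < ε) (hM : 0 < M) (ξ : E3) :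
    ‖coulSymb j ε ξ * (1 - gexp M ξ : ℝ)‖ ≤ √M := by
  rcases eq_or_ne ξ 0 with rfl | h0
  · simp [coulSymb]
  have hξ := norm_pos_iff.2 h0
  have h1 := (norm_coulSymb_mul_le j ε ξ).trans (mul_le_of_le_one_right (by positivity) (gexp_le_one hε.le ξ))
  have h2 : 1 - gexp M ξ ≤ 2 * π * √M * ‖ξ‖ := by
    set y := √2 * π * √M * ‖ξ‖
    have hy : 0 ≤ y := by positivity
    have e : gexp M ξ = exp (-y ^ 2) := by
      rw [gexp]; congr 1; simp only [y, mul_pow, Real.sq_sqrt hM.le, Real.sq_sqrt (zero_le_two : (0 : ℝ) ≤ 2)]; ring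
    have h3 : 1 - gexp M ξ ≤ y := by
      rcases le_total 1 y with h | h
      · linarith [gexp_pos M ξ]
      · rw [e]; nlinarith [Real.add_one_le_exp (-y ^ 2)]
    refine h3.trans ?_; simp only [y]
    gcongr; exact Real.sqrt_le_iff.2 ⟨by norm_num, by norm_num⟩
  have h4 : 0 ≤ 1 - gexp M ξ := sub_nonneg.2 (gexp_le_one hM.le ξ); rw [norm_mul, norm_real, norm_of_nonneg h4]
  calc _ ≤ ‖coulSymb j ε ξ‖ * (2 * π * √M * ‖ξ‖) := by gcongr
    _ = 2 * π * √M * (‖ξ‖ * ‖coulSymb j ε ξ‖) := by ring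
    _ ≤ 2 * π * √M * (2 * π)⁻¹ := by gcongr
    _ = √M := by field_simp

/-- The high frequency part of the Coulomb field of a test density. -/
lemma enorm_integral_density_mul_highFreq_le (u : X) (j : Fin 3) {M : ℝ} (hM : 0 < M) {g : E3 → ℝ} (hg : IsBdd g) :
    ‖∫ x, density u x * (comp j g x - conv M (comp j g) x)‖ₑ ≤
      eLpNorm (density u) 2 volume * (ofReal √M * eLpNorm g 2 volume) := by
  have hc := measurable_comp j hg.meas; have hc2 := hg.memLp_comp j
  have hψ : Measurable fun x => comp j g x - conv M (comp j g) x := hc.sub (measurable_conv M hc)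
  have h2 : MemLp (fun x => comp j g x - conv M (comp j g) x) 2 := hc2.sub (memLp_conv hM hc hc2)
  have hlim := tendsto_integral_mul_conv u 0 hψ h2; simp only [zero_smul, add_zero] at hlim
  rw [integral_density_mul u hψ h2] at hlim; refine le_of_tendsto hlim.enorm (of_forall fun n => ?_)
  have hε := eps_pos n; rw [integral_density_mul u (measurable_conv _ hψ) (memLp_conv hε hψ h2)]
  have hi : Integrable fun ξ => coulSymb j (eps n) ξ * 𝓕 (fun y => (g y : ℂ)) ξ :=
    integrable_mul_fourier hg (integrable_coulSymb j hε)
  have hi' : Integrable fun ξ => coulSymb j (eps n + M) ξ * 𝓕 (fun y => (g y : ℂ)) ξ :=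
    integrable_mul_fourier hg (integrable_coulSymb j (by linarith))
  set B : E3 → ℂ := fun ξ => coulSymb j (eps n) ξ * 𝓕 (fun y => (g y : ℂ)) ξ - coulSymb j (eps n + M) ξ * 𝓕 (fun y => (g y : ℂ)) ξ
  have hB : ∀ ξ, ‖B ξ‖ ≤ √M * ‖𝓕 (fun y => (g y : ℂ)) ξ‖ := fun ξ => by
    have e : B ξ = coulSymb j (eps n) ξ * (1 - gexp M ξ : ℝ) * 𝓕 (fun y => (g y : ℂ)) ξ := by
      simp only [B, coulSymb, gexp_add]; push_cast; ring
    rw [e, norm_mul]; gcongr; exact norm_coulSymb_mul_one_sub_gexp_le j hε hM ξ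
  have hBi : Integrable B := hi.sub hi'
  have hB2 : MemLp B 2 := (hg.memLp_fourier.norm.const_mul √M).mono' hBi.1 (of_forall hB)
  have hconv : ∀ x, ((conv (eps n) (fun x => comp j g x - conv M (comp j g) x) x : ℝ) : ℂ) = 𝓕⁻ B x := fun x => by
    have e : conv (eps n) (fun x => comp j g x - conv M (comp j g) x) x =
        conv (eps n) (comp j g) x - conv (eps n + M) (comp j g) x := by
      rw [← conv_conv hε hM hc hc2]; simp only [conv, mul_sub]
      exact integral_sub (integrable_gauss_mul hε hc2 x) (integrable_gauss_mul hε (memLp_conv hM hc hc2) x)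
    rw [e, Complex.ofReal_sub, conv_comp j hε hg, conv_comp j (by linarith) hg]
    simp only [fourierInv_eq', B, smul_sub]
    have hk : ∀ {f : E3 → ℂ}, Integrable f →
        Integrable fun v : E3 => Complex.exp (((2 * π * inner ℝ v x : ℝ) : ℂ) * I) • f v := fun hf =>
      hf.bdd_mul (c := 1) (by fun_prop) (of_forall fun v => by rw [norm_exp_ofReal_mul_I])
    exact (integral_sub (hk hi) (hk hi')).symm
  have hnorm : eLpNorm (conv (eps n) fun x => comp j g x - conv M (comp j g) x) 2 volume ≤
      ofReal √M * eLpNorm g 2 volume := by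
    calc _ = eLpNorm (𝓕⁻ B) 2 volume := eLpNorm_congr_norm_ae (of_forall fun x => by rw [← hconv x, norm_real])
      _ = eLpNorm B 2 volume := eLpNorm_fourierInv hBi hB2
      _ ≤ ofReal √M * eLpNorm (𝓕 fun y => (g y : ℂ)) 2 volume :=
          eLpNorm_le_mul_eLpNorm_of_ae_le_mul (of_forall hB) 2
      _ = _ := by
        rw [eLpNorm_fourier (f := fun y => (g y : ℂ)) hg.integrable.ofReal (hg.memLp 2).ofReal]; congr 1
        exact eLpNorm_congr_norm_ae (of_forall fun x => by simp)
  refine (enorm_integral_le_lintegral_enorm _).trans ?_; simp_rw [enorm_mul]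
  refine (lintegral_mul_le_sqrt (measurable_density u).enorm.aemeasurable (measurable_conv _ hψ).enorm.aemeasurable).trans ?_
  rw [← eLpNorm_two_eq, ← eLpNorm_two_eq]; gcongr

local notation:max "𝒢[" M "]" => (∫⁻ ξ : E3, ofReal (gexp (2 * M) ξ)) ^ (1 / 2 : ℝ)

lemma tendsto_lintegral_gexp : Tendsto (fun n : ℕ => ∫⁻ ξ : E3, ofReal (gexp (2 * ((n : ℝ) + 1)) ξ)) atTop (𝓝 0) := by
  have h := tendsto_lintegral_of_dominated_convergence (μ := (volume : Measure E3))
    (F := fun (n : ℕ) ξ => ofReal (gexp (2 * ((n : ℝ) + 1)) ξ)) (f := fun _ => 0)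
    (fun ξ => ofReal (gexp 2 ξ)) (fun n => (continuous_gexp _).measurable.ennreal_ofReal)
    (fun n => of_forall fun ξ => ofReal_le_ofReal (by
      rw [mul_add, mul_one, gexp_add]; exact mul_le_of_le_one_left (gexp_pos _ _).le (gexp_le_one (by positivity) ξ)))
    (integrable_gexp two_pos).lintegral_lt_top.ne (by
      filter_upwards [compl_mem_ae_iff.2 (measure_singleton (0 : E3))] with ξ hξ
      have h0 : 0 < ‖ξ‖ := norm_pos_iff.2 hξ
      have h1 : Tendsto (fun n : ℕ => 2 * π ^ 2 * (2 * ((n : ℝ) + 1)) * ‖ξ‖ ^ 2) atTop atTop :=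
        ((tendsto_natCast_atTop_atTop.atTop_add tendsto_const_nhds).const_mul_atTop two_pos |>.const_mul_atTop
          (by positivity)).atTop_mul_const (by positivity)
      have h2 := ENNReal.tendsto_ofReal (Real.tendsto_exp_neg_atTop_nhds_zero.comp h1)
      simpa [gexp, Function.comp_def] using h2)
  simpa using h

namespace IsSol

variable {α β γ σ : ℝ} {S : ℝ → X →L[ℝ] X} {T : ℝ} {w₀ : X} {w F : ℝ → X} {t : ℝ}

/-- The low frequency part of the field produced by the nonlinear term. -/
lemma exists_lowFreq_bound (h : IsSol α β γ σ S T w₀ w F) {C ω : ℝ} (hω : ω < 1)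
    (hb : ∀ t ∈ Ioc 0 T, eLpNorm (field (density (w t))) 2 volume ≤ ofReal (C * t ^ (-ω))) :
    ∃ B : ℝ≥0∞, B ≠ ∞ ∧ ∀ t ∈ Ioc 0 T, ∀ (j : Fin 3) (g : E3 → ℝ), IsBdd g → ∀ M : ℝ, 0 < M →
      ‖∫ x, density (w t - S t w₀ : X) x * conv M (comp j g) x‖ₑ ≤
        𝒢[M] * B * eLpNorm g 2 volume := by
  obtain ⟨W, hW⟩ := h.exists_bound
  set c : ℝ≥0∞ := ofReal (6 * π * T) * ((wtInt * ofReal W ^ 2) ^ (1 / 2 : ℝ) * ofReal C)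
  have hc : c ≠ ∞ := by have := wtInt_lt_top.ne; finiteness
  refine ⟨c * ofReal (T ^ (-ω + 1) / (-ω + 1)), by finiteness, fun t ht j g hg M hM => ?_⟩
  have hcm := measurable_comp j hg.meas; have hc2 := hg.memLp_comp j
  have hG : ∀ {M : ℝ}, 0 < M → 𝒢[M] ≠ ∞ := fun hM =>
    (rpow_lt_top_of_nonneg (by norm_num) (integrable_gexp (by positivity)).lintegral_lt_top.ne).ne
  rw [h.integral_density_duhamel_mul ht (measurable_conv M hcm) (memLp_conv hM hcm hc2)]
  have hpt : ∀ s ∈ Ioo 0 t, ‖∫ z : Phase, F s z * conv (R α β γ σ (t - s)) (conv M (comp j g)) (z.1 + vth β (t - s) • z.2)‖ₑ ≤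
      c * 𝒢[M] * eLpNorm g 2 volume * ofReal (s ^ (-ω)) := by
    intro s hs; have hts := sub_pos.2 hs.2
    have hsT : s ∈ Ioc 0 T := ⟨hs.1, hs.2.le.trans ht.2⟩; have hR := h.R_pos hts; simp_rw [conv_conv hR hM hcm hc2]
    have h1 := (h.theta s hsT).enorm_integral_lowFreq_le hg j (vth_pos h.hβ hts) (M := R α β γ σ (t - s) + M) (by linarith)
    have h2 : ‖w s‖ₑ ≤ ofReal W := by rw [← ofReal_norm]; exact ofReal_le_ofReal (hW s ⟨hs.1.le, hsT.2⟩)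
    have h3 : vth β (t - s) ≤ T := (vth_le h.hβ).trans (by linarith [hs.1, ht.2])
    have h4 : ∫⁻ ξ : E3, ofReal (gexp (2 * (R α β γ σ (t - s) + M)) ξ) ≤ ∫⁻ ξ : E3, ofReal (gexp (2 * M) ξ) :=
      lintegral_mono fun ξ => ofReal_le_ofReal (by
        rw [mul_add, gexp_add]; exact mul_le_of_le_one_left (gexp_pos _ _).le (gexp_le_one (by positivity) ξ))
    have h5 := hb s hsT; refine h1.trans ?_
    rcases le_or_gt 0 C with hC | hC
    · rw [ofReal_mul hC] at h5
      calc _ ≤ ofReal (6 * π * T) * (𝒢[M] * eLpNorm g 2 volume *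
            ((wtInt * ofReal W ^ 2) ^ (1 / 2 : ℝ) * (ofReal C * ofReal (s ^ (-ω))))) := by gcongr
        _ = _ := by simp only [c]; ring
    · rw [ENNReal.ofReal_of_nonpos (mul_nonpos_of_nonpos_of_nonneg hC.le (rpow_nonneg hs.1.le _))] at h5
      rw [nonpos_iff_eq_zero.1 h5]; simp
  refine (enorm_integral_le_lintegral_enorm _).trans ((setLIntegral_mono' measurableSet_Ioo hpt).trans ?_)
  have hg2 := (hg.memLp 2).2.ne; have := hG hM
  rw [lintegral_const_mul' _ _ (by finiteness), lintegral_rpow_Ioo (by linarith) ht.1]; have ht0 := ht.1.le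
  have hω' : 0 < -ω + 1 := by linarith
  calc _ ≤ c * 𝒢[M] * eLpNorm g 2 volume *
        ofReal (T ^ (-ω + 1) / (-ω + 1)) := by gcongr; exact ht.2
    _ = _ := by ring

lemma tendsto_eLpNorm_field_sub (h : IsSol α β γ σ S T w₀ w F) {C ω : ℝ} (hω : ω < 1)
    (hb : ∀ t ∈ Ioc 0 T, eLpNorm (field (density (w t))) 2 volume ≤ ofReal (C * t ^ (-ω)))
    {t₀ : ℝ} (ht₀ : t₀ ∈ Ioc 0 T) :
    Tendsto (fun t => eLpNorm (fun x => field (density (w t - S t w₀ : X)) x -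
      field (density (w t₀ - S t₀ w₀ : X)) x) 2 volume) (𝓝[Ioc 0 T] t₀) (𝓝 0) := by
  obtain ⟨B, hB, HB⟩ := h.exists_lowFreq_bound hω hb
  have hcont : Tendsto (fun t => w t - S t w₀) (𝓝[Ioc 0 T] t₀) (𝓝 (w t₀ - S t₀ w₀)) :=
    ((h.cont t₀ ⟨ht₀.1.le, ht₀.2⟩).mono Ioc_subset_Icc_self).sub
      ((h.hS.1.continuousOn w₀ t₀ ht₀.1.le).mono fun t ht => ht.1.le)
  have hbound : ∀ t ∈ Ioc 0 T, ∀ M : ℝ, 0 < M → eLpNorm (fun x => field (density (w t - S t w₀ : X)) x -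
      field (density (w t₀ - S t₀ w₀ : X)) x) 2 volume ≤
      3 * (wtInt ^ (1 / 2 : ℝ) * ‖(w t - S t w₀) - (w t₀ - S t₀ w₀)‖ₑ * ofReal √M +
        2 * (𝒢[M] * B)) := by
    intro t ht M hM; set u := w t - S t w₀; set u₀ := w t₀ - S t₀ w₀; have hd := density_sub_ae u u₀
    have e1 : (fun x => field (density u) x - field (density u₀) x) =ᵐ[volume] field (density (u - u₀ : X)) := by
      have h1 : (density u) =ᵐ[volume] fun x => density (u - u₀ : X) x + density u₀ x := by
        filter_upwards [hd] with x hx; rw [hx]; ring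
      have h2 := field_add_ae (fieldConverges (measurable_density (u - u₀ : X)) (memLp_density _))
        (fieldConverges (measurable_density u₀) (memLp_density _))
      rw [← field_congr h1] at h2
      filter_upwards [h2] with x hx
      rw [hx]; abel
    rw [eLpNorm_congr_ae e1]
    have := eLpNorm_field_le_of_forall (measurable_density (u - u₀ : X)) (memLp_density _) Real.HolderConjugate.two_two
      (B := wtInt ^ (1 / 2 : ℝ) * ‖u - u₀‖ₑ * ofReal √M +
        2 * (𝒢[M] * B)) fun j g hg => by
      have hc := measurable_comp j hg.meas; have hc2 := hg.memLp_comp j; have hv := memLp_conv hM hc hc2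
      have hi : ∀ (v : X) {ψ : E3 → ℝ}, MemLp ψ 2 → Integrable fun x => density v x * ψ x := fun v ψ hψ =>
        (memLp_density v).integrable_mul hψ
      have e : ∫ x, density (u - u₀ : X) x * comp j g x =
          (∫ x, density (u - u₀ : X) x * (comp j g x - conv M (comp j g) x)) +
            ((∫ x, density u x * conv M (comp j g) x) - ∫ x, density u₀ x * conv M (comp j g) x) := by
        rw [← integral_sub (hi u hv) (hi u₀ hv)]
        refine Eq.trans (integral_congr_ae ?_) (integral_add (hi (u - u₀) (hc2.sub hv)) ((hi u hv).sub (hi u₀ hv)))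
        filter_upwards [hd] with x hx
        simp only [hx, Pi.sub_apply]; ring
      have h1 := enorm_integral_density_mul_highFreq_le (u - u₀) j hM hg
      have h2 := rpow_le_rpow (lintegral_density_sq_le (u - u₀)) (z := 1 / 2) (by norm_num)
      rw [← eLpNorm_two_eq, mul_rpow_of_nonneg _ _ (by norm_num), ← rpow_two, ← rpow_mul,
        show (2 : ℝ) * (1 / 2) = 1 by norm_num, rpow_one] at h2
      rw [e, ofReal_ofNat]; refine (enorm_add_le _ _).trans ?_
      refine (add_le_add (h1.trans (mul_le_mul_left h2 _)) (enorm_sub_le.trans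
        (add_le_add (HB t ht j g hg M hM) (HB t₀ ht₀ j g hg M hM)))).trans (le_of_eq ?_)
      ring
    rwa [ofReal_ofNat] at this
  have hlow : Tendsto (fun n : ℕ => 3 * (2 * (𝒢[(n : ℝ) + 1] * B)))
      atTop (𝓝 0) := by
    have h1 := (ENNReal.continuous_rpow_const (y := 1 / 2)).tendsto 0 |>.comp tendsto_lintegral_gexp
    have h2 := ENNReal.Tendsto.const_mul (a := 3) (ENNReal.Tendsto.const_mul (a := 2) (ENNReal.Tendsto.mul_const (b := B) h1
      (Or.inr hB)) (Or.inr (by norm_num))) (Or.inr (by norm_num))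
    simpa [Function.comp_def] using h2
  rw [tendsto_nhds_zero]; intro ε hε
  have hε2 : 0 < ε / 2 := ENNReal.half_pos hε.ne'; obtain ⟨n, hn⟩ := ((tendsto_nhds_zero.1 hlow) (ε / 2) hε2).exists
  have hhigh : Tendsto (fun t => 3 * (wtInt ^ (1 / 2 : ℝ) * ‖(w t - S t w₀) - (w t₀ - S t₀ w₀)‖ₑ *
      ofReal √((n : ℝ) + 1))) (𝓝[Ioc 0 T] t₀) (𝓝 0) := by
    have h1 := (hcont.sub_const (w t₀ - S t₀ w₀)).enorm; rw [sub_self, enorm_zero] at h1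
    have h2 := ENNReal.Tendsto.const_mul (a := 3) (ENNReal.Tendsto.mul_const (b := ofReal √((n : ℝ) + 1))
      (ENNReal.Tendsto.const_mul (a := wtInt ^ (1 / 2 : ℝ)) h1
      (Or.inr (rpow_lt_top_of_nonneg (by norm_num) wtInt_lt_top.ne).ne)) (Or.inr ofReal_ne_top))
      (Or.inr (by norm_num))
    simpa using h2
  filter_upwards [(tendsto_nhds_zero.1 hhigh) (ε / 2) hε2, self_mem_nhdsWithin] with t h1 ht
  refine (hbound t ht ((n : ℝ) + 1) (by positivity)).trans ?_; rw [mul_add, ← ENNReal.add_halves ε]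
  exact add_le_add h1 hn

end IsSol

open Classical in
/-- The class in `L²` of a vector field (and `0` if it is not square integrable). -/
noncomputable def lpOf (f : E3 → E3) : Lp E3 2 (volume : Measure E3) := if h : MemLp f 2 then h.toLp f else 0

lemma coeFn_lpOf {f : E3 → E3} (h : MemLp f 2) : (fun x => lpOf f x) =ᵐ[volume] f := by
  rw [lpOf, dif_pos h]; exact h.coeFn_toLp

lemma edist_lpOf {f g : E3 → E3} (hf : MemLp f 2) (hg : MemLp g 2) :
    edist (lpOf f) (lpOf g) = eLpNorm (fun x => f x - g x) 2 volume := by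
  rw [Lp.edist_def]; refine eLpNorm_congr_ae ?_
  filter_upwards [coeFn_lpOf hf, coeFn_lpOf hg] with x h1 h2
  simp [h1, h2]

lemma norm_lpOf_le {f : E3 → E3} (hf : MemLp f 2) {C : ℝ} (hC : 0 ≤ C) (h : eLpNorm f 2 volume ≤ ofReal C) :
    ‖lpOf f‖ ≤ C := by
  rw [Lp.norm_def, eLpNorm_congr_ae (coeFn_lpOf hf)]; exact ENNReal.toReal_le_of_le_ofReal hC h

lemma memV_of_tendsto {T μ C : ℝ} {E : ℝ → E3 → E3} (hE : ∀ t ∈ Ioc 0 T, Measurable (E t)) (hC : 0 ≤ C)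
    (hb : ∀ t ∈ Ioc 0 T, eLpNorm (E t) 2 volume ≤ ofReal (C * t ^ (-μ)))
    (hc : ∀ t₀ ∈ Ioc 0 T, Tendsto (fun t => eLpNorm (fun x => E t x - E t₀ x) 2 volume) (𝓝[Ioc 0 T] t₀) (𝓝 0)) :
    MemV T μ E := by
  have hm : ∀ t ∈ Ioc 0 T, MemLp (E t) 2 := fun t ht =>
    ⟨(hE t ht).aestronglyMeasurable, (hb t ht).trans_lt ofReal_lt_top⟩
  refine ⟨fun t => lpOf (E t), fun t ht => coeFn_lpOf (hm t ht), fun t₀ ht₀ => ?_, C, fun t ht => ?_⟩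
  · refine tendsto_iff_edist_tendsto_0.2 ((hc t₀ ht₀).congr' ?_)
    filter_upwards [self_mem_nhdsWithin] with t ht using (edist_lpOf (hm t ht) (hm t₀ ht₀)).symm
  · have h0 := rpow_pos_of_pos ht.1 μ
    have h1 := norm_lpOf_le (hm t ht) (mul_nonneg hC (rpow_nonneg ht.1.le _)) (hb t ht)
    rw [rpow_neg ht.1.le, ← div_eq_mul_inv, le_div_iff₀ h0] at h1; linarith

/-- Weak continuity of the field of a continuous family of states. -/
lemma memVWeak_field {T μ C : ℝ} {w : ℝ → X} (hw : ContinuousOn w (Ioc 0 T)) (hμ : 0 ≤ μ) (hC : 0 ≤ C)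
    (hb : ∀ t ∈ Ioc 0 T, eLpNorm (field (density (w t))) 2 volume ≤ ofReal (C * t ^ (-μ))) :
    MemVWeak T μ fun t => field (density (w t)) := by
  have hm : ∀ t ∈ Ioc 0 T, MemLp (field (density (w t))) 2 := fun t ht =>
    ⟨(measurable_field (measurable_density _)).aestronglyMeasurable, (hb t ht).trans_lt ofReal_lt_top⟩
  set e : ℝ → Lp E3 2 (volume : Measure E3) := fun t => lpOf (field (density (w t)))
  have hn : ∀ t ∈ Ioc 0 T, ‖e t‖ ≤ C * t ^ (-μ) := fun t ht =>
    norm_lpOf_le (hm t ht) (mul_nonneg hC (rpow_nonneg ht.1.le _)) (hb t ht)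
  refine ⟨e, fun t ht => coeFn_lpOf (hm t ht), fun g => ?_, C, fun t ht => ?_⟩
  swap
  · have h0 := rpow_pos_of_pos ht.1 μ; have h1 := hn t ht
    rw [rpow_neg ht.1.le, ← div_eq_mul_inv, le_div_iff₀ h0] at h1; linarith
  have hcore : ∀ (f : E3 → E3) (hf : MemLp f 2), Continuous f → HasCompactSupport f →
      ContinuousOn (fun t => (inner ℝ (hf.toLp f) (e t) : ℝ)) (Ioc 0 T) := by
    intro f hf hfc hfs
    have hbd : ∀ j, IsBdd fun x => f x j := fun j => by
      have hcj : Continuous fun x => f x j := by fun_prop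
      have hsj : HasCompactSupport fun x => f x j := hfs.comp_left (g := fun y : E3 => y j) rfl
      obtain ⟨N, hN⟩ := hsj.exists_bound_of_continuous hcj
      obtain ⟨M, hM⟩ := hsj.isCompact.isBounded.subset_closedBall (0 : E3)
      refine ⟨hcj.measurable, ⟨N, hN⟩, M, fun x hx => ?_⟩; by_contra hne
      have := hM (subset_tsupport _ hne); rw [mem_closedBall_zero_iff] at this; linarith
    choose L hL using fun j => exists_clm (φ := fun z : Phase => comp j (fun x => f x j) z.1)
      ((measurable_comp j (hbd j).meas).comp measurable_fst).aemeasurable (by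
        simpa using dualNorm_comp_shear_lt_top 0 (measurable_comp j (hbd j).meas) ((hbd j).memLp_comp j))
    have e1 : ∀ t ∈ Ioc 0 T, inner ℝ (hf.toLp f) (e t) = -∑ j, L j (w t) := fun t ht => by
      have hd := measurable_density (w t); have hd2 := memLp_density (w t)
      rw [L2.inner_def, ← Finset.sum_neg_distrib]
      calc _ = ∫ x, ∑ j, comp j (density (w t)) x * f x j := by
            refine integral_congr_ae ?_
            filter_upwards [hf.coeFn_toLp, coeFn_lpOf (hm t ht), ae_riesz_lt_top hd hd2] with x h1 h2 h3
            rw [h1, h2, PiLp.inner_apply]; refine sum_congr rfl fun j _ => ?_; rw [field_apply hd h3]; rfl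
        _ = ∑ j, ∫ x, comp j (density (w t)) x * f x j := by
          refine integral_finset_sum _ fun j _ => ?_
          have : MemLp (comp j (density (w t))) 2 := ⟨(measurable_comp j hd).aestronglyMeasurable,
            (eLpNorm_comp_le_field hd hd2 j 2).trans_lt (hm t ht).2⟩
          exact this.integrable_mul ((hbd j).memLp 2)
        _ = _ := sum_congr rfl fun j _ => by
          rw [integral_comp_mul j hd hd2 (hbd j), (hL j).1, integral_density_mul _ (measurable_comp j (hbd j).meas) ((hbd j).memLp_comp j)]
    refine ContinuousOn.congr ?_ e1
    exact (continuousOn_finset_sum _ fun j _ => (L j).continuous.comp_continuousOn hw).neg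
  intro t₀ ht₀
  have hU : Ioc (t₀ / 2) T ∈ 𝓝[Ioc 0 T] t₀ :=
    mem_nhdsWithin.2 ⟨Ioi (t₀ / 2), isOpen_Ioi, by simpa using ht₀.1, fun t ht => ⟨ht.1, ht.2.2⟩⟩
  set B := C * (t₀ / 2) ^ (-μ) + 1; have ht2 : 0 < t₀ / 2 := half_pos ht₀.1
  have hB : 0 < B := by positivity
  have hnB : ∀ t ∈ Ioc (t₀ / 2) T, ‖e t‖ ≤ B := fun t ht => by
    have h1 := Real.rpow_le_rpow_of_nonpos ht2 ht.1.le (neg_nonpos.2 hμ); have := hn t ⟨ht2.trans ht.1, ht.2⟩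
    have := mul_le_mul_of_nonneg_left h1 hC; simp only [B]; linarith
  rw [ContinuousWithinAt, Metric.tendsto_nhds]; intro ε hε
  obtain ⟨f, hfs, hfe, hfc, hf⟩ := (Lp.memLp g).exists_hasCompactSupport_eLpNorm_sub_le (by norm_num)
    (ε := ofReal (ε / (3 * B))) (by simpa using by positivity)
  have hgf : ‖g - hf.toLp f‖ ≤ ε / (3 * B) := by
    rw [← Lp.toLp_coeFn g (Lp.memLp g), ← MemLp.toLp_sub, Lp.norm_toLp]
    exact ENNReal.toReal_le_of_le_ofReal (by positivity) hfe
  have hdiff : ∀ t ∈ Ioc (t₀ / 2) T, |inner ℝ g (e t) - inner ℝ (hf.toLp f) (e t)| ≤ ε / 3 := fun t ht => by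
    rw [← inner_sub_left]; refine (abs_real_inner_le_norm _ _).trans ?_
    calc _ ≤ ε / (3 * B) * B := mul_le_mul hgf (hnB t ht) (norm_nonneg _) (by positivity)
      _ = _ := by field_simp
  filter_upwards [hU, (Metric.tendsto_nhds.1 (hcore f hf hfc hfs t₀ ht₀)) (ε / 3) (by positivity)] with t ht h1
  have h2 := hdiff t ht; have h3 := hdiff t₀ ⟨by linarith [ht₀.1], ht₀.2⟩
  rw [Real.dist_eq] at h1 ⊢; rw [abs_le] at h2 h3; rw [abs_lt] at h1 ⊢
  constructor <;> linarith

/-- Constants that are locally uniform in `T` can be chosen to be continuous in `T`. -/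
lemma exists_continuous_bound {P : ℝ → ℝ → Prop} (hmono : ∀ T c c', c ≤ c' → P T c → P T c')
    (hloc : ∀ T₀ : ℝ, 0 < T₀ → ∃ c, ∀ T ∈ Ioc 0 T₀, P T c) : ∃ g : ℝ → ℝ, Continuous g ∧ ∀ T, 0 < T → P T (g T) := by
  obtain ⟨g, hg⟩ := exists_continuous_forall_mem_convex_of_local_const (X := ℝ) (E := ℝ)
    (t := fun T => {c | 0 < T → P T c}) (fun T => OrdConnected.convex ⟨fun c hc c' _ d hd hT => hmono T c d hd.1 (hc hT)⟩)
    fun T₀ => by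
      obtain ⟨c, hc⟩ := hloc (|T₀| + 1) (by positivity); refine ⟨c, ?_⟩
      filter_upwards [gt_mem_nhds (lt_of_le_of_lt (le_abs_self T₀) (lt_add_one _))] with T hT h0 using hc T ⟨h0, hT.le⟩
  exact ⟨g, g.continuous, hg⟩

lemma IsMildSolution.exists_isSol {α β γ σ T : ℝ} (hα : 0 ≤ α) (hβ : 0 ≤ β) (hγ : 0 ≤ γ) (hσ : 0 < σ) (hell : γ ^ 2 < α * σ)
    {w₀ : X} {w : ℝ → X} (h : IsMildSolution α β γ σ T w₀ w) (hT : 0 < T) :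
    ∃ S, IsSol α β γ σ S T w₀ w fun s => Theta (w s) (w s) := by
  obtain ⟨⟨hc, -⟩, hθ, hi, S, hS, he⟩ := h
  refine ⟨S, ⟨⟨hc, hθ, (intervalIntegrable_iff_integrableOn_Ioc_of_le hT.le).1 hi, fun t ht => ?_⟩, ?_, hβ, hγ, hσ, hell, hS⟩⟩
  · rw [he t ht, intervalIntegral.integral_of_le ht.1]
  · refine lt_of_le_of_ne hα fun h => ?_; rw [← h, zero_mul] at hell; nlinarith

/-- `c` bounds the nonlinear part of the field in `L^p` up to time `T`. -/
def E1Bound (α β γ σ ω p a b T c : ℝ) : Prop :=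
  2 ≤ p → p < 6 →
  ∀ w₀, ConditionA β ω w₀ → norm2 w₀ = a → supA β ω T w₀ = b → ∀ w, IsMildSolution α β γ σ T w₀ w → ∀ t ∈ Ioc 0 T,
    eLpNorm (E1 α β γ σ w t) (ofReal p) volume ≤ ofReal (c * t ^ (3 / (2 * p) - 1 / 4 - ω))

lemma exists_continuous_E1_bound {α β γ σ ω : ℝ} (hα : 0 ≤ α) (hβ : 0 ≤ β) (hγ : 0 ≤ γ) (hσ : 0 < σ) (hell : γ ^ 2 < α * σ)
    (hω0 : 0 ≤ ω) (hω : ω < 1) (p a b : ℝ) : ∃ g : ℝ → ℝ, Continuous g ∧ ∀ T, 0 < T → E1Bound α β γ σ ω p a b T (g T) := by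
  refine exists_continuous_bound (P := E1Bound α β γ σ ω p a b)
    (fun T c c' hc h h1 h2 w₀ h3 h4 h5 w h6 t ht => (h h1 h2 w₀ h3 h4 h5 w h6 t ht).trans (ofReal_le_ofReal
      (mul_le_mul_of_nonneg_right hc (rpow_nonneg ht.1.le _)))) fun T₀ hT₀ => ?_
  have hα' : 0 < α := lt_of_le_of_ne hα fun h => by rw [← h, zero_mul] at hell; nlinarith
  by_cases hp : 2 ≤ p ∧ p < 6
  · obtain ⟨C, -, H⟩ := IsSol.exists_E1_bound α β γ σ hα' hβ hω0 hω hT₀ (abs_nonneg a) (abs_nonneg b) hp.1 hp.2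
    refine ⟨C, fun T hT _ _ w₀ hA ha hb w hw t ht => ?_⟩; obtain ⟨S, hS⟩ := hw.exists_isSol hα hβ hγ hσ hell hT.1
    rw [E1, field_congr (hS.n1_ae ht)]
    exact H S T w₀ w _ hS hA hT.2 (ha.le.trans (le_abs_self a)) (hb.le.trans (le_abs_self b)) t ht
  · exact ⟨0, fun T hT h1 h2 => (hp ⟨h1, h2⟩).elim⟩

lemma exists_E0_bound : ∃ C : ℝ, 0 ≤ C ∧ ∀ (α β γ σ : ℝ) (w₀ : X) (t p θ : ℝ), 0 < R α β γ σ t → 2 ≤ p → p ≤ 6 →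
    θ = 3 * (p - 2) / (2 * p) → n0thNorm β w₀ t ≠ ∞ → eLpNorm (E0 α β γ σ w₀ t) (ofReal p) volume ≤
      ofReal (C * ‖w₀‖ ^ θ * (n0thNorm β w₀ t).toReal ^ (1 - θ)) := by
  obtain ⟨C, hC, H⟩ := exists_E0_bounds; refine ⟨C, hC, fun α β γ σ w₀ t p θ hR h2 h6 hθ hn => ?_⟩
  have hp : 0 < 2 * p := by linarith
  have hθ0 : 0 ≤ θ := by rw [hθ]; exact div_nonneg (by linarith) hp.le
  have hθ1 : 0 ≤ 1 - θ := by rw [hθ, sub_nonneg, div_le_one hp]; linarith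
  obtain ⟨h3, h4⟩ := H α β γ σ w₀ t hR
  have hm : Measurable (n0 α β γ σ w₀ t) := measurable_conv _ (measurable_n0th β w₀ t)
  refine (eLpNorm_interpolation (measurable_field hm) h2 h6 hθ).trans ((mul_le_mul' (rpow_le_rpow h3 hθ1)
    (rpow_le_rpow h4 hθ0)).trans (le_of_eq ?_))
  rw [← ofReal_toReal hn, ← ofReal_norm, ← ofReal_mul hC, ← ofReal_mul hC,
    ofReal_rpow_of_nonneg (by positivity) hθ1, ofReal_rpow_of_nonneg (by positivity) hθ0,
    ← ofReal_mul (by positivity), mul_rpow hC toReal_nonneg, mul_rpow hC (norm_nonneg _),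
    ENNReal.toReal_ofReal toReal_nonneg]
  congr 1
  have : C ^ (1 - θ) * C ^ θ = C := by rw [← Real.rpow_add_of_nonneg hC hθ1 hθ0, sub_add_cancel, Real.rpow_one]
  calc _ = (C ^ (1 - θ) * C ^ θ) * ‖w₀‖ ^ θ * (n0thNorm β w₀ t).toReal ^ (1 - θ) := by ring
    _ = _ := by rw [this]

end WPFP

theorem lemma4p5 (α β γ σ : ℝ) (hα : 0 ≤ α) (hβ : 0 ≤ β) (hγ : 0 ≤ γ) (hσ : 0 < σ)
    (hcoeff : γ ^ 2 + β ^ 2 / 16 ≤ α * σ) (hell : γ ^ 2 < α * σ) :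
    ∃ C₀ : ℝ → ℝ, ContinuousOn C₀ (Set.Ioi 0) ∧
    ∀ ω : ℝ, 0 ≤ ω → ω < 1 →
    ∃ (C₁ : ℝ → ℝ → ℝ → ℝ) (C₂ : ℝ → ℝ → ℝ → ℝ → ℝ),
      (∀ a b, ContinuousOn (fun T => C₁ T a b) (Set.Ioi 0)) ∧
      (∀ p a b, ContinuousOn (fun T => C₂ p T a b) (Set.Ioi 0)) ∧
      ∀ (T : ℝ) (_ : 0 < T) (w₀ : WPFP.X) (_ : WPFP.ConditionA β ω w₀) (w : ℝ → WPFP.X)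
        (_ : WPFP.IsMildSolution α β γ σ T w₀ w),
        -- the splitting of the density and of the field
        (∀ t ∈ Set.Ioc 0 T,
          WPFP.FieldConverges (WPFP.density fun z => w t z) ∧
          WPFP.FieldConverges (WPFP.n0 α β γ σ w₀ t) ∧
          WPFP.FieldConverges (WPFP.n1 α β γ σ w t) ∧
          (WPFP.density fun z => w t z) =ᵐ[volume]
            (fun x => WPFP.n0 α β γ σ w₀ t x + WPFP.n1 α β γ σ w t x) ∧
          WPFP.gradV w t =ᵐ[volume]
            (fun x => WPFP.E0 α β γ σ w₀ t x + WPFP.E1 α β γ σ w t x)) ∧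
        -- the regularity of the field
        WPFP.MemV T (ω - 1 / 2) (WPFP.E1 α β γ σ w) ∧
        WPFP.MemVWeak T ω (WPFP.gradV w) ∧
        -- the estimate of `E₀` in `L^p`, `2 ≤ p ≤ 6`, with `θ = 3(p-2)/(2p)`
        (∀ p θ : ℝ, 2 ≤ p → p ≤ 6 → θ = 3 * (p - 2) / (2 * p) →
          (∀ t ∈ Set.Ioc 0 T,
            MemLp (WPFP.E0 α β γ σ w₀ t) (ENNReal.ofReal p) volume ∧
            eLpNorm (WPFP.E0 α β γ σ w₀ t) (ENNReal.ofReal p) volume ≤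
              ENNReal.ofReal
                (C₀ T * ‖w₀‖ ^ θ * (WPFP.n0thNorm β w₀ t).toReal ^ (1 - θ))) ∧
          ∃ K : ℝ, ∀ t ∈ Set.Ioc 0 T,
            eLpNorm (WPFP.E0 α β γ σ w₀ t) (ENNReal.ofReal p) volume ≤
              ENNReal.ofReal (K * t ^ (-(ω * (1 - θ))))) ∧
        -- the estimate of `E₁` in `L²`
        (∀ t ∈ Set.Ioc 0 T,
          eLpNorm (WPFP.E1 α β γ σ w t) 2 volume ≤
            ENNReal.ofReal
              (C₁ T (WPFP.norm2 w₀) (WPFP.supA β ω T w₀) * t ^ (1 / 2 - ω))) ∧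
        -- the estimate of `E₁` in `L^p`, `2 ≤ p < 6`
        (∀ p : ℝ, 2 ≤ p → p < 6 → ∀ t ∈ Set.Ioc 0 T,
          MemLp (WPFP.E1 α β γ σ w t) (ENNReal.ofReal p) volume ∧
          eLpNorm (WPFP.E1 α β γ σ w t) (ENNReal.ofReal p) volume ≤
            ENNReal.ofReal
              (C₂ p T (WPFP.norm2 w₀) (WPFP.supA β ω T w₀) *
                t ^ (3 / (2 * p) - 1 / 4 - ω))) := by
  obtain ⟨c₀, hc₀, H₀⟩ := WPFP.exists_E0_bound
  refine ⟨fun _ => c₀, continuousOn_const, fun ω hω0 hω => ?_⟩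
  choose g hg H using WPFP.exists_continuous_E1_bound (α := α) hα hβ hγ hσ hell hω0 hω
  refine ⟨fun T a b => g 2 a b T, fun p T a b => g p a b T, fun a b => (hg 2 a b).continuousOn,
    fun p a b => (hg p a b).continuousOn, fun T hT w₀ hA w hw => ?_⟩
  obtain ⟨S, h⟩ := hw.exists_isSol hα hβ hγ hσ hell hT
  obtain ⟨C, hC, HC⟩ := WPFP.IsSol.exists_field_bound α β γ σ h.hα hβ hω0 hω hT (WPFP.norm2_nonneg w₀)
    (ENNReal.toReal_nonneg : 0 ≤ WPFP.supA β ω T w₀)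
  have hfield := HC S T w₀ w _ h hA le_rfl le_rfl le_rfl
  have hE1 : ∀ t ∈ Ioc 0 T, WPFP.E1 α β γ σ w t = WPFP.field (WPFP.density fun z => (w t - S t w₀) z) := fun t ht => by
    rw [WPFP.E1, WPFP.field_congr (h.n1_ae ht)]
  have hE1m : ∀ t ∈ Ioc 0 T, Measurable (WPFP.E1 α β γ σ w t) := fun t ht => by
    rw [hE1 t ht]; exact WPFP.measurable_field (WPFP.measurable_density _)
  have hE1b := fun p h2 h6 => H p _ _ T hT h2 h6 w₀ hA rfl rfl w hw
  have hE12 : ∀ t ∈ Ioc 0 T, eLpNorm (WPFP.E1 α β γ σ w t) 2 volume ≤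
      ENNReal.ofReal (g 2 (WPFP.norm2 w₀) (WPFP.supA β ω T w₀) T * t ^ (1 / 2 - ω)) := fun t ht => by
    have := hE1b 2 le_rfl (by norm_num) t ht
    rwa [ENNReal.ofReal_ofNat, show (3 / (2 * 2) - 1 / 4 - ω : ℝ) = 1 / 2 - ω by ring] at this
  have hfc : ∀ u : WPFP.X, WPFP.FieldConverges (WPFP.density fun z => u z) := fun u =>
    WPFP.fieldConverges (WPFP.measurable_density u) (WPFP.memLp_density u)
  refine ⟨fun t ht => ⟨hfc _, WPFP.fieldConverges (WPFP.measurable_conv _ (WPFP.measurable_n0th β w₀ t)) (h.memLp_n0 ht.1),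
    WPFP.fieldConverges_congr (h.n1_ae ht).symm (hfc _), ?_, ?_⟩, ?_, ?_, fun p θ h2 h6 hθ => ⟨fun t ht => ?_, ?_⟩, hE12,
    fun p h2 h6 t ht => ⟨⟨(hE1m t ht).aestronglyMeasurable, (hE1b p h2 h6 t ht).trans_lt ENNReal.ofReal_lt_top⟩,
      hE1b p h2 h6 t ht⟩⟩
  · filter_upwards [h.density_ae ht.1, h.n1_ae ht] with x h1 h2
    rw [h1, h2]
  · rw [hE1 t ht]
    exact h.field_ae ht.1
  · refine WPFP.memV_of_tendsto (C := |g 2 (WPFP.norm2 w₀) (WPFP.supA β ω T w₀) T|) hE1m (abs_nonneg _) (fun t ht => ?_)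
      fun t₀ ht₀ => ?_
    · refine (hE12 t ht).trans (ENNReal.ofReal_le_ofReal ?_)
      rw [neg_sub]
      exact mul_le_mul_of_nonneg_right (le_abs_self _) (Real.rpow_nonneg ht.1.le _)
    · refine (h.tendsto_eLpNorm_field_sub hω hfield ht₀).congr' ?_
      filter_upwards [self_mem_nhdsWithin] with t ht
      rw [hE1 t ht, hE1 t₀ ht₀]
  · exact WPFP.memVWeak_field (h.cont.mono Ioc_subset_Icc_self) hω0 hC hfield
  · have h1 := H₀ α β γ σ w₀ t p θ (h.R_pos ht.1) h2 h6 hθ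
      ((hA.n0thNorm_le hβ hω0 ht le_rfl le_rfl).trans_lt ENNReal.ofReal_lt_top).ne
    exact ⟨⟨(WPFP.measurable_field (WPFP.measurable_conv _ (WPFP.measurable_n0th β w₀ t))).aestronglyMeasurable,
      h1.trans_lt ENNReal.ofReal_lt_top⟩, h1⟩
  · set D := WPFP.supA β ω T w₀ * Real.exp (-(β * T)) ^ (-ω)
    have hD : 0 ≤ D := mul_nonneg ENNReal.toReal_nonneg (by positivity)
    refine ⟨c₀ * ‖w₀‖ ^ θ * D ^ (1 - θ), fun t ht => ?_⟩
    have hn := hA.n0thNorm_le hβ hω0 ht le_rfl le_rfl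
    have ht0 := ht.1.le
    refine (H₀ α β γ σ w₀ t p θ (h.R_pos ht.1) h2 h6 hθ (hn.trans_lt ENNReal.ofReal_lt_top).ne).trans
      (ENNReal.ofReal_le_ofReal ?_)
    have hθ1 : 0 ≤ 1 - θ := by rw [hθ, sub_nonneg, div_le_one (by linarith)]; linarith
    have h1 : (WPFP.n0thNorm β w₀ t).toReal ≤ D * t ^ (-ω) := ENNReal.toReal_le_of_le_ofReal (by positivity) hn
    calc _ ≤ c₀ * ‖w₀‖ ^ θ * (D * t ^ (-ω)) ^ (1 - θ) := by gcongr
      _ = _ := by rw [Real.mul_rpow hD (by positivity), ← Real.rpow_mul ht0, neg_mul, mul_assoc _ (D ^ _)]
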